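/- **Setting.** Let $\mathfrak g$ be a finite-dimensional simple complex Lie algebra with a Cartan subalgebra, simple roots $\alpha_1,\dots,\alpha_r$, highest root $\theta$ and Chevalley generators, and let $(A_{ab})_{0\le a,b\le r}$, $A_{ab}=\alpha_b(\alpha_a^\vee)$, be the Cartan matrix of its untwisted affine extension $\mathfrak g^+$, with $\alpha_0=\delta-\theta$ (so $\mathfrak g^+$ is the centrally extended loop algebra, without derivation). Add a fermionic node $-1$ with $A_{-1,-1}=0$, $A_{-1,0}=A_{0,-1}=-1$ and $A_{-1,i}=A_{i,-1}=0$ for $i\ge1$. Multiple brackets are nested to the right: $[x_1,x_2,\dots,x_s]=[x_1,[x_2,\dots,x_s]]$. Let $\tilde S(\mathfrak g^+)$ be the complex Lie superalgebra generated by even elements $e_a,f_a,h_a$ ($0\le a\le r$) and odd elements $\epsilon_{-1}$, $\phi_{-1,i}$ ($1\le i\le r$), with the following relations, where $e_{-1}=\epsilon_{-1}$, the indices $i,j,k$ run over $1,\dots,r$, the indices $a,b$ over $0,\dots,r$, and $p,q$ over $-1,\dots,r$: * $[h_a,e_p]=A_{ap}e_p$, $[h_a,f_b]=-A_{ab}f_b$,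 $[e_p,f_b]=\delta_{pb}h_b$; * $(\mathrm{ad}\,e_p)^{1-A_{pq}}(e_q)=0$ if $A_{pq}\le0$ (in particular $[\epsilon_{-1},\epsilon_{-1}]=0$), and $(\mathrm{ad}\,f_a)^{1-A_{ab}}(f_b)=0$ if $A_{ab}\le 0$; * $[\epsilon_{-1},\phi_{-1,i}]=h_i$, $[h_a,\phi_{-1,i}]=-A_{a,-1}\phi_{-1,i}$, $[e_i,f_j,\phi_{-1,k}]=\delta_{ij}A_{ki}\phi_{-1,i}$, $[e_0,\phi_{-1,i}]=0$, $[f_0,f_0,\phi_{-1,i}]=0$, $[\phi_{-1,i},\phi_{-1,j}]=0$, and $[\phi_{-1,i},\phi_{-1,j},f_0]=0$ if $A_{i0}=A_{j0}=0$; * the $\phi_{-1,i}$ are the Cartan part of an adjoint $\mathfrak g$-module: $[e_i,e_i,\phi_{-1,k}]=0$, $A_{ji}[e_i,\phi_{-1,k}]=A_{ki}[e_i,\phi_{-1,j}]$, and $[f_0,e_i,\phi_{-1,k}]=0$ if $A_{i0}\neq0$. It is graded by degree in all nodes $-1,0,\dots,r$ (with $\deg\phi_{-1,i}$ equal to minus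 the degree of $\epsilon_{-1}$); the *level* is the degree with respect to node $-1$. Let $S(\mathfrak g^+)$ be the quotient of $\tilde S(\mathfrak g^+)$ by the sum of all homogeneous ideals that intersect the subalgebra of degree $0$ trivially. Let $x_\theta,y_\theta\in\mathfrak g$ be root vectors for $\theta,-\theta$ with $[x_\theta,y_\theta]=\theta^\vee$. Let node $1$ be a node of $\mathfrak g$ adjacent to node $0$, and put $c=\theta(\alpha_1^\vee)$. (One has $c=1$ when nodes $0$ and $1$ are joined by a single line, and $c=2$ exactly for $\mathfrak g$ of type $A_1$ or $C_r$.) **Theorem.** In $S(\mathfrak g^+)$ there are a unique family of linear maps $x\mapsto T_m(x)$ ($x\in\mathfrak g$, $m\in\mathbb Z$) and a unique element $\mathsf K$ such that $T_0$ maps the Chevalley generators of $\mathfrak g$ to $e_i,f_i$ ($i\ge1$), $e_0=T_1(y_\theta)$, $f_0=T_{-1}(x_\theta)$, $[\mathsf K,T_m(x)]=0$ and $$[T_m(x),T_n(y)]=T_{m+n}([x,y])+m\,\delta_{m+n,0}\,(x,y)\,\mathsf K,$$ where $(\cdot,\cdot)$ is the invariant form with $(\theta^\vee,\theta^\vee)=2$.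 They realize $\mathfrak g^+$ faithfully in $S(\mathfrak g^+)$. Write $e_\theta=T_0(x_\theta)$ and $$J=[\epsilon_{-1},e_0,e_\theta,\phi_{-1,1}].$$ Then: 1. $J=[\phi_{-1,1},e_\theta,e_0,\epsilon_{-1}]$; $J$ has level $0$, and it does not lie in the subalgebra generated by $e_a,f_a,h_a$, $0\le a\le r$ (it has no expression without $\epsilon$ and $\phi$). 2. $[e_i,J]=[f_i,J]=0$ for $1\le i\le r$, $\;[f_0,J]=-c\,e_\theta$, $\;[e_0,J]=-\tfrac c2[e_0,e_0,e_\theta]$. 3. $[J,T_m(x)]=-c\,m\,T_{m+1}(x)$ for all $m\in\mathbb Z$, $x\in\mathfrak g$, and $[J,\mathsf K]=0$; that is, $J$ acts on $\mathfrak g^+$ as $c$ times the Virasoro derivation $L_1$. 4. $[\epsilon_{-1},J]=0$. The subspace of level $1$ is an irreducible $\mathfrak g^+$-module with lowest weight vector $\epsilon_{-1}\ne0$: $[f_a,\epsilon_{-1}]=0$ and $[h_a,\epsilon_{-1}]=-\delta_{a0}\epsilon_{-1}$ for $0\le a\le r$; on it $\mathsf K$ acts as $k=-1$. On it $J$ acts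 as $c$ times the Sugawara operator $$L_1=\frac1{2(k-g^\vee)}\sum_{n\in\mathbb Z}\sum_A{:}\,T_n(u_A)\,T_{1-n}(u'_A)\,{:}\;=\;\frac1{k-g^\vee}\sum_{n\ge1}\sum_A T_n(u_A)\,T_{1-n}(u'_A),\qquad k=-1,$$ where $(u_A)$, $(u'_A)$ are any dual bases of $\mathfrak g$ for $(\cdot,\cdot)$, $g^\vee$ is the dual Coxeter number, and the sum is finite on every vector. In particular, for $c=1$: $[f_0,J]=-e_\theta$, $[e_0,J]=-\tfrac12[e_0,e_0,e_\theta]$, $[J,T_m(x)]=-m\,T_{m+1}(x)$, and $J$ acts as $L_1$. -/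

import Mathlib

noncomputable section

namespace TensorHierarchy

open LieAlgebra.IsKilling

/-! ### Ideals and quotients of algebras with a bilinear bracket -/

section Ideals

variable {L : Type*} [AddCommGroup L] [Module ℂ L]

/-- `I` is a two-sided ideal for the bilinear operation `μ`. -/
def IsIdeal (μ : L →ₗ[ℂ] L →ₗ[ℂ] L) (I : Submodule ℂ L) : Prop :=
  ∀ x : L, ∀ y ∈ I, μ x y ∈ I ∧ μ y x ∈ I

/-- The two-sided ideal generated by a set. -/
def idealSpan (μ : L →ₗ[ℂ] L →ₗ[ℂ] L) (s : Set L) : Submodule ℂ L :=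
  sInf {I | IsIdeal μ I ∧ s ⊆ I}

theorem isIdeal_idealSpan (μ : L →ₗ[ℂ] L →ₗ[ℂ] L) (s : Set L) : IsIdeal μ (idealSpan μ s) := by
  intro x y hy
  simp only [idealSpan, Submodule.mem_sInf] at hy ⊢
  exact ⟨fun I hI => (hI.1 x y (hy I hI)).1, fun I hI => (hI.1 x y (hy I hI)).2⟩

theorem isIdeal_sSup (μ : L →ₗ[ℂ] L →ₗ[ℂ] L) (𝓘 : Set (Submodule ℂ L))
    (h : ∀ I ∈ 𝓘, IsIdeal μ I) : IsIdeal μ (sSup 𝓘) := by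
  intro x y hy
  have h1 : sSup 𝓘 ≤ (sSup 𝓘).comap (μ x) := sSup_le fun I hI z hz =>
    (le_sSup hI : I ≤ sSup 𝓘) (h I hI x z hz).1
  have h2 : sSup 𝓘 ≤ (sSup 𝓘).comap (μ.flip x) := sSup_le fun I hI z hz =>
    (le_sSup hI : I ≤ sSup 𝓘) (h I hI x z hz).2
  exact ⟨h1 hy, h2 hy⟩

/-- The operation induced on the quotient by an ideal. -/
def quotientBracket (μ : L →ₗ[ℂ] L →ₗ[ℂ] L) (I : Submodule ℂ L) (hI : IsIdeal μ I) :
    (L ⧸ I) →ₗ[ℂ] (L ⧸ I) →ₗ[ℂ] (L ⧸ I) :=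
  I.liftQ
    { toFun := fun x => I.mapQ I (μ x) fun y hy => (hI x y hy).1
      map_add' := fun x x' => by ext y; simp
      map_smul' := fun a x => by ext y; simp }
    (by
      intro x hx
      rw [LinearMap.mem_ker]
      ext y
      simpa using (hI y x hx).2)

end Ideals

/-! ### The superalgebra given by generators and relations -/

section Presentation

variable {ι : Type*}

/-- Generators. The bosonic nodes are `Option ι`: `none` is the affine node `0`, and `some i` are
the nodes of the finite Dynkin diagram. The set of all nodes is `Option (Option ι)`, where `none`
is the fermionic node `-1`. So `Gen.e none` is `ε₋₁`, `Gen.e (some none)` is `e₀`, `Gen.f none`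
is `f₀`, and `Gen.phi i` is `φ₋₁,ᵢ`. -/
inductive Gen (ι : Type*) where
  | e : Option (Option ι) → Gen ι
  | f : Option ι → Gen ι
  | h : Option ι → Gen ι
  | phi : ι → Gen ι

/-- The extension of a Cartan matrix by the fermionic node, which has diagonal entry `0` and is
joined by a single line to the affine node only. -/
def extendedCartan (A : Matrix (Option ι) (Option ι) ℤ) :
    Option (Option ι) → Option (Option ι) → ℤ
  | none, none => 0
  | none, some none => -1
  | none, some (some _) => 0
  | some none, none => -1
  | some (some _), none => 0
  | some a, some b => A a b

/-- The degree of a generator with respect to all nodes. -/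
def Gen.deg : Gen ι → (Option (Option ι) →₀ ℤ)
  | .e n => Finsupp.single n 1
  | .f a => Finsupp.single (some a) (-1)
  | .h _ => 0
  | .phi _ => Finsupp.single none (-1)

/-- The degree of a bracket monomial with respect to all nodes. -/
def deg : FreeMagma (Gen ι) → (Option (Option ι) →₀ ℤ)
  | .of g => g.deg
  | .mul x y => deg x + deg y

/-- The level of a monomial: its degree with respect to the fermionic node. Its class modulo `2`
is the parity of the monomial. -/
def level (x : FreeMagma (Gen ι)) : ℤ := deg x none

/-- The sign `(-1)^{|x||y|}`. -/
def superSign (x y : FreeMagma (Gen ι)) : ℂ :=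
  if Odd (level x) ∧ Odd (level y) then -1 else 1

/-- The free nonassociative algebra on the generators. Its product is written `*`
and becomes the bracket. -/
abbrev FreeAlg (ι : Type*) : Type _ := FreeNonUnitalNonAssocAlgebra ℂ (Gen ι)

/-- A generator in the free algebra. -/
abbrev gen (g : Gen ι) : FreeAlg ι := FreeNonUnitalNonAssocAlgebra.of ℂ g

/-- A bracket monomial in the free algebra. -/
def monomial (m : FreeMagma (Gen ι)) : FreeAlg ι := FreeMagma.lift gen m

/-- The elements of the free algebra that are set to zero: graded antisymmetry and the graded Jacobi
identity, followed by the defining relations. -/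
inductive Relator (A : Matrix (Option ι) (Option ι) ℤ) : FreeAlg ι → Prop
  | skew (x y : FreeMagma (Gen ι)) :
      Relator A (monomial x * monomial y + superSign x y • (monomial y * monomial x))
  | jacobi (x y z : FreeMagma (Gen ι)) :
      Relator A (monomial x * (monomial y * monomial z)
        - (monomial x * monomial y) * monomial z
        - superSign x y • (monomial y * (monomial x * monomial z)))
  /- Chevalley relations -/
  | h_e (a : Option ι) (n : Option (Option ι)) :
      Relator A (gen (.h a) * gen (.e n) - (extendedCartan A (some a) n : ℂ) • gen (.e n))
  | h_f (a b : Option ι) :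
      Relator A (gen (.h a) * gen (.f b) + (A a b : ℂ) • gen (.f b))
  | e_f_same (a : Option ι) :
      Relator A (gen (.e (some a)) * gen (.f a) - gen (.h a))
  | e_f_ne (n : Option (Option ι)) (b : Option ι) (hn : n ≠ some b) :
      Relator A (gen (.e n) * gen (.f b))
  /- Serre relations -/
  | serre_e (m n : Option (Option ι)) (hmn : extendedCartan A m n ≤ 0) :
      Relator A ((fun z => gen (.e m) * z)^[(1 - extendedCartan A m n).toNat] (gen (.e n)))
  | serre_f (a b : Option ι) (hab : A a b ≤ 0) :
      Relator A ((fun z => gen (.f a) * z)^[(1 - A a b).toNat] (gen (.f b)))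
  /- relations for the odd lowering generators -/
  | eps_phi (i : ι) :
      Relator A (gen (.e none) * gen (.phi i) - gen (.h (some i)))
  | h_phi (a : Option ι) (j : ι) :
      Relator A (gen (.h a) * gen (.phi j)
        + (extendedCartan A (some a) none : ℂ) • gen (.phi j))
  | e_f_phi_same (i k : ι) :
      Relator A (gen (.e (some (some i))) * (gen (.f (some i)) * gen (.phi k))
        - (A (some k) (some i) : ℂ) • gen (.phi i))
  | e_f_phi_ne (i j k : ι) (hij : i ≠ j) :
      Relator A (gen (.e (some (some i))) * (gen (.f (some j)) * gen (.phi k)))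
  | e_zero_phi (i : ι) :
      Relator A (gen (.e (some none)) * gen (.phi i))
  | f_zero_f_zero_phi (i : ι) :
      Relator A (gen (.f none) * (gen (.f none) * gen (.phi i)))
  | phi_phi (i j : ι) :
      Relator A (gen (.phi i) * gen (.phi j))
  | phi_phi_f_zero (i j : ι) (hi : A (some i) none = 0) (hj : A (some j) none = 0) :
      Relator A (gen (.phi i) * (gen (.phi j) * gen (.f none)))
  /- the `φ`'s are the Cartan part of an adjoint module -/
  | e_e_phi (i k : ι) :
      Relator A (gen (.e (some (some i))) * (gen (.e (some (some i))) * gen (.phi k)))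
  | phi_cartan (i j k : ι) :
      Relator A ((A (some j) (some i) : ℂ) • (gen (.e (some (some i))) * gen (.phi k))
        - (A (some k) (some i) : ℂ) • (gen (.e (some (some i))) * gen (.phi j)))
  | f_zero_e_phi (i k : ι) (hi : A (some i) none ≠ 0) :
      Relator A (gen (.f none) * (gen (.e (some (some i))) * gen (.phi k)))

/-- The ideal of relations. -/
def relationIdeal (A : Matrix (Option ι) (Option ι) ℤ) : Submodule ℂ (FreeAlg ι) :=
  idealSpan (LinearMap.mul ℂ (FreeAlg ι)) {x | Relator A x}

/-- The Lie superalgebra `S̃` given by the generators and relations. -/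
abbrev STilde (A : Matrix (Option ι) (Option ι) ℤ) : Type _ := FreeAlg ι ⧸ relationIdeal A

/-- The bracket of `S̃`. -/
def tildeBracket (A : Matrix (Option ι) (Option ι) ℤ) :
    STilde A →ₗ[ℂ] STilde A →ₗ[ℂ] STilde A :=
  quotientBracket (LinearMap.mul ℂ (FreeAlg ι)) (relationIdeal A) (isIdeal_idealSpan _ _)

/-- The image in `S̃` of a bracket monomial. -/
def tildeMonomial (A : Matrix (Option ι) (Option ι) ℤ) (m : FreeMagma (Gen ι)) : STilde A :=
  (relationIdeal A).mkQ (monomial m)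

/-- The homogeneous component of `S̃` of degree `d`. -/
def tildeComponent (A : Matrix (Option ι) (Option ι) ℤ) (d : Option (Option ι) →₀ ℤ) :
    Submodule ℂ (STilde A) :=
  Submodule.span ℂ {x | ∃ m : FreeMagma (Gen ι), deg m = d ∧ x = tildeMonomial A m}

/-- The sum of all homogeneous ideals of `S̃` that intersect the subalgebra of degree `0`
trivially. -/
def maximalIdeal (A : Matrix (Option ι) (Option ι) ℤ) : Submodule ℂ (STilde A) :=
  sSup {I | IsIdeal (tildeBracket A) I ∧ I ≤ (⨆ d, I ⊓ tildeComponent A d) ∧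
    I ⊓ tildeComponent A 0 = ⊥}

theorem isIdeal_maximalIdeal (A : Matrix (Option ι) (Option ι) ℤ) :
    IsIdeal (tildeBracket A) (maximalIdeal A) :=
  isIdeal_sSup _ _ fun _ hI => hI.1

/-- The tensor hierarchy algebra `S`. -/
def S (A : Matrix (Option ι) (Option ι) ℤ) : Type _ := STilde A ⧸ maximalIdeal A

instance (A : Matrix (Option ι) (Option ι) ℤ) : AddCommGroup (S A) :=
  inferInstanceAs (AddCommGroup (STilde A ⧸ maximalIdeal A))

instance (A : Matrix (Option ι) (Option ι) ℤ) : Module ℂ (S A) :=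
  inferInstanceAs (Module ℂ (STilde A ⧸ maximalIdeal A))

/-- The bracket of the Lie superalgebra `S`. -/
instance (A : Matrix (Option ι) (Option ι) ℤ) : Bracket (S A) (S A) where
  bracket x y := quotientBracket (tildeBracket A) (maximalIdeal A) (isIdeal_maximalIdeal A) x y

/-- The image in `S` of a bracket monomial. -/
def ofMonomial (A : Matrix (Option ι) (Option ι) ℤ) (m : FreeMagma (Gen ι)) : S A :=
  (maximalIdeal A).mkQ (tildeMonomial A m)

/-- A generator of `S`. -/
def ofGen (A : Matrix (Option ι) (Option ι) ℤ) (g : Gen ι) : S A := ofMonomial A (.of g)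

/-- `ε₋₁` -/
def eps (A : Matrix (Option ι) (Option ι) ℤ) : S A := ofGen A (.e none)

/-- `e_a`, for a bosonic node `a` -/
def e (A : Matrix (Option ι) (Option ι) ℤ) (a : Option ι) : S A := ofGen A (.e (some a))

/-- `f_a`, for a bosonic node `a` -/
def f (A : Matrix (Option ι) (Option ι) ℤ) (a : Option ι) : S A := ofGen A (.f a)

/-- `h_a`, for a bosonic node `a` -/
def h (A : Matrix (Option ι) (Option ι) ℤ) (a : Option ι) : S A := ofGen A (.h a)

/-- `φ₋₁,ᵢ` -/
def phi (A : Matrix (Option ι) (Option ι) ℤ) (i : ι) : S A := ofGen A (.phi i)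

/-- The part of `S` of a given level. -/
def levelComponent (A : Matrix (Option ι) (Option ι) ℤ) (l : ℤ) : Submodule ℂ (S A) :=
  Submodule.span ℂ {x | ∃ m : FreeMagma (Gen ι), level m = l ∧ x = ofMonomial A m}

/-- The elements of `S` with an expression that contains neither `ε` nor `φ`: the subalgebra
generated by the `e_a`, `f_a`, `h_a`, where `a` runs over the bosonic nodes. -/
def bosonicSubalgebra (A : Matrix (Option ι) (Option ι) ℤ) : Submodule ℂ (S A) :=
  sInf {W | (∀ a, e A a ∈ W ∧ f A a ∈ W ∧ h A a ∈ W) ∧ ∀ x ∈ W, ∀ y ∈ W, ⁅x, y⁆ ∈ W}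

/-- `W` is stable under the adjoint action of the subalgebra generated by the `e_a`, `f_a`, `h_a`
of the bosonic nodes. -/
def IsBosonicStable (A : Matrix (Option ι) (Option ι) ℤ) (W : Submodule ℂ (S A)) : Prop :=
  ∀ x ∈ bosonicSubalgebra A, ∀ w ∈ W, ⁅x, w⁆ ∈ W

/-- The element `[ε₋₁, e₀, E, φ₋₁,ᵢ]` (nested to the right). -/
def extraGenerator (A : Matrix (Option ι) (Option ι) ℤ) (i : ι) (E : S A) : S A :=
  ⁅eps A, ⁅e A none, ⁅E, phi A i⁆⁆⁆

end Presentation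

/-! ### The untwisted affine algebra of a simple Lie algebra -/

section Affine

variable {𝔤 : Type*} [LieRing 𝔤] [LieAlgebra ℂ 𝔤] [FiniteDimensional ℂ 𝔤]
  [LieAlgebra.IsSimple ℂ 𝔤] {H : LieSubalgebra ℂ 𝔤} [H.IsCartanSubalgebra]

/-- `θ` is the highest root with respect to the base `b`. -/
def IsHighestRoot (b : (rootSystem H).Base) (θ : H.root) : Prop :=
  ∀ γ : H.root, (rootSystem H).root θ - (rootSystem H).root γ ∈
    AddSubmonoid.closure ((rootSystem H).root '' b.support)

/-- The Cartan matrix of the untwisted affine extension, with `α₀ = δ - θ`. The entry at `(a, b)`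
is the value of the root `α_b` on the coroot of `α_a`. -/
def affineCartan (b : (rootSystem H).Base) (θ : H.root) :
    Matrix (Option b.support) (Option b.support) ℤ
  | none, none => 2
  | none, some j => -(rootSystem H).pairingIn ℤ j θ
  | some i, none => -(rootSystem H).pairingIn ℤ θ i
  | some i, some j => (rootSystem H).pairingIn ℤ j i

/-- `x` and `y` span the root spaces of `α` and `-α`, and their bracket is the coroot of `α`. -/
def IsRootPair (α : H.root) (x y : 𝔤) : Prop :=
  x ∈ LieAlgebra.rootSpace H (α.1 : H → ℂ) ∧ y ∈ LieAlgebra.rootSpace H (-(α.1 : H → ℂ)) ∧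
    ⁅x, y⁆ = (coroot α.1 : 𝔤)

/-- The dual Coxeter number `g^∨`: the Killing form is `2 g^∨` times the invariant form for which
the coroot of the highest root has square length `2`. -/
def dualCoxeter (θ : H.root) : ℂ :=
  killingForm ℂ 𝔤 (coroot θ.1 : 𝔤) (coroot θ.1 : 𝔤) / 4

/-- The invariant form on `𝔤` for which the coroot of the highest root has square length `2`. -/
def normalizedForm (θ : H.root) (x y : 𝔤) : ℂ :=
  killingForm ℂ 𝔤 x y / (2 * dualCoxeter θ)

/-- `T m x` (the loop generator `x ⊗ tᵐ`) and the central element `K` realize the centrally extended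
loop algebra of `𝔤` in `S`, compatibly with the Chevalley generators: `e_i = x_i ⊗ 1`,
`f_i = y_i ⊗ 1` for `i ≥ 1`, `e₀ = y_θ ⊗ t` and `f₀ = x_θ ⊗ t⁻¹`. -/
structure IsLoopRealization {ι : Type*} {A : Matrix (Option ι) (Option ι) ℤ} (θ : H.root)
    (x y : ι → 𝔤) (xθ yθ : 𝔤) (T : ℤ → 𝔤 →ₗ[ℂ] S A) (K : S A) : Prop where
  e_simple : ∀ i, T 0 (x i) = e A (some i)
  f_simple : ∀ i, T 0 (y i) = f A (some i)
  e_zero : T 1 yθ = e A none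
  f_zero : T (-1) xθ = f A none
  bracket : ∀ m n u v, ⁅T m u, T n v⁆ =
    T (m + n) ⁅u, v⁆ + (if m + n = 0 then m * normalizedForm θ u v else 0) • K
  central : ∀ m u, ⁅K, T m u⁆ = 0

/-- The partial sums (modes up to `N`) of the Sugawara operator
`L₁ = 1 / (2 (k - g^∨)) ∑ₙ η_{AB} : T^A_n T^B_{1-n} :` in a lowest weight module at affine level
`k`, where normal ordering puts the lowering (negative) modes to the right, so that
`∑ₙ : T_n T_{1-n} : = 2 ∑_{n ≥ 1} T_n T_{1-n}`. Here `u`, `u'` are dual bases of `𝔤`. -/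
def sugawaraL1 {ι : Type*} {A : Matrix (Option ι) (Option ι) ℤ} {κ : Type*} [Fintype κ]
    (θ : H.root) (k : ℂ) (u u' : κ → 𝔤) (T : ℤ → 𝔤 →ₗ[ℂ] S A) (N : ℕ) (v : S A) : S A :=
  (1 / (k - dualCoxeter θ)) • ∑ n ∈ Finset.Icc (1 : ℤ) N, ∑ j, ⁅T n (u j), ⁅T (1 - n) (u' j), v⁆⁆

end Affine

end TensorHierarchy

end

open TensorHierarchy LieAlgebra.IsKilling

noncomputable section

namespace TensorHierarchy

set_option linter.unusedSectionVars false
set_option linter.unusedSimpArgs false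
set_option linter.unusedVariables false

section

/-! ### Lie superalgebras -/

/-- A complex Lie superalgebra: a bilinear bracket with graded antisymmetry and graded Jacobi
identity with respect to an even and an odd subspace. -/
class LieSuper (L : Type*) [AddCommGroup L] [Module ℂ L] [Bracket L L] where
  add_lie' : ∀ x y z : L, ⁅x + y, z⁆ = ⁅x, z⁆ + ⁅y, z⁆
  lie_add' : ∀ x y z : L, ⁅x, y + z⁆ = ⁅x, y⁆ + ⁅x, z⁆
  smul_lie' : ∀ (a : ℂ) (x y : L), ⁅a • x, y⁆ = a • ⁅x, y⁆
  lie_smul' : ∀ (a : ℂ) (x y : L), ⁅x, a • y⁆ = a • ⁅x, y⁆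
  even : Submodule ℂ L
  odd : Submodule ℂ L
  even_sup_odd : even ⊔ odd = ⊤
  lie_even_even : ∀ x ∈ even, ∀ y ∈ even, ⁅x, y⁆ ∈ even
  lie_even_odd : ∀ x ∈ even, ∀ y ∈ odd, ⁅x, y⁆ ∈ odd
  lie_odd_odd : ∀ x ∈ odd, ∀ y ∈ odd, ⁅x, y⁆ ∈ even
  skew_even : ∀ x ∈ even, ∀ y : L, ⁅y, x⁆ = -⁅x, y⁆
  skew_odd : ∀ x ∈ odd, ∀ y ∈ odd, ⁅y, x⁆ = ⁅x, y⁆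
  jacobi_even : ∀ x ∈ even, ∀ y z : L, ⁅x, ⁅y, z⁆⁆ = ⁅⁅x, y⁆, z⁆ + ⁅y, ⁅x, z⁆⁆
  jacobi_odd : ∀ x ∈ odd, ∀ y ∈ odd, ∀ z : L, ⁅x, ⁅y, z⁆⁆ = ⁅⁅x, y⁆, z⁆ - ⁅y, ⁅x, z⁆⁆

namespace LieSuper

variable {L : Type*} [AddCommGroup L] [Module ℂ L] [Bracket L L] [LieSuper L]

/-- The adjoint action. -/
def ad : L →ₗ[ℂ] Module.End ℂ L :=
  LinearMap.mk₂ ℂ (fun x y => ⁅x, y⁆) add_lie' smul_lie' lie_add' (fun a x y => lie_smul' a x y)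

theorem ad_apply (x y : L) : ad x y = ⁅x, y⁆ := rfl

@[simp] theorem add_br (x y z : L) : ⁅x + y, z⁆ = ⁅x, z⁆ + ⁅y, z⁆ := add_lie' x y z
@[simp] theorem br_add (x y z : L) : ⁅x, y + z⁆ = ⁅x, y⁆ + ⁅x, z⁆ := lie_add' x y z
@[simp] theorem smul_br (a : ℂ) (x y : L) : ⁅a • x, y⁆ = a • ⁅x, y⁆ := smul_lie' a x y
@[simp] theorem br_smul (a : ℂ) (x y : L) : ⁅x, a • y⁆ = a • ⁅x, y⁆ := lie_smul' a x y
@[simp] theorem zero_br (y : L) : ⁅(0 : L), y⁆ = 0 := by simp [← ad_apply]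
@[simp] theorem br_zero (x : L) : ⁅x, (0 : L)⁆ = 0 := by simp [← ad_apply]
@[simp] theorem neg_br (x y : L) : ⁅-x, y⁆ = -⁅x, y⁆ := by simp [← ad_apply]
@[simp] theorem br_neg (x y : L) : ⁅x, -y⁆ = -⁅x, y⁆ := by simp [← ad_apply]
@[simp] theorem sub_br (x y z : L) : ⁅x - y, z⁆ = ⁅x, z⁆ - ⁅y, z⁆ := by simp [← ad_apply]
@[simp] theorem br_sub (x y z : L) : ⁅x, y - z⁆ = ⁅x, y⁆ - ⁅x, z⁆ := by simp [← ad_apply]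
theorem br_sum {κ : Type*} (s : Finset κ) (x : L) (f : κ → L) :
    ⁅x, ∑ k ∈ s, f k⁆ = ∑ k ∈ s, ⁅x, f k⁆ := by simp [← ad_apply]
theorem sum_br {κ : Type*} (s : Finset κ) (x : L) (f : κ → L) :
    ⁅∑ k ∈ s, f k, x⁆ = ∑ k ∈ s, ⁅f k, x⁆ := by simp [← ad_apply]

theorem lie_self_even {x : L} (hx : x ∈ even (L := L)) : ⁅x, x⁆ = 0 := by
  have := skew_even x hx x
  simpa [eq_neg_iff_add_eq_zero, ← two_smul ℂ] using this

theorem lie_eq_neg_of_even {x : L} (hx : x ∈ even (L := L)) (y : L) : ⁅x, y⁆ = -⁅y, x⁆ := by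
  rw [skew_even x hx y, neg_neg]

theorem jacobi_even_right {y : L} (hy : y ∈ even (L := L)) (x z : L) :
    ⁅x, ⁅y, z⁆⁆ = ⁅⁅x, y⁆, z⁆ + ⁅y, ⁅x, z⁆⁆ := by
  rw [jacobi_even y hy x z, skew_even y hy x]; simp

theorem exists_even_odd (x : L) : ∃ y ∈ even (L := L), ∃ z ∈ odd (L := L), y + z = x :=
  Submodule.mem_sup.1 (even_sup_odd (L := L) ▸ Submodule.mem_top)

theorem lie_odd_even {x y : L} (hx : x ∈ odd (L := L)) (hy : y ∈ even (L := L)) :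
    ⁅x, y⁆ ∈ odd (L := L) := by
  rw [skew_even y hy x]; exact neg_mem (lie_even_odd y hy x hx)

/-- Square of an odd element. -/
theorem lie_odd_lie_self {x : L} (hx : x ∈ odd (L := L)) (hxx : ⁅x, x⁆ = 0) (z : L) :
    ⁅x, ⁅x, z⁆⁆ = 0 := by
  have := jacobi_odd x hx x hx z
  rw [hxx, zero_br, zero_sub, eq_neg_iff_add_eq_zero, ← two_smul ℂ] at this
  simpa using this

/-- The set of elements on which `x` acts nilpotently. -/
def nilSet (x : L) : Set L := {y | ∃ n : ℕ, (ad x ^ n) y = 0}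

theorem ad_pow_zero_of_le {x y : L} {n m : ℕ} (h : (ad x ^ n) y = 0) (hnm : n ≤ m) :
    (ad x ^ m) y = 0 := by
  obtain ⟨k, rfl⟩ := Nat.exists_eq_add_of_le hnm
  rw [add_comm, pow_add, Module.End.mul_apply, h, map_zero]

theorem ad_pow_lie {x : L} (hx : x ∈ even (L := L)) (n : ℕ) :
    ∀ (m : ℕ) (k : ℕ), m + k = n → ∀ y z : L, (ad x ^ m) y = 0 → (ad x ^ k) z = 0 →
      (ad x ^ n) ⁅y, z⁆ = 0 := by
  induction n with
  | zero =>
    intro m k hmk y z hy hz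
    obtain ⟨rfl, rfl⟩ : m = 0 ∧ k = 0 := by omega
    have : y = 0 := by simpa using hy
    simp [this]
  | succ n ih =>
    intro m k hmk y z hy hz
    rw [pow_succ, Module.End.mul_apply, ad_apply, jacobi_even x hx, map_add]
    rcases Nat.eq_zero_or_pos m with rfl | hm
    · have : y = 0 := by simpa using hy
      simp [this]
    rcases Nat.eq_zero_or_pos k with rfl | hk
    · have : z = 0 := by simpa using hz
      simp [this]
    rw [ih (m - 1) k (by omega) ⁅x, y⁆ z _ hz, ih m (k - 1) (by omega) y ⁅x, z⁆ hy _, add_zero]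
    · rw [← ad_apply, ← Module.End.mul_apply, ← pow_succ, Nat.sub_add_cancel hk, hz]
    · rw [← ad_apply, ← Module.End.mul_apply, ← pow_succ, Nat.sub_add_cancel hm, hy]

theorem nilSet_lie {x : L} (hx : x ∈ even (L := L)) {y z : L} (hy : y ∈ nilSet x)
    (hz : z ∈ nilSet x) : ⁅y, z⁆ ∈ nilSet x := by
  obtain ⟨m, hm⟩ := hy
  obtain ⟨k, hk⟩ := hz
  exact ⟨m + k, ad_pow_lie hx _ m k rfl y z hm hk⟩

theorem nilSet_add {x y z : L} (hy : y ∈ nilSet x) (hz : z ∈ nilSet x) : y + z ∈ nilSet x := by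
  obtain ⟨m, hm⟩ := hy
  obtain ⟨k, hk⟩ := hz
  exact ⟨m + k, by rw [map_add, ad_pow_zero_of_le hm (by omega), ad_pow_zero_of_le hk (by omega),
    add_zero]⟩

theorem nilSet_smul {x y : L} (a : ℂ) (hy : y ∈ nilSet x) : a • y ∈ nilSet x := by
  obtain ⟨m, hm⟩ := hy
  exact ⟨m, by rw [map_smul, hm, smul_zero]⟩

end LieSuper

section SlTwo

variable {X : Type*} [AddCommGroup X] [Module ℂ X]

theorem lowering_raising_pow (E F H : Module.End ℂ X) (hHE : ∀ z, H (E z) = E (H z) + (2 : ℂ) • E z)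
    (hEF : ∀ z, E (F z) = F (E z) + H z) {w : X} {c : ℂ} (hF : F w = 0) (hH : H w = c • w) (n : ℕ) :
    H ((E ^ n) w) = (c + 2 * n) • (E ^ n) w ∧
      F ((E ^ (n + 1)) w) = (-((n + 1 : ℂ) * (c + n))) • (E ^ n) w := by
  have hH' : ∀ n : ℕ, H ((E ^ n) w) = (c + 2 * n) • (E ^ n) w := by
    intro n
    induction n with
    | zero => simpa using hH
    | succ n ih =>
      rw [pow_succ', Module.End.mul_apply, hHE, ih, map_smul, ← add_smul]
      push_cast; ring_nf
  refine ⟨hH' n, ?_⟩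
  have hFE : ∀ z, F (E z) = E (F z) - H z := fun z => by rw [hEF]; abel
  induction n with
  | zero => simp [hFE, hF, hH]
  | succ n ih =>
    rw [pow_succ', Module.End.mul_apply, hFE, ih, hH', map_smul, ← Module.End.mul_apply, ← pow_succ',
      ← sub_smul]
    push_cast; ring_nf

/-- A vector of positive weight that is annihilated by the lowering operator vanishes, if the
raising operator acts nilpotently. -/
theorem eq_zero_of_lowering_eq_zero (E F H : Module.End ℂ X)
    (hHE : ∀ z, H (E z) = E (H z) + (2 : ℂ) • E z)
    (hEF : ∀ z, E (F z) = F (E z) + H z) {w : X} {c : ℂ} (hF : F w = 0) (hH : H w = c • w)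
    (hc : ∀ n : ℕ, c + n ≠ 0) (hE : ∃ n : ℕ, (E ^ n) w = 0) : w = 0 := by
  obtain ⟨n, hn⟩ := hE
  induction n with
  | zero => simpa using hn
  | succ n ih =>
    have := (lowering_raising_pow E F H hHE hEF hF hH n).2
    rw [hn, map_zero, eq_comm, smul_eq_zero] at this
    refine ih (this.resolve_left ?_)
    exact neg_ne_zero.2 (mul_ne_zero (by exact_mod_cast n.succ_ne_zero) (hc n))

/-- A vector of weight `-m` that is annihilated by the lowering operator is annihilated by the
`(m + 1)`-st power of the raising operator. -/
theorem raising_pow_eq_zero (E F H : Module.End ℂ X)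
    (hHE : ∀ z, H (E z) = E (H z) + (2 : ℂ) • E z)
    (hEF : ∀ z, E (F z) = F (E z) + H z) {w : X} {m : ℕ} (hF : F w = 0) (hH : H w = (-m : ℂ) • w)
    (hE : ∃ n : ℕ, (E ^ n) w = 0) : (E ^ (m + 1)) w = 0 := by
  have key := lowering_raising_pow E F H hHE hEF hF hH
  refine eq_zero_of_lowering_eq_zero E F H hHE hEF (c := m + 2) ?_ ?_ ?_ ?_
  · rw [(key m).2]; simp
  · rw [(key (m + 1)).1]; push_cast; ring_nf
  · intro n h
    have : ((m + 2 + n : ℕ) : ℂ) = 0 := by push_cast; exact h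
    exact absurd (Nat.cast_eq_zero.1 this) (by omega)
  · obtain ⟨n, hn⟩ := hE
    exact ⟨n, by rw [← Module.End.mul_apply, ← pow_add, add_comm, pow_add, Module.End.mul_apply, hn,
      map_zero]⟩

end SlTwo

/-! ### The Lie superalgebra of an associative algebra with an odd variable -/

/-- The even part `A × 0` and the odd part `0 × A`, each a copy of `A`, with the supercommutator. -/
def Dbl (A : Type*) : Type _ := A × A

namespace Dbl

variable {A : Type*} [Ring A] [Algebra ℂ A]

instance : AddCommGroup (Dbl A) := inferInstanceAs (AddCommGroup (A × A))
instance : Module ℂ (Dbl A) := inferInstanceAs (Module ℂ (A × A))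

instance : Bracket (Dbl A) (Dbl A) where
  bracket x y := (x.1 * y.1 - y.1 * x.1 + (x.2 * y.2 + y.2 * x.2),
    x.1 * y.2 - y.2 * x.1 + (x.2 * y.1 - y.1 * x.2))

/-- The even element of an element of `A`. -/
def ev : A →ₗ[ℂ] Dbl A := LinearMap.inl ℂ A A

/-- The odd element of an element of `A`. -/
def od : A →ₗ[ℂ] Dbl A := LinearMap.inr ℂ A A

theorem ext' {x y : Dbl A} (h₁ : x.1 = y.1) (h₂ : x.2 = y.2) : x = y := Prod.ext h₁ h₂

theorem lie_fst (x y : Dbl A) : (⁅x, y⁆ : Dbl A).1 =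
    x.1 * y.1 - y.1 * x.1 + (x.2 * y.2 + y.2 * x.2) := rfl
theorem lie_snd (x y : Dbl A) : (⁅x, y⁆ : Dbl A).2 =
    x.1 * y.2 - y.2 * x.1 + (x.2 * y.1 - y.1 * x.2) := rfl
@[simp] theorem add_fst (x y : Dbl A) : (x + y).1 = x.1 + y.1 := rfl
@[simp] theorem add_snd (x y : Dbl A) : (x + y).2 = x.2 + y.2 := rfl
@[simp] theorem sub_fst (x y : Dbl A) : (x - y).1 = x.1 - y.1 := rfl
@[simp] theorem sub_snd (x y : Dbl A) : (x - y).2 = x.2 - y.2 := rfl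
@[simp] theorem neg_fst (x : Dbl A) : (-x).1 = -x.1 := rfl
@[simp] theorem neg_snd (x : Dbl A) : (-x).2 = -x.2 := rfl
@[simp] theorem smul_fst (a : ℂ) (x : Dbl A) : (a • x).1 = a • x.1 := rfl
@[simp] theorem smul_snd (a : ℂ) (x : Dbl A) : (a • x).2 = a • x.2 := rfl
@[simp] theorem zero_fst : (0 : Dbl A).1 = 0 := rfl
@[simp] theorem zero_snd : (0 : Dbl A).2 = 0 := rfl
@[simp] theorem ev_fst (a : A) : (ev a).1 = a := rfl
@[simp] theorem ev_snd (a : A) : (ev a).2 = 0 := rfl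
@[simp] theorem od_fst (a : A) : (od a).1 = 0 := rfl
@[simp] theorem od_snd (a : A) : (od a).2 = a := rfl

theorem ev_add_od (x : Dbl A) : ev x.1 + od x.2 = x := ext' (by simp) (by simp)

theorem mem_range_ev {x : Dbl A} : x ∈ LinearMap.range (ev (A := A)) ↔ x.2 = 0 :=
  ⟨by rintro ⟨a, rfl⟩; rfl, fun h => ⟨x.1, ext' rfl h.symm⟩⟩

theorem mem_range_od {x : Dbl A} : x ∈ LinearMap.range (od (A := A)) ↔ x.1 = 0 :=
  ⟨by rintro ⟨a, rfl⟩; rfl, fun h => ⟨x.2, ext' h.symm rfl⟩⟩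

instance : LieSuper (Dbl A) where
  add_lie' x y z := ext' (by simp only [lie_fst, add_fst, add_snd]; noncomm_ring)
    (by simp only [lie_snd, add_fst, add_snd]; noncomm_ring)
  lie_add' x y z := ext' (by simp only [lie_fst, add_fst, add_snd]; noncomm_ring)
    (by simp only [lie_snd, add_fst, add_snd]; noncomm_ring)
  smul_lie' a x y := ext' (by simp [lie_fst, smul_sub, smul_add]) (by simp [lie_snd, smul_sub, smul_add])
  lie_smul' a x y := ext' (by simp [lie_fst, smul_sub, smul_add]) (by simp [lie_snd, smul_sub, smul_add])
  even := LinearMap.range ev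
  odd := LinearMap.range od
  even_sup_odd := by
    refine eq_top_iff.2 fun x _ => ?_
    rw [← ev_add_od x]
    exact Submodule.add_mem_sup ⟨_, rfl⟩ ⟨_, rfl⟩
  lie_even_even x hx y hy := by
    rw [mem_range_ev] at *; simp [lie_snd, hx, hy]
  lie_even_odd x hx y hy := by
    rw [mem_range_ev] at *; rw [mem_range_od] at *; simp [lie_fst, hx, hy]
  lie_odd_odd x hx y hy := by
    rw [mem_range_ev] at *; rw [mem_range_od] at *; simp [lie_snd, hx, hy]
  skew_even x hx y := by
    rw [mem_range_ev] at hx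
    refine ext' ?_ ?_ <;> simp [lie_fst, lie_snd, hx]
  skew_odd x hx y hy := by
    rw [mem_range_od] at hx hy
    refine ext' ?_ ?_ <;> simp [lie_fst, lie_snd, hx, hy]; abel
  jacobi_even x hx y z := by
    rw [mem_range_ev] at hx
    refine ext' ?_ ?_ <;> simp only [lie_fst, lie_snd, hx, add_fst, add_snd] <;> noncomm_ring
  jacobi_odd x hx y hy z := by
    rw [mem_range_od] at hx hy
    refine ext' ?_ ?_ <;> simp only [lie_fst, lie_snd, hx, hy, sub_fst, sub_snd] <;> noncomm_ring

theorem ev_mem (a : A) : ev a ∈ LieSuper.even (L := Dbl A) := ⟨a, rfl⟩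
theorem od_mem (a : A) : od a ∈ LieSuper.odd (L := Dbl A) := ⟨a, rfl⟩
theorem lie_ev_ev (a b : A) : ⁅ev a, ev b⁆ = ev (a * b - b * a) := ext' (by simp [lie_fst]) (by simp [lie_snd])
theorem lie_ev_od (a b : A) : ⁅ev a, od b⁆ = od (a * b - b * a) := ext' (by simp [lie_fst]) (by simp [lie_snd])
theorem lie_od_ev (a b : A) : ⁅od a, ev b⁆ = od (a * b - b * a) := ext' (by simp [lie_fst]) (by simp [lie_snd])
theorem lie_od_od (a b : A) : ⁅od a, od b⁆ = ev (a * b + b * a) := ext' (by simp [lie_fst]) (by simp [lie_snd])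

end Dbl

end

section

/-! ### Superalgebras spanned by bracket monomials -/

/-- The degree lattice. -/
abbrev Degree (ι : Type*) : Type _ := Option (Option ι) →₀ ℤ

/-- A superalgebra that is spanned by bracket monomials in the generators, and graded by degree. -/
class MonSuper (ι : outParam (Type*)) (L : Type*) [AddCommGroup L] [Module ℂ L]
    [Bracket L L] where
  add_lie : ∀ x y z : L, ⁅x + y, z⁆ = ⁅x, z⁆ + ⁅y, z⁆
  lie_add : ∀ x y z : L, ⁅x, y + z⁆ = ⁅x, y⁆ + ⁅x, z⁆
  smul_lie : ∀ (a : ℂ) (x y : L), ⁅a • x, y⁆ = a • ⁅x, y⁆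
  lie_smul : ∀ (a : ℂ) (x y : L), ⁅x, a • y⁆ = a • ⁅x, y⁆
  mon : FreeMagma (Gen ι) → L
  mon_mul : ∀ x y, mon (x * y) = ⁅mon x, mon y⁆
  span_mon : Submodule.span ℂ (Set.range mon) = ⊤
  mon_skew : ∀ x y, ⁅mon x, mon y⁆ + superSign x y • ⁅mon y, mon x⁆ = 0
  mon_jacobi : ∀ x y z, ⁅mon x, ⁅mon y, mon z⁆⁆ - ⁅⁅mon x, mon y⁆, mon z⁆
    - superSign x y • ⁅mon y, ⁅mon x, mon z⁆⁆ = 0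
  proj : Set (Degree ι) → L →ₗ[ℂ] L
  proj_mon_of_mem : ∀ P x, deg x ∈ P → proj P (mon x) = mon x
  proj_mon_of_notMem : ∀ P x, deg x ∉ P → proj P (mon x) = 0

namespace MonSuper

variable {ι : Type*} {L : Type*} [AddCommGroup L] [Module ℂ L] [Bracket L L] [MonSuper ι L]

theorem eq_top_of_mon_mem {N : Submodule ℂ L} (h : ∀ x, mon x ∈ N) : N = ⊤ :=
  top_le_iff.1 (span_mon (L := L) ▸ Submodule.span_le.2 (by rintro _ ⟨x, rfl⟩; exact h x))

theorem induction {p : L → Prop} (mon : ∀ x, p (mon x)) (zero : p 0)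
    (add : ∀ x y, p x → p y → p (x + y)) (smul : ∀ (a : ℂ) x, p x → p (a • x)) (x : L) : p x := by
  have hx : x ∈ Submodule.span ℂ (Set.range (MonSuper.mon (L := L))) := span_mon (L := L) ▸ trivial
  induction hx using Submodule.span_induction with
  | mem x hx => obtain ⟨m, rfl⟩ := hx; exact mon m
  | zero => exact zero
  | add x y _ _ hx hy => exact add x y hx hy
  | smul a x _ hx => exact smul a x hx

/-- The span of the monomials with degree in `P`. -/
def comp (P : Set (Degree ι)) : Submodule ℂ L := Submodule.span ℂ (mon '' {x | deg x ∈ P})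

theorem mon_mem_comp {P : Set (Degree ι)} {x : FreeMagma (Gen ι)} (h : deg x ∈ P) :
    (mon x : L) ∈ comp P := Submodule.subset_span ⟨x, h, rfl⟩

theorem comp_induction {P : Set (Degree ι)} {p : L → Prop} (mon : ∀ x, deg x ∈ P → p (mon x))
    (zero : p 0) (add : ∀ x y, p x → p y → p (x + y)) (smul : ∀ (a : ℂ) x, p x → p (a • x))
    {x : L} (hx : x ∈ comp P) : p x := by
  induction hx using Submodule.span_induction with
  | mem x hx => obtain ⟨m, hm, rfl⟩ := hx; exact mon m hm
  | zero => exact zero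
  | add x y _ _ hx hy => exact add x y hx hy
  | smul a x _ hx => exact smul a x hx

theorem comp_mono {P Q : Set (Degree ι)} (h : P ⊆ Q) : comp (L := L) P ≤ comp Q :=
  Submodule.span_mono (Set.image_mono fun _ hx => h hx)

theorem comp_sup (P Q : Set (Degree ι)) : comp (L := L) P ⊔ comp Q = comp (P ∪ Q) := by
  rw [comp, comp, ← Submodule.span_union, ← Set.image_union]; rfl

theorem comp_univ : comp (L := L) Set.univ = ⊤ := eq_top_of_mon_mem fun _ => mon_mem_comp trivial

theorem deg_mul (x y : FreeMagma (Gen ι)) : deg (x * y) = deg x + deg y := rfl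

theorem level_mul (x y : FreeMagma (Gen ι)) : level (x * y) = level x + level y := by
  simp [level, deg_mul]

theorem lie_mem_comp {P Q R : Set (Degree ι)} (h : ∀ p ∈ P, ∀ q ∈ Q, p + q ∈ R) {x y : L}
    (hx : x ∈ comp P) (hy : y ∈ comp Q) : ⁅x, y⁆ ∈ comp R := by
  let br : L →ₗ[ℂ] L →ₗ[ℂ] L := LinearMap.mk₂ ℂ (fun x y => ⁅x, y⁆) add_lie smul_lie lie_add lie_smul
  change br x y ∈ _
  refine comp_induction (p := fun x => br x y ∈ comp R) (fun m hm => ?_) (by simp)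
    (fun _ _ h₁ h₂ => by simpa using add_mem h₁ h₂)
    (fun a _ h₁ => by simpa using Submodule.smul_mem _ a h₁) hx
  refine comp_induction (p := fun y => br (mon m) y ∈ comp R) (fun n hn => ?_) (by simp)
    (fun _ _ h₁ h₂ => by simpa using add_mem h₁ h₂)
    (fun a _ h₁ => by simpa using Submodule.smul_mem _ a h₁) hy
  change ⁅mon m, mon n⁆ ∈ _
  rw [← mon_mul]
  exact mon_mem_comp (h _ hm _ hn)

theorem superSign_of_even {x : FreeMagma (Gen ι)} (h : Even (level x)) (y : FreeMagma (Gen ι)) :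
    superSign x y = 1 := if_neg fun h' => Int.not_odd_iff_even.2 h h'.1

theorem superSign_of_odd {x y : FreeMagma (Gen ι)} (hx : Odd (level x)) (hy : Odd (level y)) :
    superSign x y = -1 := if_pos ⟨hx, hy⟩

instance : LieSuper L :=
  let br : L →ₗ[ℂ] L →ₗ[ℂ] L := LinearMap.mk₂ ℂ (fun x y => ⁅x, y⁆) add_lie smul_lie lie_add lie_smul
  have hbr : ∀ x y : L, ⁅x, y⁆ = br x y := fun _ _ => rfl
  { add_lie' := add_lie
    lie_add' := lie_add
    smul_lie' := smul_lie
    lie_smul' := lie_smul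
    even := comp {d | Even (d none)}
    odd := comp {d | Odd (d none)}
    even_sup_odd := by
      rw [comp_sup, ← comp_univ]; congr 1; ext d; simp [Int.even_or_odd]
    lie_even_even := fun x hx y hy => lie_mem_comp (fun p hp q hq => by simpa using hp.add hq) hx hy
    lie_even_odd := fun x hx y hy =>
      lie_mem_comp (fun p hp q hq => by simpa using hp.add_odd hq) hx hy
    lie_odd_odd := fun x hx y hy => lie_mem_comp (fun p hp q hq => by simpa using hp.add_odd hq) hx hy
    skew_even := fun x hx y => by
      rw [hbr, hbr]
      refine comp_induction (p := fun x => br y x = -br x y) (fun m hm => ?_) (by simp)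
        (fun _ _ h₁ h₂ => by simp [h₁, h₂]; abel) (fun a _ h₁ => by simp [h₁]) hx
      refine induction (p := fun y => br y (mon m) = -br (mon m) y) (fun n => ?_) (by simp)
        (fun _ _ h₁ h₂ => by simp [h₁, h₂]; abel) (fun a _ h₁ => by simp [h₁]) y
      have := mon_skew (L := L) m n
      rw [superSign_of_even hm, one_smul] at this
      exact (neg_eq_of_add_eq_zero_right this).symm
    skew_odd := fun x hx y hy => by
      rw [hbr, hbr]
      refine comp_induction (p := fun x => br y x = br x y) (fun m hm => ?_) (by simp)
        (fun _ _ h₁ h₂ => by simp [h₁, h₂]) (fun a _ h₁ => by simp [h₁]) hx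
      refine comp_induction (p := fun y => br y (mon m) = br (mon m) y) (fun n hn => ?_) (by simp)
        (fun _ _ h₁ h₂ => by simp [h₁, h₂]) (fun a _ h₁ => by simp [h₁]) hy
      have := mon_skew (L := L) n m
      rw [superSign_of_odd hn hm, neg_smul, one_smul, ← sub_eq_add_neg, sub_eq_zero] at this
      exact this
    jacobi_even := fun x hx y z => by
      simp only [hbr]
      refine comp_induction (p := fun x => br x (br y z) = br (br x y) z + br y (br x z))
        (fun m hm => ?_) (by simp) (fun _ _ h₁ h₂ => by simp [h₁, h₂]; abel)
        (fun a _ h₁ => by simp [h₁]) hx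
      refine induction (p := fun y => br (mon m) (br y z) = br (br (mon m) y) z + br y (br (mon m) z))
        (fun n => ?_) (by simp) (fun _ _ h₁ h₂ => by simp [h₁, h₂]; abel)
        (fun a _ h₁ => by simp [h₁]) y
      refine induction (p := fun z => br (mon m) (br (mon n) z) =
        br (br (mon m) (mon n)) z + br (mon n) (br (mon m) z)) (fun k => ?_) (by simp)
        (fun _ _ h₁ h₂ => by simp [h₁, h₂]; abel) (fun a _ h₁ => by simp [h₁]) z
      have := mon_jacobi (L := L) m n k
      rw [superSign_of_even hm, one_smul, sub_sub, sub_eq_zero] at this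
      exact this
    jacobi_odd := fun x hx y hy z => by
      simp only [hbr]
      refine comp_induction (p := fun x => br x (br y z) = br (br x y) z - br y (br x z))
        (fun m hm => ?_) (by simp) (fun _ _ h₁ h₂ => by simp [h₁, h₂]; abel)
        (fun a _ h₁ => by simp [h₁, smul_sub]) hx
      refine comp_induction
        (p := fun y => br (mon m) (br y z) = br (br (mon m) y) z - br y (br (mon m) z))
        (fun n hn => ?_) (by simp) (fun _ _ h₁ h₂ => by simp [h₁, h₂]; abel)
        (fun a _ h₁ => by simp [h₁, smul_sub]) hy
      refine induction (p := fun z => br (mon m) (br (mon n) z) =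
        br (br (mon m) (mon n)) z - br (mon n) (br (mon m) z)) (fun k => ?_) (by simp)
        (fun _ _ h₁ h₂ => by simp [h₁, h₂]; abel) (fun a _ h₁ => by simp [h₁, smul_sub]) z
      have := mon_jacobi (L := L) m n k
      rw [superSign_of_odd hm hn, sub_sub, sub_eq_zero, neg_smul, one_smul,
        ← sub_eq_add_neg] at this
      exact this }

theorem odd_eq : LieSuper.odd (L := L) = comp {d | Odd (d none)} := rfl

theorem mon_lie_lie (x y : FreeMagma (Gen ι)) (z : L) :
    ⁅⁅(mon x : L), (mon y : L)⁆, z⁆ = ⁅(mon x : L), ⁅(mon y : L), z⁆⁆ -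
      superSign x y • ⁅(mon y : L), ⁅(mon x : L), z⁆⁆ := by
  refine induction (p := fun z => ⁅⁅(mon x : L), (mon y : L)⁆, z⁆ =
    ⁅(mon x : L), ⁅(mon y : L), z⁆⁆ - superSign x y • ⁅(mon y : L), ⁅(mon x : L), z⁆⁆) (fun k => ?_) (by simp)
    (fun _ _ h₁ h₂ => ?_) (fun a _ h₁ => ?_) z
  · have := mon_jacobi (L := L) x y k
    rw [sub_right_comm, sub_eq_zero] at this
    exact this.symm
  · simp only [LieSuper.br_add, h₁, h₂, smul_add]; abel
  · simp only [LieSuper.br_smul, h₁, smul_sub, smul_comm a]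

/-- A subspace that is stable under the action of the generators is stable under everything. -/
theorem lie_mem_of_gen {N : Submodule ℂ L} (h : ∀ g, ∀ y ∈ N, ⁅(mon (.of g) : L), y⁆ ∈ N) (x : L) :
    ∀ y ∈ N, ⁅x, y⁆ ∈ N := by
  refine induction (p := fun x => ∀ y ∈ N, ⁅x, y⁆ ∈ N) (fun m => ?_) (by simp)
    (fun _ _ h₁ h₂ y hy => by simpa using add_mem (h₁ y hy) (h₂ y hy))
    (fun a _ h₁ y hy => by simpa using Submodule.smul_mem _ a (h₁ y hy)) x
  induction m with
  | ih1 g => exact h g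
  | ih2 x y hx hy =>
    intro z hz
    rw [mon_mul, mon_lie_lie]
    exact sub_mem (hx _ (hy _ hz)) (Submodule.smul_mem _ _ (hy _ (hx _ hz)))

/-- A subspace that contains the generators and is stable under them is everything. -/
theorem eq_top_of_gen {N : Submodule ℂ L} (h₀ : ∀ g, mon (.of g) ∈ N)
    (h : ∀ g, ∀ y ∈ N, ⁅(mon (.of g) : L), y⁆ ∈ N) : N = ⊤ := by
  refine eq_top_of_mon_mem fun m => ?_
  induction m with
  | ih1 g => exact h₀ g
  | ih2 x y _ hy =>
    rw [mon_mul]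
    exact lie_mem_of_gen h _ _ hy

theorem proj_mem_comp (P : Set (Degree ι)) (x : L) : proj P x ∈ comp P := by
  refine induction (p := fun x => proj P x ∈ comp P) (fun m => ?_) (by simp)
    (fun _ _ h₁ h₂ => by simpa using add_mem h₁ h₂)
    (fun a _ h₁ => by simpa using Submodule.smul_mem _ a h₁) x
  by_cases h : deg m ∈ P
  · rw [proj_mon_of_mem P m h]; exact mon_mem_comp h
  · rw [proj_mon_of_notMem P m h]; exact zero_mem _

theorem proj_eq_self {P Q : Set (Degree ι)} (h : P ⊆ Q) {x : L} (hx : x ∈ comp P) :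
    proj Q x = x :=
  comp_induction (p := fun x => proj Q x = x) (fun m hm => proj_mon_of_mem Q m (h hm)) (by simp)
    (fun _ _ h₁ h₂ => by simp [h₁, h₂]) (fun a _ h₁ => by simp [h₁]) hx

theorem proj_eq_zero {P Q : Set (Degree ι)} (h : ∀ d ∈ P, d ∉ Q) {x : L} (hx : x ∈ comp P) :
    proj Q x = 0 :=
  comp_induction (p := fun x => proj Q x = 0) (fun m hm => proj_mon_of_notMem Q m (h _ hm)) (by simp)
    (fun _ _ h₁ h₂ => by simp [h₁, h₂]) (fun a _ h₁ => by simp [h₁]) hx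

theorem proj_mon_lie (d : Degree ι) (m : FreeMagma (Gen ι)) (x : L) :
    proj {d} ⁅(mon m : L), x⁆ = ⁅(mon m : L), proj {d - deg m} x⁆ := by
  refine induction (p := fun x => proj {d} ⁅(mon m : L), x⁆ = ⁅(mon m : L), proj {d - deg m} x⁆) (fun n => ?_)
    (by simp) (fun _ _ h₁ h₂ => by simp [h₁, h₂]) (fun a _ h₁ => by simp [h₁]) x
  rw [← mon_mul]
  by_cases h : deg n = d - deg m
  · rw [proj_mon_of_mem _ _ (by rw [deg_mul, h]; simp), proj_mon_of_mem _ n (by simp [h]), mon_mul]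
  · rw [proj_mon_of_notMem _ _ (by rw [deg_mul]; contrapose! h; simp at h; rw [← h]; abel),
      proj_mon_of_notMem _ n (by simp [h]), LieSuper.br_zero]

theorem exists_sum_proj (x : L) : ∃ F : Finset (Degree ι), ∀ F', F ⊆ F' →
    ∑ d ∈ F', proj {d} x = x := by
  classical
  refine induction (p := fun x => ∃ F : Finset (Degree ι), ∀ F', F ⊆ F' →
    ∑ d ∈ F', proj {d} x = x) (fun m => ?_) ⟨∅, by simp⟩ (fun x y h₁ h₂ => ?_)
    (fun a x h₁ => ?_) x
  · refine ⟨{deg m}, fun F' hF => ?_⟩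
    rw [Finset.sum_eq_single (deg m), proj_mon_of_mem {deg m} m rfl]
    · intro d _ hd; exact proj_mon_of_notMem _ _ (by simpa using hd.symm)
    · intro h; exact absurd (hF (by simp)) h
  · obtain ⟨F, hF⟩ := h₁
    obtain ⟨G, hG⟩ := h₂
    refine ⟨F ∪ G, fun F' h => ?_⟩
    simp only [map_add, Finset.sum_add_distrib]
    rw [hF F' (Finset.union_subset_left h), hG F' (Finset.union_subset_right h)]
  · obtain ⟨F, hF⟩ := h₁
    refine ⟨F, fun F' h => ?_⟩
    simp only [map_smul, ← Finset.smul_sum]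
    rw [hF F' h]

theorem proj_eq_sum {P : Set (Degree ι)} (x : L) : ∃ F : Finset (Degree ι), (∀ d ∈ F, d ∈ P) ∧
    ∑ d ∈ F, proj {d} x = proj P x := by
  classical
  obtain ⟨F, hF⟩ := exists_sum_proj x
  refine ⟨F.filter (· ∈ P), by simp, ?_⟩
  conv_rhs => rw [← hF F subset_rfl, map_sum]
  rw [Finset.sum_filter]
  refine Finset.sum_congr rfl fun d _ => ?_
  split_ifs with h
  · rw [proj_eq_self (by simpa using h) (proj_mem_comp {d} x)]
  · rw [proj_eq_zero (by rintro _ rfl; exact h) (proj_mem_comp {d} x)]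

/-- A subspace is homogeneous if it contains the components of its elements. -/
def IsHomogeneous (N : Submodule ℂ L) : Prop := ∀ d, ∀ x ∈ N, proj {d} x ∈ N

theorem isHomogeneous_iff_le {N : Submodule ℂ L} :
    IsHomogeneous N ↔ N ≤ ⨆ d : Degree ι, N ⊓ comp {d} := by
  constructor
  · intro h x hx
    obtain ⟨F, hF⟩ := exists_sum_proj x
    rw [← hF F subset_rfl]
    exact sum_mem fun d _ => Submodule.mem_iSup_of_mem d ⟨h d x hx, proj_mem_comp _ _⟩
  · intro h d x hx
    refine Submodule.iSup_induction _ (motive := fun x => proj {d} x ∈ N) (h hx) (fun d' y hy => ?_)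
      (by simp) (fun _ _ h₁ h₂ => by simpa using add_mem h₁ h₂)
    by_cases hd : d' = d
    · rw [proj_eq_self (by simp [hd]) hy.2]; exact hy.1
    · rw [proj_eq_zero (by simpa using hd) hy.2]; exact zero_mem _

/-- Homogeneous left ideals are stable on both sides. -/
theorem lie_mem_right {N : Submodule ℂ L} (hN : IsHomogeneous N)
    (h : ∀ x : L, ∀ y ∈ N, ⁅x, y⁆ ∈ N) (x : L) {y : L} (hy : y ∈ N) : ⁅y, x⁆ ∈ N := by
  obtain ⟨F, hF⟩ := exists_sum_proj y
  rw [← hF F subset_rfl, LieSuper.sum_br]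
  refine sum_mem fun d _ => ?_
  have hd : proj {d} y ∈ N := hN d y hy
  obtain ⟨x₀, hx₀, x₁, hx₁, rfl⟩ := LieSuper.exists_even_odd x
  rw [LieSuper.br_add]
  refine add_mem ?_ ?_
  · rw [LieSuper.skew_even x₀ hx₀]; exact neg_mem (h _ _ hd)
  · rcases Int.even_or_odd (d none) with he | ho
    · rw [LieSuper.lie_eq_neg_of_even (comp_mono (by simpa using he) (proj_mem_comp _ _))]
      exact neg_mem (h _ _ hd)
    · rw [LieSuper.skew_odd x₁ hx₁ _ (comp_mono (by simpa using ho) (proj_mem_comp _ _))]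
      exact h _ _ hd

/-- The smallest homogeneous subspace containing a subspace. -/
def hull (N : Submodule ℂ L) : Submodule ℂ L := ⨆ d : Degree ι, N.map (proj {d})

theorem le_hull (N : Submodule ℂ L) : N ≤ hull N := by
  intro x hx
  obtain ⟨F, hF⟩ := exists_sum_proj x
  rw [← hF F subset_rfl]
  exact sum_mem fun d _ => Submodule.mem_iSup_of_mem d ⟨x, hx, rfl⟩

theorem isHomogeneous_hull (N : Submodule ℂ L) : IsHomogeneous (hull N) := by
  intro d x hx
  refine Submodule.iSup_induction _ (motive := fun x => proj {d} x ∈ hull N) hx (fun d' y hy => ?_)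
    (by simp) (fun _ _ h₁ h₂ => by simpa using add_mem h₁ h₂)
  obtain ⟨z, hz, rfl⟩ := hy
  by_cases hd : d' = d
  · rw [proj_eq_self (by simp [hd]) (proj_mem_comp _ _)]
    exact Submodule.mem_iSup_of_mem d' ⟨z, hz, rfl⟩
  · rw [proj_eq_zero (by simpa using hd) (proj_mem_comp _ _)]; exact zero_mem _

theorem lie_mem_hull {N : Submodule ℂ L} (h : ∀ x : L, ∀ y ∈ N, ⁅x, y⁆ ∈ N) (x : L) :
    ∀ y ∈ hull N, ⁅x, y⁆ ∈ hull N := by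
  intro y hy
  refine Submodule.iSup_induction _ (motive := fun y => ⁅x, y⁆ ∈ hull N) hy (fun d y hy => ?_)
    (by simp) (fun _ _ h₁ h₂ => by simpa using add_mem h₁ h₂)
  obtain ⟨z, hz, rfl⟩ := hy
  refine induction (p := fun x => ⁅x, proj {d} z⁆ ∈ hull N) (fun m => ?_) (by simp)
    (fun _ _ h₁ h₂ => by simpa using add_mem h₁ h₂)
    (fun a _ h₁ => by simpa using Submodule.smul_mem _ a h₁) x
  have := proj_mon_lie (d + deg m) m z
  rw [add_sub_cancel_right] at this
  rw [← this]
  exact Submodule.mem_iSup_of_mem _ ⟨_, h _ _ hz, rfl⟩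

theorem proj_zero_hull {N : Submodule ℂ L} (h : ∀ x ∈ N, proj {0} x = 0) :
    ∀ x ∈ hull N, proj {0} x = 0 := by
  intro y hy
  refine Submodule.iSup_induction _ (motive := fun y => proj {0} y = 0) hy (fun d y hy => ?_)
    (by simp) (fun _ _ h₁ h₂ => by simp [h₁, h₂])
  obtain ⟨z, hz, rfl⟩ := hy
  by_cases hd : d = 0
  · rw [hd, h z hz, map_zero]
  · exact proj_eq_zero (by simpa using hd) (proj_mem_comp _ _)

end MonSuper

end

section

/-! ### The free algebra -/

section Free

variable {ι : Type*}

/-- The basis of bracket monomials of the free algebra. -/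
def monBasis : Module.Basis (FreeMagma (Gen ι)) ℂ (FreeAlg ι) :=
  .ofRepr (MonoidAlgebra.coeffLinearEquiv ℂ)

theorem monomial_mul (x y : FreeMagma (Gen ι)) : monomial (x * y) = monomial x * monomial y :=
  map_mul (FreeMagma.lift gen) x y

theorem monBasis_apply (m : FreeMagma (Gen ι)) : monBasis m = monomial m := by
  have : ∀ m : FreeMagma (Gen ι), monBasis m = MonoidAlgebra.single m 1 := fun m => rfl
  rw [this]
  induction m with
  | ih1 g => rfl
  | ih2 x y hx hy =>
    rw [monomial_mul, ← hx, ← hy, MonoidAlgebra.single_mul_single, one_mul]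

theorem free_induction {p : FreeAlg ι → Prop} (mon : ∀ m, p (monomial m)) (zero : p 0)
    (add : ∀ x y, p x → p y → p (x + y)) (smul : ∀ (a : ℂ) x, p x → p (a • x))
    (x : FreeAlg ι) : p x := by
  have hx : x ∈ Submodule.span ℂ (Set.range (monBasis (ι := ι))) := by
    rw [monBasis.span_eq]; trivial
  induction hx using Submodule.span_induction with
  | mem x hx => obtain ⟨m, rfl⟩ := hx; rw [monBasis_apply]; exact mon m
  | zero => exact zero
  | add x y _ _ hx hy => exact add x y hx hy
  | smul a x _ hx => exact smul a x hx

open Classical in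
/-- The projection of the free algebra to the monomials with degree in `P`. -/
def freeProj (P : Set (Degree ι)) : FreeAlg ι →ₗ[ℂ] FreeAlg ι :=
  monBasis.constr ℂ fun m => if deg m ∈ P then monomial m else 0

theorem freeProj_of_mem {P : Set (Degree ι)} {m : FreeMagma (Gen ι)} (h : deg m ∈ P) :
    freeProj P (monomial m) = monomial m := by
  rw [← monBasis_apply, freeProj, Module.Basis.constr_basis, if_pos h, monBasis_apply]

theorem freeProj_of_notMem {P : Set (Degree ι)} {m : FreeMagma (Gen ι)} (h : deg m ∉ P) :
    freeProj P (monomial m) = 0 := by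
  rw [← monBasis_apply, freeProj, Module.Basis.constr_basis, if_neg h]

theorem freeProj_mul_left (P : Set (Degree ι)) (m : FreeMagma (Gen ι)) (x : FreeAlg ι) :
    freeProj P (monomial m * x) = monomial m * freeProj {q | deg m + q ∈ P} x := by
  refine free_induction (p := fun x => freeProj P (monomial m * x) =
    monomial m * freeProj {q | deg m + q ∈ P} x) (fun n => ?_) (by simp)
    (fun _ _ h₁ h₂ => by simp [mul_add, h₁, h₂])
    (fun a _ h₁ => by simp only [mul_smul_comm, map_smul, h₁]) x
  rw [← monomial_mul]
  by_cases h : deg m + deg n ∈ P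
  · rw [freeProj_of_mem (m := m * n) h, freeProj_of_mem (m := n) h, monomial_mul]
  · rw [freeProj_of_notMem (m := m * n) h, freeProj_of_notMem (m := n) h, mul_zero]

theorem freeProj_mul_right (P : Set (Degree ι)) (m : FreeMagma (Gen ι)) (x : FreeAlg ι) :
    freeProj P (x * monomial m) = freeProj {q | q + deg m ∈ P} x * monomial m := by
  refine free_induction (p := fun x => freeProj P (x * monomial m) =
    freeProj {q | q + deg m ∈ P} x * monomial m) (fun n => ?_) (by simp)
    (fun _ _ h₁ h₂ => by simp [add_mul, h₁, h₂])
    (fun a _ h₁ => by simp only [smul_mul_assoc, map_smul, h₁]) x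
  rw [← monomial_mul]
  by_cases h : deg n + deg m ∈ P
  · rw [freeProj_of_mem (m := n * m) h, freeProj_of_mem (m := n) h, monomial_mul]
  · rw [freeProj_of_notMem (m := n * m) h, freeProj_of_notMem (m := n) h, zero_mul]

/-- The span of the monomials of degree `d`. -/
def freeComp (d : Degree ι) : Submodule ℂ (FreeAlg ι) :=
  Submodule.span ℂ (monomial '' {m | deg m = d})

theorem freeProj_eq {P : Set (Degree ι)} {d : Degree ι} {x : FreeAlg ι} (hx : x ∈ freeComp d) :
    freeProj P x = x ∨ freeProj P x = 0 := by
  by_cases h : d ∈ P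
  · left
    induction hx using Submodule.span_induction with
    | mem x hx => obtain ⟨m, rfl, rfl⟩ := hx; exact freeProj_of_mem h
    | zero => simp
    | add x y _ _ hx hy => simp [hx, hy]
    | smul a x _ hx => simp [hx]
  · right
    induction hx using Submodule.span_induction with
    | mem x hx => obtain ⟨m, rfl, rfl⟩ := hx; exact freeProj_of_notMem h
    | zero => simp
    | add x y _ _ hx hy => simp [hx, hy]
    | smul a x _ hx => simp [hx]

theorem monomial_mem_freeComp (m : FreeMagma (Gen ι)) : monomial m ∈ freeComp (deg m) :=
  Submodule.subset_span ⟨m, rfl, rfl⟩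

theorem gen_mem_freeComp (g : Gen ι) : gen g ∈ freeComp g.deg := monomial_mem_freeComp (.of g)

theorem mul_mem_freeComp {d d' : Degree ι} {x y : FreeAlg ι} (hx : x ∈ freeComp d)
    (hy : y ∈ freeComp d') : x * y ∈ freeComp (d + d') := by
  induction hx using Submodule.span_induction with
  | mem x hx =>
    obtain ⟨m, rfl, rfl⟩ := hx
    induction hy using Submodule.span_induction with
    | mem y hy =>
      obtain ⟨n, rfl, rfl⟩ := hy
      rw [← monomial_mul]; exact monomial_mem_freeComp (m * n)
    | zero => simp
    | add x y _ _ hx hy => rw [mul_add]; exact add_mem hx hy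
    | smul a x _ hx => rw [mul_smul_comm]; exact Submodule.smul_mem _ a hx
  | zero => simp
  | add x y _ _ hx hy => rw [add_mul]; exact add_mem hx hy
  | smul a x _ hx => rw [smul_mul_assoc]; exact Submodule.smul_mem _ a hx

theorem exists_relator_mem_freeComp {A : Matrix (Option ι) (Option ι) ℤ} {r : FreeAlg ι}
    (hr : Relator A r) : ∃ d, r ∈ freeComp d := by
  have eq : ∀ {d d' : Degree ι} {x : FreeAlg ι}, x ∈ freeComp d → d = d' → x ∈ freeComp d' :=
    fun hx h => h ▸ hx
  have iter : ∀ (g g' : Gen ι) (n : ℕ),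
      ∃ d, (fun z => gen g * z)^[n] (gen g') ∈ freeComp d := by
    intro g g' n
    induction n with
    | zero => exact ⟨_, gen_mem_freeComp g'⟩
    | succ n ih =>
      obtain ⟨d, hd⟩ := ih
      rw [Function.iterate_succ_apply']
      exact ⟨_, mul_mem_freeComp (gen_mem_freeComp g) hd⟩
  have gm := gen_mem_freeComp (ι := ι)
  have mm := monomial_mem_freeComp (ι := ι)
  have sm : ∀ {d : Degree ι} {x : FreeAlg ι} (a : ℂ), x ∈ freeComp d → a • x ∈ freeComp d :=
    fun a h => Submodule.smul_mem _ a h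
  cases hr with
  | skew x y =>
    exact ⟨_, add_mem (mul_mem_freeComp (mm x) (mm y))
      (sm _ (eq (mul_mem_freeComp (mm y) (mm x)) (add_comm _ _)))⟩
  | jacobi x y z =>
    refine ⟨_, sub_mem (sub_mem (mul_mem_freeComp (mm x) (mul_mem_freeComp (mm y) (mm z)))
      (eq (mul_mem_freeComp (mul_mem_freeComp (mm x) (mm y)) (mm z)) (add_assoc _ _ _)))
      (sm _ (eq (mul_mem_freeComp (mm y) (mul_mem_freeComp (mm x) (mm z))) ?_))⟩
    abel
  | h_e a n => exact ⟨_, sub_mem (mul_mem_freeComp (gm _) (gm _)) (sm _ (eq (gm _) (zero_add _).symm))⟩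
  | h_f a b => exact ⟨_, add_mem (mul_mem_freeComp (gm _) (gm _)) (sm _ (eq (gm _) (zero_add _).symm))⟩
  | e_f_same a =>
    refine ⟨_, sub_mem (mul_mem_freeComp (gm _) (gm _)) (eq (gm _) ?_)⟩
    simp [Gen.deg]
  | e_f_ne n b hn => exact ⟨_, mul_mem_freeComp (gm _) (gm _)⟩
  | serre_e m n hmn => exact iter _ _ _
  | serre_f a b hab => exact iter _ _ _
  | eps_phi i =>
    refine ⟨_, sub_mem (mul_mem_freeComp (gm _) (gm _)) (eq (gm _) ?_)⟩
    simp [Gen.deg]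
  | h_phi a j =>
    exact ⟨_, add_mem (mul_mem_freeComp (gm _) (gm _)) (sm _ (eq (gm _) (zero_add _).symm))⟩
  | e_f_phi_same i k =>
    refine ⟨_, sub_mem (mul_mem_freeComp (gm _) (mul_mem_freeComp (gm _) (gm _)))
      (sm _ (eq (gm _) ?_))⟩
    simp [Gen.deg, ← add_assoc]
  | e_f_phi_ne i j k hij => exact ⟨_, mul_mem_freeComp (gm _) (mul_mem_freeComp (gm _) (gm _))⟩
  | e_zero_phi i => exact ⟨_, mul_mem_freeComp (gm _) (gm _)⟩
  | f_zero_f_zero_phi i => exact ⟨_, mul_mem_freeComp (gm _) (mul_mem_freeComp (gm _) (gm _))⟩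
  | phi_phi i j => exact ⟨_, mul_mem_freeComp (gm _) (gm _)⟩
  | phi_phi_f_zero i j hi hj => exact ⟨_, mul_mem_freeComp (gm _) (mul_mem_freeComp (gm _) (gm _))⟩
  | e_e_phi i k => exact ⟨_, mul_mem_freeComp (gm _) (mul_mem_freeComp (gm _) (gm _))⟩
  | phi_cartan i j k =>
    exact ⟨_, sub_mem (sm _ (mul_mem_freeComp (gm _) (gm _)))
      (sm _ (eq (mul_mem_freeComp (gm _) (gm (.phi j))) rfl))⟩
  | f_zero_e_phi i k hi => exact ⟨_, mul_mem_freeComp (gm _) (mul_mem_freeComp (gm _) (gm _))⟩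

theorem freeProj_mem_relationIdeal {A : Matrix (Option ι) (Option ι) ℤ} (P : Set (Degree ι))
    {x : FreeAlg ι} (hx : x ∈ relationIdeal A) : freeProj P x ∈ relationIdeal A := by
  let Q : Submodule ℂ (FreeAlg ι) := ⨅ P : Set (Degree ι), (relationIdeal A).comap (freeProj P)
  have hQ : ∀ {y}, y ∈ Q ↔ ∀ P, freeProj P y ∈ relationIdeal A := by
    intro y; simp [Q]
  have hI := isIdeal_idealSpan (LinearMap.mul ℂ (FreeAlg ι)) {x | Relator A x}
  suffices h : relationIdeal A ≤ Q from hQ.1 (h hx) P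
  refine sInf_le ⟨fun x y hy => ⟨?_, ?_⟩, fun r hr => ?_⟩
  · refine free_induction (p := fun x => LinearMap.mul ℂ (FreeAlg ι) x y ∈ Q) (fun m => ?_) (by simp)
      (fun _ _ h₁ h₂ => by simpa [add_mul] using add_mem h₁ h₂)
      (fun a _ h₁ => by simpa using Submodule.smul_mem _ a h₁) x
    refine hQ.2 fun P => ?_
    rw [LinearMap.mul_apply', freeProj_mul_left]
    exact (hI _ _ (hQ.1 hy _)).1
  · refine free_induction (p := fun x => LinearMap.mul ℂ (FreeAlg ι) y x ∈ Q) (fun m => ?_) (by simp)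
      (fun _ _ h₁ h₂ => by simpa [mul_add] using add_mem h₁ h₂)
      (fun a _ h₁ => by simpa using Submodule.smul_mem _ a h₁) x
    refine hQ.2 fun P => ?_
    rw [LinearMap.mul_apply', freeProj_mul_right]
    exact (hI _ _ (hQ.1 hy _)).2
  · refine hQ.2 fun P => ?_
    obtain ⟨d, hd⟩ := exists_relator_mem_freeComp hr
    rcases freeProj_eq (P := P) hd with h | h
    · rw [h, relationIdeal, idealSpan, Submodule.mem_sInf]; exact fun I hI => hI.2 hr
    · rw [h]; exact zero_mem _

theorem relator_mem {A : Matrix (Option ι) (Option ι) ℤ} {r : FreeAlg ι} (hr : Relator A r) :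
    r ∈ relationIdeal A := by
  rw [relationIdeal, idealSpan, Submodule.mem_sInf]; exact fun I hI => hI.2 hr

end Free

/-! ### The monomial structure of `S̃` and `S` -/

section Instances

variable {ι : Type*} (A : Matrix (Option ι) (Option ι) ℤ)

instance : Bracket (STilde A) (STilde A) where
  bracket x y := tildeBracket A x y

/-- The quotient map from the free algebra to `S̃`. -/
def toTilde : FreeAlg ι →ₗ[ℂ] STilde A := (relationIdeal A).mkQ

theorem toTilde_surjective : Function.Surjective (toTilde A) := Submodule.mkQ_surjective _

theorem toTilde_mul (x y : FreeAlg ι) : toTilde A (x * y) = ⁅toTilde A x, toTilde A y⁆ := rfl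

theorem toTilde_monomial (m : FreeMagma (Gen ι)) : toTilde A (monomial m) = tildeMonomial A m := rfl

theorem toTilde_relator {r : FreeAlg ι} (hr : Relator A r) : toTilde A r = 0 :=
  (Submodule.Quotient.mk_eq_zero _).2 (relator_mem hr)

instance : MonSuper ι (STilde A) where
  add_lie x y z := by change tildeBracket A _ _ = _; simp; rfl
  lie_add x y z := by change tildeBracket A _ _ = _; simp; rfl
  smul_lie a x y := by change tildeBracket A _ _ = _; simp; rfl
  lie_smul a x y := by change tildeBracket A _ _ = _; simp; rfl
  mon := tildeMonomial A
  mon_mul x y := by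
    rw [← toTilde_monomial, monomial_mul, toTilde_mul]; rfl
  span_mon := by
    rw [← Submodule.range_mkQ (relationIdeal A), LinearMap.range_eq_map, ← monBasis.span_eq,
      Submodule.map_span, ← Set.range_comp]
    congr 2; ext m; simp [monBasis_apply, tildeMonomial]
  mon_skew x y := by
    simpa only [map_add, map_smul, toTilde_mul, toTilde_monomial] using
      toTilde_relator A (Relator.skew x y)
  mon_jacobi x y z := by
    simpa only [map_sub, map_smul, toTilde_mul, toTilde_monomial] using
      toTilde_relator A (Relator.jacobi x y z)
  proj P := (relationIdeal A).mapQ _ (freeProj P) fun _ hx => freeProj_mem_relationIdeal P hx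
  proj_mon_of_mem P x hx := by
    simp only [tildeMonomial, Submodule.mkQ_apply, Submodule.mapQ_apply, freeProj_of_mem hx]
  proj_mon_of_notMem P x hx := by
    simp only [tildeMonomial, Submodule.mkQ_apply, Submodule.mapQ_apply, freeProj_of_notMem hx,
      Submodule.Quotient.mk_zero]

open MonSuper

theorem tildeComponent_eq (d : Degree ι) : tildeComponent A d = comp {d} := by
  rw [tildeComponent, comp]
  congr 1; ext x
  exact ⟨fun ⟨m, hm, hx⟩ => ⟨m, hm, hx.symm⟩, fun ⟨m, hm, hx⟩ => ⟨m, hm, hx.symm⟩⟩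

theorem isHomogeneous_maximalIdeal : IsHomogeneous (maximalIdeal A) := by
  intro d
  change maximalIdeal A ≤ (maximalIdeal A).comap (proj {d})
  refine sSup_le fun I hI x hx => ?_
  have : IsHomogeneous I := isHomogeneous_iff_le.2 (by simpa only [tildeComponent_eq] using hI.2.1)
  exact (le_sSup hI : I ≤ maximalIdeal A) (this d x hx)

theorem proj_mem_maximalIdeal (P : Set (Degree ι)) {x : STilde A} (hx : x ∈ maximalIdeal A) :
    proj P x ∈ maximalIdeal A := by
  obtain ⟨F, -, hF⟩ := proj_eq_sum (P := P) x
  rw [← hF]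
  exact sum_mem fun d _ => isHomogeneous_maximalIdeal A d x hx

theorem proj_zero_maximalIdeal {x : STilde A} (hx : x ∈ maximalIdeal A) :
    proj {0} x = 0 := by
  have : maximalIdeal A ≤ LinearMap.ker (proj (L := STilde A) {0}) := by
    refine sSup_le fun I hI x hx => ?_
    have h : IsHomogeneous I := isHomogeneous_iff_le.2 (by simpa only [tildeComponent_eq] using hI.2.1)
    have h' : proj {0} x ∈ I ⊓ tildeComponent A 0 := by
      rw [tildeComponent_eq]; exact ⟨h 0 x hx, proj_mem_comp _ _⟩
    rw [hI.2.2] at h'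
    exact h'
  exact this hx

theorem le_maximalIdeal {I : Submodule ℂ (STilde A)} (hI : IsHomogeneous I)
    (h : ∀ x : STilde A, ∀ y ∈ I, ⁅x, y⁆ ∈ I) (h₀ : ∀ x ∈ I, x ∈ comp {0} → x = 0) :
    I ≤ maximalIdeal A := by
  refine le_sSup ⟨fun x y hy => ⟨h x y hy, lie_mem_right hI h x hy⟩, ?_, ?_⟩
  · simpa only [tildeComponent_eq] using isHomogeneous_iff_le.1 hI
  · rw [tildeComponent_eq, eq_bot_iff]
    rintro x ⟨h₁, h₂⟩
    exact h₀ x h₁ h₂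

/-- The quotient map from `S̃` to `S`. -/
def toS : STilde A →ₗ[ℂ] S A := (maximalIdeal A).mkQ

theorem toS_surjective : Function.Surjective (toS A) := Submodule.mkQ_surjective _

theorem toS_lie (x y : STilde A) : toS A ⁅x, y⁆ = ⁅toS A x, toS A y⁆ := rfl

theorem toS_eq_zero {x : STilde A} : toS A x = 0 ↔ x ∈ maximalIdeal A :=
  Submodule.Quotient.mk_eq_zero _

theorem toS_mon (m : FreeMagma (Gen ι)) : toS A (mon m) = ofMonomial A m := rfl

instance : MonSuper ι (S A) where
  add_lie x y z := by
    obtain ⟨x, rfl⟩ := toS_surjective A x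
    obtain ⟨y, rfl⟩ := toS_surjective A y
    obtain ⟨z, rfl⟩ := toS_surjective A z
    rw [← map_add, ← toS_lie, LieSuper.add_br, map_add]; rfl
  lie_add x y z := by
    obtain ⟨x, rfl⟩ := toS_surjective A x
    obtain ⟨y, rfl⟩ := toS_surjective A y
    obtain ⟨z, rfl⟩ := toS_surjective A z
    rw [← map_add, ← toS_lie, LieSuper.br_add, map_add]; rfl
  smul_lie a x y := by
    obtain ⟨x, rfl⟩ := toS_surjective A x
    obtain ⟨y, rfl⟩ := toS_surjective A y
    rw [← map_smul, ← toS_lie, LieSuper.smul_br, map_smul]; rfl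
  lie_smul a x y := by
    obtain ⟨x, rfl⟩ := toS_surjective A x
    obtain ⟨y, rfl⟩ := toS_surjective A y
    rw [← map_smul, ← toS_lie, LieSuper.br_smul, map_smul]; rfl
  mon := ofMonomial A
  mon_mul x y := by rw [← toS_mon, mon_mul]; rfl
  span_mon := by
    have := congrArg (Submodule.map (toS A)) (span_mon (L := STilde A))
    rw [Submodule.map_span, ← Set.range_comp, Submodule.map_top,
      LinearMap.range_eq_top.2 (toS_surjective A)] at this
    exact this
  mon_skew x y := by
    simpa only [map_add, map_smul, toS_lie, toS_mon, map_zero] using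
      congrArg (toS A) (mon_skew (L := STilde A) x y)
  mon_jacobi x y z := by
    simpa only [map_sub, map_smul, toS_lie, toS_mon, map_zero] using
      congrArg (toS A) (mon_jacobi (L := STilde A) x y z)
  proj P := (maximalIdeal A).mapQ _ (proj P) fun _ hx => proj_mem_maximalIdeal A P hx
  proj_mon_of_mem P x hx := by
    have := congrArg (toS A) (proj_mon_of_mem (L := STilde A) P x hx)
    exact this
  proj_mon_of_notMem P x hx := by
    have := congrArg (toS A) (proj_mon_of_notMem (L := STilde A) P x hx)
    rw [map_zero] at this
    exact this

theorem toS_proj (P : Set (Degree ι)) (x : STilde A) : toS A (proj P x) = proj P (toS A x) := rfl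

theorem toS_mem_comp {P : Set (Degree ι)} {x : STilde A} (hx : x ∈ comp P) :
    toS A x ∈ comp P := by
  rw [← proj_eq_self subset_rfl hx, toS_proj]; exact proj_mem_comp _ _

theorem levelComponent_eq (l : ℤ) : levelComponent A l = comp {d | d none = l} := by
  rw [levelComponent, comp]
  congr 1; ext x
  exact ⟨fun ⟨m, hm, hx⟩ => ⟨m, hm, hx.symm⟩, fun ⟨m, hm, hx⟩ => ⟨m, hm, hx.symm⟩⟩

/-- A subspace of `S` that is stable under the generators vanishes if it has no component of
degree `0`. -/
theorem eq_bot_of_proj_zero {N : Submodule ℂ (S A)}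
    (h : ∀ g, ∀ y ∈ N, ⁅ofGen A g, y⁆ ∈ N) (h₀ : ∀ x ∈ N, proj {0} x = 0) : N = ⊥ := by
  have h' := lie_mem_hull (lie_mem_of_gen h)
  have hle : (hull N).comap (toS A) ≤ maximalIdeal A := by
    refine le_maximalIdeal A (fun d x hx => ?_) (fun x y hy => ?_) (fun x hx hx₀ => ?_)
    · exact isHomogeneous_hull N d _ hx
    · change toS A ⁅x, y⁆ ∈ hull N
      rw [toS_lie]; exact h' _ _ hy
    · have h₁ : toS A x = 0 := by
        rw [← proj_zero_hull h₀ _ hx, ← toS_proj, proj_eq_self subset_rfl hx₀]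
      rw [toS_eq_zero] at h₁
      rw [← proj_zero_maximalIdeal A h₁, proj_eq_self subset_rfl hx₀]
  refine eq_bot_iff.2 fun x hx => ?_
  obtain ⟨y, rfl⟩ := toS_surjective A x
  exact (toS_eq_zero A).2 (hle (le_hull N hx))

end Instances

/-! ### Homomorphisms from `S̃` -/

section Lift

variable {ι : Type*} {L : Type*} [AddCommGroup L] [Module ℂ L] [Bracket L L] [LieSuper L]

/-- The value of a bracket monomial. -/
def evalMon (g : Gen ι → L) : FreeMagma (Gen ι) → L
  | .of a => g a
  | .mul x y => ⁅evalMon g x, evalMon g y⁆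

/-- The bracket preserving map from the free algebra given by the images of the generators. -/
def evalFree (g : Gen ι → L) : FreeAlg ι →ₗ[ℂ] L := monBasis.constr ℂ (evalMon g)

theorem evalFree_monomial (g : Gen ι → L) (m : FreeMagma (Gen ι)) :
    evalFree g (monomial m) = evalMon g m := by
  rw [← monBasis_apply, evalFree, Module.Basis.constr_basis]

theorem evalFree_gen (g : Gen ι → L) (a : Gen ι) : evalFree g (gen a) = g a :=
  evalFree_monomial g (.of a)

theorem evalFree_mul (g : Gen ι → L) (x y : FreeAlg ι) :
    evalFree g (x * y) = ⁅evalFree g x, evalFree g y⁆ := by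
  refine free_induction (p := fun x => evalFree g (x * y) = ⁅evalFree g x, evalFree g y⁆)
    (fun m => ?_) (by simp) (fun _ _ h₁ h₂ => by simp [add_mul, h₁, h₂])
    (fun a _ h₁ => by simp [smul_mul_assoc, h₁]) x
  refine free_induction (p := fun y => evalFree g (monomial m * y) =
    ⁅evalFree g (monomial m), evalFree g y⁆) (fun n => ?_) (by simp)
    (fun _ _ h₁ h₂ => by simp [mul_add, h₁, h₂]) (fun a _ h₁ => by simp [mul_smul_comm, h₁]) y
  rw [← monomial_mul, evalFree_monomial, evalFree_monomial, evalFree_monomial]; rfl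

/-- The images of the generators have the right parity. -/
def IsParity (g : Gen ι → L) : Prop :=
  ∀ a, (Even (level (.of a)) → g a ∈ LieSuper.even) ∧ (Odd (level (.of a)) → g a ∈ LieSuper.odd)

theorem evalMon_parity {g : Gen ι → L} (hg : IsParity g) (m : FreeMagma (Gen ι)) :
    (Even (level m) → evalMon g m ∈ LieSuper.even) ∧
      (Odd (level m) → evalMon g m ∈ LieSuper.odd) := by
  induction m with
  | ih1 a => exact hg a
  | ih2 x y hx hy =>
    change (_ → ⁅evalMon g x, evalMon g y⁆ ∈ _) ∧ (_ → ⁅evalMon g x, evalMon g y⁆ ∈ _)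
    rw [MonSuper.level_mul]
    constructor <;> intro h
    · rcases Int.even_or_odd (level x) with h' | h'
      · exact LieSuper.lie_even_even _ (hx.1 h') _ (hy.1 ((Int.even_add.1 h).1 h'))
      · refine LieSuper.lie_odd_odd _ (hx.2 h') _ (hy.2 ?_)
        rw [← Int.not_even_iff_odd] at h' ⊢
        exact fun h'' => h' ((Int.even_add.1 h).2 h'')
    · rcases Int.even_or_odd (level x) with h' | h'
      · exact LieSuper.lie_even_odd _ (hx.1 h') _ (hy.2 ((Int.odd_add'.1 h).2 h'))
      · exact LieSuper.lie_odd_even (hx.2 h') (hy.1 ((Int.odd_add.1 h).1 h'))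

theorem evalFree_skew {g : Gen ι → L} (hg : IsParity g) (x y : FreeMagma (Gen ι)) :
    evalFree g (monomial x * monomial y + superSign x y • (monomial y * monomial x)) = 0 := by
  simp only [map_add, map_smul, evalFree_mul, evalFree_monomial]
  rcases Int.even_or_odd (level x) with hx | hx
  · rw [MonSuper.superSign_of_even hx, one_smul,
      LieSuper.lie_eq_neg_of_even ((evalMon_parity hg x).1 hx), neg_add_cancel]
  rcases Int.even_or_odd (level y) with hy | hy
  · rw [superSign, if_neg fun h => Int.not_odd_iff_even.2 hy h.2, one_smul,
      LieSuper.lie_eq_neg_of_even ((evalMon_parity hg y).1 hy), add_neg_cancel]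
  · rw [MonSuper.superSign_of_odd hx hy, neg_smul, one_smul,
      LieSuper.skew_odd _ ((evalMon_parity hg x).2 hx) _ ((evalMon_parity hg y).2 hy), add_neg_cancel]

theorem evalFree_jacobi {g : Gen ι → L} (hg : IsParity g) (x y z : FreeMagma (Gen ι)) :
    evalFree g (monomial x * (monomial y * monomial z) - (monomial x * monomial y) * monomial z
      - superSign x y • (monomial y * (monomial x * monomial z))) = 0 := by
  simp only [map_sub, map_smul, evalFree_mul, evalFree_monomial]
  rcases Int.even_or_odd (level x) with hx | hx
  · rw [MonSuper.superSign_of_even hx, one_smul,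
      LieSuper.jacobi_even _ ((evalMon_parity hg x).1 hx)]; abel
  rcases Int.even_or_odd (level y) with hy | hy
  · rw [superSign, if_neg fun h => Int.not_odd_iff_even.2 hy h.2, one_smul,
      LieSuper.jacobi_even_right ((evalMon_parity hg y).1 hy)]; abel
  · rw [MonSuper.superSign_of_odd hx hy, neg_smul, one_smul,
      LieSuper.jacobi_odd _ ((evalMon_parity hg x).2 hx) _ ((evalMon_parity hg y).2 hy)]; abel

variable {A : Matrix (Option ι) (Option ι) ℤ}

theorem relationIdeal_le_ker {g : Gen ι → L} (hg : ∀ r, Relator A r → evalFree g r = 0) :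
    relationIdeal A ≤ LinearMap.ker (evalFree g) := by
  refine sInf_le ⟨fun x y hy => ?_, fun r hr => hg r hr⟩
  rw [LinearMap.mem_ker] at hy
  simp [evalFree_mul, hy]

/-- The bracket preserving map from `S̃` given by the images of the generators. -/
def evalTilde (g : Gen ι → L) (hg : ∀ r, Relator A r → evalFree g r = 0) : STilde A →ₗ[ℂ] L :=
  (relationIdeal A).liftQ (evalFree g) (relationIdeal_le_ker hg)

theorem evalTilde_toTilde (g : Gen ι → L) (hg : ∀ r, Relator A r → evalFree g r = 0)
    (x : FreeAlg ι) : evalTilde g hg (toTilde A x) = evalFree g x := Submodule.liftQ_apply _ _ _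

theorem evalTilde_lie (g : Gen ι → L) (hg : ∀ r, Relator A r → evalFree g r = 0)
    (x y : STilde A) : evalTilde g hg ⁅x, y⁆ = ⁅evalTilde g hg x, evalTilde g hg y⁆ := by
  obtain ⟨x, rfl⟩ := toTilde_surjective A x
  obtain ⟨y, rfl⟩ := toTilde_surjective A y
  rw [← toTilde_mul, evalTilde_toTilde, evalTilde_toTilde, evalTilde_toTilde, evalFree_mul]

theorem evalTilde_mon (g : Gen ι → L) (hg : ∀ r, Relator A r → evalFree g r = 0)
    (m : FreeMagma (Gen ι)) : evalTilde g hg (MonSuper.mon m) = evalMon g m :=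
  (evalTilde_toTilde g hg (monomial m)).trans (evalFree_monomial g m)

end Lift

end

section

/-! ### Chevalley data of a simple Lie algebra and its affine extension -/

/-- The Chevalley generators `x i`, `y i`, `h i` of a simple Lie algebra, root vectors `X`, `Y` for
the highest root and its negative with coroot `Θ = [X, Y]`, the affine Cartan matrix, and the
normalized invariant form, together with the facts on root systems that are used about them. -/
structure SimpleData (ι 𝔤 : Type*) [Fintype ι] [LieRing 𝔤] [LieAlgebra ℂ 𝔤] where
  A : Matrix (Option ι) (Option ι) ℤ
  (x y h : ι → 𝔤)
  (X Y Θ : 𝔤)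
  B : 𝔤 →ₗ[ℂ] 𝔤 →ₗ[ℂ] ℂ
  A_diag : ∀ a, A a a = 2
  A_off : ∀ a b, a ≠ b → A a b ≤ 0
  A_zero : ∀ i, A (some i) none = 0 ↔ A none (some i) = 0
  A_inj : ∀ n : ι → ℤ, (∀ i, ∑ j, A (some i) (some j) * n j = 0) → n = 0
  marks : ∃ n : ι → ℤ, (∀ i, ∑ j, A (some i) (some j) * n j = -A (some i) none) ∧
    ∑ j, A none (some j) * n j = -2
  h_indep : LinearIndependent ℂ h
  h_h : ∀ i j, ⁅h i, h j⁆ = 0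
  h_x : ∀ i j, ⁅h i, x j⁆ = (A (some i) (some j) : ℂ) • x j
  h_y : ∀ i j, ⁅h i, y j⁆ = -(A (some i) (some j) : ℂ) • y j
  x_y_same : ∀ i, ⁅x i, y i⁆ = h i
  x_y_ne : ∀ i j, i ≠ j → ⁅x i, y j⁆ = 0
  h_X : ∀ i, ⁅h i, X⁆ = -(A (some i) none : ℂ) • X
  h_Y : ∀ i, ⁅h i, Y⁆ = (A (some i) none : ℂ) • Y
  Θ_x : ∀ j, ⁅Θ, x j⁆ = -(A none (some j) : ℂ) • x j
  Θ_y : ∀ j, ⁅Θ, y j⁆ = (A none (some j) : ℂ) • y j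
  Θ_h : ∀ i, ⁅Θ, h i⁆ = 0
  X_Y : ⁅X, Y⁆ = Θ
  Θ_X : ⁅Θ, X⁆ = (2 : ℂ) • X
  Θ_Y : ⁅Θ, Y⁆ = -(2 : ℂ) • Y
  x_X : ∀ i, ⁅x i, X⁆ = 0
  y_Y : ∀ i, ⁅y i, Y⁆ = 0
  B_symm : ∀ u w, B u w = B w u
  B_inv : ∀ u w z, B ⁅u, w⁆ z = B u ⁅w, z⁆
  B_nondeg : ∀ u, (∀ w, B u w = 0) → u = 0
  B_X_Y : B X Y = 1
  X_X : ∀ w, ⁅X, ⁅X, w⁆⁆ = (-2 * B X w) • X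
  Y_Y : ∀ w, ⁅Y, ⁅Y, w⁆⁆ = (-2 * B Y w) • Y
  nil_x : ∀ i (w : 𝔤), ∃ n : ℕ, (fun z => ⁅x i, z⁆)^[n] w = 0
  nil_y : ∀ i (w : 𝔤), ∃ n : ℕ, (fun z => ⁅y i, z⁆)^[n] w = 0
  exists_adjacent : ∃ i, A (some i) none ≠ 0
  pos : ∀ n : ι → ℕ, n ≠ 0 → ∃ i, 0 < ∑ j, A (some i) (some j) * n j
  root : ∀ (l : List ι) (i : ι), l.foldr (fun j z => ⁅x j, z⁆) (x i) ≠ 0 →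
    (∃ k, 0 < ((i :: l).map fun j => A (some k) (some j)).sum + A (some k) none) ∨
      ((i :: l).map fun j => A none (some j)).sum = -1 ∨
      ∃ c : ℂ, l.foldr (fun j z => ⁅x j, z⁆) (x i) = c • X
  gen : ∀ N : Submodule ℂ 𝔤, (∀ i, x i ∈ N) → (∀ i, y i ∈ N) →
    (∀ i, ∀ z ∈ N, ⁅x i, z⁆ ∈ N) → (∀ i, ∀ z ∈ N, ⁅y i, z⁆ ∈ N) → N = ⊤
  X_mem : ∀ N : Submodule ℂ 𝔤, (∀ i, x i ∈ N) → (∀ i, ∀ z ∈ N, ⁅x i, z⁆ ∈ N) → X ∈ N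
  simple : ∀ N : Submodule ℂ 𝔤, (∀ u : 𝔤, ∀ z ∈ N, ⁅u, z⁆ ∈ N) → N = ⊥ ∨ N = ⊤

namespace SimpleData

variable {ι 𝔤 : Type*} [Fintype ι] [LieRing 𝔤] [LieAlgebra ℂ 𝔤] (D : SimpleData ι 𝔤)

theorem X_ne_zero : D.X ≠ 0 := fun h => by simpa [h] using D.B_X_Y

theorem y_x (i : ι) : ⁅D.y i, D.x i⁆ = -D.h i := by rw [← lie_skew, D.x_y_same]

theorem Y_X : ⁅D.Y, D.X⁆ = -D.Θ := by rw [← lie_skew, D.X_Y]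

theorem x_h (i j : ι) : ⁅D.x j, D.h i⁆ = -(D.A (some i) (some j) : ℂ) • D.x j := by
  rw [← lie_skew, D.h_x, neg_smul]

theorem y_h (i j : ι) : ⁅D.y j, D.h i⁆ = (D.A (some i) (some j) : ℂ) • D.y j := by
  rw [← lie_skew, D.h_y, neg_smul, neg_neg]

theorem iterate_eq (z w : 𝔤) (n : ℕ) :
    (fun u => ⁅z, u⁆)^[n] w = (LieAlgebra.ad ℂ 𝔤 z ^ n) w := by
  rw [Module.End.pow_apply]; rfl

theorem serre_aux {e f h w : 𝔤} (hhe : ⁅h, e⁆ = (2 : ℂ) • e) (hef : ⁅e, f⁆ = h) {m : ℕ}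
    (hf : ⁅f, w⁆ = 0) (hh : ⁅h, w⁆ = (-m : ℂ) • w) (he : ∃ n : ℕ, (fun z => ⁅e, z⁆)^[n] w = 0) :
    (fun z => ⁅e, z⁆)^[m + 1] w = 0 := by
  rw [iterate_eq]
  refine raising_pow_eq_zero (LieAlgebra.ad ℂ 𝔤 e) (LieAlgebra.ad ℂ 𝔤 f) (LieAlgebra.ad ℂ 𝔤 h)
    (fun z => ?_) (fun z => ?_) hf hh (by simpa only [iterate_eq] using he)
  · simp only [LieAlgebra.ad_apply]
    rw [leibniz_lie, hhe, smul_lie, add_comm]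
  · simp only [LieAlgebra.ad_apply]
    rw [leibniz_lie, hef, add_comm]

theorem X_cube (w : 𝔤) : (fun z => ⁅D.X, z⁆)^[3] w = 0 := by
  simp only [Function.iterate_succ, Function.iterate_zero, Function.comp_apply, id, X_X, lie_smul,
    lie_self, smul_zero]

theorem Y_cube (w : 𝔤) : (fun z => ⁅D.Y, z⁆)^[3] w = 0 := by
  simp only [Function.iterate_succ, Function.iterate_zero, Function.comp_apply, id, Y_Y, lie_smul,
    lie_self, smul_zero]

theorem serre_x (i : ι) {w : 𝔤} {n : ℤ} (hn : n ≤ 0) (hf : ⁅D.y i, w⁆ = 0)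
    (hh : ⁅D.h i, w⁆ = (n : ℂ) • w) : (fun z => ⁅D.x i, z⁆)^[(1 - n).toNat] w = 0 := by
  obtain ⟨m, rfl⟩ := Int.exists_eq_neg_ofNat hn
  rw [show (1 - -(m : ℤ)).toNat = m + 1 by omega]
  exact serre_aux (by simpa [D.A_diag] using D.h_x i i) (D.x_y_same i) hf (by simpa using hh)
    (D.nil_x i w)

theorem serre_y (i : ι) {w : 𝔤} {n : ℤ} (hn : n ≤ 0) (hf : ⁅D.x i, w⁆ = 0)
    (hh : ⁅D.h i, w⁆ = -(n : ℂ) • w) : (fun z => ⁅D.y i, z⁆)^[(1 - n).toNat] w = 0 := by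
  obtain ⟨m, rfl⟩ := Int.exists_eq_neg_ofNat hn
  rw [show (1 - -(m : ℤ)).toNat = m + 1 by omega]
  refine serre_aux (h := -D.h i) ?_ (D.y_x i) hf (by rw [neg_lie, hh]; simp) (D.nil_y i w)
  rw [neg_lie, D.h_y, D.A_diag]; simp

theorem serre_Y (w : 𝔤) {n : ℤ} (hn : n ≤ 0) (hf : ⁅D.X, w⁆ = 0)
    (hh : ⁅D.Θ, w⁆ = -(n : ℂ) • w) : (fun z => ⁅D.Y, z⁆)^[(1 - n).toNat] w = 0 := by
  obtain ⟨m, rfl⟩ := Int.exists_eq_neg_ofNat hn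
  rw [show (1 - -(m : ℤ)).toNat = m + 1 by omega]
  exact serre_aux (h := -D.Θ) (by rw [neg_lie, D.Θ_Y]; simp) D.Y_X hf (by rw [neg_lie, hh]; simp)
    ⟨3, D.Y_cube w⟩

theorem serre_X (w : 𝔤) {n : ℤ} (hn : n ≤ 0) (hf : ⁅D.Y, w⁆ = 0)
    (hh : ⁅D.Θ, w⁆ = (n : ℂ) • w) : (fun z => ⁅D.X, z⁆)^[(1 - n).toNat] w = 0 := by
  obtain ⟨m, rfl⟩ := Int.exists_eq_neg_ofNat hn
  rw [show (1 - -(m : ℤ)).toNat = m + 1 by omega]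
  exact serre_aux D.Θ_X D.X_Y hf (by simpa using hh) ⟨3, D.X_cube w⟩

theorem B_inv' (u w z : 𝔤) : D.B ⁅u, w⁆ z = -D.B w ⁅u, z⁆ := by
  rw [← lie_skew, map_neg, LinearMap.neg_apply, D.B_inv]

/-- Eigenvectors of `t` whose eigenvalues do not cancel are orthogonal. -/
theorem B_eq_zero {t u w : 𝔤} {a b : ℂ} (hu : ⁅t, u⁆ = a • u) (hw : ⁅t, w⁆ = b • w)
    (hab : a + b ≠ 0) : D.B u w = 0 := by
  have h := D.B_inv' t u w
  rw [hu, hw, map_smul, map_smul, LinearMap.smul_apply, eq_neg_iff_add_eq_zero, smul_eq_mul,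
    smul_eq_mul, ← add_mul] at h
  exact (mul_eq_zero.1 h).resolve_left hab

theorem B_Θ (w : 𝔤) : D.B D.Θ w = D.B D.X ⁅D.Y, w⁆ := by rw [← D.X_Y, D.B_inv]

theorem B_Θ_h (i : ι) : D.B D.Θ (D.h i) = -D.A (some i) none := by
  rw [B_Θ, ← lie_skew, D.h_Y, map_neg, map_smul, D.B_X_Y]; simp

theorem B_Y_h (i : ι) : D.B D.Y (D.h i) = 0 :=
  D.B_eq_zero (t := D.Θ) D.Θ_Y (b := 0) (by rw [D.Θ_h, zero_smul]) (by norm_num)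

theorem Y_x_of_A_eq_zero {i : ι} (hi : D.A none (some i) = 0) : ⁅D.Y, D.x i⁆ = 0 := by
  have := D.serre_Y (D.x i) (n := 0) le_rfl (by rw [← lie_skew, D.x_X, neg_zero])
    (by rw [D.Θ_x, hi])
  simpa using this

theorem X_y_of_A_eq_zero {i : ι} (hi : D.A none (some i) = 0) : ⁅D.X, D.y i⁆ = 0 := by
  have := D.serre_X (D.y i) (n := 0) le_rfl (by rw [← lie_skew, D.y_Y, neg_zero])
    (by rw [D.Θ_y, hi])
  simpa using this

theorem lie_X_X (z : 𝔤) : ⁅⁅z, D.X⁆, D.X⁆ = (-2 * D.B z D.X) • D.X := by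
  rw [← lie_skew, ← lie_skew z D.X, lie_neg, neg_neg, D.X_X, D.B_symm]

/-- Polarization of `X_X`. -/
theorem X_lie_lie (z w : 𝔤) : ⁅⁅z, D.X⁆, ⁅D.X, w⁆⁆ =
    -D.B D.X w • ⁅z, D.X⁆ - D.B z D.X • ⁅D.X, w⁆ - D.B z ⁅D.X, w⁆ • D.X := by
  have h1 : ⁅⁅z, D.X⁆, ⁅D.X, w⁆⁆ = ⁅D.X, ⁅⁅z, D.X⁆, w⁆⁆ - ⁅⁅D.X, ⁅z, D.X⁆⁆, w⁆ := by
    rw [leibniz_lie D.X]; abel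
  have h2 : ⁅D.X, ⁅z, D.X⁆⁆ = (2 * D.B D.X z) • D.X := by
    rw [← lie_skew z D.X, lie_neg, D.X_X, ← neg_smul]; ring_nf
  have h3 : ⁅⁅z, D.X⁆, w⁆ = ⁅z, ⁅D.X, w⁆⁆ - ⁅D.X, ⁅z, w⁆⁆ := by rw [leibniz_lie z]; abel
  have h4 : ⁅D.X, ⁅z, ⁅D.X, w⁆⁆⁆ = -⁅⁅z, D.X⁆, ⁅D.X, w⁆⁆ + (-2 * D.B D.X w) • ⁅z, D.X⁆ := by
    rw [leibniz_lie D.X z, D.X_X w, lie_smul, ← lie_skew z D.X, neg_lie, neg_neg]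
  rw [h2, h3, lie_sub, h4, D.X_X, smul_lie] at h1
  have h7 : D.B z ⁅D.X, w⁆ = -D.B D.X ⁅z, w⁆ := by rw [← D.B_inv, D.B_inv']
  rw [h7, D.B_symm z]
  rw [← sub_eq_zero] at h1 ⊢
  refine (smul_eq_zero_iff_right (two_ne_zero (α := ℂ))).1 ?_
  rw [← h1]; module

theorem lie_X_lie_h (z : 𝔤) (i : ι) : ⁅⁅z, D.X⁆, D.h i⁆ =
    ⁅D.X, -(D.A (some i) none : ℂ) • z - ⁅z, D.h i⁆⁆ := by
  rw [lie_lie, ← lie_skew D.X (D.h i), D.h_X, lie_sub, lie_smul, lie_neg, lie_smul,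
    ← lie_skew D.X z, smul_neg]

theorem B_lie_X_lie_h (z : 𝔤) (i : ι) : D.B D.X (-(D.A (some i) none : ℂ) • z - ⁅z, D.h i⁆) = 0 := by
  rw [map_sub, ← lie_skew z, map_neg, ← D.B_inv, ← lie_skew D.X, D.h_X]
  simp

end SimpleData

end

section

/-! ### The local part of the tensor hierarchy algebra -/

section Local

variable {𝔤 : Type*} [LieRing 𝔤] [LieAlgebra ℂ 𝔤] {L : Type*} [AddCommGroup L] [Module ℂ L]
  [Bracket L L] [LieSuper L]

open LieSuper

/-- Elements of a Lie superalgebra that satisfy the relations of the local part of the tensor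
hierarchy algebra: `tm1 u`, `ph u` have degree `-1`, `t0 u`, `K`, `v` have degree `0`, and `t1 u`,
`Lo`, `eps` have degree `1`. -/
structure LocalData (B : 𝔤 →ₗ[ℂ] 𝔤 →ₗ[ℂ] ℂ) (L : Type*) [AddCommGroup L] [Module ℂ L]
    [Bracket L L] [LieSuper L] where
  (t0 t1 tm1 ph : 𝔤 →ₗ[ℂ] L)
  (K Lo v eps : L)
  t0_even : ∀ u, t0 u ∈ even (L := L)
  t1_even : ∀ u, t1 u ∈ even (L := L)
  tm1_even : ∀ u, tm1 u ∈ even (L := L)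
  K_even : K ∈ even (L := L)
  Lo_even : Lo ∈ even (L := L)
  ph_odd : ∀ u, ph u ∈ odd (L := L)
  v_odd : v ∈ odd (L := L)
  eps_odd : eps ∈ odd (L := L)
  t0_t0 : ∀ u w, ⁅t0 u, t0 w⁆ = t0 ⁅u, w⁆
  t0_t1 : ∀ u w, ⁅t0 u, t1 w⁆ = t1 ⁅u, w⁆
  t0_tm1 : ∀ u w, ⁅t0 u, tm1 w⁆ = tm1 ⁅u, w⁆
  t0_ph : ∀ u w, ⁅t0 u, ph w⁆ = ph ⁅u, w⁆
  t0_v : ∀ u, ⁅t0 u, v⁆ = 0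
  t0_Lo : ∀ u, ⁅t0 u, Lo⁆ = 0
  t0_eps : ∀ u, ⁅t0 u, eps⁆ = 0
  K_t0 : ∀ u, ⁅K, t0 u⁆ = 0
  K_t1 : ∀ u, ⁅K, t1 u⁆ = 0
  K_tm1 : ∀ u, ⁅K, tm1 u⁆ = 0
  K_Lo : ⁅K, Lo⁆ = 0
  K_ph : ∀ u, ⁅K, ph u⁆ = ph u
  K_v : ⁅K, v⁆ = v
  K_eps : ⁅K, eps⁆ = -eps
  v_v : ⁅v, v⁆ = 0
  v_tm1 : ∀ u, ⁅v, tm1 u⁆ = -ph u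
  v_ph : ∀ u, ⁅v, ph u⁆ = 0
  v_t1 : ∀ u, ⁅v, t1 u⁆ = 0
  v_Lo : ⁅v, Lo⁆ = 0
  v_eps : ⁅v, eps⁆ = -Lo
  t1_tm1 : ∀ u w, ⁅t1 u, tm1 w⁆ = t0 ⁅u, w⁆ + B u w • K
  t1_ph : ∀ u w, ⁅t1 u, ph w⁆ = B u w • v
  Lo_tm1 : ∀ u, ⁅Lo, tm1 u⁆ = t0 u
  Lo_ph : ∀ u, ⁅Lo, ph u⁆ = 0
  eps_tm1 : ∀ u, ⁅eps, tm1 u⁆ = 0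
  eps_ph : ∀ u, ⁅eps, ph u⁆ = t0 u

namespace LocalData

variable {B : 𝔤 →ₗ[ℂ] 𝔤 →ₗ[ℂ] ℂ} (P : LocalData B L)

theorem t0_lie (u : 𝔤) (y z : L) : ⁅P.t0 u, ⁅y, z⁆⁆ = ⁅⁅P.t0 u, y⁆, z⁆ + ⁅y, ⁅P.t0 u, z⁆⁆ :=
  jacobi_even _ (P.t0_even u) y z

theorem t1_lie (u : 𝔤) (y z : L) : ⁅P.t1 u, ⁅y, z⁆⁆ = ⁅⁅P.t1 u, y⁆, z⁆ + ⁅y, ⁅P.t1 u, z⁆⁆ :=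
  jacobi_even _ (P.t1_even u) y z

theorem tm1_lie (u : 𝔤) (y z : L) : ⁅P.tm1 u, ⁅y, z⁆⁆ = ⁅⁅P.tm1 u, y⁆, z⁆ + ⁅y, ⁅P.tm1 u, z⁆⁆ :=
  jacobi_even _ (P.tm1_even u) y z

theorem K_lie (y z : L) : ⁅P.K, ⁅y, z⁆⁆ = ⁅⁅P.K, y⁆, z⁆ + ⁅y, ⁅P.K, z⁆⁆ :=
  jacobi_even _ P.K_even y z

theorem Lo_lie (y z : L) : ⁅P.Lo, ⁅y, z⁆⁆ = ⁅⁅P.Lo, y⁆, z⁆ + ⁅y, ⁅P.Lo, z⁆⁆ :=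
  jacobi_even _ P.Lo_even y z

theorem lie_t0 (u : 𝔤) (y : L) : ⁅y, P.t0 u⁆ = -⁅P.t0 u, y⁆ := skew_even _ (P.t0_even u) y
theorem lie_t1 (u : 𝔤) (y : L) : ⁅y, P.t1 u⁆ = -⁅P.t1 u, y⁆ := skew_even _ (P.t1_even u) y
theorem lie_tm1 (u : 𝔤) (y : L) : ⁅y, P.tm1 u⁆ = -⁅P.tm1 u, y⁆ := skew_even _ (P.tm1_even u) y
theorem lie_K (y : L) : ⁅y, P.K⁆ = -⁅P.K, y⁆ := skew_even _ P.K_even y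
theorem lie_Lo (y : L) : ⁅y, P.Lo⁆ = -⁅P.Lo, y⁆ := skew_even _ P.Lo_even y

theorem t1_t0 (u w : 𝔤) : ⁅P.t1 u, P.t0 w⁆ = P.t1 ⁅u, w⁆ := by
  rw [lie_t0, t0_t1, ← map_neg, lie_skew]
theorem tm1_t0 (u w : 𝔤) : ⁅P.tm1 u, P.t0 w⁆ = P.tm1 ⁅u, w⁆ := by
  rw [lie_t0, t0_tm1, ← map_neg, lie_skew]
theorem ph_t0 (u w : 𝔤) : ⁅P.ph u, P.t0 w⁆ = P.ph ⁅u, w⁆ := by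
  rw [lie_t0, t0_ph, ← map_neg, lie_skew]
theorem Lo_t0 (u : 𝔤) : ⁅P.Lo, P.t0 u⁆ = 0 := by rw [lie_t0, t0_Lo, neg_zero]
theorem eps_t0 (u : 𝔤) : ⁅P.eps, P.t0 u⁆ = 0 := by rw [lie_t0, t0_eps, neg_zero]
theorem t1_K (u : 𝔤) : ⁅P.t1 u, P.K⁆ = 0 := by rw [lie_K, K_t1, neg_zero]
theorem tm1_K (u : 𝔤) : ⁅P.tm1 u, P.K⁆ = 0 := by rw [lie_K, K_tm1, neg_zero]
theorem Lo_K : ⁅P.Lo, P.K⁆ = 0 := by rw [lie_K, K_Lo, neg_zero]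
theorem ph_K (u : 𝔤) : ⁅P.ph u, P.K⁆ = -P.ph u := by rw [lie_K, K_ph]
theorem eps_K : ⁅P.eps, P.K⁆ = P.eps := by rw [lie_K, K_eps, neg_neg]
theorem tm1_v (u : 𝔤) : ⁅P.tm1 u, P.v⁆ = P.ph u := by
  rw [lie_eq_neg_of_even (P.tm1_even u), v_tm1, neg_neg]
theorem ph_v (u : 𝔤) : ⁅P.ph u, P.v⁆ = 0 := by rw [skew_odd _ P.v_odd _ (P.ph_odd u), v_ph]
theorem t1_v (u : 𝔤) : ⁅P.t1 u, P.v⁆ = 0 := by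
  rw [lie_eq_neg_of_even (P.t1_even u), v_t1, neg_zero]
theorem Lo_v : ⁅P.Lo, P.v⁆ = 0 := by rw [lie_eq_neg_of_even P.Lo_even, v_Lo, neg_zero]
theorem eps_v : ⁅P.eps, P.v⁆ = -P.Lo := by rw [skew_odd _ P.v_odd _ P.eps_odd, v_eps]
theorem tm1_t1 (u w : 𝔤) : ⁅P.tm1 u, P.t1 w⁆ = -P.t0 ⁅w, u⁆ - B w u • P.K := by
  rw [lie_t1, t1_tm1]; abel
theorem ph_t1 (u w : 𝔤) : ⁅P.ph u, P.t1 w⁆ = -(B w u • P.v) := by rw [lie_t1, t1_ph]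
theorem tm1_Lo (u : 𝔤) : ⁅P.tm1 u, P.Lo⁆ = -P.t0 u := by rw [lie_Lo, Lo_tm1]
theorem ph_Lo (u : 𝔤) : ⁅P.ph u, P.Lo⁆ = 0 := by rw [lie_Lo, Lo_ph, neg_zero]
theorem tm1_eps (u : 𝔤) : ⁅P.tm1 u, P.eps⁆ = 0 := by
  rw [lie_eq_neg_of_even (P.tm1_even u), eps_tm1, neg_zero]
theorem ph_eps (u : 𝔤) : ⁅P.ph u, P.eps⁆ = P.t0 u := by
  rw [skew_odd _ P.eps_odd _ (P.ph_odd u), eps_ph]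

theorem v_tm1_lie (u : 𝔤) (z : L) : ⁅P.v, ⁅P.tm1 u, z⁆⁆ = -⁅P.ph u, z⁆ + ⁅P.tm1 u, ⁅P.v, z⁆⁆ := by
  rw [jacobi_even_right (P.tm1_even u), v_tm1, neg_br]
theorem v_t1_lie (u : 𝔤) (z : L) : ⁅P.v, ⁅P.t1 u, z⁆⁆ = ⁅P.t1 u, ⁅P.v, z⁆⁆ := by
  rw [jacobi_even_right (P.t1_even u), v_t1, zero_br, zero_add]
theorem v_ph_lie (u : 𝔤) (z : L) : ⁅P.v, ⁅P.ph u, z⁆⁆ = -⁅P.ph u, ⁅P.v, z⁆⁆ := by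
  rw [jacobi_odd _ P.v_odd _ (P.ph_odd u), v_ph, zero_br, zero_sub]
theorem eps_tm1_lie (u : 𝔤) (z : L) : ⁅P.eps, ⁅P.tm1 u, z⁆⁆ = ⁅P.tm1 u, ⁅P.eps, z⁆⁆ := by
  rw [jacobi_even_right (P.tm1_even u), eps_tm1, zero_br, zero_add]
theorem eps_ph_lie (u : 𝔤) (z : L) : ⁅P.eps, ⁅P.ph u, z⁆⁆ = ⁅P.t0 u, z⁆ - ⁅P.ph u, ⁅P.eps, z⁆⁆ := by
  rw [jacobi_odd _ P.eps_odd _ (P.ph_odd u), eps_ph]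
theorem ph_t1_lie (u w : 𝔤) (z : L) :
    ⁅P.ph u, ⁅P.t1 w, z⁆⁆ = -(B w u • ⁅P.v, z⁆) + ⁅P.t1 w, ⁅P.ph u, z⁆⁆ := by
  rw [jacobi_even_right (P.t1_even w), ph_t1, neg_br, smul_br]
theorem ph_eps_lie (u : 𝔤) (z : L) : ⁅P.ph u, ⁅P.eps, z⁆⁆ = ⁅P.t0 u, z⁆ - ⁅P.eps, ⁅P.ph u, z⁆⁆ := by
  rw [jacobi_odd _ (P.ph_odd u) _ P.eps_odd, ph_eps]
theorem ph_Lo_lie (u : 𝔤) (z : L) : ⁅P.ph u, ⁅P.Lo, z⁆⁆ = ⁅P.Lo, ⁅P.ph u, z⁆⁆ := by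
  rw [jacobi_even_right P.Lo_even, ph_Lo, zero_br, zero_add]

/-- Elements of negative degree that are annihilated by the raising operators vanish, and elements
of positive degree that are annihilated by the lowering operators vanish. Here `Neg` contains the
brackets of degree at most `-2`, and `Pos` those of degree at least `2`. -/
structure IsTransitive (Neg Pos : Submodule ℂ L) : Prop where
  tm1_tm1 : ∀ u w, ⁅P.tm1 u, P.tm1 w⁆ ∈ Neg
  tm1_ph : ∀ u w, ⁅P.tm1 u, P.ph w⁆ ∈ Neg
  ph_ph : ∀ u w, ⁅P.ph u, P.ph w⁆ ∈ Neg
  tm1_mem : ∀ u, ∀ z ∈ Neg, ⁅P.tm1 u, z⁆ ∈ Neg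
  ph_mem : ∀ u, ∀ z ∈ Neg, ⁅P.ph u, z⁆ ∈ Neg
  neg : ∀ z ∈ Neg, (∀ u, ⁅P.t1 u, z⁆ = 0) → ⁅P.Lo, z⁆ = 0 → ⁅P.eps, z⁆ = 0 → z = 0
  t1_t1 : ∀ u w, ⁅P.t1 u, P.t1 w⁆ ∈ Pos
  t1_Lo : ∀ u, ⁅P.t1 u, P.Lo⁆ ∈ Pos
  t1_eps : ∀ u, ⁅P.t1 u, P.eps⁆ ∈ Pos
  Lo_eps : ⁅P.Lo, P.eps⁆ ∈ Pos
  eps_eps : ⁅P.eps, P.eps⁆ ∈ Pos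
  t1_mem : ∀ u, ∀ z ∈ Pos, ⁅P.t1 u, z⁆ ∈ Pos
  Lo_mem : ∀ z ∈ Pos, ⁅P.Lo, z⁆ ∈ Pos
  pos : ∀ z ∈ Pos, (∀ u, ⁅P.tm1 u, z⁆ = 0) → (∀ u, ⁅P.ph u, z⁆ = 0) → z = 0

end LocalData

namespace LocalData.IsTransitive

variable {ι : Type*} [Fintype ι] {D : SimpleData ι 𝔤} {P : LocalData D.B L} {Neg Pos : Submodule ℂ L}
  (hP : P.IsTransitive Neg Pos)

include hP

theorem ph_ph_eq_zero (u w : 𝔤) : ⁅P.ph u, P.ph w⁆ = 0 := by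
  refine hP.neg _ (hP.ph_ph u w) (fun z => ?_) ?_ ?_
  · simp [P.t1_lie, P.t1_ph, P.v_ph, P.ph_v]
  · simp [P.Lo_lie, P.Lo_ph]
  · rw [P.eps_ph_lie, P.eps_ph, P.t0_ph, P.ph_t0, sub_self]

theorem tm1_tm1_eq_zero {u w : 𝔤} (h : ⁅u, w⁆ = 0) : ⁅P.tm1 u, P.tm1 w⁆ = 0 := by
  refine hP.neg _ (hP.tm1_tm1 u w) (fun z => ?_) ?_ ?_
  · simp only [P.t1_lie, P.t1_tm1, add_br, smul_br, br_add, br_smul, P.t0_tm1, P.K_tm1, P.tm1_t0,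
      P.tm1_K, smul_zero, add_zero]
    rw [← map_add, ← leibniz_lie, h]; simp
  · simp [P.Lo_lie, P.Lo_tm1, P.t0_tm1, P.tm1_t0, h]
  · simp [P.eps_tm1_lie, P.eps_tm1]

theorem t1_t1_eq_zero {u w : 𝔤} (h : ⁅u, w⁆ = 0) : ⁅P.t1 u, P.t1 w⁆ = 0 := by
  refine hP.pos _ (hP.t1_t1 u w) (fun z => ?_) (fun z => ?_)
  · simp only [P.tm1_lie, P.tm1_t1, neg_br, sub_br, smul_br, br_sub, br_neg, br_smul, P.t0_t1,
      P.K_t1, P.t1_t0, P.t1_K, smul_zero, sub_zero]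
    rw [← map_neg, ← map_neg, ← map_add, leibniz_lie u, h, ← lie_skew _ w]; simp
  · simp [P.ph_t1_lie, P.ph_t1, P.v_t1, P.t1_v]

theorem tm1_X_ph {w : 𝔤} (h : D.B D.X w = 0) : ⁅P.tm1 D.X, P.ph ⁅D.X, w⁆⁆ = 0 := by
  refine hP.neg _ (hP.tm1_ph _ _) (fun z => ?_) ?_ ?_
  · simp only [P.t1_lie, P.t1_tm1, P.t1_ph, add_br, smul_br, br_smul, P.t0_ph, P.K_ph, P.tm1_v]
    rw [D.X_lie_lie, h]
    simp only [map_sub, map_smul]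
    module
  · simp [P.Lo_lie, P.Lo_tm1, P.Lo_ph, P.t0_ph, D.X_X, h]
  · simp [P.eps_tm1_lie, P.eps_ph, P.tm1_t0, D.X_X, h]

theorem tm1_X_ph_X : ⁅P.tm1 D.X, P.ph D.X⁆ = 0 := by
  have h := hP.tm1_X_ph (w := D.Θ) (D.B_eq_zero (t := D.Θ) (b := 0) D.Θ_X (by simp) (by norm_num))
  rw [← lie_skew, D.Θ_X, map_neg, map_smul, br_neg, br_smul, neg_eq_zero] at h
  exact (smul_eq_zero_iff_right two_ne_zero).1 h

theorem tm1_X_tm1_X_ph (i : ι) : ⁅P.tm1 D.X, ⁅P.tm1 D.X, P.ph (D.h i)⁆⁆ = 0 := by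
  have hX := hP.tm1_X_ph_X
  refine hP.neg _ (hP.tm1_mem _ _ (hP.tm1_ph _ _)) (fun z => ?_) ?_ ?_
  · have hz := hP.tm1_X_ph (D.B_lie_X_lie_h z i)
    rw [← D.lie_X_lie_h] at hz
    have hz' := D.lie_X_X z
    simp only [P.t1_lie, P.t1_tm1, P.t1_ph, add_br, br_add, smul_br, br_smul, P.t0_ph, P.K_ph,
      P.tm1_v, P.t0_lie, P.t0_tm1, P.K_lie, P.K_tm1, zero_br, zero_add, hz, hz', map_smul, hX]
    module
  · have : ⁅D.X, D.h i⁆ = (D.A (some i) none : ℂ) • D.X := by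
      rw [← lie_skew, D.h_X, neg_smul, neg_neg]
    simp [P.Lo_lie, P.Lo_tm1, P.Lo_ph, P.t0_lie, P.t0_ph, P.t0_tm1, this, hX]
  · have : ⁅D.X, D.h i⁆ = (D.A (some i) none : ℂ) • D.X := by
      rw [← lie_skew, D.h_X, neg_smul, neg_neg]
    simp [P.eps_tm1_lie, P.eps_ph, P.tm1_t0, this, lie_self_even (P.tm1_even D.X)]

theorem tm1_X_cube_aux {w : 𝔤} (h : D.B D.X w = 0) : ⁅P.tm1 D.X, P.tm1 ⁅D.X, w⁆⁆ = 0 :=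
  hP.tm1_tm1_eq_zero (by rw [D.X_X, h]; simp)

theorem tm1_X_cube (w : 𝔤) : ⁅P.tm1 D.X, ⁅P.tm1 D.X, P.tm1 ⁅D.X, w⁆⁆⁆ = 0 := by
  have hXX := lie_self_even (P.tm1_even D.X)
  have hswap : ∀ z, D.B z D.X • ⁅P.tm1 D.X, P.tm1 ⁅D.X, w⁆⁆ =
      D.B D.X w • ⁅P.tm1 D.X, P.tm1 ⁅D.X, z⁆⁆ := by
    intro z
    have := hP.tm1_X_cube_aux (w := D.B z D.X • w - D.B D.X w • z) (by
      rw [map_sub, map_smul, map_smul, D.B_symm z, smul_eq_mul, smul_eq_mul]; ring)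
    rw [lie_sub, lie_smul, lie_smul, map_sub, map_smul, map_smul, br_sub, br_smul, br_smul, sub_eq_zero] at this
    exact this
  refine hP.neg _ (hP.tm1_mem _ _ (hP.tm1_tm1 _ _)) (fun z => ?_) ?_ ?_
  · have hz' := D.lie_X_X z
    have hz'' : ⁅D.X, ⁅z, ⁅D.X, w⁆⁆⁆ = -⁅⁅z, D.X⁆, ⁅D.X, w⁆⁆ + (-2 * D.B D.X w) • ⁅z, D.X⁆ := by
      rw [leibniz_lie D.X z, D.X_X w, lie_smul, ← lie_skew z D.X, neg_lie, neg_neg]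
    have h1 : ⁅P.tm1 D.X, P.tm1 ⁅⁅z, D.X⁆, ⁅D.X, w⁆⁆⁆ = 0 := by
      rw [D.X_lie_lie, ← lie_skew z D.X]
      simp only [map_sub, map_smul, map_neg, br_sub, br_smul, hXX,
        br_neg]
      linear_combination (norm := module) (-1 : ℂ) • hswap z
    have h2 : ⁅P.tm1 D.X, P.tm1 ⁅z, D.X⁆⁆ = -⁅P.tm1 D.X, P.tm1 ⁅D.X, z⁆⁆ := by
      rw [← lie_skew z, map_neg, br_neg]
    simp only [P.t1_lie, P.t1_tm1, add_br, br_add, smul_br,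
      br_smul, P.t0_tm1, P.t0_lie, P.K_lie, P.K_tm1, zero_br, br_zero, add_zero, smul_zero,
      P.tm1_K, P.tm1_t0, hz', map_smul, h1, hz'', map_add, map_neg, h2, br_neg]
    linear_combination (norm := module) (-2 : ℂ) • hswap z
  · simp [P.Lo_lie, P.Lo_tm1, P.t0_lie, P.t0_tm1, P.tm1_t0, D.X_X, hXX]
  · simp [P.eps_tm1_lie, P.eps_tm1]

theorem t1_Y_t1 (w : 𝔤) :
    ⁅P.t1 D.Y, P.t1 ⁅D.Y, w⁆⁆ + (2 * D.B D.Y w) • ⁅P.t1 D.Y, P.Lo⁆ = 0 := by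
  refine hP.pos _ (add_mem (hP.t1_t1 _ _) (Submodule.smul_mem _ _ (hP.t1_Lo _))) (fun z => ?_)
    (fun z => ?_)
  · have h1 : ⁅D.Y, ⁅⁅D.Y, w⁆, z⁆⁆ = (-2 * D.B D.Y w) • ⁅D.Y, z⁆ - ⁅⁅D.Y, z⁆, ⁅D.Y, w⁆⁆ := by
      rw [leibniz_lie, D.Y_Y, smul_lie, ← lie_skew ⁅D.Y, w⁆]; abel
    simp only [br_add, br_smul, P.tm1_lie, P.tm1_t1, P.tm1_Lo, sub_br, neg_br, smul_br, br_sub,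
      br_neg, P.t0_t1, P.K_t1, P.t1_t0, P.t1_K, P.t0_Lo, P.K_Lo, h1, map_sub, map_smul]
    module
  · simp [P.ph_t1_lie, P.ph_t1, P.ph_Lo, P.v_t1, P.v_Lo, P.t1_v]

theorem t1_Y_t1_Y_Lo : ⁅P.t1 D.Y, ⁅P.t1 D.Y, P.Lo⁆⁆ = 0 := by
  refine hP.pos _ (hP.t1_mem _ _ (hP.t1_Lo _)) (fun z => ?_) (fun z => ?_)
  · have h1 : ⁅⁅D.Y, z⁆, D.Y⁆ = (2 * D.B D.Y z) • D.Y := by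
      rw [← lie_skew, D.Y_Y, ← neg_smul]; ring_nf
    have h2 := hP.t1_Y_t1 z
    simp only [br_add, br_smul, P.tm1_lie, P.tm1_t1, P.tm1_Lo, sub_br, neg_br, smul_br, br_sub,
      br_neg, P.t0_t1, P.K_t1, P.t1_t0, P.t1_K, P.t0_Lo, P.K_Lo, h1, map_sub, map_smul, P.t0_lie,
      P.K_lie, br_zero, zero_br]
    linear_combination (norm := module) (-1 : ℂ) • h2
  · simp [P.ph_t1_lie, P.ph_t1, P.ph_Lo, P.v_t1, P.v_Lo, P.t1_v, P.v_t1_lie]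

theorem t1_Y_cube (w : 𝔤) : ⁅P.t1 D.Y, ⁅P.t1 D.Y, P.t1 ⁅D.Y, w⁆⁆⁆ = 0 := by
  rw [eq_neg_of_add_eq_zero_left (hP.t1_Y_t1 w), br_neg, br_smul, hP.t1_Y_t1_Y_Lo, smul_zero, neg_zero]

theorem t1_Y_t1_Y_eps : ⁅P.t1 D.Y, ⁅P.t1 D.Y, P.eps⁆⁆ = 0 := by
  refine hP.pos _ (hP.t1_mem _ _ (hP.t1_eps _)) (fun z => ?_) (fun z => ?_)
  · have h1 : ⁅⁅D.Y, z⁆, D.Y⁆ = (2 * D.B D.Y z) • D.Y := by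
      rw [← lie_skew, D.Y_Y, ← neg_smul]; ring_nf
    simp only [br_add, br_smul, P.tm1_lie, P.tm1_t1, P.tm1_eps, sub_br, neg_br, smul_br, br_sub,
      br_neg, P.t0_t1, P.K_t1, P.t1_t0, P.t1_K, P.t0_eps, P.K_eps, h1, map_sub, map_smul, P.t0_lie,
      P.K_lie, br_zero, zero_br]
    module
  · rw [← hP.t1_Y_t1 z]
    simp only [P.ph_t1_lie, P.ph_eps, P.v_t1_lie, P.v_eps, br_add, br_neg, br_smul, P.t1_t0]
    module

theorem eps_eps_eq_zero : ⁅P.eps, P.eps⁆ = 0 :=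
  hP.pos _ hP.eps_eps (fun z => by simp [P.tm1_lie, P.tm1_eps])
    (fun z => by rw [P.ph_eps_lie, P.ph_eps, P.t0_eps, P.eps_t0, sub_zero])

theorem Lo_eps_eq_zero : ⁅P.Lo, P.eps⁆ = 0 :=
  hP.pos _ hP.Lo_eps (fun z => by simp [P.tm1_lie, P.tm1_eps, P.tm1_Lo, P.t0_eps])
    (fun z => by simp [P.ph_Lo_lie, P.ph_eps, P.Lo_t0])

theorem ph_ph_tm1 {i j : ι} (hi : D.A (some i) none = 0) (hj : D.A (some j) none = 0) :
    ⁅P.ph (D.h i), ⁅P.ph (D.h j), P.tm1 D.X⁆⁆ = 0 := by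
  have hX : ∀ k, D.A (some k) none = 0 → ⁅D.h k, D.X⁆ = 0 := fun k hk => by rw [D.h_X, hk]; simp
  have key : ∀ u w z, ⁅P.t1 z, ⁅P.ph u, P.tm1 w⁆⁆ = P.ph (⁅u, ⁅z, w⁆⁆ - D.B z w • u - D.B z u • w) := by
    intro u w z
    simp only [P.t1_lie, P.t1_ph, P.t1_tm1, smul_br, P.v_tm1, br_add, P.ph_t0, br_smul, P.ph_K,
      map_sub, map_smul]
    module
  have h1 : ⁅P.eps, ⁅P.ph (D.h j), P.tm1 D.X⁆⁆ = 0 := by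
    simp [P.eps_ph_lie, P.eps_tm1, P.t0_tm1, hX j hj]
  refine hP.neg _ (hP.ph_mem _ _ ?_) (fun z => ?_) ?_ ?_
  · rw [P.lie_tm1]; exact neg_mem (hP.tm1_ph _ _)
  · rw [P.t1_lie, P.t1_ph, key, hP.ph_ph_eq_zero, smul_br, P.v_ph_lie, P.v_tm1, br_neg,
      hP.ph_ph_eq_zero]
    simp
  · simp [P.Lo_lie, P.Lo_ph, P.Lo_tm1, P.ph_t0, hX j hj]
  · rw [P.eps_ph_lie, h1, P.t0_lie, P.t0_ph, P.t0_tm1, hX i hi, D.h_h]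
    simp

theorem tm1_X_ph_x {i : ι} (hi : D.A (some i) none ≠ 0) : ⁅P.tm1 D.X, P.ph (D.x i)⁆ = 0 := by
  have hA : (D.A none (some i) : ℂ) ≠ 0 := by exact_mod_cast fun h => hi ((D.A_zero i).2 h)
  have h := hP.tm1_X_ph (w := ⁅D.Y, D.x i⁆) (by
    rw [← D.B_inv, D.X_Y]
    exact D.B_eq_zero (t := D.Θ) (a := 0) (by simp) (D.Θ_x i) (by simpa using hA))
  rw [leibniz_lie, D.X_Y, ← lie_skew D.X, D.x_X, neg_zero, lie_zero, add_zero, D.Θ_x, map_smul,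
    br_smul] at h
  exact (smul_eq_zero_iff_right (neg_ne_zero.2 hA)).1 h

end LocalData.IsTransitive

end Local

end

section

/-! ### The defining relations hold in the local part -/

section Relations

variable {ι 𝔤 : Type*} [Fintype ι] [LieRing 𝔤] [LieAlgebra ℂ 𝔤] {L : Type*} [AddCommGroup L]
  [Module ℂ L] [Bracket L L] [LieSuper L]

open LieSuper

namespace LocalData

variable {D : SimpleData ι 𝔤} (P : LocalData D.B L)

/-- The images of the generators in the local part. -/
def gen : Gen ι → L
  | .e none => P.eps
  | .e (some none) => P.t1 D.Y
  | .e (some (some i)) => P.t0 (D.x i)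
  | .f none => P.tm1 D.X
  | .f (some i) => P.t0 (D.y i)
  | .h none => P.K - P.t0 D.Θ
  | .h (some i) => P.t0 (D.h i)
  | .phi i => P.ph (D.h i)

theorem isParity_gen : IsParity P.gen := by
  intro g
  rcases g with ((_ | _ | i) | (_ | i) | (_ | i) | i) <;>
    simp [level, deg, Gen.deg, gen, P.eps_odd, P.t1_even, P.t0_even, P.tm1_even, P.ph_odd,
      sub_mem P.K_even (P.t0_even _)]

theorem iterate_t0_t0 (u w : 𝔤) (n : ℕ) :
    (fun z => ⁅P.t0 u, z⁆)^[n] (P.t0 w) = P.t0 ((fun z => ⁅u, z⁆)^[n] w) :=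
  ((Function.Semiconj.iterate_right (fun z => (P.t0_t0 u z).symm) n) w).symm

theorem iterate_t0_t1 (u w : 𝔤) (n : ℕ) :
    (fun z => ⁅P.t0 u, z⁆)^[n] (P.t1 w) = P.t1 ((fun z => ⁅u, z⁆)^[n] w) :=
  ((Function.Semiconj.iterate_right (fun z => (P.t0_t1 u z).symm) n) w).symm

theorem iterate_t0_tm1 (u w : 𝔤) (n : ℕ) :
    (fun z => ⁅P.t0 u, z⁆)^[n] (P.tm1 w) = P.tm1 ((fun z => ⁅u, z⁆)^[n] w) :=
  ((Function.Semiconj.iterate_right (fun z => (P.t0_tm1 u z).symm) n) w).symm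

end LocalData

theorem iterate_br_eq_zero {z w : L} {k n : ℕ} (h : (fun u => ⁅z, u⁆)^[k] w = 0) (hk : k ≤ n) :
    (fun u => ⁅z, u⁆)^[n] w = 0 := by
  obtain ⟨m, rfl⟩ := Nat.exists_eq_add_of_le hk
  rw [add_comm, Function.iterate_add_apply, h]
  exact Function.iterate_fixed (br_zero z) m

theorem evalFree_iterate (g : Gen ι → L) (a b : Gen ι) (n : ℕ) :
    evalFree g ((fun z => gen a * z)^[n] (gen b)) = (fun z => ⁅g a, z⁆)^[n] (g b) := by
  have := Function.Semiconj.iterate_right (f := evalFree g) (ga := fun z => gen a * z)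
    (gb := fun z => ⁅g a, z⁆) (fun z => by rw [evalFree_mul, evalFree_gen]) n (gen b)
  rw [this, evalFree_gen]

namespace LocalData.IsTransitive

variable {D : SimpleData ι 𝔤} {P : LocalData D.B L} {Neg Pos : Submodule ℂ L}
  (hP : P.IsTransitive Neg Pos)

include hP

theorem serre_e (m n : Option (Option ι)) (hmn : extendedCartan D.A m n ≤ 0) :
    (fun z => ⁅P.gen (.e m), z⁆)^[(1 - extendedCartan D.A m n).toNat] (P.gen (.e n)) = 0 := by
  rcases m with _ | _ | i <;> rcases n with _ | _ | j
  · exact hP.eps_eps_eq_zero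
  · change ⁅P.eps, ⁅P.eps, P.t1 D.Y⁆⁆ = 0
    exact lie_odd_lie_self P.eps_odd hP.eps_eps_eq_zero _
  · exact P.eps_t0 _
  · exact hP.t1_Y_t1_Y_eps
  · have := D.A_diag none
    exact absurd (show D.A none none ≤ 0 from hmn) (by omega)
  · change D.A none (some j) ≤ 0 at hmn
    change (fun z => ⁅P.t1 D.Y, z⁆)^[(1 - D.A none (some j)).toNat] (P.t0 (D.x j)) = 0
    have hB : (2 + D.A none (some j) : ℂ) ≠ 0 → D.B D.Y (D.x j) = 0 := fun h =>
      D.B_eq_zero (t := D.Θ) D.Θ_Y (D.Θ_x j) (by rwa [← neg_add, neg_ne_zero])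
    rcases (by omega : D.A none (some j) = 0 ∨ D.A none (some j) = -1 ∨ D.A none (some j) ≤ -2)
      with h | h | h
    · rw [h]
      change ⁅P.t1 D.Y, P.t0 (D.x j)⁆ = 0
      rw [P.t1_t0, D.Y_x_of_A_eq_zero h, map_zero]
    · rw [h]
      change ⁅P.t1 D.Y, ⁅P.t1 D.Y, P.t0 (D.x j)⁆⁆ = 0
      rw [P.t1_t0]
      refine hP.t1_t1_eq_zero ?_
      rw [D.Y_Y, hB (by rw [h]; norm_num)]; simp
    · refine iterate_br_eq_zero (k := 3) ?_ (by omega)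
      change ⁅P.t1 D.Y, ⁅P.t1 D.Y, ⁅P.t1 D.Y, P.t0 (D.x j)⁆⁆⁆ = 0
      rw [P.t1_t0]
      exact hP.t1_Y_cube _
  · exact P.t0_eps _
  · change (fun z => ⁅P.t0 (D.x i), z⁆)^[(1 - D.A (some i) none).toNat] (P.t1 D.Y) = 0
    rw [P.iterate_t0_t1, D.serre_x i (D.A_off _ _ (by simp)) (D.y_Y i) (D.h_Y i), map_zero]
  · change D.A (some i) (some j) ≤ 0 at hmn
    have hij : i ≠ j := by rintro rfl; have := D.A_diag (some i); omega
    change (fun z => ⁅P.t0 (D.x i), z⁆)^[(1 - D.A (some i) (some j)).toNat] (P.t0 (D.x j)) = 0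
    rw [P.iterate_t0_t0, D.serre_x i hmn _ (D.h_x i j), map_zero]
    rw [← lie_skew, D.x_y_ne j i hij.symm, neg_zero]

theorem serre_f (a b : Option ι) (hab : D.A a b ≤ 0) :
    (fun z => ⁅P.gen (.f a), z⁆)^[(1 - D.A a b).toNat] (P.gen (.f b)) = 0 := by
  rcases a with _ | i <;> rcases b with _ | j
  · have := D.A_diag none
    exact absurd hab (by omega)
  · change (fun z => ⁅P.tm1 D.X, z⁆)^[(1 - D.A none (some j)).toNat] (P.t0 (D.y j)) = 0
    have hB : (2 + D.A none (some j) : ℂ) ≠ 0 → D.B D.X (D.y j) = 0 := fun h =>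
      D.B_eq_zero (t := D.Θ) D.Θ_X (D.Θ_y j) h
    rcases (by omega : D.A none (some j) = 0 ∨ D.A none (some j) = -1 ∨ D.A none (some j) ≤ -2)
      with h | h | h
    · rw [h]
      change ⁅P.tm1 D.X, P.t0 (D.y j)⁆ = 0
      rw [P.tm1_t0, D.X_y_of_A_eq_zero h, map_zero]
    · rw [h]
      change ⁅P.tm1 D.X, ⁅P.tm1 D.X, P.t0 (D.y j)⁆⁆ = 0
      rw [P.tm1_t0]
      exact hP.tm1_X_cube_aux (hB (by rw [h]; norm_num))
    · refine iterate_br_eq_zero (k := 3) ?_ (by omega)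
      change ⁅P.tm1 D.X, ⁅P.tm1 D.X, ⁅P.tm1 D.X, P.t0 (D.y j)⁆⁆⁆ = 0
      rw [P.tm1_t0]
      exact hP.tm1_X_cube _
  · change (fun z => ⁅P.t0 (D.y i), z⁆)^[(1 - D.A (some i) none).toNat] (P.tm1 D.X) = 0
    rw [P.iterate_t0_tm1, D.serre_y i (D.A_off _ _ (by simp)) (D.x_X i) (D.h_X i), map_zero]
  · have hij : i ≠ j := by rintro rfl; have := D.A_diag (some i); omega
    change (fun z => ⁅P.t0 (D.y i), z⁆)^[(1 - D.A (some i) (some j)).toNat] (P.t0 (D.y j)) = 0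
    rw [P.iterate_t0_t0, D.serre_y i hab (D.x_y_ne i j hij) (D.h_y i j), map_zero]

theorem h_e (a : Option ι) (n : Option (Option ι)) :
    ⁅P.gen (.h a), P.gen (.e n)⁆ = (extendedCartan D.A (some a) n : ℂ) • P.gen (.e n) := by
  have h0 : D.A none none = 2 := D.A_diag none
  rcases a with _ | i <;> rcases n with _ | _ | j <;>
    simp [gen, extendedCartan, P.t0_eps, P.K_eps, P.t0_t1, P.K_t1, P.t0_t0, P.K_t0, D.Θ_Y, D.Θ_x,
      D.h_Y, D.h_x, h0]

theorem h_f (a b : Option ι) :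
    ⁅P.gen (.h a), P.gen (.f b)⁆ + (D.A a b : ℂ) • P.gen (.f b) = 0 := by
  have h0 : D.A none none = 2 := D.A_diag none
  rcases a with _ | i <;> rcases b with _ | j <;>
    simp [gen, P.t0_tm1, P.K_tm1, P.t0_t0, P.K_t0, D.Θ_X, D.Θ_y, D.h_X, D.h_y, h0]

theorem e_f_same (a : Option ι) : ⁅P.gen (.e (some a)), P.gen (.f a)⁆ = P.gen (.h a) := by
  rcases a with _ | i
  · simp only [gen, P.t1_tm1, D.Y_X, D.B_symm D.Y, D.B_X_Y, map_neg]; module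
  · simp only [gen, P.t0_t0, D.x_y_same]

theorem e_f_ne (n : Option (Option ι)) (b : Option ι) (hn : n ≠ some b) :
    ⁅P.gen (.e n), P.gen (.f b)⁆ = 0 := by
  rcases n with _ | _ | i <;> rcases b with _ | j
  · exact P.eps_tm1 _
  · exact P.eps_t0 _
  · exact absurd rfl hn
  · simp only [gen]
    rw [P.t1_t0, ← lie_skew, D.y_Y, neg_zero, map_zero]
  · simp only [gen]
    rw [P.t0_tm1, D.x_X, map_zero]
  · simp only [gen]
    rw [P.t0_t0, D.x_y_ne i j (fun h => hn (by rw [h])), map_zero]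

theorem evalFree_relator {r : FreeAlg ι} (hr : Relator D.A r) : evalFree P.gen r = 0 := by
  cases hr with
  | skew x y => exact evalFree_skew P.isParity_gen x y
  | jacobi x y z => exact evalFree_jacobi P.isParity_gen x y z
  | serre_e m n hmn => rw [evalFree_iterate]; exact hP.serre_e m n hmn
  | serre_f a b hab => rw [evalFree_iterate]; exact hP.serre_f a b hab
  | h_e a n => simp only [map_sub, map_smul, evalFree_mul, evalFree_gen, hP.h_e, sub_self]
  | h_f a b => simp only [map_add, map_smul, evalFree_mul, evalFree_gen, hP.h_f]
  | e_f_same a => simp only [map_sub, evalFree_mul, evalFree_gen, hP.e_f_same, sub_self]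
  | e_f_ne n b hn => simp only [evalFree_mul, evalFree_gen, hP.e_f_ne n b hn]
  | eps_phi i => simp only [map_sub, evalFree_mul, evalFree_gen, gen, P.eps_ph, sub_self]
  | h_phi a j =>
    simp only [map_add, map_smul, evalFree_mul, evalFree_gen]
    rcases a with _ | i <;> simp [gen, extendedCartan, P.K_ph, P.t0_ph, D.Θ_h, D.h_h]
  | e_f_phi_same i k =>
    simp only [map_sub, map_smul, evalFree_mul, evalFree_gen, gen, P.t0_ph, D.y_h, map_smul, br_smul,
      D.x_y_same, sub_self]
  | e_f_phi_ne i j k hij =>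
    simp only [evalFree_mul, evalFree_gen, gen, P.t0_ph, D.y_h, map_smul, br_smul, D.x_y_ne i j hij,
      smul_zero, map_zero]
  | e_zero_phi i => simp only [evalFree_mul, evalFree_gen, gen, P.t1_ph, D.B_Y_h, zero_smul]
  | f_zero_f_zero_phi i => simp only [evalFree_mul, evalFree_gen, gen, hP.tm1_X_tm1_X_ph]
  | phi_phi i j => simp only [evalFree_mul, evalFree_gen, gen, hP.ph_ph_eq_zero]
  | phi_phi_f_zero i j hi hj => simp only [evalFree_mul, evalFree_gen, gen, hP.ph_ph_tm1 hi hj]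
  | e_e_phi i k =>
    simp only [evalFree_mul, evalFree_gen, gen, P.t0_ph, D.x_h, map_smul, br_smul, lie_self, smul_zero,
      map_zero]
  | phi_cartan i j k =>
    simp only [map_sub, map_smul, evalFree_mul, evalFree_gen, gen, P.t0_ph, D.x_h]
    module
  | f_zero_e_phi i k hi =>
    simp only [evalFree_mul, evalFree_gen, gen, P.t0_ph, D.x_h, map_smul, br_smul,
      hP.tm1_X_ph_x hi, smul_zero]

/-- The homomorphism from `S̃` to a transitive Lie superalgebra with local data. -/
def hom : STilde D.A →ₗ[ℂ] L := evalTilde P.gen fun _ => hP.evalFree_relator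

theorem hom_lie (x y : STilde D.A) : hP.hom ⁅x, y⁆ = ⁅hP.hom x, hP.hom y⁆ := evalTilde_lie _ _ _ _

theorem hom_gen (g : Gen ι) : hP.hom (MonSuper.mon (.of g)) = P.gen g := evalTilde_mon _ _ _

end LocalData.IsTransitive

end Relations

end

section

/-! ### A module in which the local part is realized -/

namespace Model

variable {𝔤 : Type*} [LieRing 𝔤] [LieAlgebra ℂ 𝔤]

variable (𝔤) in
/-- The tensor algebra of two copies of `𝔤`, the free algebra on the operators of degree `-1`. -/
abbrev T : Type _ := TensorAlgebra ℂ (𝔤 × 𝔤)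

/-- The inclusion of degree `1`. -/
abbrev inc : (𝔤 × 𝔤) →ₗ[ℂ] T 𝔤 := TensorAlgebra.ι ℂ

theorem eq_top_of_inc_mul {N : Submodule ℂ (T 𝔤)} (h₁ : 1 ∈ N)
    (h : ∀ a, ∀ t ∈ N, inc a * t ∈ N) : N = ⊤ := by
  refine eq_top_iff.2 fun t _ => ?_
  suffices H : ∀ n ∈ N, t * n ∈ N by simpa using H 1 h₁
  induction t using TensorAlgebra.induction with
  | algebraMap r => intro n hn; rw [← Algebra.smul_def]; exact N.smul_mem r hn
  | ι a => exact h a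
  | mul x y hx hy => intro n hn; rw [mul_assoc]; exact hx trivial _ (hy trivial n hn)
  | add x y hx hy => intro n hn; rw [add_mul]; exact add_mem (hx trivial n hn) (hy trivial n hn)

theorem induction {X : Type*} [AddCommGroup X] [Module ℂ X] {f g : T 𝔤 →ₗ[ℂ] X} (h₁ : f 1 = g 1)
    (h : ∀ a t, f t = g t → f (inc a * t) = g (inc a * t)) (t : T 𝔤) : f t = g t := by
  have : LinearMap.eqLocus f g = ⊤ :=
    eq_top_of_inc_mul (N := LinearMap.eqLocus f g) h₁ h
  have ht : t ∈ LinearMap.eqLocus f g := this ▸ trivial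
  exact ht

section Rec

variable {X : Type*} [AddCommGroup X] [Module ℂ X]

/-- The step of the recursion `rec`. -/
def recStep (m : 𝔤 × 𝔤 →ₗ[ℂ] T 𝔤 →ₗ[ℂ] X) (s : 𝔤 × 𝔤 →ₗ[ℂ] Module.End ℂ X) :
    𝔤 × 𝔤 →ₗ[ℂ] Module.End ℂ (T 𝔤 × X) where
  toFun a := ((LinearMap.mulLeft ℂ (inc a)).comp (LinearMap.fst ℂ _ _)).prod
    ((m a).comp (LinearMap.fst ℂ _ _) + (s a).comp (LinearMap.snd ℂ _ _))
  map_add' a b := by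
    refine LinearMap.ext fun p => Prod.ext ?_ ?_ <;> simp [add_mul]; abel
  map_smul' c a := by
    refine LinearMap.ext fun p => Prod.ext ?_ ?_ <;> simp

/-- The linear map `d` on the tensor algebra with `d 1 = x` and `d (a t) = m a t + s a (d t)`. -/
def rec (m : 𝔤 × 𝔤 →ₗ[ℂ] T 𝔤 →ₗ[ℂ] X) (s : 𝔤 × 𝔤 →ₗ[ℂ] Module.End ℂ X) (x : X) : T 𝔤 →ₗ[ℂ] X :=
  (LinearMap.snd ℂ _ _).comp
    ((LinearMap.applyₗ (1, x)).comp (TensorAlgebra.lift ℂ (recStep m s)).toLinearMap)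

theorem rec_one (m : 𝔤 × 𝔤 →ₗ[ℂ] T 𝔤 →ₗ[ℂ] X) (s : 𝔤 × 𝔤 →ₗ[ℂ] Module.End ℂ X) (x : X) :
    rec m s x 1 = x := by simp [rec]

theorem rec_inc_mul (m : 𝔤 × 𝔤 →ₗ[ℂ] T 𝔤 →ₗ[ℂ] X) (s : 𝔤 × 𝔤 →ₗ[ℂ] Module.End ℂ X) (x : X)
    (a : 𝔤 × 𝔤) (t : T 𝔤) : rec m s x (inc a * t) = m a t + s a (rec m s x t) := by
  have h : ∀ t : T 𝔤, (TensorAlgebra.lift ℂ (recStep m s) t (1, x)).1 = t := by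
    refine induction (f := (LinearMap.fst ℂ _ _).comp
      ((LinearMap.applyₗ (1, x)).comp (TensorAlgebra.lift ℂ (recStep m s)).toLinearMap))
      (g := LinearMap.id) (by simp) fun a t ht => ?_
    simp only [LinearMap.comp_apply, LinearMap.applyₗ_apply_apply, AlgHom.toLinearMap_apply, map_mul,
      TensorAlgebra.lift_ι_apply, Module.End.mul_apply, LinearMap.id_apply] at ht ⊢
    change inc a * _ = _
    exact congrArg _ ht
  simp only [rec, LinearMap.comp_apply, LinearMap.applyₗ_apply_apply, AlgHom.toLinearMap_apply,
    map_mul, TensorAlgebra.lift_ι_apply, Module.End.mul_apply]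
  change m a (TensorAlgebra.lift ℂ (recStep m s) t (1, x)).1 + _ = _
  rw [h]; rfl

end Rec

/-- Left multiplication by degree `1`. -/
def lm : 𝔤 × 𝔤 →ₗ[ℂ] Module.End ℂ (T 𝔤) := (LinearMap.mul ℂ (T 𝔤)).comp inc

theorem lm_apply (a : 𝔤 × 𝔤) (t : T 𝔤) : lm a t = inc a * t := rfl

/-- The parity automorphism of degree `1`. -/
def σ : 𝔤 × 𝔤 →ₗ[ℂ] 𝔤 × 𝔤 := (LinearMap.fst ℂ _ _).prod (-LinearMap.snd ℂ _ _)

/-- The extension by zero on `1` to an even operator. -/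
def recEven : (𝔤 × 𝔤 →ₗ[ℂ] Module.End ℂ (T 𝔤)) →ₗ[ℂ] Module.End ℂ (T 𝔤) where
  toFun m := rec m lm 0
  map_add' m m' := LinearMap.ext <| induction (by simp [rec_one]) fun a t ht => by
    simp only [LinearMap.add_apply, rec_inc_mul, lm_apply] at ht ⊢; rw [ht, mul_add]; abel
  map_smul' c m := LinearMap.ext <| induction (by simp [rec_one]) fun a t ht => by
    simp only [LinearMap.smul_apply, rec_inc_mul, lm_apply, RingHom.id_apply] at ht ⊢
    rw [ht, mul_smul_comm, smul_add]

/-- The extension by zero on `1` to an odd operator. -/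
def recOdd (m : 𝔤 × 𝔤 →ₗ[ℂ] Module.End ℂ (T 𝔤)) : Module.End ℂ (T 𝔤) := rec m (lm.comp σ) 0

theorem recEven_one (m : 𝔤 × 𝔤 →ₗ[ℂ] Module.End ℂ (T 𝔤)) : recEven m 1 = 0 := rec_one _ _ _
theorem recOdd_one (m : 𝔤 × 𝔤 →ₗ[ℂ] Module.End ℂ (T 𝔤)) : recOdd m 1 = 0 := rec_one _ _ _

theorem recEven_mul (m : 𝔤 × 𝔤 →ₗ[ℂ] Module.End ℂ (T 𝔤)) (a b : 𝔤) (t : T 𝔤) :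
    recEven m (inc (a, b) * t) = m (a, b) t + inc (a, b) * recEven m t := rec_inc_mul _ _ _ _ _
theorem recOdd_mul (m : 𝔤 × 𝔤 →ₗ[ℂ] Module.End ℂ (T 𝔤)) (a b : 𝔤) (t : T 𝔤) :
    recOdd m (inc (a, b) * t) = m (a, b) t + inc (a, -b) * recOdd m t := rec_inc_mul _ _ _ _ _

/-- The adjoint action on `𝔤 × 𝔤`. -/
def ad₂ : 𝔤 →ₗ[ℂ] Module.End ℂ (𝔤 × 𝔤) :=
  LinearMap.mk₂ ℂ (fun u a => (⁅u, a.1⁆, ⁅u, a.2⁆)) (fun _ _ _ => by simp) (fun _ _ _ => by simp)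
    (fun _ _ _ => by simp) (fun _ _ _ => by simp)

def t0 : 𝔤 →ₗ[ℂ] Module.End ℂ (T 𝔤) := recEven.comp ((LinearMap.llcomp ℂ _ _ _ lm).comp ad₂)

def K : Module.End ℂ (T 𝔤) :=
  recEven (lm.comp ((LinearMap.inr ℂ 𝔤 𝔤).comp (LinearMap.snd ℂ 𝔤 𝔤)))

/-- The number operator. -/
def N : Module.End ℂ (T 𝔤) := recEven lm

def v : Module.End ℂ (T 𝔤) :=
  recOdd (lm.comp ((LinearMap.inr ℂ 𝔤 𝔤).comp (-LinearMap.fst ℂ 𝔤 𝔤)))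

def eps : Module.End ℂ (T 𝔤) := recOdd (t0.comp (LinearMap.snd ℂ 𝔤 𝔤))

def Lo : Module.End ℂ (T 𝔤) := recEven (t0.comp (LinearMap.fst ℂ 𝔤 𝔤))

variable (B : 𝔤 →ₗ[ℂ] 𝔤 →ₗ[ℂ] ℂ)

def t1 : 𝔤 →ₗ[ℂ] Module.End ℂ (T 𝔤) := recEven.comp <|
  LinearMap.mk₂ ℂ (fun u a => t0 ⁅u, a.1⁆ + B u a.1 • K + B u a.2 • v)
    (fun _ _ _ => by simp only [add_lie, map_add, LinearMap.add_apply]; module)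
    (fun _ _ _ => by simp only [smul_lie, map_smul, LinearMap.smul_apply, smul_eq_mul]; module)
    (fun _ _ _ => by simp only [lie_add, map_add, Prod.fst_add, Prod.snd_add]; module)
    (fun _ _ _ => by simp only [lie_smul, map_smul, Prod.smul_fst, Prod.smul_snd, smul_eq_mul]; module)

@[simp] theorem t0_one (u : 𝔤) : t0 u (1 : T 𝔤) = 0 := recEven_one _
@[simp] theorem K_one : K (1 : T 𝔤) = 0 := recEven_one _
@[simp] theorem N_one : N (1 : T 𝔤) = 0 := recEven_one _
@[simp] theorem v_one : v (1 : T 𝔤) = 0 := recOdd_one _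
@[simp] theorem eps_one : eps (1 : T 𝔤) = 0 := recOdd_one _
@[simp] theorem Lo_one : Lo (1 : T 𝔤) = 0 := recEven_one _
@[simp] theorem t1_one (u : 𝔤) : t1 B u (1 : T 𝔤) = 0 := recEven_one _

/-- Left multiplication by the first copy of `𝔤`. -/
def tm : 𝔤 →ₗ[ℂ] Module.End ℂ (T 𝔤) := lm.comp (LinearMap.inl ℂ 𝔤 𝔤)

/-- Left multiplication by the second copy of `𝔤`. -/
def ph : 𝔤 →ₗ[ℂ] Module.End ℂ (T 𝔤) := lm.comp (LinearMap.inr ℂ 𝔤 𝔤)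

theorem tm_apply (a : 𝔤) (t : T 𝔤) : tm a t = inc (a, 0) * t := rfl
theorem ph_apply (a : 𝔤) (t : T 𝔤) : ph a t = inc (0, a) * t := rfl

theorem neg_inc (a : 𝔤) : inc ((0 : 𝔤), -a) = -inc ((0 : 𝔤), a) := by
  rw [← map_neg]; simp

/-- Two operators agree if they agree on `1` and agree after either kind of multiplication. -/
theorem ext_op {f g : Module.End ℂ (T 𝔤)} (h₁ : f 1 = g 1)
    (ha : ∀ a t, tm a (f t) = tm a (g t) → f (tm a t) = g (tm a t))
    (hb : ∀ b t, ph b (f t) = ph b (g t) → f (ph b t) = g (ph b t)) (t : T 𝔤) : f t = g t := by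
  refine induction h₁ (fun a t ht => ?_) t
  have : inc a * t = tm a.1 t + ph a.2 t := by
    rw [tm_apply, ph_apply, ← add_mul, ← map_add]; simp
  rw [this, map_add, map_add, ha _ _ (congrArg _ ht), hb _ _ (congrArg _ ht)]

theorem recEven_tm (m : 𝔤 × 𝔤 →ₗ[ℂ] Module.End ℂ (T 𝔤)) (a : 𝔤) (t : T 𝔤) :
    recEven m (tm a t) = m (a, 0) t + tm a (recEven m t) := recEven_mul _ _ _ _
theorem recEven_ph (m : 𝔤 × 𝔤 →ₗ[ℂ] Module.End ℂ (T 𝔤)) (a : 𝔤) (t : T 𝔤) :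
    recEven m (ph a t) = m (0, a) t + ph a (recEven m t) := recEven_mul _ _ _ _
theorem recOdd_tm (m : 𝔤 × 𝔤 →ₗ[ℂ] Module.End ℂ (T 𝔤)) (a : 𝔤) (t : T 𝔤) :
    recOdd m (tm a t) = m (a, 0) t + tm a (recOdd m t) := by
  refine (recOdd_mul _ _ _ _).trans ?_; simp [tm_apply]
theorem recOdd_ph (m : 𝔤 × 𝔤 →ₗ[ℂ] Module.End ℂ (T 𝔤)) (a : 𝔤) (t : T 𝔤) :
    recOdd m (ph a t) = m (0, a) t - ph a (recOdd m t) := by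
  refine (recOdd_mul _ _ _ _).trans ?_; simp [ph_apply, neg_inc, sub_eq_add_neg]

@[simp] theorem t0_tm (u : 𝔤) (a : 𝔤) (t : T 𝔤) : t0 u (tm a t) = tm ⁅u, a⁆ t + tm a (t0 u t) := by
  refine (recEven_tm _ a t).trans (congrArg (· + tm a (t0 u t)) ?_)
  simp [lm_apply, tm_apply, ph_apply, ad₂, neg_inc]

@[simp] theorem t0_ph (u : 𝔤) (a : 𝔤) (t : T 𝔤) : t0 u (ph a t) = ph ⁅u, a⁆ t + ph a (t0 u t) := by
  refine (recEven_ph _ a t).trans (congrArg (· + ph a (t0 u t)) ?_)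
  simp [lm_apply, tm_apply, ph_apply, ad₂, neg_inc]

@[simp] theorem K_tm (a : 𝔤) (t : T 𝔤) : K (tm a t) = tm a (K t) := by
  refine (recEven_tm _ a t).trans ((congrArg (· + tm a (K t)) (a₂ := 0) ?_).trans (by simp))
  simp [lm_apply, tm_apply, ph_apply, ad₂, neg_inc]

@[simp] theorem K_ph (a : 𝔤) (t : T 𝔤) : K (ph a t) = ph a t + ph a (K t) := by
  refine (recEven_ph _ a t).trans (congrArg (· + ph a (K t)) ?_)
  simp [lm_apply, tm_apply, ph_apply, ad₂, neg_inc]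

@[simp] theorem N_tm (a : 𝔤) (t : T 𝔤) : N (tm a t) = tm a t + tm a (N t) := by
  refine (recEven_tm _ a t).trans (congrArg (· + tm a (N t)) ?_)
  simp [lm_apply, tm_apply, ph_apply, ad₂, neg_inc]

@[simp] theorem N_ph (a : 𝔤) (t : T 𝔤) : N (ph a t) = ph a t + ph a (N t) := by
  refine (recEven_ph _ a t).trans (congrArg (· + ph a (N t)) ?_)
  simp [lm_apply, tm_apply, ph_apply, ad₂, neg_inc]

@[simp] theorem v_tm (a : 𝔤) (t : T 𝔤) : v (tm a t) = -ph a t + tm a (v t) := by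
  refine (recOdd_tm _ a t).trans (congrArg (· + tm a (v t)) ?_)
  simp [lm_apply, tm_apply, ph_apply, ad₂, neg_inc]

@[simp] theorem v_ph (a : 𝔤) (t : T 𝔤) : v (ph a t) = -ph a (v t) := by
  refine (recOdd_ph _ a t).trans ((congrArg (· - ph a (v t)) (a₂ := 0) ?_).trans (by simp))
  simp [lm_apply, tm_apply, ph_apply, ad₂, neg_inc]

@[simp] theorem eps_tm (a : 𝔤) (t : T 𝔤) : eps (tm a t) = tm a (eps t) := by
  refine (recOdd_tm _ a t).trans ((congrArg (· + tm a (eps t)) (a₂ := 0) ?_).trans (by simp))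
  simp [lm_apply, tm_apply, ph_apply, ad₂, neg_inc]

@[simp] theorem eps_ph (a : 𝔤) (t : T 𝔤) : eps (ph a t) = t0 a t - ph a (eps t) := by
  refine (recOdd_ph _ a t).trans (congrArg (· - ph a (eps t)) ?_)
  simp [lm_apply, tm_apply, ph_apply, ad₂, neg_inc]

@[simp] theorem Lo_tm (a : 𝔤) (t : T 𝔤) : Lo (tm a t) = t0 a t + tm a (Lo t) := by
  refine (recEven_tm _ a t).trans (congrArg (· + tm a (Lo t)) ?_)
  simp [lm_apply, tm_apply, ph_apply, ad₂, neg_inc]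

@[simp] theorem Lo_ph (a : 𝔤) (t : T 𝔤) : Lo (ph a t) = ph a (Lo t) := by
  refine (recEven_ph _ a t).trans ((congrArg (· + ph a (Lo t)) (a₂ := 0) ?_).trans (by simp))
  simp [lm_apply, tm_apply, ph_apply, ad₂, neg_inc]

@[simp] theorem t1_tm (u : 𝔤) (a : 𝔤) (t : T 𝔤) : t1 B u (tm a t) = t0 ⁅u, a⁆ t + B u a • K t + tm a (t1 B u t) := by
  refine (recEven_tm _ a t).trans (congrArg (· + tm a (t1 B u t)) ?_)
  simp [lm_apply, tm_apply, ph_apply, ad₂, neg_inc]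

@[simp] theorem t1_ph (u : 𝔤) (a : 𝔤) (t : T 𝔤) : t1 B u (ph a t) = B u a • v t + ph a (t1 B u t) := by
  refine (recEven_ph _ a t).trans (congrArg (· + ph a (t1 B u t)) ?_)
  simp [lm_apply, tm_apply, ph_apply, ad₂, neg_inc]

theorem t0_t0 (u w : 𝔤) (t : T 𝔤) : t0 u (t0 w t) - t0 w (t0 u t) = t0 ⁅u, w⁆ t := by
  refine ext_op (f := t0 u * t0 w - t0 w * t0 u) (g := t0 ⁅u, w⁆) (by simp)
    (fun a t h' => ?_) (fun a t h' => ?_) t <;> simp at h' ⊢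
  · linear_combination (norm := module) h'
  · linear_combination (norm := module) h'

theorem t0_K (u : 𝔤) (t : T 𝔤) : t0 u (K t) - K (t0 u t) = 0 := by
  refine ext_op (f := t0 u * K - K * t0 u) (g := (0 : Module.End ℂ (T 𝔤))) (by simp)
    (fun a t h' => ?_) (fun a t h' => ?_) t <;> simp at h' ⊢
  · linear_combination (norm := module) h'
  · linear_combination (norm := module) h'

theorem t0_v (u : 𝔤) (t : T 𝔤) : t0 u (v t) - v (t0 u t) = 0 := by
  refine ext_op (f := t0 u * v - v * t0 u) (g := (0 : Module.End ℂ (T 𝔤))) (by simp)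
    (fun a t h' => ?_) (fun a t h' => ?_) t <;> simp at h' ⊢
  · linear_combination (norm := module) h'
  · linear_combination (norm := module) -h'

theorem K_v (t : T 𝔤) : K (v t) - v (K t) = v t := by
  refine ext_op (f := K * v - v * K) (g := v) (by simp)
    (fun a t h' => ?_) (fun a t h' => ?_) t <;> simp at h' ⊢
  · linear_combination (norm := module) h'
  · linear_combination (norm := module) -h'

theorem v_v (t : T 𝔤) : v (v t) + v (v t) = 0 := by
  refine ext_op (f := v * v + v * v) (g := (0 : Module.End ℂ (T 𝔤))) (by simp)
    (fun a t h' => ?_) (fun a t h' => ?_) t <;> simp at h' ⊢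
  · linear_combination (norm := module) h'
  · linear_combination (norm := module) h'

theorem t0_Lo (u : 𝔤) (t : T 𝔤) : t0 u (Lo t) - Lo (t0 u t) = 0 := by
  refine ext_op (f := t0 u * Lo - Lo * t0 u) (g := (0 : Module.End ℂ (T 𝔤))) (by simp)
    (fun a t h' => ?_) (fun a t h' => ?_) t <;> simp at h' ⊢
  · linear_combination (norm := module) h' + t0_t0 u a t
  · linear_combination (norm := module) h'

theorem t0_eps (u : 𝔤) (t : T 𝔤) : t0 u (eps t) - eps (t0 u t) = 0 := by
  refine ext_op (f := t0 u * eps - eps * t0 u) (g := (0 : Module.End ℂ (T 𝔤))) (by simp)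
    (fun a t h' => ?_) (fun a t h' => ?_) t <;> simp at h' ⊢
  · linear_combination (norm := module) h'
  · linear_combination (norm := module) -h' + t0_t0 u a t

theorem K_Lo (t : T 𝔤) : K (Lo t) - Lo (K t) = 0 := by
  refine ext_op (f := K * Lo - Lo * K) (g := (0 : Module.End ℂ (T 𝔤))) (by simp)
    (fun a t h' => ?_) (fun a t h' => ?_) t <;> simp at h' ⊢
  · linear_combination (norm := module) h' - t0_K a t
  · linear_combination (norm := module) h'

theorem K_eps (t : T 𝔤) : K (eps t) - eps (K t) = (-eps) t := by
  refine ext_op (f := K * eps - eps * K) (g := (-eps)) (by simp)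
    (fun a t h' => ?_) (fun a t h' => ?_) t <;> simp at h' ⊢
  · linear_combination (norm := module) h'
  · linear_combination (norm := module) -h' - t0_K a t

theorem v_Lo (t : T 𝔤) : v (Lo t) - Lo (v t) = 0 := by
  refine ext_op (f := v * Lo - Lo * v) (g := (0 : Module.End ℂ (T 𝔤))) (by simp)
    (fun a t h' => ?_) (fun a t h' => ?_) t <;> simp at h' ⊢
  · linear_combination (norm := module) h' - t0_v a t
  · linear_combination (norm := module) -h'

theorem v_eps (t : T 𝔤) : v (eps t) + eps (v t) = (-Lo) t := by
  refine ext_op (f := v * eps + eps * v) (g := (-Lo)) (by simp)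
    (fun a t h' => ?_) (fun a t h' => ?_) t <;> simp at h' ⊢
  · linear_combination (norm := module) h'
  · linear_combination (norm := module) h' - t0_v a t

theorem t0_t1 (hB : ∀ u w z : 𝔤, B ⁅u, w⁆ z = -B w ⁅u, z⁆) (u w : 𝔤) (t : T 𝔤) : t0 u (t1 B w t) - t1 B w (t0 u t) = t1 B ⁅u, w⁆ t := by
  refine ext_op (f := t0 u * t1 B w - t1 B w * t0 u) (g := t1 B ⁅u, w⁆) (by simp)
    (fun a t h' => ?_) (fun a t h' => ?_) t <;> simp [hB] at h' ⊢
  · linear_combination (norm := module) h' + t0_t0 u ⁅w, a⁆ t + B w a • t0_K u t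
  · linear_combination (norm := module) h' + B w a • t0_v u t

theorem K_t1 (w : 𝔤) (t : T 𝔤) : K (t1 B w t) - t1 B w (K t) = 0 := by
  refine ext_op (f := K * t1 B w - t1 B w * K) (g := (0 : Module.End ℂ (T 𝔤))) (by simp)
    (fun a t h' => ?_) (fun a t h' => ?_) t <;> simp at h' ⊢
  · linear_combination (norm := module) h' - t0_K ⁅w, a⁆ t
  · linear_combination (norm := module) h' + B w a • K_v t

theorem v_t1 (w : 𝔤) (t : T 𝔤) : v (t1 B w t) - t1 B w (v t) = 0 := by
  refine ext_op (f := v * t1 B w - t1 B w * v) (g := (0 : Module.End ℂ (T 𝔤))) (by simp)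
    (fun a t h' => ?_) (fun a t h' => ?_) t <;> simp at h' ⊢
  · linear_combination (norm := module) h' - t0_v ⁅w, a⁆ t - B w a • K_v t
  · linear_combination (norm := module) -h' + B w a • v_v t

theorem N_t0 (u : 𝔤) (t : T 𝔤) : N (t0 u t) - t0 u (N t) = 0 := by
  refine ext_op (f := N * t0 u - t0 u * N) (g := (0 : Module.End ℂ (T 𝔤))) (by simp)
    (fun a t h' => ?_) (fun a t h' => ?_) t <;> simp at h' ⊢
  · linear_combination (norm := module) h'
  · linear_combination (norm := module) h'

theorem N_K (t : T 𝔤) : N (K t) - K (N t) = 0 := by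
  refine ext_op (f := N * K - K * N) (g := (0 : Module.End ℂ (T 𝔤))) (by simp)
    (fun a t h' => ?_) (fun a t h' => ?_) t <;> simp at h' ⊢
  · linear_combination (norm := module) h'
  · linear_combination (norm := module) h'

theorem N_v (t : T 𝔤) : N (v t) - v (N t) = 0 := by
  refine ext_op (f := N * v - v * N) (g := (0 : Module.End ℂ (T 𝔤))) (by simp)
    (fun a t h' => ?_) (fun a t h' => ?_) t <;> simp at h' ⊢
  · linear_combination (norm := module) h'
  · linear_combination (norm := module) -h'

theorem N_Lo (t : T 𝔤) : N (Lo t) - Lo (N t) = (-Lo) t := by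
  refine ext_op (f := N * Lo - Lo * N) (g := (-Lo)) (by simp)
    (fun a t h' => ?_) (fun a t h' => ?_) t <;> simp at h' ⊢
  · linear_combination (norm := module) h' + N_t0 a t
  · linear_combination (norm := module) h'

theorem N_eps (t : T 𝔤) : N (eps t) - eps (N t) = (-eps) t := by
  refine ext_op (f := N * eps - eps * N) (g := (-eps)) (by simp)
    (fun a t h' => ?_) (fun a t h' => ?_) t <;> simp at h' ⊢
  · linear_combination (norm := module) h'
  · linear_combination (norm := module) -h' + N_t0 a t

theorem N_t1 (w : 𝔤) (t : T 𝔤) : N (t1 B w t) - t1 B w (N t) = (-t1 B w) t := by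
  refine ext_op (f := N * t1 B w - t1 B w * N) (g := (-t1 B w)) (by simp)
    (fun a t h' => ?_) (fun a t h' => ?_) t <;> simp at h' ⊢
  · linear_combination (norm := module) h' + N_t0 ⁅w, a⁆ t + B w a • N_K t
  · linear_combination (norm := module) h' + B w a • N_v t

end Model

end

section

section Stable

variable {L : Type*} [AddCommGroup L] [Module ℂ L] [Bracket L L] [LieSuper L]

open LieSuper

theorem LieSuper.exists_jacobi {a b : L} (ha : a ∈ even (L := L) ∨ a ∈ odd (L := L))
    (hb : b ∈ even (L := L) ∨ b ∈ odd (L := L)) :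
    ∃ s : ℂ, ∀ x : L, ⁅a, ⁅b, x⁆⁆ = ⁅⁅a, b⁆, x⁆ + s • ⁅b, ⁅a, x⁆⁆ := by
  rcases ha with ha | ha
  · exact ⟨1, fun x => by rw [jacobi_even a ha, one_smul]⟩
  rcases hb with hb | hb
  · exact ⟨1, fun x => by rw [jacobi_even_right hb, one_smul]⟩
  · exact ⟨-1, fun x => by rw [jacobi_odd a ha b hb, neg_smul, one_smul, sub_eq_add_neg]⟩

theorem LieSuper.span_lie_mem {s : Set L} {N M : Submodule ℂ L} (h : ∀ a ∈ s, ∀ x ∈ N, ⁅a, x⁆ ∈ M)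
    {a : L} (ha : a ∈ Submodule.span ℂ s) {x : L} (hx : x ∈ N) : ⁅a, x⁆ ∈ M := by
  induction ha using Submodule.span_induction with
  | mem a ha => exact h a ha x hx
  | zero => simp
  | add a b _ _ ha hb => rw [add_br]; exact add_mem ha hb
  | smul c a _ ha => rw [smul_br]; exact M.smul_mem c ha

/-- An element of `N` that is annihilated by the operators in `R` lies in a subspace of `N` that is
stable under the operators in `G`, `Z` and `R`. -/
theorem LieSuper.exists_stable (G Z R : Set L)
    (hpar : ∀ a ∈ G ∪ Z ∪ R, a ∈ even (L := L) ∨ a ∈ odd (L := L))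
    (hZG : ∀ z ∈ Z, ∀ g ∈ G, ⁅z, g⁆ ∈ Submodule.span ℂ G)
    (hRG : ∀ r ∈ R, ∀ g ∈ G, ⁅r, g⁆ ∈ Submodule.span ℂ Z)
    (hRZ : ∀ r ∈ R, ∀ z ∈ Z, ⁅r, z⁆ ∈ Submodule.span ℂ R)
    (N : Submodule ℂ L) (hNG : ∀ g ∈ G, ∀ x ∈ N, ⁅g, x⁆ ∈ N) (hNZ : ∀ z ∈ Z, ∀ x ∈ N, ⁅z, x⁆ ∈ N)
    {x : L} (hx : x ∈ N) (hRx : ∀ r ∈ R, ⁅r, x⁆ = 0) :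
    ∃ I ≤ N, x ∈ I ∧ ∀ a ∈ G ∪ Z ∪ R, ∀ y ∈ I, ⁅a, y⁆ ∈ I := by
  let Kill : Submodule ℂ L :=
    { carrier := {x | x ∈ N ∧ ∀ r ∈ R, ⁅r, x⁆ = 0}
      add_mem' := fun {a b} ha hb => ⟨add_mem ha.1 hb.1, fun r hr => by
        rw [br_add, ha.2 r hr, hb.2 r hr, add_zero]⟩
      zero_mem' := ⟨zero_mem _, fun r _ => by simp⟩
      smul_mem' := fun c a ha => ⟨N.smul_mem c ha.1, fun r hr => by rw [br_smul, ha.2 r hr, smul_zero]⟩ }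
  let I : Submodule ℂ L := sInf {U | Kill ≤ U ∧ ∀ g ∈ G, ∀ y ∈ U, ⁅g, y⁆ ∈ U}
  have hIN : I ≤ N := sInf_le ⟨fun y hy => hy.1, hNG⟩
  have hKI : Kill ≤ I := le_sInf fun U hU => hU.1
  have hG : ∀ g ∈ G, ∀ y ∈ I, ⁅g, y⁆ ∈ I := by
    intro g hg y hy
    rw [Submodule.mem_sInf] at hy ⊢
    exact fun U hU => hU.2 g hg y (hy U hU)
  have step : ∀ (S : Set L), (∀ s ∈ S, s ∈ even (L := L) ∨ s ∈ odd (L := L)) →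
      (∀ s ∈ S, ∀ y ∈ Kill, ⁅s, y⁆ ∈ I) → (∀ s ∈ S, ∀ g ∈ G, ∀ y ∈ I, ⁅⁅s, g⁆, y⁆ ∈ I) →
      ∀ s ∈ S, ∀ y ∈ I, ⁅s, y⁆ ∈ I := by
    intro S hS hSK hSG
    let U : Submodule ℂ L :=
      { carrier := {y | y ∈ I ∧ ∀ s ∈ S, ⁅s, y⁆ ∈ I}
        add_mem' := fun {a b} ha hb => ⟨add_mem ha.1 hb.1, fun r hr => by
          rw [br_add]; exact add_mem (ha.2 r hr) (hb.2 r hr)⟩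
        zero_mem' := ⟨zero_mem _, fun r _ => by simp⟩
        smul_mem' := fun c a ha => ⟨I.smul_mem c ha.1, fun r hr => by
          rw [br_smul]; exact I.smul_mem c (ha.2 r hr)⟩ }
    have hU : I ≤ U := by
      refine sInf_le ⟨fun y hy => ⟨hKI hy, fun s hs => hSK s hs y hy⟩, fun g hg y hy =>
        ⟨hG g hg y hy.1, fun s hs => ?_⟩⟩
      obtain ⟨c, hc⟩ := exists_jacobi (hS s hs) (hpar g (Or.inl (Or.inl hg)))
      rw [hc]
      exact add_mem (hSG s hs g hg y hy.1) (I.smul_mem c (hG g hg _ (hy.2 s hs)))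
    exact fun s hs y hy => (hU hy).2 s hs
  have hZ : ∀ z ∈ Z, ∀ y ∈ I, ⁅z, y⁆ ∈ I := by
    refine step Z (fun z hz => hpar z (Or.inl (Or.inr hz))) (fun z hz y hy => ?_)
      (fun z hz g hg y hy => span_lie_mem hG (hZG z hz g hg) hy)
    refine hKI ⟨hNZ z hz y hy.1, fun r hr => ?_⟩
    obtain ⟨c, hc⟩ := exists_jacobi (hpar r (Or.inr hr)) (hpar z (Or.inl (Or.inr hz)))
    rw [hc, hy.2 r hr, br_zero, smul_zero, add_zero]
    have : ⁅⁅r, z⁆, y⁆ ∈ (⊥ : Submodule ℂ L) :=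
      span_lie_mem (N := Kill) (fun r hr y hy => hy.2 r hr) (hRZ r hr z hz) hy
    simpa using this
  have hR : ∀ r ∈ R, ∀ y ∈ I, ⁅r, y⁆ ∈ I :=
    step R (fun r hr => hpar r (Or.inr hr)) (fun r hr y hy => by rw [hy.2 r hr]; exact zero_mem _)
      (fun r hr g hg y hy => span_lie_mem hZ (hRG r hr g hg) hy)
  refine ⟨I, hIN, hKI ⟨hx, hRx⟩, ?_⟩
  rintro a ((ha | ha) | ha)
  · exact hG a ha
  · exact hZ a ha
  · exact hR a ha

variable {𝔤 : Type*} [LieRing 𝔤] [LieAlgebra ℂ 𝔤] {B : 𝔤 →ₗ[ℂ] 𝔤 →ₗ[ℂ] ℂ}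

namespace LocalData

variable (P : LocalData B L)

/-- The lowering operators. -/
def lower : Set L := Set.range P.tm1 ∪ Set.range P.ph
/-- The operators of degree `0`. -/
def middle : Set L := Set.range P.t0 ∪ {P.K, P.v}
/-- The raising operators. -/
def raise : Set L := Set.range P.t1 ∪ {P.Lo, P.eps}

theorem parity_ops : ∀ a ∈ P.lower ∪ P.middle ∪ P.raise, a ∈ even (L := L) ∨ a ∈ odd (L := L) := by
  rintro a (((⟨u, rfl⟩ | ⟨u, rfl⟩) | ⟨u, rfl⟩ | rfl | rfl) | ⟨u, rfl⟩ | rfl | rfl)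
  exacts [.inl (P.tm1_even u), .inr (P.ph_odd u), .inl (P.t0_even u), .inl P.K_even, .inr P.v_odd,
    .inl (P.t1_even u), .inl P.Lo_even, .inr P.eps_odd]

theorem tm1_mem (u : 𝔤) : P.tm1 u ∈ Submodule.span ℂ P.lower :=
  Submodule.subset_span (.inl ⟨u, rfl⟩)
theorem ph_mem (u : 𝔤) : P.ph u ∈ Submodule.span ℂ P.lower :=
  Submodule.subset_span (.inr ⟨u, rfl⟩)
theorem t0_mem (u : 𝔤) : P.t0 u ∈ Submodule.span ℂ P.middle :=
  Submodule.subset_span (.inl ⟨u, rfl⟩)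
theorem K_mem : P.K ∈ Submodule.span ℂ P.middle := Submodule.subset_span (.inr (.inl rfl))
theorem v_mem : P.v ∈ Submodule.span ℂ P.middle := Submodule.subset_span (.inr (.inr rfl))
theorem t1_mem (u : 𝔤) : P.t1 u ∈ Submodule.span ℂ P.raise :=
  Submodule.subset_span (.inl ⟨u, rfl⟩)
theorem Lo_mem : P.Lo ∈ Submodule.span ℂ P.raise := Submodule.subset_span (.inr (.inl rfl))
theorem eps_mem : P.eps ∈ Submodule.span ℂ P.raise := Submodule.subset_span (.inr (.inr rfl))

theorem middle_lower : ∀ z ∈ P.middle, ∀ g ∈ P.lower, ⁅z, g⁆ ∈ Submodule.span ℂ P.lower := by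
  rintro z (⟨u, rfl⟩ | rfl | rfl) g (⟨w, rfl⟩ | ⟨w, rfl⟩)
  · rw [P.t0_tm1]; exact P.tm1_mem _
  · rw [P.t0_ph]; exact P.ph_mem _
  · rw [P.K_tm1]; exact zero_mem _
  · rw [P.K_ph]; exact P.ph_mem _
  · rw [P.v_tm1]; exact neg_mem (P.ph_mem _)
  · rw [P.v_ph]; exact zero_mem _

theorem raise_lower : ∀ r ∈ P.raise, ∀ g ∈ P.lower, ⁅r, g⁆ ∈ Submodule.span ℂ P.middle := by
  rintro z (⟨u, rfl⟩ | rfl | rfl) g (⟨w, rfl⟩ | ⟨w, rfl⟩)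
  · rw [P.t1_tm1]; exact add_mem (P.t0_mem _) (Submodule.smul_mem _ _ P.K_mem)
  · rw [P.t1_ph]; exact Submodule.smul_mem _ _ P.v_mem
  · rw [P.Lo_tm1]; exact P.t0_mem _
  · rw [P.Lo_ph]; exact zero_mem _
  · rw [P.eps_tm1]; exact zero_mem _
  · rw [P.eps_ph]; exact P.t0_mem _

theorem raise_middle : ∀ r ∈ P.raise, ∀ z ∈ P.middle, ⁅r, z⁆ ∈ Submodule.span ℂ P.raise := by
  rintro z (⟨u, rfl⟩ | rfl | rfl) g (⟨w, rfl⟩ | rfl | rfl)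
  · rw [P.t1_t0]; exact P.t1_mem _
  · rw [P.t1_K]; exact zero_mem _
  · rw [P.t1_v]; exact zero_mem _
  · rw [P.Lo_t0]; exact zero_mem _
  · rw [P.Lo_K]; exact zero_mem _
  · rw [P.Lo_v]; exact zero_mem _
  · rw [P.eps_t0]; exact zero_mem _
  · rw [P.eps_K]; exact P.eps_mem
  · rw [P.eps_v]; exact neg_mem P.Lo_mem

theorem middle_raise : ∀ z ∈ P.middle, ∀ r ∈ P.raise, ⁅z, r⁆ ∈ Submodule.span ℂ P.raise := by
  rintro g (⟨w, rfl⟩ | rfl | rfl) z (⟨u, rfl⟩ | rfl | rfl)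
  · rw [P.t0_t1]; exact P.t1_mem _
  · rw [P.t0_Lo]; exact zero_mem _
  · rw [P.t0_eps]; exact zero_mem _
  · rw [P.K_t1]; exact zero_mem _
  · rw [P.K_Lo]; exact zero_mem _
  · rw [P.K_eps]; exact neg_mem P.eps_mem
  · rw [P.v_t1]; exact zero_mem _
  · rw [P.v_Lo]; exact zero_mem _
  · rw [P.v_eps]; exact neg_mem P.Lo_mem

theorem lower_middle : ∀ g ∈ P.lower, ∀ z ∈ P.middle, ⁅g, z⁆ ∈ Submodule.span ℂ P.lower := by
  rintro g (⟨w, rfl⟩ | ⟨w, rfl⟩) z (⟨u, rfl⟩ | rfl | rfl)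
  · rw [P.tm1_t0]; exact P.tm1_mem _
  · rw [P.tm1_K]; exact zero_mem _
  · rw [P.tm1_v]; exact P.ph_mem _
  · rw [P.ph_t0]; exact P.ph_mem _
  · rw [P.ph_K]; exact neg_mem (P.ph_mem _)
  · rw [P.ph_v]; exact zero_mem _

theorem lower_raise : ∀ g ∈ P.lower, ∀ r ∈ P.raise, ⁅g, r⁆ ∈ Submodule.span ℂ P.middle := by
  rintro g (⟨w, rfl⟩ | ⟨w, rfl⟩) z (⟨u, rfl⟩ | rfl | rfl)
  · rw [P.tm1_t1]
    exact sub_mem (neg_mem (P.t0_mem _)) (Submodule.smul_mem _ _ P.K_mem)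
  · rw [P.tm1_Lo]; exact neg_mem (P.t0_mem _)
  · rw [P.tm1_eps]; exact zero_mem _
  · rw [P.ph_t1]; exact neg_mem (Submodule.smul_mem _ _ P.v_mem)
  · rw [P.ph_Lo]; exact zero_mem _
  · rw [P.ph_eps]; exact P.t0_mem _

/-- A subspace that is stable under all operators, around an element that is annihilated by the
raising operators. -/
theorem exists_stable_neg {N : Submodule ℂ L} (hG : ∀ g ∈ P.lower, ∀ x ∈ N, ⁅g, x⁆ ∈ N)
    (hZ : ∀ z ∈ P.middle, ∀ x ∈ N, ⁅z, x⁆ ∈ N) {x : L} (hx : x ∈ N)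
    (h1 : ∀ u, ⁅P.t1 u, x⁆ = 0) (h2 : ⁅P.Lo, x⁆ = 0) (h3 : ⁅P.eps, x⁆ = 0) :
    ∃ I ≤ N, x ∈ I ∧ ∀ a ∈ P.lower ∪ P.middle ∪ P.raise, ∀ y ∈ I, ⁅a, y⁆ ∈ I :=
  exists_stable _ _ _ P.parity_ops P.middle_lower P.raise_lower P.raise_middle N hG hZ hx (by
    rintro r (⟨u, rfl⟩ | rfl | rfl)
    exacts [h1 u, h2, h3])

/-- A subspace that is stable under all operators, around an element that is annihilated by the
lowering operators. -/
theorem exists_stable_pos {N : Submodule ℂ L} (hG : ∀ g ∈ P.raise, ∀ x ∈ N, ⁅g, x⁆ ∈ N)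
    (hZ : ∀ z ∈ P.middle, ∀ x ∈ N, ⁅z, x⁆ ∈ N) {x : L} (hx : x ∈ N)
    (h1 : ∀ u, ⁅P.tm1 u, x⁆ = 0) (h2 : ∀ u, ⁅P.ph u, x⁆ = 0) :
    ∃ I ≤ N, x ∈ I ∧ ∀ a ∈ P.lower ∪ P.middle ∪ P.raise, ∀ y ∈ I, ⁅a, y⁆ ∈ I := by
  have hc : P.lower ∪ P.middle ∪ P.raise = P.raise ∪ P.middle ∪ P.lower := by
    rw [Set.union_comm, Set.union_comm P.lower, Set.union_assoc]
  rw [hc]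
  refine exists_stable _ _ _ (by rw [← hc]; exact P.parity_ops) P.middle_raise P.lower_raise
    P.lower_middle N hG hZ hx ?_
  rintro r (⟨u, rfl⟩ | ⟨u, rfl⟩)
  exacts [h1 u, h2 u]

end LocalData

end Stable

namespace Model

variable {𝔤 : Type*} [LieRing 𝔤] [LieAlgebra ℂ 𝔤]

/-- The components of degree `0` and `1`. -/
def low : T 𝔤 →ₗ[ℂ] ℂ × (𝔤 × 𝔤) :=
  rec 0 (LinearMap.mk₂ ℂ (fun a p => (0, p.1 • a)) (fun a b p => by simp)
    (fun c a p => Prod.ext (by simp) (smul_comm _ _ _)) (fun a p q => by simp [add_smul])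
    (fun c a p => by simp [mul_smul])) (1, 0)

theorem low_one : low (1 : T 𝔤) = (1, 0) := rec_one _ _ _

theorem low_inc (a : 𝔤 × 𝔤) (t : T 𝔤) : low (inc a * t) = (0, (low t).1 • a) := by
  refine (rec_inc_mul _ _ _ _ _).trans ?_
  simp [low]

theorem low_tm (a : 𝔤) (t : T 𝔤) : low (tm a t) = (0, (low t).1 • (a, 0)) := low_inc _ _
theorem low_ph (a : 𝔤) (t : T 𝔤) : low (ph a t) = (0, (low t).1 • (0, a)) := low_inc _ _

/-- The components of degree at least `2`. -/
def T2 : Submodule ℂ (T 𝔤) := LinearMap.ker low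

theorem ext_low {f g : T 𝔤 →ₗ[ℂ] ℂ × (𝔤 × 𝔤)} (h₁ : f 1 = g 1)
    (ha : ∀ a t, f t = g t → f (tm a t) = g (tm a t))
    (hb : ∀ b t, f t = g t → f (ph b t) = g (ph b t)) : f = g := by
  refine LinearMap.ext <| induction h₁ fun a t ht => ?_
  have : inc a * t = tm a.1 t + ph a.2 t := by
    rw [tm_apply, ph_apply, ← add_mul, ← map_add]; simp
  rw [this, map_add, map_add, ha _ _ ht, hb _ _ ht]

theorem low_t0 (u : 𝔤) (t : T 𝔤) : low (t0 u t) = (0, (⁅u, (low t).2.1⁆, ⁅u, (low t).2.2⁆)) := by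
  refine LinearMap.congr_fun (f := low.comp (t0 u))
    (g := ((0 : _ →ₗ[ℂ] ℂ).prod ((ad₂ u).comp (LinearMap.snd ℂ _ _))).comp low) (ext_low ?_ ?_ ?_) t
  · simp [t0_one, low_one]; rfl
  · intro a t ht
    have : (low (t0 u t)).1 = 0 := congrArg Prod.fst ht
    simp [t0_tm, low_tm, this, ad₂]
  · intro a t ht
    have : (low (t0 u t)).1 = 0 := congrArg Prod.fst ht
    simp [t0_ph, low_ph, this, ad₂]

theorem low_K (t : T 𝔤) : low (K t) = (0, (0, (low t).2.2)) := by
  refine LinearMap.congr_fun (f := low.comp K)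
    (g := ((0 : _ →ₗ[ℂ] ℂ).prod (((0 : _ →ₗ[ℂ] 𝔤).prod (LinearMap.snd ℂ _ _)).comp
      (LinearMap.snd ℂ _ _))).comp low) (ext_low ?_ ?_ ?_) t
  · simp [K_one, low_one]; rfl
  · intro a t ht
    have : (low (K t)).1 = 0 := congrArg Prod.fst ht
    simp [K_tm, low_tm, this]; rfl
  · intro a t ht
    have : (low (K t)).1 = 0 := congrArg Prod.fst ht
    simp [K_ph, low_ph, this]

theorem low_N (t : T 𝔤) : low (N t) = (0, (low t).2) := by
  refine LinearMap.congr_fun (f := low.comp N)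
    (g := ((0 : _ →ₗ[ℂ] ℂ).prod (LinearMap.snd ℂ _ _)).comp low) (ext_low ?_ ?_ ?_) t
  · simp [N_one, low_one]; rfl
  · intro a t ht
    have : (low (N t)).1 = 0 := congrArg Prod.fst ht
    simp [N_tm, low_tm, this]
  · intro a t ht
    have : (low (N t)).1 = 0 := congrArg Prod.fst ht
    simp [N_ph, low_ph, this]

theorem low_v (t : T 𝔤) : low (v t) = (0, (0, -(low t).2.1)) := by
  refine LinearMap.congr_fun (f := low.comp v)
    (g := ((0 : _ →ₗ[ℂ] ℂ).prod (((0 : _ →ₗ[ℂ] 𝔤).prod (-LinearMap.fst ℂ _ _)).comp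
      (LinearMap.snd ℂ _ _))).comp low) (ext_low ?_ ?_ ?_) t
  · simp [v_one, low_one]; rfl
  · intro a t ht
    have : (low (v t)).1 = 0 := congrArg Prod.fst ht
    simp [v_tm, low_tm, low_ph, this]
  · intro a t ht
    have : (low (v t)).1 = 0 := congrArg Prod.fst ht
    simp [v_ph, low_ph, this]; rfl

variable (B : 𝔤 →ₗ[ℂ] 𝔤 →ₗ[ℂ] ℂ)

/-- The operators of the local part. -/
def ops : Set (Module.End ℂ (T 𝔤)) :=
  Set.range tm ∪ Set.range ph ∪ (Set.range t0 ∪ {K, v}) ∪ (Set.range (t1 B) ∪ {Lo, eps})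

theorem tm_mem_ops (u : 𝔤) : tm u ∈ ops B := .inl (.inl (.inl ⟨u, rfl⟩))
theorem ph_mem_ops (u : 𝔤) : ph u ∈ ops B := .inl (.inl (.inr ⟨u, rfl⟩))
theorem t0_mem_ops (u : 𝔤) : t0 u ∈ ops B := .inl (.inr (.inl ⟨u, rfl⟩))
theorem K_mem_ops : K ∈ ops B := .inl (.inr (.inr (.inl rfl)))
theorem v_mem_ops : v ∈ ops B := .inl (.inr (.inr (.inr rfl)))
theorem t1_mem_ops (u : 𝔤) : t1 B u ∈ ops B := .inr (.inl ⟨u, rfl⟩)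
theorem Lo_mem_ops : Lo ∈ ops B := .inr (.inr (.inl rfl))
theorem eps_mem_ops : eps ∈ ops B := .inr (.inr (.inr rfl))

/-- The largest stable subspace without components of degree `0` and `1`. -/
def Y : Submodule ℂ (T 𝔤) := sSup {U | U ≤ T2 ∧ ∀ X ∈ ops B, ∀ t ∈ U, X t ∈ U}

theorem Y_le : Y B ≤ T2 := sSup_le fun _ hU => hU.1

theorem le_Y {U : Submodule ℂ (T 𝔤)} (h₁ : U ≤ T2) (h₂ : ∀ X ∈ ops B, ∀ t ∈ U, X t ∈ U) : U ≤ Y B :=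
  le_sSup ⟨h₁, h₂⟩

theorem Y_stable {X : Module.End ℂ (T 𝔤)} (hX : X ∈ ops B) : Y B ≤ (Y B).comap X :=
  sSup_le fun _ hU t ht => (le_sSup hU : _ ≤ Y B) (hU.2 X hX t ht)

theorem N_op {X : Module.End ℂ (T 𝔤)} (hX : X ∈ ops B) :
    ∃ c : ℂ, ∀ t, X (N t) = N (X t) + c • X t := by
  rcases hX with ((⟨u, rfl⟩ | ⟨u, rfl⟩) | ⟨u, rfl⟩ | rfl | rfl) | ⟨u, rfl⟩ | rfl | rfl
  · exact ⟨-1, fun t => by rw [N_tm]; module⟩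
  · exact ⟨-1, fun t => by rw [N_ph]; module⟩
  · exact ⟨0, fun t => by linear_combination (norm := module) -N_t0 u t⟩
  · exact ⟨0, fun t => by linear_combination (norm := module) -N_K t⟩
  · exact ⟨0, fun t => by linear_combination (norm := module) -N_v t⟩
  · exact ⟨1, fun t => by
      have := N_t1 B u t
      rw [LinearMap.neg_apply] at this
      linear_combination (norm := module) -this⟩
  · exact ⟨1, fun t => by
      have := N_Lo t
      rw [LinearMap.neg_apply] at this
      linear_combination (norm := module) -this⟩
  · exact ⟨1, fun t => by
      have := N_eps t
      rw [LinearMap.neg_apply] at this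
      linear_combination (norm := module) -this⟩

theorem Y_stable_N : Y B ≤ (Y B).comap N := by
  have h : Y B ⊔ (Y B).map N ≤ Y B := by
    refine le_Y B (sup_le (Y_le B) ?_) fun X hX t ht => ?_
    · rintro _ ⟨t, ht, rfl⟩
      have : low t = 0 := Y_le B ht
      simp [T2, low_N, this]
    · obtain ⟨y, hy, _, ⟨z, hz, rfl⟩, rfl⟩ := Submodule.mem_sup.1 ht
      obtain ⟨c, hc⟩ := N_op B hX
      rw [map_add, hc]
      have hXz : X z ∈ Y B := Y_stable B hX hz
      exact add_mem (Submodule.mem_sup_left (Y_stable B hX hy)) (add_mem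
        (Submodule.mem_sup_right ⟨_, hXz, rfl⟩) (Submodule.mem_sup_left (Submodule.smul_mem _ c hXz)))
  exact fun t ht => h (Submodule.mem_sup_right ⟨t, ht, rfl⟩)

/-- The quotient module. -/
abbrev W : Type _ := T 𝔤 ⧸ Y B

/-- The operator on the quotient module of an operator that stabilizes `Y`. -/
def desc (X : Module.End ℂ (T 𝔤)) (hX : Y B ≤ (Y B).comap X) : Module.End ℂ (W B) := (Y B).mapQ _ X hX

/-- The operators on the quotient module of a family of operators. -/
def descL (X : 𝔤 →ₗ[ℂ] Module.End ℂ (T 𝔤)) (hX : ∀ u, Y B ≤ (Y B).comap (X u)) :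
    𝔤 →ₗ[ℂ] Module.End ℂ (W B) where
  toFun u := desc B (X u) (hX u)
  map_add' u w := Submodule.linearMap_qext _ (LinearMap.ext fun t =>
    congrArg (Y B).mkQ (LinearMap.congr_fun (X.map_add u w) t))
  map_smul' c u := Submodule.linearMap_qext _ (LinearMap.ext fun t =>
    congrArg (Y B).mkQ (LinearMap.congr_fun (X.map_smul c u) t))

theorem ext_W {f g : Module.End ℂ (W B)} (h : ∀ t, f ((Y B).mkQ t) = g ((Y B).mkQ t)) : f = g :=
  Submodule.linearMap_qext _ (LinearMap.ext h)

variable {B}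

open Dbl in
/-- The local part acts on the quotient module. -/
def localData (hB : ∀ u w z : 𝔤, B ⁅u, w⁆ z = -B w ⁅u, z⁆) : LocalData B (Dbl (Module.End ℂ (W B))) where
  t0 := ev.comp (descL B t0 fun u => Y_stable B (t0_mem_ops B u))
  t1 := ev.comp (descL B (t1 B) fun u => Y_stable B (t1_mem_ops B u))
  tm1 := ev.comp (descL B tm fun u => Y_stable B (tm_mem_ops B u))
  ph := od.comp (descL B ph fun u => Y_stable B (ph_mem_ops B u))
  K := ev (desc B K (Y_stable B (K_mem_ops B)))
  Lo := ev (desc B Lo (Y_stable B (Lo_mem_ops B)))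
  v := od (desc B v (Y_stable B (v_mem_ops B)))
  eps := od (desc B eps (Y_stable B (eps_mem_ops B)))
  t0_even u := ev_mem _
  t1_even u := ev_mem _
  tm1_even u := ev_mem _
  K_even := ev_mem _
  Lo_even := ev_mem _
  ph_odd u := od_mem _
  v_odd := od_mem _
  eps_odd := od_mem _
  t0_t0 u w := (lie_ev_ev _ _).trans (congrArg ev (ext_W B fun t =>
    congrArg (Y B).mkQ (t0_t0 u w t)))
  t0_t1 u w := (lie_ev_ev _ _).trans (congrArg ev (ext_W B fun t =>
    congrArg (Y B).mkQ (t0_t1 B hB u w t)))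
  t0_tm1 u w := (lie_ev_ev _ _).trans (congrArg ev (ext_W B fun t =>
    congrArg (Y B).mkQ (sub_eq_iff_eq_add.2 (t0_tm u w t))))
  t0_ph u w := (lie_ev_od _ _).trans (congrArg od (ext_W B fun t =>
    congrArg (Y B).mkQ (sub_eq_iff_eq_add.2 (t0_ph u w t))))
  t0_v u := (lie_ev_od _ _).trans ((congrArg od (ext_W B fun t =>
    congrArg (Y B).mkQ (t0_v u t))).trans (map_zero od))
  t0_Lo u := (lie_ev_ev _ _).trans ((congrArg ev (ext_W B fun t =>
    congrArg (Y B).mkQ (t0_Lo u t))).trans (map_zero ev))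
  t0_eps u := (lie_ev_od _ _).trans ((congrArg od (ext_W B fun t =>
    congrArg (Y B).mkQ (t0_eps u t))).trans (map_zero od))
  K_t0 u := (lie_ev_ev _ _).trans ((congrArg ev (ext_W B fun t =>
    congrArg (Y B).mkQ ((neg_sub _ _).symm.trans (neg_eq_zero.2 (t0_K u t))))).trans (map_zero ev))
  K_t1 u := (lie_ev_ev _ _).trans ((congrArg ev (ext_W B fun t =>
    congrArg (Y B).mkQ (K_t1 B u t))).trans (map_zero ev))
  K_tm1 u := (lie_ev_ev _ _).trans ((congrArg ev (ext_W B fun t =>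
    congrArg (Y B).mkQ (sub_eq_zero.2 (K_tm u t)))).trans (map_zero ev))
  K_Lo := (lie_ev_ev _ _).trans ((congrArg ev (ext_W B fun t =>
    congrArg (Y B).mkQ (K_Lo t))).trans (map_zero ev))
  K_ph u := (lie_ev_od _ _).trans (congrArg od (ext_W B fun t =>
    congrArg (Y B).mkQ (sub_eq_iff_eq_add.2 (K_ph u t))))
  K_v := (lie_ev_od _ _).trans (congrArg od (ext_W B fun t => congrArg (Y B).mkQ (K_v t)))
  K_eps := (lie_ev_od _ _).trans ((congrArg od (ext_W B (g := -desc B eps _) fun t =>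
    congrArg (Y B).mkQ (K_eps t))).trans (map_neg od _))
  v_v := (lie_od_od _ _).trans ((congrArg ev (ext_W B fun t =>
    congrArg (Y B).mkQ (v_v t))).trans (map_zero ev))
  v_tm1 u := (lie_od_ev _ _).trans ((congrArg od (ext_W B (g := -descL B ph _ u) fun t =>
    congrArg (Y B).mkQ (sub_eq_iff_eq_add.2 (v_tm u t)))).trans (map_neg od _))
  v_ph u := (lie_od_od _ _).trans ((congrArg ev (ext_W B fun t =>
    congrArg (Y B).mkQ (add_eq_zero_iff_eq_neg.2 (v_ph u t)))).trans (map_zero ev))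
  v_t1 u := (lie_od_ev _ _).trans ((congrArg od (ext_W B fun t =>
    congrArg (Y B).mkQ (v_t1 B u t))).trans (map_zero od))
  v_Lo := (lie_od_ev _ _).trans ((congrArg od (ext_W B fun t =>
    congrArg (Y B).mkQ (v_Lo t))).trans (map_zero od))
  v_eps := (lie_od_od _ _).trans ((congrArg ev (ext_W B (g := -desc B Lo _) fun t =>
    congrArg (Y B).mkQ (v_eps t))).trans (map_neg ev _))
  t1_tm1 u w := by
    refine (lie_ev_ev _ _).trans ((congrArg ev (ext_W B (g := descL B t0
      (fun u => Y_stable B (t0_mem_ops B u)) ⁅u, w⁆ + B u w • desc B K (Y_stable B (K_mem_ops B)))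
      fun t => congrArg (Y B).mkQ (sub_eq_iff_eq_add.2 (t1_tm B u w t)))).trans ?_)
    rw [map_add, map_smul]; rfl
  t1_ph u w := by
    refine (lie_ev_od _ _).trans ((congrArg od (ext_W B (g := B u w • desc B v (Y_stable B (v_mem_ops B)))
      fun t => congrArg (Y B).mkQ (sub_eq_iff_eq_add.2 (t1_ph B u w t)))).trans ?_)
    rw [map_smul]
  Lo_tm1 u := (lie_ev_ev _ _).trans (congrArg ev (ext_W B fun t =>
    congrArg (Y B).mkQ (sub_eq_iff_eq_add.2 (Lo_tm u t))))
  Lo_ph u := (lie_ev_od _ _).trans ((congrArg od (ext_W B fun t =>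
    congrArg (Y B).mkQ (sub_eq_zero.2 (Lo_ph u t)))).trans (map_zero od))
  eps_tm1 u := (lie_od_ev _ _).trans ((congrArg od (ext_W B fun t =>
    congrArg (Y B).mkQ (sub_eq_zero.2 (eps_tm u t)))).trans (map_zero od))
  eps_ph u := (lie_od_od _ _).trans (congrArg ev (ext_W B fun t =>
    congrArg (Y B).mkQ (eq_sub_iff_add_eq.1 (eps_ph u t))))

end Model

end

section

namespace Model

variable {𝔤 : Type*} [LieRing 𝔤] [LieAlgebra ℂ 𝔤] {B : 𝔤 →ₗ[ℂ] 𝔤 →ₗ[ℂ] ℂ}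
  (hB : ∀ u w z : 𝔤, B ⁅u, w⁆ z = -B w ⁅u, z⁆)

open Dbl

theorem exists_elem {X : Module.End ℂ (T 𝔤)} (hX : X ∈ ops B) :
    ∃ a ∈ (localData hB).lower ∪ (localData hB).middle ∪ (localData hB).raise,
      a = ev (desc B X (Y_stable B hX)) ∨ a = od (desc B X (Y_stable B hX)) := by
  rcases hX with ((⟨u, rfl⟩ | ⟨u, rfl⟩) | ⟨u, rfl⟩ | rfl | rfl) | ⟨u, rfl⟩ | rfl | rfl
  · exact ⟨_, .inl (.inl (.inl ⟨u, rfl⟩)), .inl rfl⟩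
  · exact ⟨_, .inl (.inl (.inr ⟨u, rfl⟩)), .inr rfl⟩
  · exact ⟨_, .inl (.inr (.inl ⟨u, rfl⟩)), .inl rfl⟩
  · exact ⟨_, .inl (.inr (.inr (.inl rfl))), .inl rfl⟩
  · exact ⟨_, .inl (.inr (.inr (.inr rfl))), .inr rfl⟩
  · exact ⟨_, .inr (.inl ⟨u, rfl⟩), .inl rfl⟩
  · exact ⟨_, .inr (.inr (.inl rfl)), .inl rfl⟩
  · exact ⟨_, .inr (.inr (.inr rfl)), .inr rfl⟩

variable (B) in
/-- The image of `T2`. -/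
def W2 : Submodule ℂ (W B) := T2.map (Y B).mkQ

theorem mem_W2 {t : T 𝔤} : (Y B).mkQ t ∈ W2 B ↔ low t = 0 := by
  constructor
  · rintro ⟨s, hs, hst⟩
    have h1 : s - t ∈ Y B := by
      rw [← Submodule.ker_mkQ (Y B), LinearMap.mem_ker, map_sub, hst, sub_self]
    have h2 : low (s - t) = 0 := Y_le B h1
    rw [map_sub, show low s = 0 from hs, zero_sub, neg_eq_zero] at h2
    exact h2
  · exact fun h => ⟨t, h, rfl⟩

variable (B) in
/-- The elements whose image is in degree at least `2`. -/
def Neg : Submodule ℂ (Dbl (Module.End ℂ (W B))) where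
  carrier := {X | ∀ w, X.1 w ∈ W2 B ∧ X.2 w ∈ W2 B}
  add_mem' hX hZ w := ⟨add_mem (hX w).1 (hZ w).1, add_mem (hX w).2 (hZ w).2⟩
  zero_mem' w := ⟨zero_mem _, zero_mem _⟩
  smul_mem' c X hX w := ⟨Submodule.smul_mem _ c (hX w).1, Submodule.smul_mem _ c (hX w).2⟩

variable (B) in
/-- The elements that annihilate the lowest weight vector. -/
def Pos : Submodule ℂ (Dbl (Module.End ℂ (W B))) where
  carrier := {X | X.1 ((Y B).mkQ 1) = 0 ∧ X.2 ((Y B).mkQ 1) = 0}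
  add_mem' hX hZ := ⟨by
    have := congrArg₂ (· + ·) hX.1 hZ.1; simpa using this, by
    have := congrArg₂ (· + ·) hX.2 hZ.2; simpa using this⟩
  zero_mem' := ⟨rfl, rfl⟩
  smul_mem' c X hX := ⟨by
    have := congrArg (c • ·) hX.1; simpa using this, by
    have := congrArg (c • ·) hX.2; simpa using this⟩

theorem lie_mem_Neg {X : Module.End ℂ (T 𝔤)} (hX : X ∈ ops B)
    (h2 : ∀ t, low t = 0 → low (X t) = 0) {a : Dbl (Module.End ℂ (W B))}
    (ha : a = ev (desc B X (Y_stable B hX)) ∨ a = od (desc B X (Y_stable B hX)))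
    {x : Dbl (Module.End ℂ (W B))} (hx : x ∈ Neg B) : ⁅a, x⁆ ∈ Neg B := by
  have h : ∀ w ∈ W2 B, desc B X (Y_stable B hX) w ∈ W2 B := by
    rintro _ ⟨t, ht, rfl⟩
    exact mem_W2.2 (h2 t ht)
  intro w
  rcases ha with rfl | rfl
  · simp only [lie_fst, lie_snd, ev_fst, ev_snd, zero_mul, mul_zero, add_zero, sub_zero]
    exact ⟨sub_mem (h _ (hx w).1) (hx _).1, sub_mem (h _ (hx w).2) (hx _).2⟩
  · simp only [lie_fst, lie_snd, od_fst, od_snd, zero_mul, mul_zero, zero_add, sub_zero]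
    exact ⟨add_mem (h _ (hx w).2) (hx _).2, sub_mem (h _ (hx w).1) (hx _).1⟩

theorem eq_zero_of_mem_Neg {x : Dbl (Module.End ℂ (W B))} (hx : x ∈ Neg B)
    (h1 : ∀ u, ⁅(localData hB).t1 u, x⁆ = 0) (h2 : ⁅(localData hB).Lo, x⁆ = 0)
    (h3 : ⁅(localData hB).eps, x⁆ = 0) : x = 0 := by
  obtain ⟨I, hIN, hxI, hI⟩ := (localData hB).exists_stable_neg (N := Neg B) (by
    rintro g (⟨u, rfl⟩ | ⟨u, rfl⟩) x hx
    · exact lie_mem_Neg (tm_mem_ops B u) (fun t ht => by rw [low_tm, ht]; simp) (.inl rfl) hx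
    · exact lie_mem_Neg (ph_mem_ops B u) (fun t ht => by rw [low_ph, ht]; simp) (.inr rfl) hx) (by
    rintro g (⟨u, rfl⟩ | rfl | rfl) x hx
    · exact lie_mem_Neg (t0_mem_ops B u) (fun t ht => by rw [low_t0, ht]; simp) (.inl rfl) hx
    · exact lie_mem_Neg (K_mem_ops B) (fun t ht => by rw [low_K, ht]; simp) (.inl rfl) hx
    · exact lie_mem_Neg (v_mem_ops B) (fun t ht => by rw [low_v, ht]; simp) (.inr rfl) hx) hx h1 h2 h3
  let V : Submodule ℂ (W B) := Submodule.span ℂ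
    ({y | ∃ X ∈ I, ∃ w, y = X.1 w} ∪ {y | ∃ X ∈ I, ∃ w, y = X.2 w})
  have hV1 : ∀ X ∈ I, ∀ w, X.1 w ∈ V := fun X hX w => Submodule.subset_span (.inl ⟨X, hX, w, rfl⟩)
  have hV2 : ∀ X ∈ I, ∀ w, X.2 w ∈ V := fun X hX w => Submodule.subset_span (.inr ⟨X, hX, w, rfl⟩)
  have hVW : V ≤ W2 B := Submodule.span_le.2 (by
    rintro _ (⟨X, hX, w, rfl⟩ | ⟨X, hX, w, rfl⟩)
    exacts [(hIN hX w).1, (hIN hX w).2])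
  have hstab : ∀ (X) (hX : X ∈ ops B), ∀ y ∈ V, desc B X (Y_stable B hX) y ∈ V := by
    intro X hX
    obtain ⟨a, ha, ha'⟩ := exists_elem hB hX
    set o := desc B X (Y_stable B hX)
    change V ≤ V.comap o
    refine Submodule.span_le.2 ?_
    rintro _ (⟨Z, hZ, w, rfl⟩ | ⟨Z, hZ, w, rfl⟩)
    · change o (Z.1 w) ∈ V
      rcases ha' with rfl | rfl
      · have e : o (Z.1 w) = (⁅ev o, Z⁆ : Dbl _).1 w + Z.1 (o w) := by simp [lie_fst]
        rw [e]; exact add_mem (hV1 _ (hI _ ha Z hZ) w) (hV1 Z hZ _)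
      · have e : o (Z.1 w) = (⁅od o, Z⁆ : Dbl _).2 w + Z.1 (o w) := by simp [lie_snd]
        rw [e]; exact add_mem (hV2 _ (hI _ ha Z hZ) w) (hV1 Z hZ _)
    · change o (Z.2 w) ∈ V
      rcases ha' with rfl | rfl
      · have e : o (Z.2 w) = (⁅ev o, Z⁆ : Dbl _).2 w + Z.2 (o w) := by simp [lie_snd]
        rw [e]; exact add_mem (hV2 _ (hI _ ha Z hZ) w) (hV2 Z hZ _)
      · have e : o (Z.2 w) = (⁅od o, Z⁆ : Dbl _).1 w - Z.2 (o w) := by simp [lie_fst]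
        rw [e]; exact sub_mem (hV1 _ (hI _ ha Z hZ) w) (hV2 Z hZ _)
  have hVY : V.comap (Y B).mkQ ≤ Y B :=
    le_Y B (fun t ht => mem_W2.1 (hVW ht)) fun X hX t ht => hstab X hX _ ht
  have hV : ∀ y ∈ V, y = 0 := by
    intro y hy
    obtain ⟨t, rfl⟩ := Submodule.mkQ_surjective _ y
    have := hVY hy
    rwa [← Submodule.ker_mkQ (Y B)] at this
  exact ext' (LinearMap.ext fun w => hV _ (hV1 x hxI w)) (LinearMap.ext fun w => hV _ (hV2 x hxI w))

theorem _root_.TensorHierarchy.Dbl.comm_of_ev {A : Type*} [Ring A] [Algebra ℂ A] {o : A} {x : Dbl A}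
    (h : ⁅ev o, x⁆ = 0) : x.1 * o = o * x.1 ∧ x.2 * o = o * x.2 := by
  have h1 := congrArg Prod.fst h
  have h2 := congrArg Prod.snd h
  rw [lie_fst] at h1
  rw [lie_snd] at h2
  simp only [ev_fst, ev_snd, zero_mul, mul_zero, add_zero, sub_zero] at h1 h2
  exact ⟨(sub_eq_zero.1 h1).symm, (sub_eq_zero.1 h2).symm⟩

theorem _root_.TensorHierarchy.Dbl.comm_of_od {A : Type*} [Ring A] [Algebra ℂ A] {o : A} {x : Dbl A}
    (h : ⁅od o, x⁆ = 0) : x.1 * o = o * x.1 ∧ x.2 * o = -(o * x.2) := by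
  have h1 := congrArg Prod.fst h
  have h2 := congrArg Prod.snd h
  rw [lie_fst] at h1
  rw [lie_snd] at h2
  simp only [od_fst, od_snd, zero_mul, mul_zero, zero_add, sub_zero] at h1 h2
  exact ⟨(sub_eq_zero.1 h2).symm, eq_neg_of_add_eq_zero_right h1⟩

theorem eq_zero_of_mem_Pos {x : Dbl (Module.End ℂ (W B))} (hx : x ∈ Pos B)
    (h1 : ∀ u, ⁅(localData hB).tm1 u, x⁆ = 0) (h2 : ∀ u, ⁅(localData hB).ph u, x⁆ = 0) : x = 0 := by
  have H : ∀ t, x.1 ((Y B).mkQ t) = 0 ∧ x.2 ((Y B).mkQ t) = 0 := by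
    let U : Submodule ℂ (T 𝔤) := (LinearMap.ker x.1 ⊓ LinearMap.ker x.2).comap (Y B).mkQ
    suffices h : U = ⊤ from fun t => (h ▸ trivial : t ∈ U)
    refine eq_top_of_inc_mul hx fun a t ht => ?_
    have : inc a * t = tm a.1 t + ph a.2 t := by
      rw [tm_apply, ph_apply, ← add_mul, ← map_add]; simp
    rw [this]
    have ht1 : x.1 ((Y B).mkQ t) = 0 := ht.1
    have ht2 : x.2 ((Y B).mkQ t) = 0 := ht.2
    have c1 := Dbl.comm_of_ev (h1 a.1)
    have c2 := Dbl.comm_of_od (h2 a.2)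
    refine add_mem ⟨?_, ?_⟩ ⟨?_, ?_⟩
    · refine (LinearMap.congr_fun c1.1 ((Y B).mkQ t)).trans ?_
      rw [Module.End.mul_apply, ht1, map_zero]
    · refine (LinearMap.congr_fun c1.2 ((Y B).mkQ t)).trans ?_
      rw [Module.End.mul_apply, ht2, map_zero]
    · refine (LinearMap.congr_fun c2.1 ((Y B).mkQ t)).trans ?_
      rw [Module.End.mul_apply, ht1, map_zero]
    · refine (LinearMap.congr_fun c2.2 ((Y B).mkQ t)).trans ?_
      rw [LinearMap.neg_apply, Module.End.mul_apply, ht2, map_zero, neg_zero]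
  exact ext' (ext_W B fun t => (H t).1) (ext_W B fun t => (H t).2)

theorem lie_mem_Pos {x y : Dbl (Module.End ℂ (W B))} (hx : x ∈ Pos B) (hy : y ∈ Pos B) :
    ⁅x, y⁆ ∈ Pos B := by
  obtain ⟨hx1, hx2⟩ := hx
  obtain ⟨hy1, hy2⟩ := hy
  constructor
  · rw [lie_fst]
    simp only [LinearMap.add_apply, LinearMap.sub_apply, Module.End.mul_apply, hx1, hx2, hy1, hy2,
      map_zero, sub_zero, add_zero]
  · rw [lie_snd]
    simp only [LinearMap.add_apply, LinearMap.sub_apply, Module.End.mul_apply, hx1, hx2, hy1, hy2,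
      map_zero, sub_zero, add_zero]

theorem ev_mem_Pos {X : Module.End ℂ (T 𝔤)} (hX : X ∈ ops B) (h : X 1 = 0) :
    ev (desc B X (Y_stable B hX)) ∈ Pos B :=
  ⟨(congrArg (Y B).mkQ h).trans (map_zero _), rfl⟩

theorem od_mem_Pos {X : Module.End ℂ (T 𝔤)} (hX : X ∈ ops B) (h : X 1 = 0) :
    od (desc B X (Y_stable B hX)) ∈ Pos B :=
  ⟨rfl, (congrArg (Y B).mkQ h).trans (map_zero _)⟩

theorem t1_mem_Pos (u : 𝔤) : (localData hB).t1 u ∈ Pos B := ev_mem_Pos (t1_mem_ops B u) (t1_one B u)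
theorem Lo_mem_Pos : (localData hB).Lo ∈ Pos B := ev_mem_Pos (Lo_mem_ops B) Lo_one
theorem eps_mem_Pos : (localData hB).eps ∈ Pos B := od_mem_Pos (eps_mem_ops B) eps_one

theorem mem_Neg_of {x : Dbl (Module.End ℂ (W B))} (X₁ X₂ : Module.End ℂ (T 𝔤))
    (h1 : ∀ t, x.1 ((Y B).mkQ t) = (Y B).mkQ (X₁ t)) (h2 : ∀ t, x.2 ((Y B).mkQ t) = (Y B).mkQ (X₂ t))
    (h1' : ∀ t, low (X₁ t) = 0) (h2' : ∀ t, low (X₂ t) = 0) : x ∈ Neg B := by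
  intro w
  obtain ⟨t, rfl⟩ := Submodule.mkQ_surjective _ w
  rw [h1, h2]
  exact ⟨mem_W2.2 (h1' t), mem_W2.2 (h2' t)⟩

theorem isTransitive : (localData hB).IsTransitive (Neg B) (Pos B) where
  tm1_tm1 u w := by
    rw [show ⁅(localData hB).tm1 u, (localData hB).tm1 w⁆ = _ from lie_ev_ev _ _]
    exact mem_Neg_of (tm u * tm w - tm w * tm u) 0 (fun t => rfl) (fun t => (map_zero _).symm)
      (fun t => by simp [low_tm]) fun t => map_zero _
  tm1_ph u w := by
    rw [show ⁅(localData hB).tm1 u, (localData hB).ph w⁆ = _ from lie_ev_od _ _]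
    exact mem_Neg_of 0 (tm u * ph w - ph w * tm u) (fun t => (map_zero _).symm) (fun t => rfl)
      (fun t => map_zero _) (fun t => by simp [low_tm, low_ph])
  ph_ph u w := by
    rw [show ⁅(localData hB).ph u, (localData hB).ph w⁆ = _ from lie_od_od _ _]
    exact mem_Neg_of (ph u * ph w + ph w * ph u) 0 (fun t => rfl) (fun t => (map_zero _).symm)
      (fun t => by simp [low_ph]) fun t => map_zero _
  tm1_mem u x hx := lie_mem_Neg (tm_mem_ops B u) (fun t ht => by rw [low_tm, ht]; simp) (.inl rfl) hx
  ph_mem u x hx := lie_mem_Neg (ph_mem_ops B u) (fun t ht => by rw [low_ph, ht]; simp) (.inr rfl) hx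
  neg _ := eq_zero_of_mem_Neg hB
  t1_t1 u w := lie_mem_Pos (t1_mem_Pos hB u) (t1_mem_Pos hB w)
  t1_Lo u := lie_mem_Pos (t1_mem_Pos hB u) (Lo_mem_Pos hB)
  t1_eps u := lie_mem_Pos (t1_mem_Pos hB u) (eps_mem_Pos hB)
  Lo_eps := lie_mem_Pos (Lo_mem_Pos hB) (eps_mem_Pos hB)
  eps_eps := lie_mem_Pos (eps_mem_Pos hB) (eps_mem_Pos hB)
  t1_mem u _ := lie_mem_Pos (t1_mem_Pos hB u)
  Lo_mem _ := lie_mem_Pos (Lo_mem_Pos hB)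
  pos _ := eq_zero_of_mem_Pos hB

theorem low_eq_of_mkQ {t : T 𝔤} (h : (Y B).mkQ t = 0) : low t = 0 :=
  Y_le B (by rwa [← Submodule.ker_mkQ (Y B), LinearMap.mem_ker])

theorem ph_injective : Function.Injective (localData hB).ph := by
  rw [injective_iff_map_eq_zero]
  intro u hu
  have := low_eq_of_mkQ (LinearMap.congr_fun (congrArg Prod.snd hu) ((Y B).mkQ 1))
  simpa [low_ph, low_one] using this

theorem tm1_injective : Function.Injective (localData hB).tm1 := by
  rw [injective_iff_map_eq_zero]
  intro u hu
  have := low_eq_of_mkQ (LinearMap.congr_fun (congrArg Prod.fst hu) ((Y B).mkQ 1))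
  simpa [low_tm, low_one] using this

/-- The elements `K` and `t0 u` are linearly independent. -/
theorem t0_add_K {u : 𝔤} {c : ℂ} (h : (localData hB).t0 u + c • (localData hB).K = 0) (w : 𝔤) :
    ⁅u, w⁆ = 0 ∧ c • w = 0 := by
  have h1 := congrArg (⁅·, (localData hB).tm1 w⁆) h
  have h2 := congrArg (⁅·, (localData hB).ph w⁆) h
  simp only [LieSuper.add_br, LieSuper.smul_br, LieSuper.zero_br, (localData hB).t0_tm1,
    (localData hB).K_tm1, (localData hB).t0_ph, (localData hB).K_ph, smul_zero, add_zero] at h1 h2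
  have h3 : ⁅u, w⁆ = 0 := tm1_injective hB (by rw [h1, map_zero])
  refine ⟨h3, ph_injective hB ?_⟩
  rw [map_smul, map_zero, ← h2, h3, map_zero, zero_add]

variable (B) in
/-- The number operator. -/
def number : Dbl (Module.End ℂ (W B)) := ev (desc B N (Y_stable_N B))

theorem number_tm1 (u : 𝔤) : ⁅number B, (localData hB).tm1 u⁆ = (localData hB).tm1 u :=
  (lie_ev_ev _ _).trans (congrArg ev (ext_W B fun t =>
    congrArg (Y B).mkQ (sub_eq_iff_eq_add.2 (N_tm u t))))

theorem number_ph (u : 𝔤) : ⁅number B, (localData hB).ph u⁆ = (localData hB).ph u :=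
  (lie_ev_od _ _).trans (congrArg od (ext_W B fun t =>
    congrArg (Y B).mkQ (sub_eq_iff_eq_add.2 (N_ph u t))))

theorem number_t0 (u : 𝔤) : ⁅number B, (localData hB).t0 u⁆ = 0 :=
  (lie_ev_ev _ _).trans ((congrArg ev (ext_W B fun t =>
    congrArg (Y B).mkQ (N_t0 u t))).trans (map_zero ev))

theorem number_K : ⁅number B, (localData hB).K⁆ = 0 :=
  (lie_ev_ev _ _).trans ((congrArg ev (ext_W B fun t =>
    congrArg (Y B).mkQ (N_K t))).trans (map_zero ev))

theorem number_t1 (u : 𝔤) : ⁅number B, (localData hB).t1 u⁆ = -(localData hB).t1 u :=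
  (lie_ev_ev _ _).trans ((congrArg ev (ext_W B
    (g := -descL B (t1 B) (fun u => Y_stable B (t1_mem_ops B u)) u) fun t =>
    congrArg (Y B).mkQ (N_t1 B u t))).trans (map_neg ev _))

theorem number_eps : ⁅number B, (localData hB).eps⁆ = -(localData hB).eps :=
  (lie_ev_od _ _).trans ((congrArg od (ext_W B
    (g := -desc B eps (Y_stable B (eps_mem_ops B))) fun t =>
    congrArg (Y B).mkQ (N_eps t))).trans (map_neg od _))

end Model

end

section

/-! ### Relations in `S̃` -/

section TildeRelations

variable {ι : Type*} (A : Matrix (Option ι) (Option ι) ℤ)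

open LieSuper MonSuper

/-- A generator of `S̃`. -/
def tg (g : Gen ι) : STilde A := mon (.of g)

theorem toTilde_gen (g : Gen ι) : toTilde A (gen g) = tg A g := rfl

theorem tg_mem_comp (g : Gen ι) : tg A g ∈ comp {g.deg} := mon_mem_comp (by rfl)

theorem tg_even {g : Gen ι} (h : Even (g.deg none)) : tg A g ∈ even (L := STilde A) :=
  mon_mem_comp h
theorem tg_odd {g : Gen ι} (h : Odd (g.deg none)) : tg A g ∈ odd (L := STilde A) :=
  mon_mem_comp h

theorem e_even (a : Option ι) : tg A (.e (some a)) ∈ even (L := STilde A) :=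
  tg_even A (by simp [Gen.deg])
theorem f_even (a : Option ι) : tg A (.f a) ∈ even (L := STilde A) := tg_even A (by simp [Gen.deg])
theorem h_even (a : Option ι) : tg A (.h a) ∈ even (L := STilde A) := tg_even A (by simp [Gen.deg])
theorem eps_odd : tg A (.e none) ∈ odd (L := STilde A) := tg_odd A (by simp [Gen.deg])
theorem phi_odd (i : ι) : tg A (.phi i) ∈ odd (L := STilde A) := tg_odd A (by simp [Gen.deg])

theorem rel_h_e (a : Option ι) (n : Option (Option ι)) :
    ⁅tg A (.h a), tg A (.e n)⁆ = (extendedCartan A (some a) n : ℂ) • tg A (.e n) := by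
  simpa only [map_sub, map_smul, toTilde_mul, toTilde_gen, sub_eq_zero] using
    toTilde_relator A (.h_e a n)
theorem rel_h_f (a b : Option ι) : ⁅tg A (.h a), tg A (.f b)⁆ = -(A a b : ℂ) • tg A (.f b) := by
  simpa only [map_add, map_smul, toTilde_mul, toTilde_gen, add_eq_zero_iff_eq_neg, neg_smul] using
    toTilde_relator A (.h_f a b)
theorem rel_e_f_same (a : Option ι) : ⁅tg A (.e (some a)), tg A (.f a)⁆ = tg A (.h a) := by
  simpa only [map_sub, map_smul, toTilde_mul, toTilde_gen, sub_eq_zero] using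
    toTilde_relator A (.e_f_same a)
theorem rel_e_f_ne {n : Option (Option ι)} {b : Option ι} (hn : n ≠ some b) :
    ⁅tg A (.e n), tg A (.f b)⁆ = 0 := by
  simpa only [toTilde_mul, toTilde_gen] using toTilde_relator A (.e_f_ne n b hn)
theorem toTilde_iterate (g g' : Gen ι) (n : ℕ) :
    toTilde A ((fun z => gen g * z)^[n] (gen g')) = (ad (tg A g) ^ n) (tg A g') := by
  have := Function.Semiconj.iterate_right (f := toTilde A) (ga := fun z => gen g * z)
    (gb := ad (tg A g)) (fun z => by rw [toTilde_mul, ad_apply]; rfl) n (gen g')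
  rw [this, Module.End.pow_apply]; rfl
theorem rel_serre_e (m n : Option (Option ι)) (hmn : extendedCartan A m n ≤ 0) :
    (ad (tg A (.e m)) ^ (1 - extendedCartan A m n).toNat) (tg A (.e n)) = 0 := by
  rw [← toTilde_iterate]; exact toTilde_relator A (.serre_e m n hmn)
theorem rel_eps_phi (i : ι) : ⁅tg A (.e none), tg A (.phi i)⁆ = tg A (.h (some i)) := by
  simpa only [map_sub, map_smul, toTilde_mul, toTilde_gen, sub_eq_zero] using
    toTilde_relator A (.eps_phi i)
theorem rel_h_phi (a : Option ι) (j : ι) :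
    ⁅tg A (.h a), tg A (.phi j)⁆ = -(extendedCartan A (some a) none : ℂ) • tg A (.phi j) := by
  simpa only [map_add, map_smul, toTilde_mul, toTilde_gen, add_eq_zero_iff_eq_neg, neg_smul] using
    toTilde_relator A (.h_phi a j)
theorem rel_e_f_phi_same (i k : ι) :
    ⁅tg A (.e (some (some i))), ⁅tg A (.f (some i)), tg A (.phi k)⁆⁆ =
      (A (some k) (some i) : ℂ) • tg A (.phi i) := by
  simpa only [map_sub, map_smul, toTilde_mul, toTilde_gen, sub_eq_zero] using
    toTilde_relator A (.e_f_phi_same i k)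
theorem rel_e_f_phi_ne {i j : ι} (k : ι) (hij : i ≠ j) :
    ⁅tg A (.e (some (some i))), ⁅tg A (.f (some j)), tg A (.phi k)⁆⁆ = 0 := by
  simpa only [toTilde_mul, toTilde_gen] using toTilde_relator A (.e_f_phi_ne i j k hij)
theorem rel_e_zero_phi (i : ι) : ⁅tg A (.e (some none)), tg A (.phi i)⁆ = 0 := by
  simpa only [toTilde_mul, toTilde_gen] using toTilde_relator A (.e_zero_phi i)
theorem rel_phi_phi (i j : ι) : ⁅tg A (.phi i), tg A (.phi j)⁆ = 0 := by
  simpa only [toTilde_mul, toTilde_gen] using toTilde_relator A (.phi_phi i j)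
theorem rel_e_e_phi (i k : ι) :
    ⁅tg A (.e (some (some i))), ⁅tg A (.e (some (some i))), tg A (.phi k)⁆⁆ = 0 := by
  simpa only [toTilde_mul, toTilde_gen] using toTilde_relator A (.e_e_phi i k)
theorem rel_f_zero_e_phi (i k : ι) (hi : A (some i) none ≠ 0) :
    ⁅tg A (.f none), ⁅tg A (.e (some (some i))), tg A (.phi k)⁆⁆ = 0 := by
  simpa only [toTilde_mul, toTilde_gen] using toTilde_relator A (.f_zero_e_phi i k hi)

theorem rel_h_h (a b : Option ι) : ⁅tg A (.h a), tg A (.h b)⁆ = 0 := by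
  rw [← rel_e_f_same A b, jacobi_even _ (h_even A a), rel_h_e, rel_h_f, smul_br, br_smul, neg_smul]
  have : extendedCartan A (some a) (some b) = A a b := by rcases a with _ | i <;> rcases b with _ | j <;> rfl
  rw [this, add_neg_cancel]

variable [Fintype ι]

/-- The weight of a degree with respect to `h a`. -/
def wt (a : Option ι) : Degree ι →+ ℤ where
  toFun d := ∑ n, extendedCartan A (some a) n * d n
  map_zero' := by simp
  map_add' d d' := by simp [mul_add, Finset.sum_add_distrib]

theorem wt_single (a : Option ι) (n : Option (Option ι)) (c : ℤ) :
    wt A a (Finsupp.single n c) = extendedCartan A (some a) n * c := by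
  classical
  change ∑ m, _ = _
  simp [Finsupp.single_apply]

theorem lie_h_mon (a : Option ι) (m : FreeMagma (Gen ι)) :
    ⁅tg A (.h a), (mon m : STilde A)⁆ = (wt A a (deg m) : ℂ) • (mon m : STilde A) := by
  induction m with
  | ih1 g =>
    change ⁅tg A (.h a), tg A g⁆ = (wt A a g.deg : ℂ) • tg A g
    rcases g with n | b | b | i
    · rw [rel_h_e, Gen.deg, wt_single, mul_one]
    · rw [rel_h_f, Gen.deg, wt_single]
      have : extendedCartan A (some a) (some b) = A a b := by
        rcases a with _ | i <;> rcases b with _ | j <;> rfl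
      simp [this]
    · rw [rel_h_h, Gen.deg, map_zero]; simp
    · rw [rel_h_phi, Gen.deg, wt_single]; simp
  | ih2 x y hx hy =>
    rw [mon_mul, jacobi_even _ (h_even A a), hx, hy, smul_br, br_smul, ← add_smul, deg_mul, map_add]
    push_cast; rfl

theorem lie_h_of_mem (a : Option ι) {d : Degree ι} {x : STilde A} (hx : x ∈ comp {d}) :
    ⁅tg A (.h a), x⁆ = (wt A a d : ℂ) • x := by
  refine comp_induction (p := fun x => ⁅tg A (.h a), x⁆ = (wt A a d : ℂ) • x) (fun m hm => ?_)
    (by simp) (fun x y hx hy => by rw [br_add, hx, hy, smul_add])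
    (fun c x hx => by rw [br_smul, hx, smul_comm]) hx
  rw [lie_h_mon, hm]

end TildeRelations

/-! ### The kernel of the homomorphism to the model -/

/-- Joint eigenvectors with different eigenvalues are linearly independent. -/
theorem eq_zero_of_sum_eq_zero {M κ δ : Type*} [AddCommGroup M] [Module ℂ M]
    (O : κ → Module.End ℂ M) (l : δ → κ → ℂ) (hl : Function.Injective l) (F : Finset δ) :
    ∀ y : δ → M, (∀ d k, O k (y d) = l d k • y d) → ∑ d ∈ F, y d = 0 → ∀ d ∈ F, y d = 0 := by
  classical
  induction F using Finset.induction_on with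
  | empty => simp
  | insert d₀ F hd₀ ih =>
    intro y hy hsum
    rw [Finset.sum_insert hd₀] at hsum
    have h1 : ∀ d ∈ F, y d = 0 := by
      intro d hd
      have hne : l d ≠ l d₀ := fun h => hd₀ (hl h ▸ hd)
      obtain ⟨k, hk⟩ := Function.ne_iff.1 hne
      have h2 := ih (fun d => (l d k - l d₀ k) • y d) (fun d k' => by
        rw [map_smul, hy, smul_comm]) (by
        have h3 := congrArg (O k) hsum
        have h4 := congrArg (l d₀ k • ·) hsum
        simp only [map_add, map_sum, hy, map_zero, smul_add, smul_zero, Finset.smul_sum] at h3 h4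
        simp only [sub_smul, Finset.sum_sub_distrib]
        rw [← sub_eq_zero.2 (h3.trans h4.symm)]
        abel) d hd
      exact (smul_eq_zero.1 h2).resolve_left (sub_ne_zero.2 hk)
    intro d hd
    rcases Finset.mem_insert.1 hd with rfl | hd
    · rw [Finset.sum_eq_zero h1, add_zero] at hsum; exact hsum
    · exact h1 d hd

namespace SimpleData

variable {ι 𝔤 : Type*} [Fintype ι] [LieRing 𝔤] [LieAlgebra ℂ 𝔤] (D : SimpleData ι 𝔤)

open LieSuper MonSuper

/-- The local data of the model. -/
abbrev model : LocalData D.B (Dbl (Module.End ℂ (Model.W D.B))) := Model.localData D.B_inv'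

/-- The homomorphism from `S̃` to the model. -/
def π : STilde D.A →ₗ[ℂ] Dbl (Module.End ℂ (Model.W D.B)) := (Model.isTransitive D.B_inv').hom

theorem π_lie (x y : STilde D.A) : D.π ⁅x, y⁆ = ⁅D.π x, D.π y⁆ :=
  (Model.isTransitive D.B_inv').hom_lie x y

theorem π_gen (g : Gen ι) : D.π (tg D.A g) = D.model.gen g := (Model.isTransitive D.B_inv').hom_gen g

theorem _root_.TensorHierarchy.LocalData.lie_gen_of_number {L : Type*} [AddCommGroup L] [Module ℂ L]
    [Bracket L L] [LieSuper L] (P : LocalData D.B L) {ν : L} (h1 : ∀ u, ⁅ν, P.tm1 u⁆ = P.tm1 u)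
    (h2 : ∀ u, ⁅ν, P.ph u⁆ = P.ph u) (h3 : ∀ u, ⁅ν, P.t0 u⁆ = 0) (h4 : ⁅ν, P.K⁆ = 0)
    (h5 : ∀ u, ⁅ν, P.t1 u⁆ = -P.t1 u) (h6 : ⁅ν, P.eps⁆ = -P.eps) (g : Gen ι) :
    ⁅ν, P.gen g⁆ = (-(g.deg none + g.deg (some none) : ℤ) : ℂ) • P.gen g := by
  rcases g with (_ | _ | i) | (_ | i) | (_ | i) | i <;>
    simp [LocalData.gen, Gen.deg, h1, h2, h3, h4, h5, h6]

theorem number_π_mon (m : FreeMagma (Gen ι)) : ⁅Model.number D.B, D.π (mon m)⁆ =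
    (-(deg m none + deg m (some none) : ℤ) : ℂ) • D.π (mon m) := by
  induction m with
  | ih1 g =>
    change ⁅_, D.π (tg D.A g)⁆ = (-(g.deg none + g.deg (some none) : ℤ) : ℂ) • D.π (tg D.A g)
    rw [π_gen]
    exact D.model.lie_gen_of_number D (Model.number_tm1 _) (Model.number_ph _) (Model.number_t0 _)
      (Model.number_K _) (Model.number_t1 _) (Model.number_eps _) g
  | ih2 x y hx hy =>
    rw [mon_mul, π_lie, jacobi_even (Model.number D.B) (Dbl.ev_mem _), hx, hy, smul_br, br_smul,
      ← add_smul, deg_mul]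
    simp only [Finsupp.add_apply]
    push_cast; ring_nf

/-- The eigenvalues that separate the degrees. -/
def eigenvalues (d : Degree ι) : Option (Option ι) → ℂ
  | none => (-(d none + d (some none) : ℤ) : ℂ)
  | some a => (wt D.A a d : ℂ)

theorem sum_nodes {M : Type*} [AddCommMonoid M] (F : Option (Option ι) → M) :
    ∑ n, F n = F none + (F (some none) + ∑ i, F (some (some i))) := by
  rw [Fintype.sum_option, Fintype.sum_option]

theorem wt_none (d : Degree ι) : wt D.A none d =
    -d none + (2 * d (some none) + ∑ i, D.A none (some i) * d (some (some i))) := by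
  have h0 : D.A none none = 2 := D.A_diag none
  change ∑ n, _ = _
  rw [sum_nodes]
  simp [extendedCartan, h0]

theorem wt_some (i : ι) (d : Degree ι) : wt D.A (some i) d =
    D.A (some i) none * d (some none) + ∑ j, D.A (some i) (some j) * d (some (some j)) := by
  change ∑ n, _ = _
  rw [sum_nodes]
  simp [extendedCartan]

theorem eq_zero_of_wt {d : Degree ι} (h : ∀ a, wt D.A a d = 0) (h0 : d none + d (some none) = 0) :
    d = 0 := by
  obtain ⟨n, hn, hn0⟩ := D.marks
  have h1 : (fun j => d (some (some j)) - d (some none) * n j) = 0 := by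
    refine D.A_inj _ fun i => ?_
    have := h (some i)
    rw [wt_some] at this
    simp only [mul_sub, Finset.sum_sub_distrib]
    have h2 : ∑ j, D.A (some i) (some j) * (d (some none) * n j) =
        d (some none) * ∑ j, D.A (some i) (some j) * n j := by
      rw [Finset.mul_sum]; exact Finset.sum_congr rfl fun _ _ => by ring
    rw [h2, hn]; linarith
  have h2 : ∀ j, d (some (some j)) = d (some none) * n j := fun j => sub_eq_zero.1 (congrFun h1 j)
  have h3 := h none
  rw [wt_none] at h3
  have h4 : ∑ j, D.A none (some j) * d (some (some j)) = d (some none) * ∑ j, D.A none (some j) * n j := by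
    rw [Finset.mul_sum]; exact Finset.sum_congr rfl fun _ _ => by rw [h2]; ring
  rw [h4, hn0] at h3
  have h5 : d none = 0 := by linarith
  have h6 : d (some none) = 0 := by linarith
  ext n
  rcases n with _ | _ | i
  · exact h5
  · exact h6
  · rw [h2, h6]; simp

theorem eigenvalues_injective : Function.Injective D.eigenvalues := by
  intro d d' h
  rw [← sub_eq_zero]
  refine D.eq_zero_of_wt (fun a => ?_) ?_
  · have := congrFun h (some a)
    rw [map_sub, sub_eq_zero]
    exact Int.cast_injective this
  · have h1 : -(d none + d (some none)) = -(d' none + d' (some none)) := by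
      have := congrFun h none
      simp only [eigenvalues] at this
      exact_mod_cast this
    simp only [Finsupp.sub_apply]
    linarith

/-- The operators that separate the degrees. -/
def separators : Option (Option ι) → Module.End ℂ (Dbl (Module.End ℂ (Model.W D.B)))
  | none => ad (Model.number D.B)
  | some a => ad (D.model.gen (.h a))

theorem separators_π (n : Option (Option ι)) {d : Degree ι} {x : STilde D.A} (hx : x ∈ comp {d}) :
    D.separators n (D.π x) = D.eigenvalues d n • D.π x := by
  refine comp_induction (p := fun x => D.separators n (D.π x) = D.eigenvalues d n • D.π x)
    (fun m hm => ?_) (by simp) (fun x y hx hy => by rw [map_add, map_add, hx, hy, smul_add])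
    (fun c x hx => by rw [map_smul, map_smul, hx, smul_comm]) hx
  rw [Set.mem_singleton_iff] at hm
  subst hm
  rcases n with _ | a
  · exact D.number_π_mon m
  · change ⁅D.model.gen (.h a), D.π (mon m)⁆ = _
    rw [← π_gen, ← π_lie, lie_h_mon, map_smul]; rfl

theorem isHomogeneous_ker : IsHomogeneous (LinearMap.ker D.π) := by
  intro d x hx
  obtain ⟨F, hF⟩ := exists_sum_proj x
  classical
  have h1 : ∑ d' ∈ insert d F, D.π (proj {d'} x) = 0 := by
    rw [← map_sum, hF _ (Finset.subset_insert _ _)]; exact hx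
  exact eq_zero_of_sum_eq_zero D.separators D.eigenvalues D.eigenvalues_injective _
    (fun d' => D.π (proj {d'} x)) (fun d' n => D.separators_π n (proj_mem_comp _ _)) h1 d
    (Finset.mem_insert_self _ _)

end SimpleData

end

section

/-! ### Brackets of raising generators with the odd lowering generators -/

namespace SimpleData

variable {ι 𝔤 : Type*} [Fintype ι] [LieRing 𝔤] [LieAlgebra ℂ 𝔤] (D : SimpleData ι 𝔤)

open LieSuper MonSuper

/-- The generator `e a` of `S̃`. -/
abbrev te (a : Option ι) : STilde D.A := tg D.A (.e (some a))
/-- The generator `f a` of `S̃`. -/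
abbrev tf (a : Option ι) : STilde D.A := tg D.A (.f a)
/-- The generator `h a` of `S̃`. -/
abbrev th (a : Option ι) : STilde D.A := tg D.A (.h a)
/-- The generator `ε` of `S̃`. -/
abbrev teps : STilde D.A := tg D.A (.e none)
/-- The generator `φ i` of `S̃`. -/
abbrev tphi (i : ι) : STilde D.A := tg D.A (.phi i)

theorem extended_some_some (a b : Option ι) : extendedCartan D.A (some a) (some b) = D.A a b := by
  rcases a with _ | i <;> rcases b with _ | j <;> rfl

theorem extended_nonpos {a : Option ι} {n : Option (Option ι)} (h : n ≠ some a) :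
    extendedCartan D.A (some a) n ≤ 0 := by
  rcases n with _ | b
  · rcases a with _ | i <;> simp [extendedCartan]
  · rw [extended_some_some]; exact D.A_off a b fun h' => h (by rw [h'])

theorem te_lie (a : Option ι) (y z : STilde D.A) : ⁅D.te a, ⁅y, z⁆⁆ = ⁅⁅D.te a, y⁆, z⁆ + ⁅y, ⁅D.te a, z⁆⁆ :=
  jacobi_even _ (e_even _ a) y z
theorem tf_lie (a : Option ι) (y z : STilde D.A) : ⁅D.tf a, ⁅y, z⁆⁆ = ⁅⁅D.tf a, y⁆, z⁆ + ⁅y, ⁅D.tf a, z⁆⁆ :=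
  jacobi_even _ (f_even _ a) y z
theorem th_lie (a : Option ι) (y z : STilde D.A) : ⁅D.th a, ⁅y, z⁆⁆ = ⁅⁅D.th a, y⁆, z⁆ + ⁅y, ⁅D.th a, z⁆⁆ :=
  jacobi_even _ (h_even _ a) y z

theorem th_te (a b : Option ι) : ⁅D.th a, D.te b⁆ = (D.A a b : ℂ) • D.te b := by
  rw [rel_h_e, extended_some_some]
theorem th_tf (a b : Option ι) : ⁅D.th a, D.tf b⁆ = -(D.A a b : ℂ) • D.tf b := rel_h_f _ _ _
theorem te_th (a b : Option ι) : ⁅D.te b, D.th a⁆ = -(D.A a b : ℂ) • D.te b := by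
  rw [skew_even _ (h_even _ a), th_te, neg_smul]
theorem te_tf (a : Option ι) : ⁅D.te a, D.tf a⁆ = D.th a := rel_e_f_same _ _
theorem te_tf_ne {a b : Option ι} (h : a ≠ b) : ⁅D.te a, D.tf b⁆ = 0 :=
  rel_e_f_ne _ fun h' => h (Option.some_injective _ h')
theorem tf_te (a : Option ι) : ⁅D.tf a, D.te a⁆ = -D.th a := by rw [skew_even _ (e_even _ a), te_tf]
theorem tf_te_ne {a b : Option ι} (h : a ≠ b) : ⁅D.tf a, D.te b⁆ = 0 := by
  rw [skew_even _ (e_even _ b), te_tf_ne _ h.symm, neg_zero]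
theorem th_te_lie (a b : Option ι) (z : STilde D.A) :
    ⁅D.th a, ⁅D.te b, z⁆⁆ = ⁅D.te b, ⁅D.th a, z⁆⁆ + (D.A a b : ℂ) • ⁅D.te b, z⁆ := by
  rw [th_lie, th_te, smul_br, add_comm]
theorem tf_te_lie (a : Option ι) (z : STilde D.A) :
    ⁅D.tf a, ⁅D.te a, z⁆⁆ = ⁅D.te a, ⁅D.tf a, z⁆⁆ - ⁅D.th a, z⁆ := by
  rw [tf_lie, tf_te, neg_br]; abel
theorem te_tf_lie (a : Option ι) (z : STilde D.A) :
    ⁅D.te a, ⁅D.tf a, z⁆⁆ = ⁅D.tf a, ⁅D.te a, z⁆⁆ + ⁅D.th a, z⁆ := by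
  rw [tf_te_lie]; abel
theorem tf_te_lie_ne {a b : Option ι} (h : a ≠ b) (z : STilde D.A) :
    ⁅D.tf a, ⁅D.te b, z⁆⁆ = ⁅D.te b, ⁅D.tf a, z⁆⁆ := by
  rw [tf_lie, tf_te_ne _ h, zero_br, zero_add]
theorem te_teps (i : ι) : ⁅D.te (some i), D.teps⁆ = 0 := by
  simpa [extendedCartan, ad_apply] using rel_serre_e D.A (some (some i)) none (by simp [extendedCartan])
theorem teps_te (i : ι) : ⁅D.teps, D.te (some i)⁆ = 0 := by rw [skew_even _ (e_even _ _), te_teps, neg_zero]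
theorem teps_tf (a : Option ι) : ⁅D.teps, D.tf a⁆ = 0 := rel_e_f_ne _ (by simp)
theorem tf_teps (a : Option ι) : ⁅D.tf a, D.teps⁆ = 0 := by rw [lie_eq_neg_of_even (f_even _ _), teps_tf, neg_zero]
theorem te_none_tphi (i : ι) : ⁅D.te none, D.tphi i⁆ = 0 := rel_e_zero_phi _ _

/-- The raising generators act locally nilpotently. -/
theorem te_nilpotent (a : Option ι) (z : STilde D.A) : z ∈ nilSet (D.te a) := by
  refine induction (p := fun z => z ∈ nilSet (D.te a)) (fun m => ?_) ⟨0, by simp⟩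
    (fun x y hx hy => nilSet_add hx hy) (fun c x hx => nilSet_smul c hx) z
  have hee : ⁅D.te a, D.te a⁆ = 0 := lie_self_even (e_even _ a)
  have heh (b) : ⁅D.te a, ⁅D.te a, D.th b⁆⁆ = 0 := by rw [te_th, br_smul, hee, smul_zero]
  induction m with
  | ih1 g =>
    change tg D.A g ∈ _
    rcases g with n | b | b | i
    · by_cases h : n = some a
      · subst h; exact ⟨1, by simpa [ad_apply] using hee⟩
      · exact ⟨_, rel_serre_e D.A (some a) n (D.extended_nonpos h)⟩
    · by_cases h : a = b
      · subst h
        refine ⟨3, ?_⟩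
        simp only [pow_succ, pow_zero, one_mul, Module.End.mul_apply, ad_apply]
        rw [te_tf, heh]
      · exact ⟨1, by simpa [ad_apply] using D.te_tf_ne h⟩
    · refine ⟨2, ?_⟩
      simp only [pow_succ, pow_zero, one_mul, Module.End.mul_apply, ad_apply, heh]
    · rcases a with _ | j
      · exact ⟨1, by simpa [ad_apply] using D.te_none_tphi i⟩
      · refine ⟨2, ?_⟩
        simp only [pow_succ, pow_zero, one_mul, Module.End.mul_apply, ad_apply]
        exact rel_e_e_phi _ _ _
  | ih2 x y hx hy => rw [mon_mul]; exact nilSet_lie (e_even _ a) hx hy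

theorem eq_zero_of_tf_eq_zero (a : Option ι) {z : STilde D.A} {n : ℤ} (hn : 0 < n)
    (hF : ⁅D.tf a, z⁆ = 0) (hH : ⁅D.th a, z⁆ = (n : ℂ) • z) : z = 0 := by
  refine eq_zero_of_lowering_eq_zero (ad (D.te a)) (ad (D.tf a)) (ad (D.th a))
    (fun z => by simp only [ad_apply]; rw [th_te_lie, D.A_diag]; simp)
    (fun z => D.te_tf_lie a z) hF hH (fun k h => ?_) (D.te_nilpotent a z)
  have : n + (k : ℤ) = 0 := by exact_mod_cast h
  omega

theorem te_pow_eq_zero (a : Option ι) {z : STilde D.A} {m : ℕ}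
    (hF : ⁅D.tf a, z⁆ = 0) (hH : ⁅D.th a, z⁆ = (-m : ℂ) • z) : (ad (D.te a) ^ (m + 1)) z = 0 :=
  raising_pow_eq_zero (ad (D.te a)) (ad (D.tf a)) (ad (D.th a))
    (fun z => by simp only [ad_apply]; rw [th_te_lie, D.A_diag]; simp)
    (fun z => D.te_tf_lie a z) hF hH (D.te_nilpotent a z)

theorem te_eq_zero (a : Option ι) {z : STilde D.A} (hF : ⁅D.tf a, z⁆ = 0) (hH : ⁅D.th a, z⁆ = 0) :
    ⁅D.te a, z⁆ = 0 := by
  simpa [ad_apply] using D.te_pow_eq_zero a (m := 0) hF (by simpa using hH)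

/-- Brackets of generators `e j` with some `φ k`, with the multiset of the indices `j`, and the
corresponding brackets in `𝔤`. -/
inductive Word : Multiset ι → STilde D.A → 𝔤 → Prop
  | phi (k : ι) : Word 0 (D.tphi k) (D.h k)
  | e (j : ι) {c : Multiset ι} {z : STilde D.A} {u : 𝔤} (h : Word c z u) :
      Word (j ::ₘ c) ⁅D.te (some j), z⁆ ⁅D.x j, u⁆

/-- The span of the words with a given multiset of indices. -/
def words (c : Multiset ι) : Submodule ℂ (STilde D.A) := Submodule.span ℂ {z | ∃ u, D.Word c z u}

/-- The span of all words. -/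
def allWords : Submodule ℂ (STilde D.A) := Submodule.span ℂ {z | ∃ c u, D.Word c z u}

variable {D}

theorem Word.of_zero {z : STilde D.A} {u : 𝔤} (h : D.Word 0 z u) : ∃ k, z = D.tphi k ∧ u = D.h k := by
  generalize hc : (0 : Multiset ι) = c at h
  rcases h with k | ⟨j, _⟩
  · exact ⟨k, rfl, rfl⟩
  · exact absurd hc.symm Multiset.cons_ne_zero

theorem Word.mem {c : Multiset ι} {z : STilde D.A} {u : 𝔤} (h : D.Word c z u) : z ∈ D.words c :=
  Submodule.subset_span ⟨u, h⟩

theorem Word.π_eq {c : Multiset ι} {z : STilde D.A} {u : 𝔤} (h : D.Word c z u) :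
    D.π z = D.model.ph u := by
  induction h with
  | phi k => exact D.π_gen _
  | e j h ih => rw [π_lie, ih, π_gen]; exact D.model.t0_ph _ _

/-- The degree of a word. -/
def wordDeg (c : Multiset ι) : Degree ι :=
  Finsupp.single none (-1) + (c.map fun i => Finsupp.single (some (some i)) 1).sum

theorem wordDeg_cons (j : ι) (c : Multiset ι) :
    wordDeg (j ::ₘ c) = Finsupp.single (some (some j)) 1 + wordDeg c := by
  rw [wordDeg, Multiset.map_cons, Multiset.sum_cons, wordDeg]; abel

theorem wordDeg_none (c : Multiset ι) : wordDeg c none = -1 := by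
  induction c using Multiset.induction_on with
  | empty => simp [wordDeg]
  | cons j c ih => rw [wordDeg_cons, Finsupp.add_apply, ih]; simp

open scoped Classical in
theorem wordDeg_some (c : Multiset ι) (i : ι) : wordDeg c (some (some i)) = c.count i := by
  induction c using Multiset.induction_on with
  | empty => simp [wordDeg]
  | cons j c ih =>
    rw [wordDeg_cons, Finsupp.add_apply, ih, Finsupp.single_apply, Multiset.count_cons, add_comm]
    simp [eq_comm]

theorem wordDeg_injective : Function.Injective (wordDeg (ι := ι)) := by
  classical
  intro c c' h
  ext i
  have := wordDeg_some c i
  rw [h, wordDeg_some] at this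
  exact_mod_cast this.symm

theorem Word.mem_comp {c : Multiset ι} {z : STilde D.A} {u : 𝔤} (h : D.Word c z u) :
    z ∈ comp {wordDeg c} := by
  induction h with
  | phi k => simpa [wordDeg, Gen.deg] using tg_mem_comp D.A (.phi k)
  | e j h ih =>
    refine lie_mem_comp ?_ (tg_mem_comp D.A (.e (some (some j)))) ih
    rintro _ rfl _ rfl
    rw [wordDeg_cons]; rfl

theorem words_le_comp (c : Multiset ι) : D.words c ≤ comp {wordDeg c} :=
  Submodule.span_le.2 fun _ ⟨_, h⟩ => h.mem_comp

theorem words_le_allWords (c : Multiset ι) : D.words c ≤ D.allWords :=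
  Submodule.span_mono fun _ ⟨u, h⟩ => ⟨c, u, h⟩

theorem allWords_le_comp : D.allWords ≤ comp {d | d none = -1} :=
  Submodule.span_le.2 fun _ ⟨c, _, h⟩ => comp_mono (by simp [wordDeg_none]) h.mem_comp

theorem tphi_mem_allWords (k : ι) : D.tphi k ∈ D.allWords := Submodule.subset_span ⟨_, _, .phi k⟩

theorem te_words (j : ι) {c : Multiset ι} {z : STilde D.A} (hz : z ∈ D.words c) :
    ⁅D.te (some j), z⁆ ∈ D.words (j ::ₘ c) := by
  refine Submodule.span_induction (p := fun z _ => ⁅D.te (some j), z⁆ ∈ D.words (j ::ₘ c)) ?_ (by simp)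
    (fun _ _ _ _ h₁ h₂ => by simpa using add_mem h₁ h₂)
    (fun a _ _ h => by simpa using Submodule.smul_mem _ a h) hz
  rintro z ⟨u, h⟩
  exact (h.e j).mem

theorem te_allWords (j : ι) {z : STilde D.A} (hz : z ∈ D.allWords) : ⁅D.te (some j), z⁆ ∈ D.allWords := by
  refine Submodule.span_induction (p := fun z _ => ⁅D.te (some j), z⁆ ∈ D.allWords) ?_ (by simp)
    (fun _ _ _ _ h₁ h₂ => by simpa using add_mem h₁ h₂)
    (fun a _ _ h => by simpa using Submodule.smul_mem _ a h) hz
  rintro z ⟨c, u, h⟩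
  exact Submodule.subset_span ⟨_, _, h.e j⟩

theorem th_words (a : Option ι) {c : Multiset ι} {z : STilde D.A} (hz : z ∈ D.words c) :
    ⁅D.th a, z⁆ = (wt D.A a (wordDeg c) : ℂ) • z := lie_h_of_mem D.A a (words_le_comp c hz)

theorem th_allWords (a : Option ι) {z : STilde D.A} (hz : z ∈ D.allWords) : ⁅D.th a, z⁆ ∈ D.allWords := by
  refine Submodule.span_induction (p := fun z _ => ⁅D.th a, z⁆ ∈ D.allWords) ?_ (by simp)
    (fun _ _ _ _ h₁ h₂ => by simpa using add_mem h₁ h₂)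
    (fun a _ _ h => by simpa using Submodule.smul_mem _ a h) hz
  rintro z ⟨c, u, h⟩
  rw [th_words a h.mem]
  exact Submodule.smul_mem _ _ (Submodule.subset_span ⟨_, _, h⟩)

open scoped Classical in
theorem tf_word {c : Multiset ι} {z : STilde D.A} {u : 𝔤} (h : D.Word c z u) (k : ι) (hc : c ≠ 0) :
    (k ∈ c → ⁅D.tf (some k), z⁆ ∈ D.words (c.erase k)) ∧ (k ∉ c → ⁅D.tf (some k), z⁆ = 0) := by
  induction h with
  | phi l => exact absurd rfl hc
  | @e j c z u h ih =>
    have hk : ⁅D.te (some j), ⁅D.tf (some k), z⁆⁆ ∈ D.words c ∧ j = k ∨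
        j ≠ k ∧ (k ∈ c → ⁅D.te (some j), ⁅D.tf (some k), z⁆⁆ ∈ D.words (j ::ₘ c.erase k)) ∧
          (k ∉ c → ⁅D.te (some j), ⁅D.tf (some k), z⁆⁆ = 0) := by
      by_cases hc' : c = 0
      · subst hc'
        obtain ⟨l, rfl, rfl⟩ := h.of_zero
        by_cases hjk : j = k
        · subst hjk
          left
          rw [rel_e_f_phi_same]
          exact ⟨Submodule.smul_mem _ _ (Word.phi j).mem, rfl⟩
        · right
          exact ⟨hjk, by simp, fun _ => rel_e_f_phi_ne _ _ hjk⟩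
      · obtain ⟨h1, h2⟩ := ih hc'
        by_cases hjk : j = k
        · subst hjk
          left
          by_cases hj : j ∈ c
          · have := te_words j (h1 hj)
            rw [Multiset.cons_erase hj] at this
            exact ⟨this, rfl⟩
          · rw [h2 hj, br_zero]
            exact ⟨zero_mem _, rfl⟩
        · right
          exact ⟨hjk, fun hk => te_words j (h1 hk), fun hk => by rw [h2 hk, br_zero]⟩
    rcases hk with ⟨hk, rfl⟩ | ⟨hjk, h1, h2⟩
    · refine ⟨fun _ => ?_, fun h => absurd (Multiset.mem_cons_self _ _) h⟩
      rw [tf_te_lie, Multiset.erase_cons_head, th_words _ h.mem]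
      exact sub_mem hk (Submodule.smul_mem _ _ h.mem)
    · rw [tf_te_lie_ne D (by simpa using Ne.symm hjk)]
      refine ⟨fun hk => ?_, fun hk => h2 fun h => hk (Multiset.mem_cons_of_mem h)⟩
      rw [Multiset.erase_cons_tail _ (by simpa using hjk)]
      exact h1 ((Multiset.mem_cons.1 hk).resolve_left (Ne.symm hjk))

open scoped Classical in
theorem tf_words (k : ι) {c : Multiset ι} (hc : c ≠ 0) {z : STilde D.A} (hz : z ∈ D.words c) :
    ⁅D.tf (some k), z⁆ = 0 ∨ k ∈ c ∧ ⁅D.tf (some k), z⁆ ∈ D.words (c.erase k) := by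
  by_cases hk : k ∈ c
  · refine .inr ⟨hk, ?_⟩
    refine Submodule.span_induction (p := fun z _ => ⁅D.tf (some k), z⁆ ∈ D.words (c.erase k)) ?_ (by simp)
      (fun _ _ _ _ h₁ h₂ => by simpa using add_mem h₁ h₂)
      (fun a _ _ h => by simpa using Submodule.smul_mem _ a h) hz
    rintro z ⟨u, h⟩
    exact (tf_word h k hc).1 hk
  · left
    refine Submodule.span_induction (p := fun z _ => ⁅D.tf (some k), z⁆ = 0) ?_ (by simp)
      (fun _ _ _ _ h₁ h₂ => by simp [h₁, h₂]) (fun a _ _ h => by simp [h]) hz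
    rintro z ⟨u, h⟩
    exact (tf_word h k hc).2 hk

theorem sum_A_count (a : Option ι) (c : Multiset ι) : wt D.A a (wordDeg c) =
    -extendedCartan D.A (some a) none + (c.map fun j => D.A a (some j)).sum := by
  induction c using Multiset.induction_on with
  | empty => simp [wordDeg, wt_single]
  | cons j c ih =>
    rw [wordDeg_cons, map_add, ih, wt_single, Multiset.map_cons, Multiset.sum_cons,
      D.extended_some_some]
    ring

theorem exists_wt_pos {c : Multiset ι} (hc : c ≠ 0) : ∃ k : ι, 0 < wt D.A (some k) (wordDeg c) := by
  classical
  obtain ⟨k, hk⟩ := D.pos (fun i => c.count i) (by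
    contrapose! hc
    ext i
    simpa using congrFun hc i)
  refine ⟨k, ?_⟩
  rw [wt_some]
  simp only [wordDeg_some]
  have : wordDeg c (some none) = 0 := by
    clear hk hc
    induction c using Multiset.induction_on with
    | empty => simp [wordDeg]
    | cons j c ih => rw [wordDeg_cons, Finsupp.add_apply, ih]; simp
  rw [this, mul_zero, zero_add]
  exact hk

theorem words_zero_eq_zero {z : STilde D.A} (hz : z ∈ D.words 0) (h : D.π z = 0) : z = 0 := by
  have h1 : D.words 0 ≤ Submodule.span ℂ (Set.range D.tphi) := by
    refine Submodule.span_le.2 ?_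
    rintro _ ⟨u, hw⟩
    obtain ⟨k, rfl, -⟩ := hw.of_zero
    exact Submodule.subset_span ⟨k, rfl⟩
  obtain ⟨a, rfl⟩ := (Submodule.mem_span_range_iff_exists_fun ℂ).1 (h1 hz)
  simp only [map_sum, map_smul, π_gen, LocalData.gen] at h
  rw [← map_zero D.model.ph] at h
  simp only [← map_smul, ← map_sum] at h
  have h2 := Fintype.linearIndependent_iff.1 D.h_indep a (Model.ph_injective D.B_inv' h)
  simp [h2]

theorem words_eq_zero : ∀ (n : ℕ) (c : Multiset ι), Multiset.card c = n → ∀ z ∈ D.words c, D.π z = 0 → z = 0 := by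
  classical
  intro n
  induction n with
  | zero =>
    intro c hc z hz h
    obtain rfl := Multiset.card_eq_zero.1 hc
    exact words_zero_eq_zero hz h
  | succ n ih =>
    intro c hc z hz h
    have hc0 : c ≠ 0 := by rintro rfl; simp at hc
    obtain ⟨k, hk⟩ := exists_wt_pos (D := D) hc0
    refine D.eq_zero_of_tf_eq_zero (some k) hk ?_ (th_words _ hz)
    rcases tf_words k hc0 hz with h0 | ⟨hk, h0⟩
    · exact h0
    · refine ih _ (by rw [Multiset.card_erase_of_mem hk, hc]; rfl) _ h0 ?_
      rw [π_lie, h, br_zero]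

/-- The homomorphism to the model is injective on words. -/
theorem allWords_eq_zero {z : STilde D.A} (hz : z ∈ D.allWords) (h : D.π z = 0) : z = 0 := by
  obtain ⟨F, hF⟩ := exists_sum_proj z
  rw [← hF F subset_rfl]
  refine Finset.sum_eq_zero fun d _ => ?_
  by_cases hd : ∃ c, wordDeg c = d
  · obtain ⟨c, rfl⟩ := hd
    refine words_eq_zero _ c rfl _ ?_ (D.isHomogeneous_ker _ z h)
    refine Submodule.span_induction (p := fun z _ => proj {wordDeg c} z ∈ D.words c) ?_ (by simp)
      (fun _ _ _ _ h₁ h₂ => by simpa using add_mem h₁ h₂)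
      (fun a _ _ h => by simpa using Submodule.smul_mem _ a h) hz
    rintro z ⟨c', u, h'⟩
    by_cases hcc : c' = c
    · subst hcc
      rw [proj_eq_self subset_rfl h'.mem_comp]
      exact h'.mem
    · rw [proj_eq_zero (by simpa using fun h => hcc (wordDeg_injective h)) h'.mem_comp]
      exact zero_mem _
  · refine Submodule.span_induction (p := fun z _ => proj {d} z = 0) ?_ (by simp)
      (fun _ _ _ _ h₁ h₂ => by simp [h₁, h₂]) (fun a _ _ h => by simp [h]) hz
    rintro z ⟨c', u, h'⟩
    exact proj_eq_zero (by simpa using fun h => hd ⟨_, h⟩) h'.mem_comp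

theorem allWords_ext {z z' : STilde D.A} (hz : z ∈ D.allWords) (hz' : z' ∈ D.allWords)
    (h : D.π z = D.π z') : z = z' :=
  sub_eq_zero.1 (allWords_eq_zero (sub_mem hz hz') (by rw [map_sub, h, sub_self]))

/-- The elements of `𝔤` that correspond to linear combinations of words annihilated by `f 0`. -/
def annihilated (D : SimpleData ι 𝔤) : Submodule ℂ 𝔤 where
  carrier := {u | ∃ z ∈ D.allWords, ⁅D.tf none, z⁆ = 0 ∧ D.π z = D.model.ph u}
  zero_mem' := ⟨0, zero_mem _, by simp, by simp⟩
  add_mem' := by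
    rintro u u' ⟨z, h1, h2, h3⟩ ⟨z', h1', h2', h3'⟩
    exact ⟨z + z', add_mem h1 h1', by rw [br_add, h2, h2', add_zero], by rw [map_add, map_add, h3, h3']⟩
  smul_mem' := by
    rintro a u ⟨z, h1, h2, h3⟩
    exact ⟨a • z, Submodule.smul_mem _ a h1, by rw [br_smul, h2, smul_zero], by rw [map_smul, map_smul, h3]⟩

theorem x_annihilated (j : ι) {u : 𝔤} (hu : u ∈ D.annihilated) : ⁅D.x j, u⁆ ∈ D.annihilated := by
  obtain ⟨z, h1, h2, h3⟩ := hu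
  refine ⟨⁅D.te (some j), z⁆, te_allWords j h1, ?_, ?_⟩
  · rw [tf_te_lie_ne _ (by simp), h2, br_zero]
  · rw [π_lie, h3, π_gen]; exact D.model.t0_ph _ _

theorem Θ_annihilated {u : 𝔤} (hu : u ∈ D.annihilated) : ⁅D.Θ, u⁆ ∈ D.annihilated := by
  obtain ⟨z, h1, h2, h3⟩ := hu
  refine ⟨z - ⁅D.th none, z⁆, sub_mem h1 (th_allWords _ h1), ?_, ?_⟩
  · have h4 := D.th_lie none (D.tf none) z
    rw [h2, th_tf, smul_br, h2, smul_zero, zero_add, br_zero] at h4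
    rw [br_sub, h2, ← h4, sub_zero]
  · have h4 : D.π (D.th none) = D.model.K - D.model.t0 D.Θ := D.π_gen _
    rw [map_sub, π_lie, h3, h4, sub_br, D.model.K_ph, D.model.t0_ph]
    abel

theorem x_mem_annihilated {j : ι} (hj : D.A (some j) none ≠ 0) : D.x j ∈ D.annihilated := by
  refine ⟨-(1 / 2 : ℂ) • ⁅D.te (some j), D.tphi j⁆,
    Submodule.smul_mem _ _ (te_allWords j (tphi_mem_allWords j)), ?_, ?_⟩
  · rw [br_smul, rel_f_zero_e_phi _ _ _ hj, smul_zero]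
  · have h := ((Word.phi (D := D) j).e j).π_eq
    rw [map_smul, h, ← map_smul, D.x_h, D.A_diag, smul_smul]
    norm_num

/-- A word in which a neighbour of node `0` occurs corresponds to an element of `annihilated`. -/
theorem Word.mem_annihilated {c : Multiset ι} {z : STilde D.A} {u : 𝔤} (h : D.Word c z u)
    (hc : ∃ j ∈ c, D.A (some j) none ≠ 0) : u ∈ D.annihilated := by
  have key : ∀ {c z u}, D.Word c z u → c ≠ 0 → ∀ w ∈ D.annihilated, ⁅u, w⁆ ∈ D.annihilated := by
    intro c z u h
    induction h with
    | phi k => exact fun h => absurd rfl h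
    | @e j c z u h ih =>
      intro _ w hw
      by_cases hc : c = 0
      · subst hc
        obtain ⟨k, rfl, rfl⟩ := h.of_zero
        rw [D.x_h, _root_.smul_lie]
        exact Submodule.smul_mem _ _ (x_annihilated j hw)
      · rw [lie_lie]
        exact sub_mem (x_annihilated j (ih hc _ hw)) (ih hc _ (x_annihilated j hw))
  induction h with
  | phi k => simp at hc
  | @e j c z u h ih =>
    by_cases h' : ∃ j ∈ c, D.A (some j) none ≠ 0
    · exact x_annihilated j (ih h')
    · have hj : D.A (some j) none ≠ 0 := by
        obtain ⟨i, hi, hi'⟩ := hc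
        rcases Multiset.mem_cons.1 hi with rfl | hi
        · exact hi'
        · exact absurd ⟨i, hi, hi'⟩ h'
      by_cases hc : c = 0
      · subst hc
        obtain ⟨k, rfl, rfl⟩ := h.of_zero
        rw [D.x_h]
        exact Submodule.smul_mem _ _ (x_mem_annihilated hj)
      · rw [← lie_skew]
        exact neg_mem (key h hc _ (x_mem_annihilated hj))

theorem Word.h_lie {c : Multiset ι} {z : STilde D.A} {u : 𝔤} (h : D.Word c z u) (k : ι) :
    ⁅D.h k, u⁆ = ((c.map fun j => D.A (some k) (some j)).sum : ℂ) • u := by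
  induction h with
  | phi l => simp [D.h_h]
  | e j h ih =>
    rw [leibniz_lie, ih, D.h_x, Multiset.map_cons, Multiset.sum_cons, _root_.smul_lie, _root_.lie_smul, ← add_smul]
    push_cast; rfl

theorem Word.Θ_lie {c : Multiset ι} {z : STilde D.A} {u : 𝔤} (h : D.Word c z u) :
    ⁅D.Θ, u⁆ = (-(c.map fun j => D.A none (some j)).sum : ℂ) • u := by
  induction h with
  | phi l => simp [D.Θ_h]
  | e j h ih =>
    rw [leibniz_lie, ih, D.Θ_x, Multiset.map_cons, Multiset.sum_cons, _root_.smul_lie, _root_.lie_smul, ← add_smul]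
    push_cast; ring_nf

theorem Word.exists_list {c : Multiset ι} {z : STilde D.A} {u : 𝔤} (h : D.Word c z u) (hc : c ≠ 0) :
    ∃ (l : List ι) (i : ι) (a : ℂ), c = ↑(i :: l) ∧ u = a • l.foldr (fun j z => ⁅D.x j, z⁆) (D.x i) := by
  induction h with
  | phi k => exact absurd rfl hc
  | @e j c z u h ih =>
    by_cases hc : c = 0
    · subst hc
      obtain ⟨k, rfl, rfl⟩ := h.of_zero
      exact ⟨[], j, _, rfl, D.x_h k j⟩
    · obtain ⟨l, i, a, rfl, rfl⟩ := ih hc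
      refine ⟨j :: l, i, a, ?_, by rw [_root_.lie_smul]; rfl⟩
      rw [Multiset.cons_coe]
      exact Multiset.coe_eq_coe.2 (List.Perm.swap i j l)

theorem exists_word_of_mem {u : 𝔤} (hu : ∀ N : Submodule ℂ 𝔤, (∀ i, D.x i ∈ N) →
    (∀ i, ∀ z ∈ N, ⁅D.x i, z⁆ ∈ N) → u ∈ N) : ∃ z ∈ D.allWords, D.π z = D.model.ph u := by
  refine hu (Submodule.comap D.model.ph (D.allWords.map D.π)) (fun i => ?_) ?_
  · refine ⟨-(1 / 2 : ℂ) • ⁅D.te (some i), D.tphi i⁆,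
      Submodule.smul_mem _ _ (te_allWords i (tphi_mem_allWords i)), ?_⟩
    have h := ((Word.phi (D := D) i).e i).π_eq
    rw [map_smul, h, ← map_smul, D.x_h, D.A_diag, smul_smul]
    norm_num
  · rintro i u ⟨z, hz, hzu⟩
    refine ⟨⁅D.te (some i), z⁆, te_allWords i hz, ?_⟩
    rw [π_lie, hzu, π_gen]; exact D.model.t0_ph _ _

variable (D)

theorem exists_wordX : ∃ z ∈ D.allWords, D.π z = D.model.ph D.X := exists_word_of_mem D.X_mem

/-- The element of `S̃` that corresponds to the highest root vector. -/
def wordX : STilde D.A := D.exists_wordX.choose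

theorem wordX_mem : D.wordX ∈ D.allWords := D.exists_wordX.choose_spec.1
theorem π_wordX : D.π D.wordX = D.model.ph D.X := D.exists_wordX.choose_spec.2

theorem tf_none_wordX : ⁅D.tf none, D.wordX⁆ = 0 := by
  suffices h : D.X ∈ D.annihilated by
    obtain ⟨z, h1, h2, h3⟩ := h
    rwa [allWords_ext D.wordX_mem h1 (D.π_wordX.trans h3.symm)]
  have h1 : ∃ u ∈ D.annihilated, ⁅D.Θ, D.X - u⁆ = 0 := by
    have h2 : ∀ z ∈ D.allWords, ∃ w, D.π z = D.model.ph w ∧ ∃ u ∈ D.annihilated, ⁅D.Θ, w - u⁆ = 0 := by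
      intro z hz
      refine Submodule.span_induction (p := fun z _ => ∃ w, D.π z = D.model.ph w ∧
        ∃ u ∈ D.annihilated, ⁅D.Θ, w - u⁆ = 0) ?_ ⟨0, by simp, 0, zero_mem _, by simp⟩ ?_ ?_ hz
      · rintro z ⟨c, w, h⟩
        refine ⟨w, h.π_eq, ?_⟩
        by_cases hc : ∃ j ∈ c, D.A (some j) none ≠ 0
        · exact ⟨w, h.mem_annihilated hc, by simp⟩
        · refine ⟨0, zero_mem _, ?_⟩
          push Not at hc
          rw [sub_zero, h.Θ_lie, Multiset.map_congr rfl (g := fun _ => (0 : ℤ)) fun j hj =>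
            (D.A_zero j).1 (hc j hj)]
          simp
      · rintro z z' _ _ ⟨w, h1, u, h2, h3⟩ ⟨w', h1', u', h2', h3'⟩
        refine ⟨w + w', by rw [map_add, map_add, h1, h1'], u + u', add_mem h2 h2', ?_⟩
        rw [add_sub_add_comm, _root_.lie_add, h3, h3', add_zero]
      · rintro a z _ ⟨w, h1, u, h2, h3⟩
        refine ⟨a • w, by rw [map_smul, map_smul, h1], a • u, Submodule.smul_mem _ a h2, ?_⟩
        rw [← smul_sub, _root_.lie_smul, h3, smul_zero]
    obtain ⟨w, h3, u, h4, h5⟩ := h2 _ D.wordX_mem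
    rw [π_wordX] at h3
    rw [Model.ph_injective D.B_inv' h3]
    exact ⟨u, h4, h5⟩
  obtain ⟨u, hu, h⟩ := h1
  rw [lie_sub, D.Θ_X, sub_eq_zero] at h
  have : D.X = (1 / 2 : ℂ) • ⁅D.Θ, u⁆ := by rw [← h, smul_smul]; norm_num
  rw [this]
  exact Submodule.smul_mem _ _ (Θ_annihilated hu)

/-- The element of `S̃` of level `-1` that commutes with the finite part. -/
def vt : STilde D.A := ⁅D.te none, D.wordX⁆

variable {D}

theorem Word.te_none {n : ℕ} (ih : ∀ c, Multiset.card c < n → ∀ z ∈ D.words c,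
      ∃ u, D.π z = D.model.ph u ∧ ⁅D.te none, z⁆ = D.B D.Y u • D.vt)
    {c : Multiset ι} (hcn : Multiset.card c = n) {z : STilde D.A} {u : 𝔤} (h : D.Word c z u) :
    ⁅D.te none, z⁆ = D.B D.Y u • D.vt := by
  classical
  by_cases hc : c = 0
  · subst hc
    obtain ⟨k, rfl, rfl⟩ := h.of_zero
    rw [te_none_tphi, D.B_Y_h, zero_smul]
  by_cases hu : u = 0
  · have : z = 0 := allWords_eq_zero (words_le_allWords c h.mem) (by rw [h.π_eq, hu, map_zero])
    rw [this, hu]; simp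
  obtain ⟨l, i, a, hcl, hul⟩ := h.exists_list hc
  have hroot := D.root l i (fun h0 => hu (by rw [hul, h0, smul_zero]))
  have hsum (b : Option ι) : ((i :: l).map fun j => D.A b (some j)).sum = (c.map fun j => D.A b (some j)).sum := by
    rw [hcl, Multiset.map_coe, Multiset.sum_coe]
  simp only [hsum] at hroot
  rcases hroot with ⟨k, hk⟩ | h1 | ⟨b, hb⟩
  · have hB : D.B D.Y u = 0 := by
      refine D.B_eq_zero (D.h_Y k) (h.h_lie k) ?_
      have h0 : D.A (some k) none + (c.map fun j => D.A (some k) (some j)).sum ≠ 0 := by omega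
      exact_mod_cast h0
    rw [hB, zero_smul]
    refine D.eq_zero_of_tf_eq_zero (some k) (n := D.A (some k) none + wt D.A (some k) (wordDeg c)) ?_ ?_ ?_
    · rw [sum_A_count]
      simp only [extendedCartan]
      omega
    · rw [tf_te_lie_ne _ (by simp)]
      rcases tf_words k hc h.mem with h0 | ⟨hkc, h0⟩
      · rw [h0, br_zero]
      · obtain ⟨u', h2, h3⟩ := ih _ (by rw [← hcn]; exact Multiset.card_erase_lt_of_mem hkc) _ h0
        have h4 : D.π ⁅D.tf (some k), z⁆ = D.model.ph ⁅D.y k, u⁆ := by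
          rw [π_lie, h.π_eq, π_gen]; exact D.model.t0_ph _ _
        rw [h3, ← Model.ph_injective D.B_inv' (h4.symm.trans h2), ← D.B_inv, ← lie_skew, D.y_Y]
        simp
    · rw [th_te_lie, th_words _ h.mem, br_smul, ← add_smul]
      push_cast; ring_nf
  · have hadj : ∃ j ∈ c, D.A (some j) none ≠ 0 := by
      by_contra! hcon
      rw [Multiset.map_congr rfl (g := fun _ => (0 : ℤ)) fun j hj => (D.A_zero j).1 (hcon j hj)] at h1
      simp at h1
    have hΘ : ⁅D.Θ, u⁆ = (1 : ℂ) • u := by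
      rw [h.Θ_lie, h1]; simp
    rw [D.B_eq_zero D.Θ_Y hΘ (by norm_num), zero_smul]
    refine D.te_eq_zero none ?_ ?_
    · obtain ⟨z', h2, h3, h4⟩ := h.mem_annihilated hadj
      rwa [allWords_ext (words_le_allWords c h.mem) h2 (h.π_eq.trans h4.symm)]
    · rw [th_words _ h.mem, sum_A_count, h1]
      simp [extendedCartan]
  · have hz : z = (a * b) • D.wordX := by
      refine allWords_ext (words_le_allWords c h.mem) (Submodule.smul_mem _ _ D.wordX_mem) ?_
      rw [h.π_eq, map_smul, π_wordX, ← map_smul, hul, hb, smul_smul]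
    rw [hz, hul, hb, br_smul, smul_smul, map_smul, D.B_symm, D.B_X_Y, smul_eq_mul, mul_one]; rfl

theorem te_none_words : ∀ (n : ℕ) (c : Multiset ι), Multiset.card c = n → ∀ z ∈ D.words c,
      ∃ u, D.π z = D.model.ph u ∧ ⁅D.te none, z⁆ = D.B D.Y u • D.vt := by
  intro n
  induction n using Nat.strong_induction_on with
  | _ n ih =>
    intro c hc z hz
    refine Submodule.span_induction (p := fun z _ => ∃ u, D.π z = D.model.ph u ∧
      ⁅D.te none, z⁆ = D.B D.Y u • D.vt) ?_ ⟨0, by simp, by simp⟩ ?_ ?_ hz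
    · rintro z ⟨u, h⟩
      exact ⟨u, h.π_eq, h.te_none (fun c hc => ih _ hc c rfl) hc⟩
    · rintro z z' _ _ ⟨u, h1, h2⟩ ⟨u', h1', h2'⟩
      exact ⟨u + u', by rw [map_add, map_add, h1, h1'], by rw [br_add, h2, h2', map_add, add_smul]⟩
    · rintro a z _ ⟨u, h1, h2⟩
      exact ⟨a • u, by rw [map_smul, map_smul, h1], by rw [br_smul, h2, map_smul, smul_smul]; rfl⟩

theorem te_none_allWords {z : STilde D.A} (hz : z ∈ D.allWords) {u : 𝔤} (hu : D.π z = D.model.ph u) :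
    ⁅D.te none, z⁆ = D.B D.Y u • D.vt := by
  have : ∃ u, D.π z = D.model.ph u ∧ ⁅D.te none, z⁆ = D.B D.Y u • D.vt := by
    refine Submodule.span_induction (p := fun z _ => ∃ u, D.π z = D.model.ph u ∧
      ⁅D.te none, z⁆ = D.B D.Y u • D.vt) ?_ ⟨0, by simp, by simp⟩ ?_ ?_ hz
    · rintro z ⟨c, u, h⟩
      exact te_none_words _ c rfl z h.mem
    · rintro z z' _ _ ⟨u, h1, h2⟩ ⟨u', h1', h2'⟩
      exact ⟨u + u', by rw [map_add, map_add, h1, h1'], by rw [br_add, h2, h2', map_add, add_smul]⟩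
    · rintro a z _ ⟨u, h1, h2⟩
      exact ⟨a • u, by rw [map_smul, map_smul, h1], by rw [br_smul, h2, map_smul, smul_smul]; rfl⟩
  obtain ⟨u', h1, h2⟩ := this
  rw [h2, Model.ph_injective D.B_inv' (h1.symm.trans hu)]

end SimpleData

end

section

/-! ### Closures under brackets -/

namespace LieSuper

variable {L : Type*} [AddCommGroup L] [Module ℂ L] [Bracket L L] [LieSuper L]

/-- The smallest subspace that contains `s` and is stable under the brackets with `o`. -/
def cl (s o : Set L) : Submodule ℂ L := sInf {N | s ⊆ N ∧ ∀ x ∈ o, ∀ z ∈ N, ⁅x, z⁆ ∈ N}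

theorem subset_cl {s o : Set L} : s ⊆ cl s o := fun _ hx =>
  Submodule.mem_sInf.2 fun _ hN => hN.1 hx

theorem lie_mem_cl {s o : Set L} {x z : L} (hx : x ∈ o) (hz : z ∈ cl s o) : ⁅x, z⁆ ∈ cl s o :=
  Submodule.mem_sInf.2 fun N hN => hN.2 x hx z (Submodule.mem_sInf.1 hz N hN)

theorem cl_le {s o : Set L} {N : Submodule ℂ L} (hs : s ⊆ N) (ho : ∀ x ∈ o, ∀ z ∈ N, ⁅x, z⁆ ∈ N) :
    cl s o ≤ N := sInf_le ⟨hs, ho⟩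

/-- The elements that map a subspace to itself. -/
def stab (N : Submodule ℂ L) : Submodule ℂ L where
  carrier := {x | ∀ z ∈ N, ⁅x, z⁆ ∈ N}
  zero_mem' := by simp
  add_mem' h h' z hz := by rw [add_br]; exact add_mem (h z hz) (h' z hz)
  smul_mem' a x h z hz := by rw [smul_br]; exact Submodule.smul_mem _ a (h z hz)

theorem lie_mem_stab {N : Submodule ℂ L} {x y : L} (hxe : x ∈ even (L := L)) (hx : x ∈ stab N)
    (hy : y ∈ stab N) : ⁅x, y⁆ ∈ stab N := by
  intro z hz
  have : ⁅⁅x, y⁆, z⁆ = ⁅x, ⁅y, z⁆⁆ - ⁅y, ⁅x, z⁆⁆ := by rw [jacobi_even x hxe]; abel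
  rw [this]
  exact sub_mem (hx _ (hy z hz)) (hy _ (hx z hz))

theorem cl_le_stab {s o : Set L} {N : Submodule ℂ L} (hoe : o ⊆ even (L := L)) (hs : s ⊆ stab N)
    (ho : o ⊆ stab N) : cl s o ≤ stab N :=
  cl_le hs fun x hx _ hz => lie_mem_stab (x := x) (hoe hx) (ho hx) hz

theorem lie_mem_of_cl {s o : Set L} {N : Submodule ℂ L} {x : L} (hxe : x ∈ even (L := L))
    (hs : ∀ m ∈ s, ⁅x, m⁆ ∈ N) (ho : ∀ y ∈ o, ∀ z ∈ cl s o, ⁅⁅x, y⁆, z⁆ ∈ N)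
    (hN : ∀ y ∈ o, ∀ z ∈ N, ⁅y, z⁆ ∈ N) :
    ∀ z ∈ cl s o, ⁅x, z⁆ ∈ N := by
  have : cl s o ≤ cl s o ⊓ N.comap (ad x) := by
    refine cl_le (fun m hm => ⟨subset_cl hm, hs m hm⟩) fun y hy z hz => ⟨lie_mem_cl hy hz.1, ?_⟩
    change ⁅x, ⁅y, z⁆⁆ ∈ N
    rw [jacobi_even x hxe]
    exact add_mem (ho y hy z hz.1) (hN y hy _ hz.2)
  exact fun z hz => (this hz).2

theorem mem_stab_cl {s o : Set L} {x : L} (hxe : x ∈ even (L := L))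
    (hs : ∀ m ∈ s, ⁅x, m⁆ ∈ cl s o) (ho : ∀ y ∈ o, ⁅x, y⁆ ∈ stab (cl s o)) : x ∈ stab (cl s o) :=
  lie_mem_of_cl hxe hs (fun y hy z hz => ho y hy z hz) fun _ hy _ hz => lie_mem_cl hy hz

theorem mem_stab_cl_self {Q : Submodule ℂ L} {x : L} (hxe : x ∈ even (L := L)) (hx : x ∈ stab Q) :
    x ∈ stab (cl (Q : Set L) Q) :=
  mem_stab_cl hxe (fun m hm => subset_cl (hx m hm)) fun y hy _ hz => lie_mem_cl (hx y hy) hz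

theorem cl_even {s o : Set L} (hs : s ⊆ even (L := L)) (ho : o ⊆ even (L := L)) :
    cl s o ≤ even (L := L) := cl_le hs fun x hx z hz => lie_even_even x (ho hx) z hz

theorem cl_odd {s o : Set L} (hs : s ⊆ odd (L := L)) (ho : o ⊆ even (L := L)) :
    cl s o ≤ odd (L := L) := cl_le hs fun x hx z hz => lie_even_odd x (ho hx) z hz

theorem lie_cl_self {V Q P : Submodule ℂ L} (hV : V ≤ odd (L := L)) (hQ : Q ≤ odd (L := L))
    (hP : P ≤ even (L := L)) (hPQ : P ≤ stab Q) (h : ∀ x ∈ V, ∀ q ∈ Q, ⁅x, q⁆ ∈ P) {x : L} (hx : x ∈ V) :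
    ∀ z ∈ cl (Q : Set L) Q, ⁅x, z⁆ ∈ cl (Q : Set L) Q ⊔ P := by
  have : cl (Q : Set L) Q ≤ cl (Q : Set L) Q ⊓ (cl (Q : Set L) Q ⊔ P).comap (ad x) := by
    refine cl_le (fun q hq => ⟨subset_cl hq, Submodule.mem_sup_right (h x hx q hq)⟩)
      fun q hq z hz => ⟨lie_mem_cl hq hz.1, ?_⟩
    change ⁅x, ⁅q, z⁆⁆ ∈ cl (Q : Set L) Q ⊔ P
    rw [jacobi_odd x (hV hx) q (hQ hq)]
    refine sub_mem (Submodule.mem_sup_left ?_) (Submodule.mem_sup_left ?_)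
    · have hp := h x hx q hq
      exact mem_stab_cl_self (hP hp) (hPQ hp) z hz.1
    · obtain ⟨r, hr, p, hp, hrp⟩ := Submodule.mem_sup.1 hz.2
      rw [ad_apply] at hrp
      rw [← hrp, br_add]
      refine add_mem (lie_mem_cl hq hr) (subset_cl ?_)
      rw [skew_even p (hP hp)]
      exact neg_mem (hPQ hp q hq)
  exact fun z hz => (this hz).2

end LieSuper

/-! ### The element `vt` and its bracket with `ε` -/

namespace SimpleData

variable {ι 𝔤 : Type*} [Fintype ι] [LieRing 𝔤] [LieAlgebra ℂ 𝔤] (D : SimpleData ι 𝔤)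

open LieSuper MonSuper

theorem π_te_some (i : ι) : D.π (D.te (some i)) = D.model.t0 (D.x i) := D.π_gen _
theorem π_tf_some (i : ι) : D.π (D.tf (some i)) = D.model.t0 (D.y i) := D.π_gen _
theorem π_th_some (i : ι) : D.π (D.th (some i)) = D.model.t0 (D.h i) := D.π_gen _
theorem π_te_none : D.π (D.te none) = D.model.t1 D.Y := D.π_gen _
theorem π_tf_none : D.π (D.tf none) = D.model.tm1 D.X := D.π_gen _
theorem π_th_none : D.π (D.th none) = D.model.K - D.model.t0 D.Θ := D.π_gen _
theorem π_teps : D.π D.teps = D.model.eps := D.π_gen _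
theorem π_tphi (i : ι) : D.π (D.tphi i) = D.model.ph (D.h i) := D.π_gen _

variable {D} in
theorem odd_of_allWords {z : STilde D.A} (hz : z ∈ D.allWords) : z ∈ odd (L := STilde D.A) := by
  rw [odd_eq]
  refine comp_mono ?_ (allWords_le_comp hz)
  rintro d hd
  simp only [Set.mem_ofPred_eq] at hd ⊢
  rw [hd]; decide

theorem wordX_odd : D.wordX ∈ odd (L := STilde D.A) := odd_of_allWords D.wordX_mem

theorem vt_mem_comp : D.vt ∈ comp {d | d none = -1} := by
  refine lie_mem_comp (P := {Finsupp.single (some none) 1}) ?_ (tg_mem_comp D.A (.e (some none)))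
    (allWords_le_comp D.wordX_mem)
  rintro _ rfl q hq
  simp only [Set.mem_ofPred_eq] at hq ⊢
  rw [Finsupp.add_apply, hq]; simp

theorem vt_odd : D.vt ∈ odd (L := STilde D.A) := lie_even_odd _ (e_even _ _) _ D.wordX_odd

theorem π_vt : D.π D.vt = D.model.v := by
  rw [vt, π_lie, π_te_none, π_wordX, D.model.t1_ph, D.B_symm, D.B_X_Y, one_smul]

theorem th_some_wordX (i : ι) : ⁅D.th (some i), D.wordX⁆ = -(D.A (some i) none : ℂ) • D.wordX := by
  refine allWords_ext (th_allWords _ D.wordX_mem) (Submodule.smul_mem _ _ D.wordX_mem) ?_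
  rw [π_lie, map_smul, π_wordX, π_th_some, D.model.t0_ph, D.h_X, map_smul]

theorem th_none_wordX : ⁅D.th none, D.wordX⁆ = -D.wordX := by
  refine allWords_ext (th_allWords _ D.wordX_mem) (neg_mem D.wordX_mem) ?_
  rw [π_lie, map_neg, π_wordX, π_th_none, sub_br, D.model.K_ph, D.model.t0_ph, D.Θ_X, map_smul]
  module

theorem th_some_vt (i : ι) : ⁅D.th (some i), D.vt⁆ = 0 := by
  rw [vt, th_te_lie, th_some_wordX, br_smul, ← add_smul, neg_add_cancel, zero_smul]

theorem th_none_vt : ⁅D.th none, D.vt⁆ = D.vt := by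
  rw [vt, th_te_lie, th_none_wordX, D.A_diag, br_neg]; module

theorem tf_none_vt : ⁅D.tf none, D.vt⁆ = D.wordX := by
  rw [vt, tf_te_lie, tf_none_wordX, br_zero, th_none_wordX]; simp

theorem te_none_vt : ⁅D.te none, D.vt⁆ = 0 := by
  have := D.te_pow_eq_zero none (m := 1) D.tf_none_wordX (by rw [th_none_wordX]; simp)
  simpa [pow_succ, ad_apply, vt] using this

theorem te_none_tf_allWords (k : ι) {z : STilde D.A} (hz : z ∈ D.allWords) :
    ⁅D.te none, ⁅D.tf (some k), z⁆⁆ = 0 := by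
  refine Submodule.span_induction (p := fun z _ => ⁅D.te none, ⁅D.tf (some k), z⁆⁆ = 0) ?_ (by simp)
      (fun _ _ _ _ h₁ h₂ => by simp [h₁, h₂]) (fun a _ _ h => by simp [h]) hz
  rintro z ⟨c, u, h⟩
  by_cases hc : c = 0
  · subst hc
    obtain ⟨i, rfl, rfl⟩ := h.of_zero
    rw [← tf_te_lie_ne _ (by simp), te_none_tphi, br_zero]
  · rcases tf_words k hc h.mem with h0 | ⟨-, h0⟩
    · rw [h0, br_zero]
    · have h1 : D.π ⁅D.tf (some k), z⁆ = D.model.ph ⁅D.y k, u⁆ := by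
        rw [π_lie, h.π_eq, π_gen]; exact D.model.t0_ph _ _
      rw [te_none_allWords (words_le_allWords _ h0) h1, ← D.B_inv, ← lie_skew, D.y_Y]
      simp

theorem tf_some_vt (k : ι) : ⁅D.tf (some k), D.vt⁆ = 0 := by
  rw [vt, tf_te_lie_ne _ (by simp), te_none_tf_allWords _ _ D.wordX_mem]

theorem te_some_vt (i : ι) : ⁅D.te (some i), D.vt⁆ = 0 :=
  D.te_eq_zero (some i) (D.tf_some_vt i) (D.th_some_vt i)

theorem th_vt (a : Option ι) : ∃ c : ℂ, ⁅D.th a, D.vt⁆ = c • D.vt := by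
  rcases a with _ | i
  · exact ⟨1, by rw [th_none_vt, one_smul]⟩
  · exact ⟨0, by rw [th_some_vt, zero_smul]⟩

theorem te_vt (a : Option ι) : ⁅D.te a, D.vt⁆ = 0 := by
  rcases a with _ | i
  · exact D.te_none_vt
  · exact D.te_some_vt i

/-- The span of the brackets of the generators `e i` of the finite part. -/
def nilp : Submodule ℂ (STilde D.A) :=
  cl (Set.range fun i => D.te (some i)) (Set.range fun i => D.te (some i))

theorem range_te_even : (Set.range fun i => D.te (some i)) ⊆ even (L := STilde D.A) := by
  rintro _ ⟨i, rfl⟩; exact e_even _ _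

theorem nilp_le_stab {N : Submodule ℂ (STilde D.A)} (h : ∀ i, D.te (some i) ∈ stab N) :
    D.nilp ≤ stab N :=
  cl_le_stab D.range_te_even (by rintro _ ⟨i, rfl⟩; exact h i) (by rintro _ ⟨i, rfl⟩; exact h i)

theorem te_stab_allWords (i : ι) : D.te (some i) ∈ stab D.allWords := fun _ hz => te_allWords i hz

variable {D} in
theorem lie_tphi_mem {g : STilde D.A} (hg : g ∈ D.nilp) (k : ι) : ⁅g, D.tphi k⁆ ∈ D.allWords :=
  D.nilp_le_stab D.te_stab_allWords hg _ (tphi_mem_allWords k)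

variable {D} in
theorem teps_allWords {z : STilde D.A} (hz : z ∈ D.allWords) :
    ⁅D.teps, z⁆ ∈ D.nilp ⊔ Submodule.span ℂ (Set.range fun i => D.th (some i)) := by
  refine Submodule.span_induction (p := fun z _ => ⁅D.teps, z⁆ ∈
    D.nilp ⊔ Submodule.span ℂ (Set.range fun i => D.th (some i))) ?_ (by simp)
      (fun _ _ _ _ h₁ h₂ => by simpa using add_mem h₁ h₂)
      (fun a _ _ h => by simpa using Submodule.smul_mem _ a h) hz
  rintro z ⟨c, u, h⟩
  induction h with
  | phi k =>
    rw [rel_eps_phi]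
    exact Submodule.mem_sup_right (Submodule.subset_span ⟨k, rfl⟩)
  | @e j c z u h ih =>
    obtain ⟨g, hg, t, ht, hgt⟩ := Submodule.mem_sup.1 ih
    rw [jacobi_even_right (e_even _ _), teps_te, zero_br, zero_add, ← hgt, br_add]
    refine Submodule.mem_sup_left (add_mem (lie_mem_cl ⟨j, rfl⟩ hg) ?_)
    refine Submodule.span_induction (p := fun t _ => ⁅D.te (some j), t⁆ ∈ D.nilp) ?_ (by simp)
      (fun _ _ _ _ h₁ h₂ => by simpa using add_mem h₁ h₂)
      (fun a _ _ h => by simpa using Submodule.smul_mem _ a h) ht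
    rintro _ ⟨i, rfl⟩
    rw [te_th]
    exact Submodule.smul_mem _ _ (subset_cl ⟨j, rfl⟩)

/-- The bracket of `ε` and `wordX`. -/
def raiseX : STilde D.A := ⁅D.teps, D.wordX⁆

theorem π_raiseX : D.π D.raiseX = D.model.t0 D.X := by
  rw [raiseX, π_lie, π_teps, π_wordX, D.model.eps_ph]

theorem raiseX_even : D.raiseX ∈ even (L := STilde D.A) :=
  lie_odd_odd _ (eps_odd _) _ D.wordX_odd

theorem raiseX_mem : D.raiseX ∈ D.nilp := by
  classical
  obtain ⟨i, hi⟩ := D.exists_adjacent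
  have h1 : D.raiseX ∈ D.nilp ⊔ Submodule.span ℂ (Set.range fun i => D.th (some i)) :=
    teps_allWords D.wordX_mem
  obtain ⟨g, hg, t, ht, hgt⟩ := Submodule.mem_sup.1 h1
  have h2 : ⁅D.th (some i), D.raiseX⁆ = -(D.A (some i) none : ℂ) • D.raiseX := by
    rw [raiseX, th_lie, rel_h_e, th_some_wordX]; simp [extendedCartan]
  have h3 : ⁅D.th (some i), t⁆ = 0 := by
    refine Submodule.span_induction (p := fun t _ => ⁅D.th (some i), t⁆ = 0) ?_ (by simp)
      (fun _ _ _ _ h₁ h₂ => by simp [h₁, h₂]) (fun a _ _ h => by simp [h]) ht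
    rintro _ ⟨j, rfl⟩
    exact rel_h_h _ _ _
  have h4 : ⁅D.th (some i), g⁆ ∈ D.nilp := by
    refine mem_stab_cl (h_even _ _) ?_ ?_ g hg
    · rintro _ ⟨j, rfl⟩
      rw [th_te]
      exact Submodule.smul_mem _ _ (subset_cl ⟨j, rfl⟩)
    · rintro _ ⟨j, rfl⟩
      rw [th_te]
      exact Submodule.smul_mem _ _ fun z hz => lie_mem_cl ⟨j, rfl⟩ hz
  have h5 : D.raiseX = (-(D.A (some i) none : ℂ))⁻¹ • ⁅D.th (some i), g⁆ := by
    rw [← hgt, br_add, h3, add_zero, hgt] at h2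
    rw [h2, smul_smul, inv_mul_cancel₀ (neg_ne_zero.2 (Int.cast_ne_zero.2 hi)), one_smul]
  rw [h5]
  exact Submodule.smul_mem _ _ h4

theorem raiseX_tphi (k : ι) : ⁅D.raiseX, D.tphi k⁆ = (D.A (some k) none : ℂ) • D.wordX := by
  refine allWords_ext (lie_tphi_mem D.raiseX_mem k) (Submodule.smul_mem _ _ D.wordX_mem) ?_
  rw [π_lie, map_smul, π_wordX, π_raiseX, π_tphi, D.model.t0_ph, ← lie_skew, D.h_X, ← map_smul]
  simp

theorem tphi_wordX (k : ι) : ⁅D.tphi k, D.wordX⁆ = 0 := by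
  have key (j k : ι) : (D.A (some k) none : ℂ) • ⁅D.tphi j, D.wordX⁆ +
      (D.A (some j) none : ℂ) • ⁅D.tphi k, D.wordX⁆ = 0 := by
    have h := jacobi_odd _ (phi_odd D.A j) _ (phi_odd D.A k) D.raiseX
    rw [skew_even _ D.raiseX_even, skew_even _ D.raiseX_even (D.tphi j), raiseX_tphi, raiseX_tphi, rel_phi_phi, zero_br,
      br_neg, br_neg, br_smul, br_smul] at h
    linear_combination (norm := module) -h
  obtain ⟨i, hi⟩ := D.exists_adjacent
  have hi' : (D.A (some i) none : ℂ) ≠ 0 := Int.cast_ne_zero.2 hi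
  have h1 : ⁅D.tphi i, D.wordX⁆ = 0 := by
    have := key i i
    rw [← two_smul ℂ, smul_smul, smul_eq_zero] at this
    exact this.resolve_left (mul_ne_zero two_ne_zero hi')
  have h2 := key i k
  rw [h1, smul_zero, zero_add, smul_eq_zero] at h2
  exact h2.resolve_left hi'

theorem wordX_wordX : ⁅D.wordX, D.wordX⁆ = 0 := by
  obtain ⟨i, hi⟩ := D.exists_adjacent
  have hi' : (D.A (some i) none : ℂ) ≠ 0 := Int.cast_ne_zero.2 hi
  have h0 : ⁅D.raiseX, D.wordX⁆ = 0 := by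
    refine allWords_eq_zero (D.nilp_le_stab D.te_stab_allWords D.raiseX_mem _ D.wordX_mem) ?_
    rw [π_lie, π_raiseX, π_wordX, D.model.t0_ph, lie_self, map_zero]
  have h1 := jacobi_even_right D.raiseX_even D.wordX (D.tphi i)
  rw [skew_even _ D.raiseX_even D.wordX, h0, neg_zero, zero_br, zero_add, raiseX_tphi,
    skew_odd _ (phi_odd _ _) _ D.wordX_odd, tphi_wordX, br_zero, br_smul, smul_eq_zero] at h1
  exact h1.resolve_left hi'

theorem vt_tphi (k : ι) : ⁅D.vt, D.tphi k⁆ = 0 := by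
  have h := D.te_lie none D.wordX (D.tphi k)
  rw [te_none_tphi, br_zero, add_zero, skew_odd _ (phi_odd _ _) _ D.wordX_odd, tphi_wordX, br_zero] at h
  exact h.symm

theorem vt_vt : ⁅D.vt, D.vt⁆ = 0 := by
  have h1 := D.te_lie none D.wordX D.wordX
  rw [wordX_wordX, br_zero, skew_odd _ D.wordX_odd _ (lie_even_odd _ (e_even _ _) _ D.wordX_odd),
    ← two_smul ℂ, eq_comm, smul_eq_zero] at h1
  have h2 : ⁅D.wordX, D.vt⁆ = 0 := h1.resolve_left two_ne_zero
  have h3 := D.te_lie none D.wordX D.vt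
  rw [h2, te_none_vt, br_zero, br_zero, add_zero] at h3
  exact h3.symm

/-- The bracket of `ε` and `vt`. -/
def Lt : STilde D.A := ⁅D.teps, D.vt⁆

theorem Lt_even : D.Lt ∈ even (L := STilde D.A) := lie_odd_odd _ (eps_odd _) _ D.vt_odd

theorem π_Lt : D.π D.Lt = -D.model.Lo := by
  rw [Lt, π_lie, π_teps, π_vt, D.model.eps_v]

theorem te_some_Lt (i : ι) : ⁅D.te (some i), D.Lt⁆ = 0 := by
  rw [Lt, te_lie, te_teps, zero_br, te_some_vt, br_zero, add_zero]

theorem tf_Lt (a : Option ι) : ⁅D.tf a, D.Lt⁆ ∈ D.nilp := by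
  rw [Lt, tf_lie, tf_teps, zero_br, zero_add]
  rcases a with _ | i
  · rw [tf_none_vt]; exact D.raiseX_mem
  · rw [tf_some_vt, br_zero]; exact zero_mem _

theorem Lt_tf (a : Option ι) : ⁅D.Lt, D.tf a⁆ ∈ D.nilp := by
  rw [skew_even _ (f_even _ _)]; exact neg_mem (D.tf_Lt a)

theorem th_Lt (a : Option ι) : ⁅D.th a, D.Lt⁆ = 0 := by
  rw [Lt, th_lie, rel_h_e]
  rcases a with _ | i
  · rw [th_none_vt]; simp [extendedCartan]
  · rw [th_some_vt]; simp [extendedCartan]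

theorem Lt_th (a : Option ι) : ⁅D.Lt, D.th a⁆ = 0 := by rw [skew_even _ (h_even _ _), th_Lt, neg_zero]

theorem Lt_vt : ⁅D.Lt, D.vt⁆ = 0 := by
  have h := jacobi_odd _ (eps_odd D.A) _ D.vt_odd D.vt
  rw [vt_vt, br_zero] at h
  change 0 = ⁅D.Lt, D.vt⁆ - ⁅D.vt, D.Lt⁆ at h
  rw [skew_even _ D.Lt_even] at h
  rw [sub_neg_eq_add, ← two_smul ℂ, eq_comm, smul_eq_zero] at h
  exact h.resolve_left two_ne_zero

theorem Lt_tphi (k : ι) : ⁅D.Lt, D.tphi k⁆ = 0 := by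
  have h := jacobi_odd _ (eps_odd D.A) _ D.vt_odd (D.tphi k)
  rw [vt_tphi, br_zero, rel_eps_phi, skew_even _ (h_even _ _) D.vt, th_some_vt] at h
  simpa [Lt] using h.symm

variable {D} in
theorem Lt_allWords {z : STilde D.A} (hz : z ∈ D.allWords) : ⁅D.Lt, z⁆ = 0 := by
  refine Submodule.span_induction (p := fun z _ => ⁅D.Lt, z⁆ = 0) ?_ (by simp)
      (fun _ _ _ _ h₁ h₂ => by simp [h₁, h₂]) (fun a _ _ h => by simp [h]) hz
  rintro z ⟨c, u, h⟩
  induction h with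
  | phi k => exact D.Lt_tphi k
  | @e j c z u h ih =>
    rw [jacobi_even _ D.Lt_even, ih, br_zero, lie_eq_neg_of_even D.Lt_even, te_some_Lt]
    simp

end SimpleData

end

section

/-! ### The decomposition of `S̃` by level -/

namespace SimpleData

variable {ι 𝔤 : Type*} [Fintype ι] [LieRing 𝔤] [LieAlgebra ℂ 𝔤] (D : SimpleData ι 𝔤)

open LieSuper MonSuper

/-- The generators of the raising part of level `0`. -/
def raisingSet : Set (STilde D.A) := insert D.Lt (Set.range D.te)

theorem raisingSet_even : D.raisingSet ⊆ even (L := STilde D.A) := by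
  rintro _ (rfl | ⟨a, rfl⟩)
  exacts [D.Lt_even, e_even _ a]

theorem range_tf_even : Set.range D.tf ⊆ even (L := STilde D.A) := by
  rintro _ ⟨a, rfl⟩; exact f_even _ _

/-- The raising part of level `0`. -/
def raisingPart : Submodule ℂ (STilde D.A) := cl D.raisingSet D.raisingSet

/-- The lowering part of level `0`. -/
def loweringPart : Submodule ℂ (STilde D.A) := cl (Set.range D.tf) (Set.range D.tf)

/-- The Cartan part of level `0`. -/
def cartanPart : Submodule ℂ (STilde D.A) := Submodule.span ℂ (Set.range D.th)

/-- The part of level `0`. -/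
def levelZero : Submodule ℂ (STilde D.A) := D.loweringPart ⊔ D.cartanPart ⊔ D.raisingPart

/-- The generators of level `0`. -/
def levelZeroSet : Set (STilde D.A) := D.raisingSet ∪ Set.range D.tf

/-- The part of level `1`. -/
def levelOne : Submodule ℂ (STilde D.A) := cl {D.teps} D.levelZeroSet

/-- The part of level `-1`. -/
def levelNegOne : Submodule ℂ (STilde D.A) := cl (insert D.vt D.allWords) (Set.range D.tf)

theorem levelZeroSet_even : D.levelZeroSet ⊆ even (L := STilde D.A) :=
  Set.union_subset D.raisingSet_even D.range_tf_even

theorem te_mem (a : Option ι) : D.te a ∈ D.raisingSet := .inr ⟨a, rfl⟩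
theorem Lt_mem : D.Lt ∈ D.raisingSet := .inl rfl
theorem tf_mem (a : Option ι) : D.tf a ∈ Set.range D.tf := ⟨a, rfl⟩

theorem cartan_le {N : Submodule ℂ (STilde D.A)} (h : ∀ a, D.th a ∈ N) : D.cartanPart ≤ N :=
  Submodule.span_le.2 (by rintro _ ⟨a, rfl⟩; exact h a)

theorem loweringPart_le : D.loweringPart ≤ D.levelZero := le_sup_of_le_left le_sup_left
theorem cartanPart_le : D.cartanPart ≤ D.levelZero := le_sup_of_le_left le_sup_right
theorem raisingPart_le : D.raisingPart ≤ D.levelZero := le_sup_right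

theorem nilp_le_raisingPart : D.nilp ≤ D.raisingPart := by
  refine cl_le ?_ ?_
  · rintro _ ⟨i, rfl⟩; exact subset_cl (D.te_mem _)
  · rintro _ ⟨i, rfl⟩ z hz; exact lie_mem_cl (D.te_mem _) hz

variable {D} in
/-- The part of level `0` maps a subspace to itself if its generators do. -/
theorem levelZero_le_stab {N : Submodule ℂ (STilde D.A)} (h : D.levelZeroSet ⊆ stab N) :
    D.levelZero ≤ stab N := by
  have h1 : D.raisingSet ⊆ stab N := Set.subset_union_left.trans h
  have h2 : Set.range D.tf ⊆ stab N := Set.subset_union_right.trans h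
  refine sup_le (sup_le (cl_le_stab D.range_tf_even h2 h2) (D.cartan_le fun a => ?_))
    (cl_le_stab D.raisingSet_even h1 h1)
  have := lie_mem_stab (e_even _ _) (h1 (D.te_mem a)) (h2 (D.tf_mem a))
  rwa [te_tf] at this

theorem th_stab_loweringPart (a : Option ι) : D.th a ∈ stab D.loweringPart := by
  refine mem_stab_cl (h_even _ _) ?_ ?_
  · rintro _ ⟨b, rfl⟩
    rw [th_tf]
    exact Submodule.smul_mem _ _ (subset_cl (D.tf_mem b))
  · rintro _ ⟨b, rfl⟩
    rw [th_tf]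
    exact Submodule.smul_mem _ _ fun z hz => lie_mem_cl (D.tf_mem b) hz

theorem th_stab_raisingPart (a : Option ι) : D.th a ∈ stab D.raisingPart := by
  have h : ∀ x ∈ D.raisingSet, ∃ c : ℂ, ⁅D.th a, x⁆ = c • x := by
    rintro _ (rfl | ⟨b, rfl⟩)
    · exact ⟨0, by rw [th_Lt, zero_smul]⟩
    · exact ⟨_, D.th_te a b⟩
  refine mem_stab_cl (h_even _ _) (fun x hx => ?_) fun x hx => ?_
  · obtain ⟨c, hc⟩ := h x hx
    rw [hc]; exact Submodule.smul_mem _ _ (subset_cl hx)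
  · obtain ⟨c, hc⟩ := h x hx
    rw [hc]; exact Submodule.smul_mem _ _ fun z hz => lie_mem_cl hx hz

variable {D} in
theorem lie_cartanPart {x : STilde D.A} {N : Submodule ℂ (STilde D.A)} (h : ∀ a, ⁅x, D.th a⁆ ∈ N) :
    ∀ z ∈ D.cartanPart, ⁅x, z⁆ ∈ N := by
  have : D.cartanPart ≤ N.comap (ad x) := D.cartan_le h
  exact fun z hz => this hz

theorem te_loweringPart (b : Option ι) : ∀ z ∈ D.loweringPart, ⁅D.te b, z⁆ ∈ D.loweringPart ⊔ D.cartanPart := by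
  refine lie_mem_of_cl (e_even _ _) ?_ ?_ ?_
  · rintro _ ⟨a, rfl⟩
    by_cases h : b = a
    · subst h
      rw [te_tf]
      exact Submodule.mem_sup_right (Submodule.subset_span ⟨b, rfl⟩)
    · rw [te_tf_ne _ h]; exact zero_mem _
  · rintro _ ⟨a, rfl⟩ z hz
    by_cases h : b = a
    · subst h
      rw [te_tf]
      exact Submodule.mem_sup_left (D.th_stab_loweringPart b z hz)
    · rw [te_tf_ne _ h, zero_br]; exact zero_mem _
  · rintro _ ⟨a, rfl⟩ z hz
    obtain ⟨y, hy, t, ht, rfl⟩ := Submodule.mem_sup.1 hz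
    rw [br_add]
    refine Submodule.mem_sup_left (add_mem (lie_mem_cl (D.tf_mem a) hy) ?_)
    refine lie_cartanPart (fun b => ?_) t ht
    rw [skew_even _ (h_even _ b), th_tf, neg_smul, neg_neg]
    exact Submodule.smul_mem _ _ (subset_cl (D.tf_mem a))

theorem nilp_stab {N : Submodule ℂ (STilde D.A)} (h : ∀ a, D.te a ∈ stab N) : D.nilp ≤ stab N :=
  D.nilp_le_stab fun i => h (some i)

theorem te_stab_raisingPart (a : Option ι) : D.te a ∈ stab D.raisingPart :=
  fun _ hz => lie_mem_cl (D.te_mem a) hz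

theorem tf_raisingPart (b : Option ι) : ∀ z ∈ D.raisingPart, ⁅D.tf b, z⁆ ∈ D.cartanPart ⊔ D.raisingPart := by
  refine lie_mem_of_cl (f_even _ _) ?_ ?_ ?_
  · rintro _ (rfl | ⟨a, rfl⟩)
    · exact Submodule.mem_sup_right (D.nilp_le_raisingPart (D.tf_Lt b))
    by_cases h : b = a
    · subst h
      rw [tf_te]
      exact Submodule.mem_sup_left (neg_mem (Submodule.subset_span ⟨b, rfl⟩))
    · rw [tf_te_ne _ h]; exact zero_mem _
  · rintro _ (rfl | ⟨a, rfl⟩) z hz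
    · exact Submodule.mem_sup_right (D.nilp_stab D.te_stab_raisingPart (D.tf_Lt b) z hz)
    by_cases h : b = a
    · subst h
      rw [tf_te, neg_br]
      exact Submodule.mem_sup_right (neg_mem (D.th_stab_raisingPart b z hz))
    · rw [tf_te_ne _ h, zero_br]; exact zero_mem _
  · intro y hy z hz
    obtain ⟨t, ht, z, hz', rfl⟩ := Submodule.mem_sup.1 hz
    rw [br_add]
    refine Submodule.mem_sup_right (add_mem ?_ (lie_mem_cl hy hz'))
    refine lie_cartanPart (fun b => ?_) t ht
    rcases hy with rfl | ⟨a, rfl⟩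
    · rw [Lt_th]; exact zero_mem _
    · rw [te_th]; exact Submodule.smul_mem _ _ (subset_cl (D.te_mem a))

theorem stab_levelZero {x : STilde D.A} (h1 : ∀ z ∈ D.loweringPart, ⁅x, z⁆ ∈ D.levelZero)
    (h2 : ∀ a, ⁅x, D.th a⁆ ∈ D.levelZero) (h3 : ∀ z ∈ D.raisingPart, ⁅x, z⁆ ∈ D.levelZero) :
    x ∈ stab D.levelZero := by
  have : D.levelZero ≤ D.levelZero.comap (ad x) := sup_le (sup_le h1 (D.cartan_le h2)) h3
  exact fun z hz => this hz

theorem te_stab_levelZero (a : Option ι) : D.te a ∈ stab D.levelZero := by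
  refine D.stab_levelZero (fun z hz => ?_) (fun b => ?_) fun z hz => D.raisingPart_le (D.te_stab_raisingPart a z hz)
  · exact (sup_le D.loweringPart_le D.cartanPart_le) (D.te_loweringPart a z hz)
  · rw [te_th]; exact Submodule.smul_mem _ _ (D.raisingPart_le (subset_cl (D.te_mem a)))

theorem tf_stab_levelZero (a : Option ι) : D.tf a ∈ stab D.levelZero := by
  refine D.stab_levelZero (fun z hz => D.loweringPart_le (lie_mem_cl (D.tf_mem a) hz)) (fun b => ?_) fun z hz => ?_
  · rw [skew_even _ (h_even _ b), th_tf, neg_smul, neg_neg]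
    exact Submodule.smul_mem _ _ (D.loweringPart_le (subset_cl (D.tf_mem a)))
  · exact (sup_le D.cartanPart_le D.raisingPart_le) (D.tf_raisingPart a z hz)

theorem Lt_stab_levelZero : D.Lt ∈ stab D.levelZero := by
  refine D.stab_levelZero (lie_mem_of_cl D.Lt_even ?_ ?_ ?_) (fun b => ?_)
    fun z hz => D.raisingPart_le (lie_mem_cl D.Lt_mem hz)
  · rintro _ ⟨a, rfl⟩
    exact D.raisingPart_le (D.nilp_le_raisingPart (D.Lt_tf a))
  · rintro _ ⟨a, rfl⟩ z hz
    exact D.nilp_stab D.te_stab_levelZero (D.Lt_tf a) z (D.loweringPart_le hz)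
  · rintro _ ⟨a, rfl⟩ z hz
    exact D.tf_stab_levelZero a z hz
  · rw [Lt_th]; exact zero_mem _

theorem levelZeroSet_stab_levelZero : D.levelZeroSet ⊆ stab D.levelZero := by
  rintro _ ((rfl | ⟨a, rfl⟩) | ⟨a, rfl⟩)
  exacts [D.Lt_stab_levelZero, D.te_stab_levelZero a, D.tf_stab_levelZero a]

theorem levelZeroSet_stab_levelOne : D.levelZeroSet ⊆ stab D.levelOne :=
  fun _ hx _ hz => lie_mem_cl hx hz

theorem tf_stab_levelNegOne (a : Option ι) : D.tf a ∈ stab D.levelNegOne :=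
  fun _ hz => lie_mem_cl (D.tf_mem a) hz

theorem th_stab_levelNegOne (a : Option ι) : D.th a ∈ stab D.levelNegOne := by
  refine mem_stab_cl (h_even _ _) ?_ ?_
  · rintro z (rfl | hz)
    · obtain ⟨c, hc⟩ := D.th_vt a
      rw [hc]; exact Submodule.smul_mem _ _ (subset_cl (.inl rfl))
    · exact subset_cl (.inr (th_allWords a hz))
  · rintro _ ⟨b, rfl⟩
    rw [th_tf]
    exact Submodule.smul_mem _ _ (D.tf_stab_levelNegOne b)

variable {D} in
theorem exists_π_eq {z : STilde D.A} (hz : z ∈ D.allWords) : ∃ u, D.π z = D.model.ph u := by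
  refine Submodule.span_induction (p := fun z _ => ∃ u, D.π z = D.model.ph u) ?_ ⟨0, by simp⟩ ?_ ?_ hz
  · rintro z ⟨c, u, h⟩; exact ⟨u, h.π_eq⟩
  · rintro z z' _ _ ⟨u, h1⟩ ⟨u', h1'⟩
    exact ⟨u + u', by rw [map_add, map_add, h1, h1']⟩
  · rintro a z _ ⟨u, h1⟩
    exact ⟨a • u, by rw [map_smul, map_smul, h1]⟩

theorem te_stab_levelNegOne (a : Option ι) : D.te a ∈ stab D.levelNegOne := by
  refine mem_stab_cl (e_even _ _) ?_ ?_
  · rintro z (rfl | hz)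
    · rw [te_vt]; exact zero_mem _
    · rcases a with _ | i
      · obtain ⟨u, hu⟩ := exists_π_eq hz
        rw [te_none_allWords hz hu]
        exact Submodule.smul_mem _ _ (subset_cl (.inl rfl))
      · exact subset_cl (.inr (te_allWords i hz))
  · rintro _ ⟨b, rfl⟩
    by_cases h : a = b
    · subst h
      rw [te_tf]; exact D.th_stab_levelNegOne a
    · rw [te_tf_ne _ h]; exact zero_mem _

theorem Lt_stab_levelNegOne : D.Lt ∈ stab D.levelNegOne := by
  refine mem_stab_cl D.Lt_even ?_ ?_
  · rintro z (rfl | hz)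
    · rw [Lt_vt]; exact zero_mem _
    · rw [Lt_allWords hz]; exact zero_mem _
  · rintro _ ⟨b, rfl⟩
    exact D.nilp_stab D.te_stab_levelNegOne (D.Lt_tf b)

theorem levelZeroSet_stab_levelNegOne : D.levelZeroSet ⊆ stab D.levelNegOne := by
  rintro _ ((rfl | ⟨a, rfl⟩) | ⟨a, rfl⟩)
  exacts [D.Lt_stab_levelNegOne, D.te_stab_levelNegOne a, D.tf_stab_levelNegOne a]

theorem levelZero_even : D.levelZero ≤ even (L := STilde D.A) :=
  sup_le (sup_le (cl_even D.range_tf_even D.range_tf_even) (D.cartan_le fun a => h_even _ a))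
    (cl_even D.raisingSet_even D.raisingSet_even)

theorem levelOne_odd : D.levelOne ≤ odd (L := STilde D.A) :=
  cl_odd (by rintro _ rfl; exact eps_odd _) D.levelZeroSet_even

theorem levelNegOne_odd : D.levelNegOne ≤ odd (L := STilde D.A) := by
  refine cl_odd ?_ D.range_tf_even
  rintro z (rfl | hz)
  exacts [D.vt_odd, odd_of_allWords hz]

theorem teps_levelNegOne : ∀ q ∈ D.levelNegOne, ⁅D.teps, q⁆ ∈ D.levelZero := by
  have : D.levelNegOne ≤ D.levelZero.comap (ad D.teps) := by
    refine cl_le ?_ ?_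
    · rintro z (rfl | hz)
      · exact D.raisingPart_le (subset_cl D.Lt_mem)
      · refine (sup_le (D.nilp_le_raisingPart.trans D.raisingPart_le) ?_ : _ ≤ D.levelZero) (teps_allWords hz)
        refine Submodule.span_le.2 ?_
        rintro _ ⟨i, rfl⟩
        exact D.cartanPart_le (Submodule.subset_span ⟨some i, rfl⟩)
    · rintro _ ⟨a, rfl⟩ z hz
      change ⁅D.teps, ⁅D.tf a, z⁆⁆ ∈ D.levelZero
      rw [jacobi_even_right (f_even _ a), teps_tf, zero_br, zero_add]
      exact D.tf_stab_levelZero a _ hz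
  exact fun q hq => this hq

theorem levelOne_levelNegOne : ∀ x ∈ D.levelOne, ∀ q ∈ D.levelNegOne, ⁅x, q⁆ ∈ D.levelZero := by
  let N : Submodule ℂ (STilde D.A) :=
    { carrier := {x | ∀ q ∈ D.levelNegOne, ⁅x, q⁆ ∈ D.levelZero}
      zero_mem' := by simp
      add_mem' := fun h h' z hz => by rw [add_br]; exact add_mem (h z hz) (h' z hz)
      smul_mem' := fun a x h z hz => by rw [smul_br]; exact Submodule.smul_mem _ a (h z hz) }
  have : D.levelOne ≤ N := by
    refine cl_le (by rintro _ rfl; exact D.teps_levelNegOne) fun g hg x hx q hq => ?_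
    have : ⁅⁅g, x⁆, q⁆ = ⁅g, ⁅x, q⁆⁆ - ⁅x, ⁅g, q⁆⁆ := by
      rw [jacobi_even g (D.levelZeroSet_even hg)]; abel
    rw [this]
    exact sub_mem (D.levelZeroSet_stab_levelZero hg _ (hx q hq))
      (hx _ (D.levelZeroSet_stab_levelNegOne hg q hq))
  exact fun x hx => this hx

/-- The part of positive level. -/
def levelPos : Submodule ℂ (STilde D.A) := cl (D.levelOne : Set (STilde D.A)) D.levelOne

/-- The part of negative level. -/
def levelNeg : Submodule ℂ (STilde D.A) := cl (D.levelNegOne : Set (STilde D.A)) D.levelNegOne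

theorem tphi_mem_levelNegOne (i : ι) : D.tphi i ∈ D.levelNegOne := subset_cl (.inr (tphi_mem_allWords i))
theorem teps_mem_levelOne : D.teps ∈ D.levelOne := subset_cl rfl

theorem tg_stab (g : Gen ι) : tg D.A g ∈ stab (D.levelNeg ⊔ D.levelZero ⊔ D.levelPos) := by
  have hZ : ∀ x ∈ D.levelZero, x ∈ stab (D.levelNeg ⊔ D.levelZero ⊔ D.levelPos) := by
    intro x hx
    have : D.levelNeg ⊔ D.levelZero ⊔ D.levelPos ≤
        (D.levelNeg ⊔ D.levelZero ⊔ D.levelPos).comap (ad x) := by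
      refine sup_le (sup_le ?_ ?_) ?_
      · intro z hz
        exact Submodule.mem_sup_left (Submodule.mem_sup_left (mem_stab_cl_self (D.levelZero_even hx)
          (levelZero_le_stab D.levelZeroSet_stab_levelNegOne hx) z hz))
      · intro z hz
        exact Submodule.mem_sup_left (Submodule.mem_sup_right
          (levelZero_le_stab D.levelZeroSet_stab_levelZero hx z hz))
      · intro z hz
        exact Submodule.mem_sup_right (mem_stab_cl_self (D.levelZero_even hx)
          (levelZero_le_stab D.levelZeroSet_stab_levelOne hx) z hz)
    exact fun z hz => this hz
  have hO : ∀ x ∈ D.levelOne, x ∈ stab (D.levelNeg ⊔ D.levelZero ⊔ D.levelPos) := by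
    intro x hx
    have : D.levelNeg ⊔ D.levelZero ⊔ D.levelPos ≤
        (D.levelNeg ⊔ D.levelZero ⊔ D.levelPos).comap (ad x) := by
      refine sup_le (sup_le ?_ ?_) ?_
      · intro z hz
        exact Submodule.mem_sup_left (lie_cl_self D.levelOne_odd D.levelNegOne_odd D.levelZero_even
          (levelZero_le_stab D.levelZeroSet_stab_levelNegOne) D.levelOne_levelNegOne hx z hz)
      · intro z hz
        refine Submodule.mem_sup_right (subset_cl ?_)
        change ⁅x, z⁆ ∈ _
        rw [skew_even _ (D.levelZero_even hz)]
        exact neg_mem (levelZero_le_stab D.levelZeroSet_stab_levelOne hz x hx)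
      · intro z hz
        exact Submodule.mem_sup_right (lie_mem_cl hx hz)
    exact fun z hz => this hz
  have hN : ∀ x ∈ D.levelNegOne, x ∈ stab (D.levelNeg ⊔ D.levelZero ⊔ D.levelPos) := by
    intro x hx
    have : D.levelNeg ⊔ D.levelZero ⊔ D.levelPos ≤
        (D.levelNeg ⊔ D.levelZero ⊔ D.levelPos).comap (ad x) := by
      refine sup_le (sup_le ?_ ?_) ?_
      · intro z hz
        exact Submodule.mem_sup_left (Submodule.mem_sup_left (lie_mem_cl hx hz))
      · intro z hz
        refine Submodule.mem_sup_left (Submodule.mem_sup_left (subset_cl ?_))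
        change ⁅x, z⁆ ∈ _
        rw [skew_even _ (D.levelZero_even hz)]
        exact neg_mem (levelZero_le_stab D.levelZeroSet_stab_levelNegOne hz x hx)
      · intro z hz
        refine (sup_le (le_sup_right : D.levelPos ≤ _) (le_sup_of_le_left le_sup_right) : _ ≤ _) (lie_cl_self D.levelNegOne_odd D.levelOne_odd D.levelZero_even
          (levelZero_le_stab D.levelZeroSet_stab_levelOne) (fun x hx q hq => ?_) hx z hz)
        rw [skew_odd _ (D.levelOne_odd hq) _ (D.levelNegOne_odd hx)]
        exact D.levelOne_levelNegOne q hq x hx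
    exact fun z hz => this hz
  rcases g with (_ | a) | a | a | i
  · exact hO _ D.teps_mem_levelOne
  · exact hZ _ (D.raisingPart_le (subset_cl (D.te_mem a)))
  · exact hZ _ (D.loweringPart_le (subset_cl (D.tf_mem a)))
  · exact hZ _ (D.cartanPart_le (Submodule.subset_span ⟨a, rfl⟩))
  · exact hN _ (D.tphi_mem_levelNegOne i)

theorem sup_levels : D.levelNeg ⊔ D.levelZero ⊔ D.levelPos = ⊤ := by
  refine eq_top_of_gen (fun g => ?_) fun g y hy => D.tg_stab g y hy
  change tg D.A g ∈ _
  rcases g with (_ | a) | a | a | i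
  · exact Submodule.mem_sup_right (subset_cl D.teps_mem_levelOne)
  · exact Submodule.mem_sup_left (Submodule.mem_sup_right (D.raisingPart_le (subset_cl (D.te_mem a))))
  · exact Submodule.mem_sup_left (Submodule.mem_sup_right (D.loweringPart_le (subset_cl (D.tf_mem a))))
  · exact Submodule.mem_sup_left (Submodule.mem_sup_right (D.cartanPart_le (Submodule.subset_span ⟨a, rfl⟩)))
  · exact Submodule.mem_sup_left (Submodule.mem_sup_left (subset_cl (D.tphi_mem_levelNegOne i)))

/-- The sum of all coordinates of a degree. -/
def total : Degree ι →+ ℤ where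
  toFun d := ∑ n, d n
  map_zero' := by simp
  map_add' d d' := by simp [Finset.sum_add_distrib]

theorem total_single (n : Option (Option ι)) (c : ℤ) : total (Finsupp.single n c) = c := by
  classical
  change ∑ m, _ = _
  simp [Finsupp.single_apply]

theorem total_wordDeg (c : Multiset ι) : -1 ≤ total (wordDeg c) := by
  induction c using Multiset.induction_on with
  | empty => simp [wordDeg, total_single]
  | cons j c ih => rw [wordDeg_cons, map_add, total_single]; omega

theorem allWords_le_comp_total : D.allWords ≤ comp {d | d none = -1 ∧ -1 ≤ total d} :=
  Submodule.span_le.2 fun _ ⟨c, _, h⟩ =>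
    comp_mono (by simp [wordDeg_none, total_wordDeg]) h.mem_comp

theorem vt_mem_comp_total : D.vt ∈ comp {d | d none = -1 ∧ 0 ≤ total d} := by
  refine lie_mem_comp (P := {Finsupp.single (some none) 1}) ?_ (tg_mem_comp D.A (.e (some none)))
    (D.allWords_le_comp_total D.wordX_mem)
  rintro _ rfl q ⟨hq, hq'⟩
  refine ⟨by rw [Finsupp.add_apply, hq]; simp, ?_⟩
  rw [map_add, total_single]; omega

theorem Lt_mem_comp_total : D.Lt ∈ comp {d | d none = 0 ∧ 0 < total d} := by
  refine lie_mem_comp (P := {Finsupp.single none 1}) ?_ (tg_mem_comp D.A (.e none)) D.vt_mem_comp_total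
  rintro _ rfl q ⟨hq, hq'⟩
  refine ⟨by rw [Finsupp.add_apply, hq]; simp, ?_⟩
  rw [map_add, total_single]; omega

theorem te_mem_comp_total (a : Option ι) : D.te a ∈ comp {d | d none = 0 ∧ 0 < total d} :=
  comp_mono (by rintro _ rfl; simp [Gen.deg, total_single]) (tg_mem_comp D.A (.e (some a)))

theorem tf_mem_comp_total (a : Option ι) : D.tf a ∈ comp {d | d none = 0 ∧ total d < 0} :=
  comp_mono (by rintro _ rfl; simp [Gen.deg, total_single]) (tg_mem_comp D.A (.f a))

theorem raisingPart_le_comp : D.raisingPart ≤ comp {d | d none = 0 ∧ 0 < total d} := by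
  have : D.raisingSet ⊆ comp (L := STilde D.A) {d | d none = 0 ∧ 0 < total d} := by
    rintro _ (rfl | ⟨a, rfl⟩)
    exacts [D.Lt_mem_comp_total, D.te_mem_comp_total a]
  refine cl_le this fun x hx z hz => lie_mem_comp ?_ (this hx) hz
  rintro p ⟨h1, h2⟩ q ⟨h3, h4⟩
  exact ⟨by rw [Finsupp.add_apply, h1, h3]; rfl, by rw [map_add]; omega⟩

theorem loweringPart_le_comp : D.loweringPart ≤ comp {d | d none = 0 ∧ total d < 0} := by
  have : Set.range D.tf ⊆ comp (L := STilde D.A) {d | d none = 0 ∧ total d < 0} := by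
    rintro _ ⟨a, rfl⟩
    exact D.tf_mem_comp_total a
  refine cl_le this fun x hx z hz => lie_mem_comp ?_ (this hx) hz
  rintro p ⟨h1, h2⟩ q ⟨h3, h4⟩
  exact ⟨by rw [Finsupp.add_apply, h1, h3]; rfl, by rw [map_add]; omega⟩

theorem cartanPart_le_comp : D.cartanPart ≤ comp {0} := D.cartan_le fun a => tg_mem_comp D.A (.h a)

theorem levelZero_le_comp : D.levelZero ≤ comp {d | d none = 0} :=
  sup_le (sup_le (D.loweringPart_le_comp.trans (comp_mono fun _ h => h.1))
    (D.cartanPart_le_comp.trans (comp_mono (by rintro _ rfl; rfl))))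
    (D.raisingPart_le_comp.trans (comp_mono fun _ h => h.1))

theorem levelZeroSet_le : D.levelZeroSet ⊆ D.levelZero :=
  Set.union_subset (subset_cl.trans D.raisingPart_le) (subset_cl.trans D.loweringPart_le)

theorem lie_levelZero_mem_comp {k : ℤ} {x z : STilde D.A} (hx : x ∈ D.levelZero)
    (hz : z ∈ comp {d | d none = k}) : ⁅x, z⁆ ∈ comp {d | d none = k} := by
  refine lie_mem_comp ?_ (D.levelZero_le_comp hx) hz
  intro p hp q hq
  simp only [Set.mem_ofPred_eq] at hp hq ⊢
  rw [Finsupp.add_apply, hp, hq, zero_add]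

theorem levelOne_le_comp : D.levelOne ≤ comp {d | d none = 1} :=
  cl_le (by rintro _ rfl; exact comp_mono (by rintro _ rfl; simp [Gen.deg]) (tg_mem_comp D.A (.e none)))
    fun x hx z hz => D.lie_levelZero_mem_comp (D.levelZeroSet_le hx) hz

theorem levelNegOne_le_comp : D.levelNegOne ≤ comp {d | d none = -1} := by
  refine cl_le ?_ fun x hx z hz => D.lie_levelZero_mem_comp (D.loweringPart_le (subset_cl hx)) hz
  rintro z (rfl | hz)
  exacts [D.vt_mem_comp, allWords_le_comp hz]

theorem levelPos_le : D.levelPos ≤ D.levelOne ⊔ comp {d | 2 ≤ d none} := by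
  have h1 : D.levelOne ⊔ comp {d | 2 ≤ d none} ≤ comp {d | 1 ≤ d none} :=
    sup_le (D.levelOne_le_comp.trans (comp_mono fun d h => by simp at h ⊢; omega))
      (comp_mono fun d h => by simp at h ⊢; omega)
  refine cl_le (fun x hx => Submodule.mem_sup_left hx) fun x hx z hz => Submodule.mem_sup_right ?_
  refine lie_mem_comp ?_ (D.levelOne_le_comp hx) (h1 hz)
  intro p hp q hq
  simp only [Set.mem_ofPred_eq] at hp hq ⊢
  rw [Finsupp.add_apply]; omega

theorem levelNeg_le : D.levelNeg ≤ comp {d | d none ≤ -1} := by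
  refine cl_le (D.levelNegOne_le_comp.trans (comp_mono fun d h => by simp at h ⊢; omega)) fun x hx z hz => ?_
  refine lie_mem_comp ?_ (D.levelNegOne_le_comp hx) hz
  intro p hp q hq
  simp only [Set.mem_ofPred_eq] at hp hq ⊢
  rw [Finsupp.add_apply]; omega

/-- The component of degree `0` is the span of the generators `h a`. -/
theorem comp_zero_le : comp {0} ≤ D.cartanPart := by
  intro x hx
  have hx' : x ∈ D.levelNeg ⊔ D.levelZero ⊔ D.levelPos := D.sup_levels ▸ Submodule.mem_top
  obtain ⟨y, hy, z, hz, rfl⟩ := Submodule.mem_sup.1 hx'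
  obtain ⟨w, hw, y, hy', rfl⟩ := Submodule.mem_sup.1 hy
  obtain ⟨y, hy₀, r, hr, rfl⟩ := Submodule.mem_sup.1 hy'
  obtain ⟨l, hl, t, ht, rfl⟩ := Submodule.mem_sup.1 hy₀
  rw [← proj_eq_self subset_rfl hx]
  have hzz : D.levelPos ≤ comp {d | 1 ≤ d none} := D.levelPos_le.trans
    (sup_le (D.levelOne_le_comp.trans (comp_mono fun d h => by simp at h ⊢; omega))
      (comp_mono fun d h => by simp at h ⊢; omega))
  have e1 : proj {0} w = 0 := proj_eq_zero (by rintro d hd rfl; simp at hd) (D.levelNeg_le hw)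
  have e2 : proj {0} l = 0 := proj_eq_zero (by rintro d hd rfl; simp at hd) (D.loweringPart_le_comp hl)
  have e3 : proj {0} r = 0 := proj_eq_zero (by rintro d hd rfl; simp at hd) (D.raisingPart_le_comp hr)
  have e4 : proj {0} z = 0 := proj_eq_zero (by rintro d hd rfl; simp at hd) (hzz hz)
  simp only [map_add, e1, e2, e3, e4, zero_add, add_zero]
  rwa [proj_eq_self subset_rfl (D.cartanPart_le_comp ht)]

/-- The component of level `1` is generated by `ε`. -/
theorem comp_one_le : comp {d | d none = 1} ≤ D.levelOne := by
  intro x hx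
  have hx' : x ∈ D.levelNeg ⊔ D.levelZero ⊔ D.levelPos := D.sup_levels ▸ Submodule.mem_top
  obtain ⟨y, hy, z, hz, rfl⟩ := Submodule.mem_sup.1 hx'
  obtain ⟨w, hw, y, hy', rfl⟩ := Submodule.mem_sup.1 hy
  obtain ⟨z, hz', r, hr, rfl⟩ := Submodule.mem_sup.1 (D.levelPos_le hz)
  rw [← proj_eq_self subset_rfl hx]
  have e1 : proj {d | d none = 1} w = 0 := proj_eq_zero (by intro d hd; simp at hd ⊢; omega) (D.levelNeg_le hw)
  have e2 : proj {d | d none = 1} y = 0 := proj_eq_zero (by intro d hd; simp at hd ⊢; omega) (D.levelZero_le_comp hy')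
  have e3 : proj {d | d none = 1} r = 0 := proj_eq_zero (by intro d hd; simp at hd ⊢; omega) hr
  simp only [map_add, e1, e2, e3, zero_add, add_zero]
  rwa [proj_eq_self subset_rfl (D.levelOne_le_comp hz')]

end SimpleData

end

section

/-! ### The local part of `S` -/

open LieSuper MonSuper

/-- The image of local data under a linear map that respects the brackets of elements of `R`. -/
def LocalData.map {𝔤 : Type*} [LieRing 𝔤] [LieAlgebra ℂ 𝔤] {B : 𝔤 →ₗ[ℂ] 𝔤 →ₗ[ℂ] ℂ} {L M : Type*}
    [AddCommGroup L] [Module ℂ L] [Bracket L L] [LieSuper L]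
    [AddCommGroup M] [Module ℂ M] [Bracket M M] [LieSuper M] (P : LocalData B L) (g : L →ₗ[ℂ] M)
    (h : ∀ a ∈ P.lower ∪ P.middle ∪ P.raise, ∀ b ∈ P.lower ∪ P.middle ∪ P.raise, g ⁅a, b⁆ = ⁅g a, g b⁆)
    (hev : ∀ a ∈ P.lower ∪ P.middle ∪ P.raise, a ∈ even (L := L) → g a ∈ even (L := M))
    (hod : ∀ a ∈ P.lower ∪ P.middle ∪ P.raise, a ∈ odd (L := L) → g a ∈ odd (L := M)) :
    LocalData B M := by
  have m1 (u) : P.tm1 u ∈ P.lower ∪ P.middle ∪ P.raise := .inl (.inl (.inl ⟨u, rfl⟩))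
  have m2 (u) : P.ph u ∈ P.lower ∪ P.middle ∪ P.raise := .inl (.inl (.inr ⟨u, rfl⟩))
  have m3 (u) : P.t0 u ∈ P.lower ∪ P.middle ∪ P.raise := .inl (.inr (.inl ⟨u, rfl⟩))
  have m4 : P.K ∈ P.lower ∪ P.middle ∪ P.raise := .inl (.inr (.inr (.inl rfl)))
  have m5 : P.v ∈ P.lower ∪ P.middle ∪ P.raise := .inl (.inr (.inr (.inr rfl)))
  have m6 (u) : P.t1 u ∈ P.lower ∪ P.middle ∪ P.raise := .inr (.inl ⟨u, rfl⟩)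
  have m7 : P.Lo ∈ P.lower ∪ P.middle ∪ P.raise := .inr (.inr (.inl rfl))
  have m8 : P.eps ∈ P.lower ∪ P.middle ∪ P.raise := .inr (.inr (.inr rfl))
  exact
  { t0 := g ∘ₗ P.t0, t1 := g ∘ₗ P.t1, tm1 := g ∘ₗ P.tm1, ph := g ∘ₗ P.ph
    K := g P.K, Lo := g P.Lo, v := g P.v, eps := g P.eps
    t0_even := fun u => hev _ (m3 u) (P.t0_even u)
    t1_even := fun u => hev _ (m6 u) (P.t1_even u)
    tm1_even := fun u => hev _ (m1 u) (P.tm1_even u)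
    K_even := hev _ m4 P.K_even
    Lo_even := hev _ m7 P.Lo_even
    ph_odd := fun u => hod _ (m2 u) (P.ph_odd u)
    v_odd := hod _ m5 P.v_odd
    eps_odd := hod _ m8 P.eps_odd
    t0_t0 := fun u w => (h _ (m3 u) _ (m3 w)).symm.trans (by rw [P.t0_t0]; rfl)
    t0_t1 := fun u w => (h _ (m3 u) _ (m6 w)).symm.trans (by rw [P.t0_t1]; rfl)
    t0_tm1 := fun u w => (h _ (m3 u) _ (m1 w)).symm.trans (by rw [P.t0_tm1]; rfl)
    t0_ph := fun u w => (h _ (m3 u) _ (m2 w)).symm.trans (by rw [P.t0_ph]; rfl)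
    t0_v := fun u => (h _ (m3 u) _ m5).symm.trans (by rw [P.t0_v, map_zero])
    t0_Lo := fun u => (h _ (m3 u) _ m7).symm.trans (by rw [P.t0_Lo, map_zero])
    t0_eps := fun u => (h _ (m3 u) _ m8).symm.trans (by rw [P.t0_eps, map_zero])
    K_t0 := fun u => (h _ m4 _ (m3 u)).symm.trans (by rw [P.K_t0, map_zero])
    K_t1 := fun u => (h _ m4 _ (m6 u)).symm.trans (by rw [P.K_t1, map_zero])
    K_tm1 := fun u => (h _ m4 _ (m1 u)).symm.trans (by rw [P.K_tm1, map_zero])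
    K_Lo := (h _ m4 _ m7).symm.trans (by rw [P.K_Lo, map_zero])
    K_ph := fun u => (h _ m4 _ (m2 u)).symm.trans (by rw [P.K_ph]; rfl)
    K_v := (h _ m4 _ m5).symm.trans (by rw [P.K_v])
    K_eps := (h _ m4 _ m8).symm.trans (by rw [P.K_eps, map_neg])
    v_v := (h _ m5 _ m5).symm.trans (by rw [P.v_v, map_zero])
    v_tm1 := fun u => (h _ m5 _ (m1 u)).symm.trans (by rw [P.v_tm1, map_neg]; rfl)
    v_ph := fun u => (h _ m5 _ (m2 u)).symm.trans (by rw [P.v_ph, map_zero])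
    v_t1 := fun u => (h _ m5 _ (m6 u)).symm.trans (by rw [P.v_t1, map_zero])
    v_Lo := (h _ m5 _ m7).symm.trans (by rw [P.v_Lo, map_zero])
    v_eps := (h _ m5 _ m8).symm.trans (by rw [P.v_eps, map_neg])
    t1_tm1 := fun u w => (h _ (m6 u) _ (m1 w)).symm.trans (by rw [P.t1_tm1, map_add, map_smul]; rfl)
    t1_ph := fun u w => (h _ (m6 u) _ (m2 w)).symm.trans (by rw [P.t1_ph, map_smul])
    Lo_tm1 := fun u => (h _ m7 _ (m1 u)).symm.trans (by rw [P.Lo_tm1]; rfl)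
    Lo_ph := fun u => (h _ m7 _ (m2 u)).symm.trans (by rw [P.Lo_ph, map_zero])
    eps_tm1 := fun u => (h _ m8 _ (m1 u)).symm.trans (by rw [P.eps_tm1, map_zero])
    eps_ph := fun u => (h _ m8 _ (m2 u)).symm.trans (by rw [P.eps_ph]; rfl) }

/-- The degrees of level `l` in which the total degree of the nodes `-1` and `0` is `p`. -/
def bi {ι : Type*} (l p : ℤ) : Set (Degree ι) := {d | d none = l ∧ d none + d (some none) = p}

theorem lie_mem_bi {ι L : Type*} [AddCommGroup L] [Module ℂ L] [Bracket L L] [MonSuper ι L]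
    {l p l' p' : ℤ} {x y : L} (hx : x ∈ comp (bi l p)) (hy : y ∈ comp (bi l' p')) :
    ⁅x, y⁆ ∈ comp (bi (l + l') (p + p')) := by
  refine lie_mem_comp ?_ hx hy
  rintro d ⟨h1, h2⟩ d' ⟨h3, h4⟩
  refine ⟨by rw [Finsupp.add_apply, h1, h3], ?_⟩
  rw [Finsupp.add_apply, Finsupp.add_apply]; omega

namespace SimpleData

variable {ι 𝔤 : Type*} [Fintype ι] [LieRing 𝔤] [LieAlgebra ℂ 𝔤] (D : SimpleData ι 𝔤)

include D in
theorem eq_zero_of_central {u : 𝔤} (h : ∀ w : 𝔤, ⁅u, w⁆ = 0) : u = 0 := by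
  rcases D.simple (ℂ ∙ u) (fun w z hz => by
    obtain ⟨a, rfl⟩ := Submodule.mem_span_singleton.1 hz
    rw [_root_.lie_smul, ← lie_skew, h]; simp) with h1 | h1
  · exact Submodule.span_singleton_eq_bot.1 h1
  · obtain ⟨a, ha⟩ := Submodule.mem_span_singleton.1 (h1 ▸ Submodule.mem_top : D.Θ ∈ ℂ ∙ u)
    have h2 := D.Θ_X
    rw [← ha, _root_.smul_lie, h, smul_zero, eq_comm, smul_eq_zero] at h2
    exact absurd (h2.resolve_left two_ne_zero) D.X_ne_zero

theorem eq_zero_of_mem_ker {x : STilde D.A} (hx : D.π x = 0) (h0 : x ∈ comp {0}) : x = 0 := by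
  obtain ⟨a, rfl⟩ := (Submodule.mem_span_range_iff_exists_fun ℂ).1 (D.comp_zero_le h0)
  rw [map_sum, Fintype.sum_option] at hx
  simp only [map_smul, π_th_none, π_th_some] at hx
  have h1 : D.model.t0 (∑ i, a (some i) • D.h i - a none • D.Θ) + a none • D.model.K = 0 := by
    rw [← hx, map_sub, map_sum, map_smul]
    simp only [map_smul, smul_sub]
    abel
  have h2 := fun w => Model.t0_add_K D.B_inv' h1 w
  have h3 : a none = 0 := (smul_eq_zero.1 (h2 D.X).2).resolve_right D.X_ne_zero
  have h4 := D.eq_zero_of_central fun w => (h2 w).1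
  rw [h3, zero_smul, sub_zero] at h4
  have h5 := Fintype.linearIndependent_iff.1 D.h_indep _ h4
  rw [Fintype.sum_option, h3]
  simp [h5]

theorem ker_π_le : LinearMap.ker D.π ≤ LinearMap.ker (toS D.A) := by
  intro x hx
  rw [LinearMap.mem_ker, toS_eq_zero]
  exact le_maximalIdeal D.A D.isHomogeneous_ker (fun x y hy => by
    rw [LinearMap.mem_ker, π_lie, LinearMap.mem_ker.1 hy, br_zero])
    (fun x hx h0 => D.eq_zero_of_mem_ker hx h0) hx

theorem exists_fromModel : ∃ g : Dbl (Module.End ℂ (Model.W D.B)) →ₗ[ℂ] S D.A,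
    ∀ x, g (D.π x) = toS D.A x := by
  obtain ⟨g, hg⟩ := LinearMap.exists_extend
    (((LinearMap.ker D.π).liftQ (toS D.A) D.ker_π_le).comp D.π.quotKerEquivRange.symm.toLinearMap)
  refine ⟨g, fun x => ?_⟩
  have h1 := LinearMap.congr_fun hg ⟨D.π x, x, rfl⟩
  have h2 : D.π.quotKerEquivRange.symm ⟨D.π x, x, rfl⟩ = (LinearMap.ker D.π).mkQ x := by
    rw [LinearEquiv.symm_apply_eq]; rfl
  change g (D.π x) = (LinearMap.ker D.π).liftQ (toS D.A) D.ker_π_le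
    (D.π.quotKerEquivRange.symm ⟨D.π x, x, rfl⟩) at h1
  rw [h1, h2, Submodule.mkQ_apply, Submodule.liftQ_apply]

/-- A linear map on the model that takes the image of an element of `S̃` to its image in `S`. -/
def fromModel : Dbl (Module.End ℂ (Model.W D.B)) →ₗ[ℂ] S D.A := D.exists_fromModel.choose

theorem fromModel_π (x : STilde D.A) : D.fromModel (D.π x) = toS D.A x := D.exists_fromModel.choose_spec x

/-- The image in the model of a component of `S̃`. -/
def imageComp (l p : ℤ) : Submodule ℂ (Dbl (Module.End ℂ (Model.W D.B))) := (comp (bi l p)).map D.π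

variable {D} in
theorem lie_mem_imageComp {l p l' p' : ℤ} {a b : Dbl (Module.End ℂ (Model.W D.B))}
    (ha : a ∈ D.imageComp l p) (hb : b ∈ D.imageComp l' p') : ⁅a, b⁆ ∈ D.imageComp (l + l') (p + p') := by
  obtain ⟨x, hx, rfl⟩ := ha
  obtain ⟨y, hy, rfl⟩ := hb
  exact ⟨⁅x, y⁆, lie_mem_bi hx hy, D.π_lie x y⟩

theorem π_tg_mem {l p : ℤ} (g : Gen ι) (h : g.deg none = l ∧ g.deg none + g.deg (some none) = p) :
    D.π (tg D.A g) ∈ D.imageComp l p :=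
  ⟨_, comp_mono (by rintro _ rfl; exact h) (tg_mem_comp D.A g), rfl⟩

theorem model_t0_mem (u : 𝔤) : D.model.t0 u ∈ D.imageComp 0 0 := by
  have hx (i) : D.model.t0 (D.x i) ∈ D.imageComp 0 0 := by
    rw [← π_te_some]; exact D.π_tg_mem _ (by simp [Gen.deg])
  have hy (i) : D.model.t0 (D.y i) ∈ D.imageComp 0 0 := by
    rw [← π_tf_some]; exact D.π_tg_mem _ (by simp [Gen.deg])
  have := D.gen ((D.imageComp 0 0).comap D.model.t0) hx hy
    (fun i z hz => by
      change D.model.t0 _ ∈ D.imageComp 0 0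
      rw [← D.model.t0_t0]; simpa using lie_mem_imageComp (hx i) hz)
    (fun i z hz => by
      change D.model.t0 _ ∈ D.imageComp 0 0
      rw [← D.model.t0_t0]; simpa using lie_mem_imageComp (hy i) hz)
  exact (this ▸ Submodule.mem_top : u ∈ (D.imageComp 0 0).comap D.model.t0)

theorem mem_of_equivariant {l p : ℤ} {f : 𝔤 →ₗ[ℂ] Dbl (Module.End ℂ (Model.W D.B))}
    (hf : ∀ u w, ⁅D.model.t0 u, f w⁆ = f ⁅u, w⁆) {w : 𝔤} (hw : w ≠ 0) (hfw : f w ∈ D.imageComp l p) (u : 𝔤) :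
    f u ∈ D.imageComp l p := by
  rcases D.simple ((D.imageComp l p).comap f) (fun u z hz => by
    change f _ ∈ D.imageComp l p
    rw [← hf]; simpa using lie_mem_imageComp (D.model_t0_mem u) hz) with h | h
  · exact absurd (h ▸ hfw : w ∈ (⊥ : Submodule ℂ 𝔤)) (by simpa using hw)
  · exact (h ▸ Submodule.mem_top : u ∈ (D.imageComp l p).comap f)

theorem Y_ne_zero : D.Y ≠ 0 := fun h => by simpa [h] using D.B_X_Y

theorem model_t1_mem (u : 𝔤) : D.model.t1 u ∈ D.imageComp 0 1 :=
  D.mem_of_equivariant D.model.t0_t1 D.Y_ne_zero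
    (by rw [← π_te_none]; exact D.π_tg_mem _ (by simp [Gen.deg])) u

theorem model_tm1_mem (u : 𝔤) : D.model.tm1 u ∈ D.imageComp 0 (-1) :=
  D.mem_of_equivariant D.model.t0_tm1 D.X_ne_zero
    (by rw [← π_tf_none]; exact D.π_tg_mem _ (by simp [Gen.deg])) u

theorem model_ph_mem (u : 𝔤) : D.model.ph u ∈ D.imageComp (-1) (-1) := by
  obtain ⟨i, -⟩ := D.exists_adjacent
  exact D.mem_of_equivariant D.model.t0_ph (D.h_indep.ne_zero i)
    (by rw [← π_tphi]; exact D.π_tg_mem _ (by simp [Gen.deg])) u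

theorem model_K_mem : D.model.K ∈ D.imageComp 0 0 := by
  have : D.model.K = D.π (D.th none) + D.model.t0 D.Θ := by rw [π_th_none]; abel
  rw [this]
  exact add_mem (D.π_tg_mem _ (by simp [Gen.deg])) (D.model_t0_mem _)

theorem model_v_mem : D.model.v ∈ D.imageComp (-1) 0 := by
  have : D.model.v = ⁅D.model.t1 D.Y, D.model.ph D.X⁆ := by
    rw [D.model.t1_ph, D.B_symm, D.B_X_Y, one_smul]
  rw [this]
  have h := lie_mem_imageComp (D.model_t1_mem D.Y) (D.model_ph_mem D.X)
  rwa [zero_add, add_neg_cancel] at h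

theorem model_eps_mem : D.model.eps ∈ D.imageComp 1 1 := by
  rw [← π_teps]; exact D.π_tg_mem _ (by simp [Gen.deg])

theorem model_Lo_mem : D.model.Lo ∈ D.imageComp 0 1 := by
  have : D.model.Lo = -⁅D.model.v, D.model.eps⁆ := by rw [D.model.v_eps, neg_neg]
  rw [this]
  have h := lie_mem_imageComp D.model_v_mem D.model_eps_mem
  rw [zero_add, neg_add_cancel] at h
  exact neg_mem h

variable {D} in
theorem fromModel_mem {l p : ℤ} {a : Dbl (Module.End ℂ (Model.W D.B))} (ha : a ∈ D.imageComp l p) :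
    D.fromModel a ∈ comp (L := S D.A) (bi l p) := by
  obtain ⟨x, hx, rfl⟩ := ha
  rw [fromModel_π]; exact toS_mem_comp D.A hx

theorem ops_mem : ∀ a ∈ D.model.lower ∪ D.model.middle ∪ D.model.raise,
    a ∈ even (L := Dbl (Module.End ℂ (Model.W D.B))) ∧ (∃ p, a ∈ D.imageComp 0 p) ∨
      a ∈ odd (L := Dbl (Module.End ℂ (Model.W D.B))) ∧ ∃ l p, Odd l ∧ a ∈ D.imageComp l p := by
  rintro a (((⟨u, rfl⟩ | ⟨u, rfl⟩) | ⟨u, rfl⟩ | rfl | rfl) | ⟨u, rfl⟩ | rfl | rfl)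
  exacts [.inl ⟨D.model.tm1_even u, _, D.model_tm1_mem u⟩,
    .inr ⟨D.model.ph_odd u, _, _, by decide, D.model_ph_mem u⟩,
    .inl ⟨D.model.t0_even u, _, D.model_t0_mem u⟩, .inl ⟨D.model.K_even, _, D.model_K_mem⟩,
    .inr ⟨D.model.v_odd, _, _, by decide, D.model_v_mem⟩, .inl ⟨D.model.t1_even u, _, D.model_t1_mem u⟩,
    .inl ⟨D.model.Lo_even, _, D.model_Lo_mem⟩, .inr ⟨D.model.eps_odd, _, _, by decide, D.model_eps_mem⟩]

theorem mem_range_of_op {a : Dbl (Module.End ℂ (Model.W D.B))}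
    (ha : a ∈ D.model.lower ∪ D.model.middle ∪ D.model.raise) : ∃ x, D.π x = a := by
  rcases D.ops_mem a ha with ⟨-, p, x, -, hx⟩ | ⟨-, l, p, -, x, -, hx⟩ <;> exact ⟨x, hx⟩

theorem eq_zero_of_even_odd {a : Dbl (Module.End ℂ (Model.W D.B))}
    (h1 : a ∈ even (L := Dbl (Module.End ℂ (Model.W D.B))))
    (h2 : a ∈ odd (L := Dbl (Module.End ℂ (Model.W D.B)))) : a = 0 :=
  Dbl.ext' (Dbl.mem_range_od.1 h2) (Dbl.mem_range_ev.1 h1)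

/-- The local part of `S`. -/
def loc : LocalData D.B (S D.A) := by
  refine D.model.map D.fromModel (fun a ha b hb => ?_) (fun a ha hae => ?_) (fun a ha hao => ?_)
  · obtain ⟨x, rfl⟩ := D.mem_range_of_op ha
    obtain ⟨y, rfl⟩ := D.mem_range_of_op hb
    rw [← π_lie, fromModel_π, fromModel_π, fromModel_π, toS_lie]
  · rcases D.ops_mem a ha with ⟨-, p, h⟩ | ⟨h, -⟩
    · exact comp_mono (by rintro d ⟨hd, -⟩; simp [hd]) (fromModel_mem h)
    · rw [D.eq_zero_of_even_odd hae h, map_zero]; exact zero_mem _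
  · rcases D.ops_mem a ha with ⟨h, -⟩ | ⟨h, l, p, hl, h'⟩
    · rw [D.eq_zero_of_even_odd h hao, map_zero]; exact zero_mem _
    · exact comp_mono (by rintro d ⟨hd, -⟩; simpa [hd] using hl) (fromModel_mem h')

theorem loc_t0_mem (u : 𝔤) : D.loc.t0 u ∈ comp (bi 0 0) := fromModel_mem (D.model_t0_mem u)
theorem loc_t1_mem (u : 𝔤) : D.loc.t1 u ∈ comp (bi 0 1) := fromModel_mem (D.model_t1_mem u)
theorem loc_tm1_mem (u : 𝔤) : D.loc.tm1 u ∈ comp (bi 0 (-1)) := fromModel_mem (D.model_tm1_mem u)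
theorem loc_ph_mem (u : 𝔤) : D.loc.ph u ∈ comp (bi (-1) (-1)) := fromModel_mem (D.model_ph_mem u)
theorem loc_K_mem : D.loc.K ∈ comp (bi 0 0) := fromModel_mem D.model_K_mem
theorem loc_v_mem : D.loc.v ∈ comp (bi (-1) 0) := fromModel_mem D.model_v_mem
theorem loc_Lo_mem : D.loc.Lo ∈ comp (bi 0 1) := fromModel_mem D.model_Lo_mem
theorem loc_eps_mem : D.loc.eps ∈ comp (bi 1 1) := fromModel_mem D.model_eps_mem

theorem ofGen_eq (g : Gen ι) : ofGen D.A g = D.loc.gen g := by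
  have : ofGen D.A g = D.fromModel (D.model.gen g) := by rw [← π_gen, fromModel_π]; rfl
  rw [this]
  rcases g with (_ | _ | i) | (_ | i) | (_ | i) | i
  all_goals first | rfl | exact map_sub _ _ _

theorem toS_Lt : toS D.A D.Lt = -D.loc.Lo := by
  rw [← fromModel_π, π_Lt, map_neg]; rfl

/-- A subspace of `S` without component of degree `0` that is stable under the local part
vanishes. -/
theorem eq_zero_of_stable {I : Submodule ℂ (S D.A)} (h0 : ∀ x ∈ I, proj {0} x = 0)
    (h : ∀ a ∈ D.loc.lower ∪ D.loc.middle ∪ D.loc.raise, ∀ y ∈ I, ⁅a, y⁆ ∈ I) {x : S D.A} (hx : x ∈ I) :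
    x = 0 := by
  have h' : I = ⊥ := by
    refine eq_bot_of_proj_zero D.A (fun g y hy => ?_) h0
    rw [ofGen_eq]
    rcases g with (_ | _ | i) | (_ | i) | (_ | i) | i
    · exact h _ (.inr (.inr (.inr rfl))) y hy
    · exact h _ (.inr (.inl ⟨_, rfl⟩)) y hy
    · exact h _ (.inl (.inr (.inl ⟨_, rfl⟩))) y hy
    · exact h _ (.inl (.inl (.inl ⟨_, rfl⟩))) y hy
    · exact h _ (.inl (.inr (.inl ⟨_, rfl⟩))) y hy
    · change ⁅D.loc.K - D.loc.t0 D.Θ, y⁆ ∈ I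
      rw [sub_br]
      exact sub_mem (h _ (.inl (.inr (.inr (.inl rfl)))) y hy) (h _ (.inl (.inr (.inl ⟨_, rfl⟩))) y hy)
    · exact h _ (.inl (.inr (.inl ⟨_, rfl⟩))) y hy
    · exact h _ (.inl (.inl (.inr ⟨_, rfl⟩))) y hy
  rw [h'] at hx
  simpa using hx

/-- The part of `S` in which the total degree of the nodes `-1` and `0` lies in `Q`. -/
abbrev pcomp (Q : Set ℤ) : Submodule ℂ (S D.A) := comp {d | d none + d (some none) ∈ Q}

variable {D} in
theorem lie_mem_pcomp {l p : ℤ} {Q R : Set ℤ} {a x : S D.A} (ha : a ∈ comp (bi l p)) (hx : x ∈ D.pcomp Q)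
    (h : ∀ q ∈ Q, p + q ∈ R) : ⁅a, x⁆ ∈ D.pcomp R := by
  refine lie_mem_comp ?_ ha hx
  rintro d ⟨-, h1⟩ d' h2
  have h3 := h _ h2
  simp only [Set.mem_ofPred_eq, Finsupp.add_apply]
  convert h3 using 1
  omega

theorem mem_pcomp {l p : ℤ} {Q : Set ℤ} {a : S D.A} (ha : a ∈ comp (bi l p)) (h : p ∈ Q) : a ∈ D.pcomp Q :=
  comp_mono (by rintro d ⟨-, h1⟩; simpa [h1] using h) ha

/-- The local part of `S` is transitive. -/
theorem loc_isTransitive : D.loc.IsTransitive (D.pcomp (Set.Iic (-2))) (D.pcomp (Set.Ici 2)) where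
  tm1_tm1 u w := D.mem_pcomp (lie_mem_bi (D.loc_tm1_mem u) (D.loc_tm1_mem w)) (by simp)
  tm1_ph u w := D.mem_pcomp (lie_mem_bi (D.loc_tm1_mem u) (D.loc_ph_mem w)) (by simp)
  ph_ph u w := D.mem_pcomp (lie_mem_bi (D.loc_ph_mem u) (D.loc_ph_mem w)) (by simp)
  tm1_mem u z hz := lie_mem_pcomp (D.loc_tm1_mem u) hz (fun q hq => by simp at hq ⊢; omega)
  ph_mem u z hz := lie_mem_pcomp (D.loc_ph_mem u) hz (fun q hq => by simp at hq ⊢; omega)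
  neg z hz h1 h2 h3 := by
    obtain ⟨I, hIN, hxI, hI⟩ := D.loc.exists_stable_neg (N := D.pcomp (Set.Iic (-2))) (by
      rintro g (⟨u, rfl⟩ | ⟨u, rfl⟩) x hx
      · exact lie_mem_pcomp (D.loc_tm1_mem u) hx (fun q hq => by simp at hq ⊢; omega)
      · exact lie_mem_pcomp (D.loc_ph_mem u) hx (fun q hq => by simp at hq ⊢; omega)) (by
      rintro g (⟨u, rfl⟩ | rfl | rfl) x hx
      · exact lie_mem_pcomp (D.loc_t0_mem u) hx (fun q hq => by simpa using hq)
      · exact lie_mem_pcomp D.loc_K_mem hx (fun q hq => by simpa using hq)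
      · exact lie_mem_pcomp D.loc_v_mem hx (fun q hq => by simpa using hq)) hz h1 h2 h3
    exact D.eq_zero_of_stable (fun x hx => proj_eq_zero (by rintro d hd rfl; simp at hd) (hIN hx)) hI hxI
  t1_t1 u w := D.mem_pcomp (lie_mem_bi (D.loc_t1_mem u) (D.loc_t1_mem w)) (by simp)
  t1_Lo u := D.mem_pcomp (lie_mem_bi (D.loc_t1_mem u) D.loc_Lo_mem) (by simp)
  t1_eps u := D.mem_pcomp (lie_mem_bi (D.loc_t1_mem u) D.loc_eps_mem) (by simp)
  Lo_eps := D.mem_pcomp (lie_mem_bi D.loc_Lo_mem D.loc_eps_mem) (by simp)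
  eps_eps := D.mem_pcomp (lie_mem_bi D.loc_eps_mem D.loc_eps_mem) (by simp)
  t1_mem u z hz := lie_mem_pcomp (D.loc_t1_mem u) hz (fun q hq => by simp at hq ⊢; omega)
  Lo_mem z hz := lie_mem_pcomp D.loc_Lo_mem hz (fun q hq => by simp at hq ⊢; omega)
  pos z hz h1 h2 := by
    obtain ⟨I, hIN, hxI, hI⟩ := D.loc.exists_stable_pos (N := D.pcomp (Set.Ici 2)) (by
      rintro g (⟨u, rfl⟩ | rfl | rfl) x hx
      · exact lie_mem_pcomp (D.loc_t1_mem u) hx (fun q hq => by simp at hq ⊢; omega)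
      · exact lie_mem_pcomp D.loc_Lo_mem hx (fun q hq => by simp at hq ⊢; omega)
      · exact lie_mem_pcomp D.loc_eps_mem hx (fun q hq => by simp at hq ⊢; omega)) (by
      rintro g (⟨u, rfl⟩ | rfl | rfl) x hx
      · exact lie_mem_pcomp (D.loc_t0_mem u) hx (fun q hq => by simpa using hq)
      · exact lie_mem_pcomp D.loc_K_mem hx (fun q hq => by simpa using hq)
      · exact lie_mem_pcomp D.loc_v_mem hx (fun q hq => by simpa using hq)) hz h1 h2
    exact D.eq_zero_of_stable (fun x hx => proj_eq_zero (by rintro d hd rfl; simp at hd) (hIN hx)) hI hxI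

/-- The component of level `1` of `S` is generated by `ε` under the brackets of level `0`. -/
theorem levelComponent_one_le {N : Submodule ℂ (S D.A)} (h0 : D.loc.eps ∈ N) (h1 : ∀ u, D.loc.t0 u ∈ stab N)
    (h2 : D.loc.t1 D.Y ∈ stab N) (h3 : D.loc.tm1 D.X ∈ stab N) (h4 : D.loc.Lo ∈ stab N) :
    levelComponent D.A 1 ≤ N := by
  have h5 : D.levelOne ≤ N.comap (toS D.A) := by
    refine cl_le ?_ ?_
    · rintro _ rfl
      change ofGen D.A (.e none) ∈ N
      rw [ofGen_eq]; exact h0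
    · have hg : ∀ g, (∀ z ∈ N, ⁅D.loc.gen g, z⁆ ∈ N) → ∀ z ∈ N.comap (toS D.A), ⁅tg D.A g, z⁆ ∈ N.comap (toS D.A) := by
        intro g h z hz
        change toS D.A ⁅tg D.A g, z⁆ ∈ N
        rw [toS_lie]
        change ⁅ofGen D.A g, _⁆ ∈ N
        rw [ofGen_eq]; exact h _ hz
      rintro x ((rfl | ⟨_ | i, rfl⟩) | ⟨_ | i, rfl⟩) z hz
      · change toS D.A ⁅D.Lt, z⁆ ∈ N
        rw [toS_lie, toS_Lt, neg_br]
        exact neg_mem (h4 _ hz)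
      · exact hg (.e (some none)) h2 z hz
      · exact hg (.e (some (some i))) (h1 _) z hz
      · exact hg (.f none) h3 z hz
      · exact hg (.f (some i)) (h1 _) z hz
  rw [levelComponent_eq]
  refine Submodule.span_le.2 ?_
  rintro _ ⟨m, hm, rfl⟩
  exact h5 (D.comp_one_le (mon_mem_comp hm))

end SimpleData

end

section

/-! ### The loop algebra generated by the local part -/

open LieSuper TensorProduct

variable {ι 𝔤 : Type*} [Fintype ι] [LieRing 𝔤] [LieAlgebra ℂ 𝔤]

namespace SimpleData

variable (D : SimpleData ι 𝔤)

include D in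
theorem span_lie_eq_top : Submodule.span ℂ {z : 𝔤 | ∃ u w : 𝔤, ⁅u, w⁆ = z} = ⊤ := by
  rcases D.simple (Submodule.span ℂ {z : 𝔤 | ∃ u w : 𝔤, ⁅u, w⁆ = z})
    (fun u z _ => Submodule.subset_span ⟨u, z, rfl⟩) with h | h
  · have h1 : ⁅D.Θ, D.X⁆ ∈ Submodule.span ℂ {z : 𝔤 | ∃ u w : 𝔤, ⁅u, w⁆ = z} :=
      Submodule.subset_span ⟨_, _, rfl⟩
    rw [h, D.Θ_X, Submodule.mem_bot, smul_eq_zero] at h1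
    exact absurd (h1.resolve_left two_ne_zero) D.X_ne_zero
  · exact h

include D in
/-- Linear maps that agree on brackets are equal. -/
theorem ext_of_lie {M : Type*} [AddCommGroup M] [Module ℂ M] {f g : 𝔤 →ₗ[ℂ] M}
    (h : ∀ u w : 𝔤, f ⁅u, w⁆ = g ⁅u, w⁆) : f = g := by
  refine LinearMap.ext_on D.span_lie_eq_top ?_
  rintro _ ⟨u, w, rfl⟩
  exact h u w

/-- The bracket as a linear map on the tensor product. -/
def br : 𝔤 ⊗[ℂ] 𝔤 →ₗ[ℂ] 𝔤 := lift (LieAlgebra.ad ℂ 𝔤 : 𝔤 →ₗ[ℂ] 𝔤 →ₗ[ℂ] 𝔤)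

theorem br_tmul (u w : 𝔤) : br (u ⊗ₜ[ℂ] w) = ⁅u, w⁆ := rfl

include D in
theorem exists_section : ∃ σ : 𝔤 →ₗ[ℂ] 𝔤 ⊗[ℂ] 𝔤, br ∘ₗ σ = LinearMap.id := by
  refine LinearMap.exists_rightInverse_of_surjective _ ?_
  rw [eq_top_iff, ← D.span_lie_eq_top]
  refine Submodule.span_le.2 ?_
  rintro _ ⟨u, w, rfl⟩
  exact ⟨u ⊗ₜ w, rfl⟩

/-- A section of the bracket. -/
def sec : 𝔤 →ₗ[ℂ] 𝔤 ⊗[ℂ] 𝔤 := D.exists_section.choose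

theorem br_sec (u : 𝔤) : br (D.sec u) = u := LinearMap.congr_fun D.exists_section.choose_spec u

end SimpleData

variable {L : Type*} [AddCommGroup L] [Module ℂ L] [Bracket L L] [LieSuper L]

/-- The linear map on the tensor product with `u ⊗ w ↦ ⁅f u, g w⁆`. -/
def brMap (f g : 𝔤 →ₗ[ℂ] L) : 𝔤 ⊗[ℂ] 𝔤 →ₗ[ℂ] L := lift ((ad (L := L)).compl₁₂ f g)

theorem brMap_tmul (f g : 𝔤 →ₗ[ℂ] L) (u w : 𝔤) : brMap f g (u ⊗ₜ[ℂ] w) = ⁅f u, g w⁆ := rfl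

variable {D : SimpleData ι 𝔤}

/-- Loop modes of nonnegative degree generated by `f 1`. -/
def modes (D : SimpleData ι 𝔤) (f₀ f₁ : 𝔤 →ₗ[ℂ] L) : ℕ → 𝔤 →ₗ[ℂ] L
  | 0 => f₀
  | 1 => f₁
  | n + 2 => brMap f₁ (modes D f₀ f₁ (n + 1)) ∘ₗ D.sec

theorem brMap_induction {f g : 𝔤 →ₗ[ℂ] L} {p : L → 𝔤 → Prop} (h0 : p 0 0)
    (hadd : ∀ a b u w, p a u → p b w → p (a + b) (u + w)) (h : ∀ u w, p ⁅f u, g w⁆ ⁅u, w⁆) (r : 𝔤 ⊗[ℂ] 𝔤) :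
    p (brMap f g r) (SimpleData.br r) := by
  induction r using TensorProduct.induction_on with
  | zero => simpa using h0
  | tmul u w => exact h u w
  | add a b ha hb => rw [map_add, map_add]; exact hadd _ _ _ _ ha hb

namespace LocalData.IsTransitive

variable {P : LocalData D.B L} {Neg Pos : Submodule ℂ L} (hP : P.IsTransitive Neg Pos)

variable (P) in
/-- The properties of two successive modes of nonnegative degrees `n` and `n + 1`. -/
structure UpInv (Pos : Submodule ℂ L) (n : ℕ) (s f : 𝔤 →ₗ[ℂ] L) : Prop where
  even : ∀ w, f w ∈ LieSuper.even (L := L)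
  t0 : ∀ u w, ⁅P.t0 u, f w⁆ = f ⁅u, w⁆
  K : ∀ w, ⁅P.K, f w⁆ = 0
  v : ∀ w, ⁅P.v, f w⁆ = 0
  t1 : ∀ u w, ⁅P.t1 u, s w⁆ = f ⁅u, w⁆
  tm1 : ∃ κ : ℂ, (κ = if n = 0 then -1 else 0) ∧ ∀ z w, ⁅P.tm1 z, f w⁆ = s ⁅z, w⁆ + (κ * D.B z w) • P.K
  ph : ∃ κ : ℂ, (κ = if n = 0 then -1 else 0) ∧ ∀ z w, ⁅P.ph z, f w⁆ = (κ * D.B z w) • P.v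
  Lo : ∀ w, ⁅P.Lo, s w⁆ = -(n : ℂ) • f w
  t1_mem : ∀ u w, ⁅P.t1 u, f w⁆ ∈ Pos
  Lo_mem : ∀ w, ⁅P.Lo, f w⁆ ∈ Pos

include hP

theorem upInv_zero : UpInv P Pos 0 P.t0 P.t1 where
  even := P.t1_even
  t0 := P.t0_t1
  K := P.K_t1
  v := P.v_t1
  t1 := P.t1_t0
  tm1 := ⟨-1, rfl, fun z w => by
    rw [P.tm1_t1, D.B_symm w z, ← map_neg, lie_skew]; module⟩
  ph := ⟨-1, rfl, fun z w => by rw [P.ph_t1, D.B_symm w z]; module⟩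
  Lo w := by rw [P.Lo_t0]; simp
  t1_mem := hP.t1_t1
  Lo_mem w := by rw [P.lie_t1]; exact neg_mem (hP.t1_Lo w)

theorem upInv_succ {n : ℕ} {s f : 𝔤 →ₗ[ℂ] L} (h : UpInv P Pos n s f) :
    UpInv P Pos (n + 1) f (brMap P.t1 f ∘ₗ D.sec) := by
  obtain ⟨κ, hκ, htm⟩ := h.tm1
  obtain ⟨κ', hκ', hph⟩ := h.ph
  have rmem (r) : brMap P.t1 f r ∈ Pos :=
    brMap_induction (p := fun a _ => a ∈ Pos) (zero_mem _) (fun _ _ _ _ => add_mem) h.t1_mem r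
  have rtm (z : 𝔤) (r) : ⁅P.tm1 z, brMap P.t1 f r⁆ = f ⁅z, SimpleData.br r⁆ :=
    brMap_induction (p := fun a u => ⁅P.tm1 z, a⁆ = f ⁅z, u⁆) (by simp)
      (fun a b u w h1 h2 => by rw [br_add, h1, h2, lie_add, map_add]) (fun u w => by
        rw [P.tm1_lie, P.tm1_t1, htm, sub_br, neg_br, smul_br, h.t0, h.K, br_add, br_smul, P.t1_K, h.t1,
          leibniz_lie u z w, map_add]
        simp) r
  have rph (z : 𝔤) (r) : ⁅P.ph z, brMap P.t1 f r⁆ = 0 :=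
    brMap_induction (p := fun a _ => ⁅P.ph z, a⁆ = 0) (by simp)
      (fun a b u w h1 h2 => by rw [br_add, h1, h2, add_zero]) (fun u w => by
        rw [P.ph_t1_lie, hph, br_smul, P.t1_v, h.v]; simp) r
  have key (u w) : ⁅P.t1 u, f w⁆ = brMap P.t1 f (D.sec ⁅u, w⁆) := by
    rw [← brMap_tmul, ← sub_eq_zero, ← map_sub]
    refine hP.pos _ (rmem _) (fun z => ?_) fun z => rph z _
    rw [rtm, map_sub, SimpleData.br_tmul, D.br_sec, sub_self, lie_zero, map_zero]
  have stm (z w : 𝔤) : ⁅P.tm1 z, brMap P.t1 f (D.sec w)⁆ = f ⁅z, w⁆ := by rw [rtm, D.br_sec]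
  refine ⟨fun w => ?_, fun u w => ?_, fun w => ?_, fun w => ?_, key,
    ⟨0, rfl, fun z w => by simp [stm]⟩, ⟨0, rfl, fun z w => by simp [rph]⟩,
    fun w => ?_, fun u w => hP.t1_mem _ _ (rmem _), fun w => hP.Lo_mem _ (rmem _)⟩
  · exact brMap_induction (p := fun a _ => a ∈ LieSuper.even (L := L)) (zero_mem _) (fun _ _ _ _ => add_mem)
      (fun u w => lie_even_even _ (P.t1_even u) _ (h.even w)) _
  · have : ∀ r, ⁅P.t0 u, brMap P.t1 f r⁆ = brMap P.t1 f (D.sec ⁅u, SimpleData.br r⁆) :=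
      brMap_induction (p := fun a w => ⁅P.t0 u, a⁆ = brMap P.t1 f (D.sec ⁅u, w⁆)) (by simp)
        (fun a b u' w h1 h2 => by rw [br_add, h1, h2, lie_add, map_add, map_add]) (fun u' w => by
          rw [P.t0_lie, P.t0_t1, h.t0, key, key, ← map_add, ← map_add, ← leibniz_lie])
    rw [LinearMap.comp_apply, this, D.br_sec]; rfl
  · exact brMap_induction (p := fun a _ => ⁅P.K, a⁆ = 0) (by simp)
      (fun a b u' w h1 h2 => by rw [br_add, h1, h2, add_zero]) (fun u' w => by
        rw [P.K_lie, P.K_t1, h.K]; simp) _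
  · exact brMap_induction (p := fun a _ => ⁅P.v, a⁆ = 0) (by simp)
      (fun a b u' w h1 h2 => by rw [br_add, h1, h2, add_zero]) (fun u' w => by
        rw [P.v_t1_lie, h.v]; simp) _
  · rw [← sub_eq_zero]
    refine hP.pos _ (sub_mem (h.Lo_mem w) (Submodule.smul_mem _ _ (rmem _))) (fun z => ?_) fun z => ?_
    · rw [LinearMap.comp_apply, br_sub, br_smul, stm, P.tm1_lie, P.tm1_Lo, neg_br, h.t0, htm, br_add, h.Lo, br_smul, P.Lo_K]
      push_cast; module
    · rw [LinearMap.comp_apply, br_sub, br_smul, rph, P.ph_Lo_lie, hph, br_smul, P.Lo_v]; simp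

theorem upInv (n : ℕ) : UpInv P Pos n (modes D P.t0 P.t1 n) (modes D P.t0 P.t1 (n + 1)) := by
  induction n with
  | zero => exact hP.upInv_zero
  | succ n ih => exact hP.upInv_succ ih

omit hP in
variable (P) in
/-- The properties of two successive modes of nonpositive degrees `-n` and `-(n + 1)`. -/
structure DownInv (Neg : Submodule ℂ L) (n : ℕ) (s f : 𝔤 →ₗ[ℂ] L) : Prop where
  even : ∀ w, f w ∈ LieSuper.even (L := L)
  t0 : ∀ u w, ⁅P.t0 u, f w⁆ = f ⁅u, w⁆
  K : ∀ w, ⁅P.K, f w⁆ = 0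
  tm1 : ∀ u w, ⁅P.tm1 u, s w⁆ = f ⁅u, w⁆
  t1 : ∃ κ : ℂ, (κ = if n = 0 then 1 else 0) ∧ ∀ z w, ⁅P.t1 z, f w⁆ = s ⁅z, w⁆ + (κ * D.B z w) • P.K
  Lo : ∀ w, ⁅P.Lo, f w⁆ = (n + 1 : ℂ) • s w
  eps : ∀ w, ⁅P.eps, f w⁆ = 0
  tm1_mem : ∀ u w, ⁅P.tm1 u, f w⁆ ∈ Neg

theorem downInv_zero : DownInv P Neg 0 P.t0 P.tm1 where
  even := P.tm1_even
  t0 := P.t0_tm1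
  K := P.K_tm1
  tm1 := P.tm1_t0
  t1 := ⟨1, rfl, fun z w => by rw [P.t1_tm1]; module⟩
  Lo w := by rw [P.Lo_tm1]; simp
  eps := P.eps_tm1
  tm1_mem := hP.tm1_tm1

theorem downInv_succ {n : ℕ} {s f : 𝔤 →ₗ[ℂ] L} (h : DownInv P Neg n s f) :
    DownInv P Neg (n + 1) f (brMap P.tm1 f ∘ₗ D.sec) := by
  obtain ⟨κ, hκ, ht⟩ := h.t1
  have rmem (r) : brMap P.tm1 f r ∈ Neg :=
    brMap_induction (p := fun a _ => a ∈ Neg) (zero_mem _) (fun _ _ _ _ => add_mem) h.tm1_mem r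
  have rt (z : 𝔤) (r) : ⁅P.t1 z, brMap P.tm1 f r⁆ = f ⁅z, SimpleData.br r⁆ :=
    brMap_induction (p := fun a u => ⁅P.t1 z, a⁆ = f ⁅z, u⁆) (by simp)
      (fun a b u w h1 h2 => by rw [br_add, h1, h2, lie_add, map_add]) (fun u w => by
        rw [P.t1_lie, P.t1_tm1, ht, add_br, smul_br, h.t0, h.K, br_add, br_smul, P.tm1_K, h.tm1,
          leibniz_lie z u w, map_add]
        simp) r
  have rLo (r) : ⁅P.Lo, brMap P.tm1 f r⁆ = (n + 2 : ℂ) • f (SimpleData.br r) :=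
    brMap_induction (p := fun a w => ⁅P.Lo, a⁆ = (n + 2 : ℂ) • f w) (by simp)
      (fun a b u w h1 h2 => by rw [br_add, h1, h2, map_add, smul_add]) (fun u w => by
        rw [P.Lo_lie, P.Lo_tm1, h.t0, h.Lo, br_smul, h.tm1]; module) r
  have reps (r) : ⁅P.eps, brMap P.tm1 f r⁆ = 0 :=
    brMap_induction (p := fun a _ => ⁅P.eps, a⁆ = 0) (by simp)
      (fun a b u w h1 h2 => by rw [br_add, h1, h2, add_zero]) (fun u w => by
        rw [P.eps_tm1_lie, h.eps]; simp) r
  have key (u w) : ⁅P.tm1 u, f w⁆ = brMap P.tm1 f (D.sec ⁅u, w⁆) := by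
    rw [← brMap_tmul, ← sub_eq_zero, ← map_sub]
    refine hP.neg _ (rmem _) (fun z => ?_) ?_ (reps _)
    · rw [rt, map_sub, SimpleData.br_tmul, D.br_sec, sub_self, lie_zero, map_zero]
    · rw [rLo, map_sub, SimpleData.br_tmul, D.br_sec, sub_self, map_zero, smul_zero]
  refine ⟨fun w => ?_, fun u w => ?_, fun w => ?_, key,
    ⟨0, rfl, fun z w => by simp [rt, D.br_sec]⟩, fun w => ?_, fun w => reps _,
    fun u w => hP.tm1_mem _ _ (rmem _)⟩
  · exact brMap_induction (p := fun a _ => a ∈ LieSuper.even (L := L)) (zero_mem _) (fun _ _ _ _ => add_mem)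
      (fun u w => lie_even_even _ (P.tm1_even u) _ (h.even w)) _
  · have : ∀ r, ⁅P.t0 u, brMap P.tm1 f r⁆ = brMap P.tm1 f (D.sec ⁅u, SimpleData.br r⁆) :=
      brMap_induction (p := fun a w => ⁅P.t0 u, a⁆ = brMap P.tm1 f (D.sec ⁅u, w⁆)) (by simp)
        (fun a b u' w h1 h2 => by rw [br_add, h1, h2, lie_add, map_add, map_add]) (fun u' w => by
          rw [P.t0_lie, P.t0_tm1, h.t0, key, key, ← map_add, ← map_add, ← leibniz_lie])
    rw [LinearMap.comp_apply, this, D.br_sec]; rfl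
  · exact brMap_induction (p := fun a _ => ⁅P.K, a⁆ = 0) (by simp)
      (fun a b u' w h1 h2 => by rw [br_add, h1, h2, add_zero]) (fun u' w => by
        rw [P.K_lie, P.K_tm1, h.K]; simp) _
  · rw [LinearMap.comp_apply, rLo, D.br_sec]; push_cast; module

theorem downInv (n : ℕ) : DownInv P Neg n (modes D P.t0 P.tm1 n) (modes D P.t0 P.tm1 (n + 1)) := by
  induction n with
  | zero => exact hP.downInv_zero
  | succ n ih => exact hP.downInv_succ ih

omit hP

variable (P) in
/-- The modes of the loop algebra. -/
def _root_.TensorHierarchy.LocalData.T : ℤ → 𝔤 →ₗ[ℂ] L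
  | .ofNat n => modes D P.t0 P.t1 n
  | .negSucc n => modes D P.t0 P.tm1 (n + 1)

theorem T_zero : P.T 0 = P.t0 := rfl
theorem T_one : P.T 1 = P.t1 := rfl
theorem T_neg_one : P.T (-1) = P.tm1 := rfl

include hP

theorem T_even (m : ℤ) (u : 𝔤) : P.T m u ∈ LieSuper.even (L := L) := by
  rcases m with (_ | n) | n
  exacts [P.t0_even u, (hP.upInv n).even u, (hP.downInv n).even u]

theorem K_T (m : ℤ) (u : 𝔤) : ⁅P.K, P.T m u⁆ = 0 := by
  rcases m with (_ | n) | n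
  exacts [P.K_t0 u, (hP.upInv n).K u, (hP.downInv n).K u]

theorem t0_T (m : ℤ) (u w : 𝔤) : ⁅P.t0 u, P.T m w⁆ = P.T m ⁅u, w⁆ := by
  rcases m with (_ | n) | n
  exacts [P.t0_t0 u w, (hP.upInv n).t0 u w, (hP.downInv n).t0 u w]

theorem t1_T (n : ℤ) (u w : 𝔤) : ⁅P.t1 u, P.T n w⁆ =
    P.T (1 + n) ⁅u, w⁆ + (if n = -1 then D.B u w else 0) • P.K := by
  rcases n with n | _ | n
  · have e : 1 + Int.ofNat n = Int.ofNat (n + 1) := by simp [add_comm]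
    rw [if_neg (by simp), zero_smul, add_zero, e]
    exact (hP.upInv n).t1 u w
  · exact P.t1_tm1 u w
  · obtain ⟨κ, hκ, h⟩ := (hP.downInv (n + 1)).t1
    have e : 1 + Int.negSucc (n + 1) = Int.negSucc n := by omega
    rw [if_neg (by omega), zero_smul, add_zero, e]
    refine (h u w).trans ?_
    simp [hκ]; rfl

theorem tm1_T (n : ℤ) (u w : 𝔤) : ⁅P.tm1 u, P.T n w⁆ =
    P.T (-1 + n) ⁅u, w⁆ + (if n = 1 then -D.B u w else 0) • P.K := by
  rcases n with (_ | _ | n) | n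
  · rw [if_neg (by simp), zero_smul, add_zero]
    exact P.tm1_t0 u w
  · obtain ⟨κ, hκ, h⟩ := (hP.upInv 0).tm1
    refine (h u w).trans ?_
    simp [hκ]; rfl
  · obtain ⟨κ, hκ, h⟩ := (hP.upInv (n + 1)).tm1
    have e : -1 + Int.ofNat (n + 1 + 1) = Int.ofNat (n + 1) := by simp
    rw [if_neg (by simp; omega), zero_smul, add_zero, e]
    refine (h u w).trans ?_
    simp [hκ]; rfl
  · have e : -1 + Int.negSucc n = Int.negSucc (n + 1) := by omega
    rw [if_neg (by omega), zero_smul, add_zero, e]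
    exact (hP.downInv (n + 1)).tm1 u w

theorem T_lie_right (a : ℤ) (ε : ℂ) {m : ℤ} (ha : ∀ n u w, ⁅P.T a u, P.T n w⁆ =
      P.T (a + n) ⁅u, w⁆ + (if n = -a then ε * D.B u w else 0) • P.K)
    (hm : ∀ u w, ⁅P.T a u, P.T m w⁆ = P.T (a + m) ⁅u, w⁆)
    (h : ∀ n u w, ⁅P.T m u, P.T n w⁆ = P.T (m + n) ⁅u, w⁆ + (if m + n = 0 then m * D.B u w else 0) • P.K)
    (n : ℤ) (u w : 𝔤) : ⁅P.T (a + m) u, P.T n w⁆ =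
      P.T (a + m + n) ⁅u, w⁆ + (if a + m + n = 0 then (ε + m) * D.B u w else 0) • P.K := by
  let F : 𝔤 →ₗ[ℂ] L := ((ad (L := L)).flip (P.T n w)) ∘ₗ (P.T (a + m))
  let B' : 𝔤 →ₗ[ℂ] ℂ := if a + m + n = 0 then (ε + m) • D.B.flip w else 0
  let G : 𝔤 →ₗ[ℂ] L := (P.T (a + m + n)) ∘ₗ ((LieAlgebra.ad ℂ 𝔤 : 𝔤 →ₗ[ℂ] 𝔤 →ₗ[ℂ] 𝔤).flip w) +
    B'.smulRight P.K
  have hG (u) : G u = P.T (a + m + n) ⁅u, w⁆ + (if a + m + n = 0 then (ε + m) * D.B u w else 0) • P.K := by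
    simp only [G, B', LinearMap.add_apply, LinearMap.smulRight_apply]
    split_ifs <;> rfl
  suffices hFG : F = G from (LinearMap.congr_fun hFG u).trans (hG u)
  refine D.ext_of_lie fun u u' => ?_
  rw [hG]
  change ⁅P.T (a + m) ⁅u, u'⁆, P.T n w⁆ = _
  have hJ : ⁅⁅P.T a u, P.T m u'⁆, P.T n w⁆ = ⁅P.T a u, ⁅P.T m u', P.T n w⁆⁆ - ⁅P.T m u', ⁅P.T a u, P.T n w⁆⁆ := by
    rw [jacobi_even (P.T a u) (hP.T_even a u)]; abel
  have hK (m u) : ⁅P.T m u, P.K⁆ = 0 := by rw [P.lie_K, hP.K_T, neg_zero]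
  rw [← hm, hJ, h, ha n u w, br_add, br_add, br_smul, br_smul, hK, hK, smul_zero, smul_zero, add_zero, add_zero, ha, h,
    lie_lie, map_sub, D.B_inv, show a + (m + n) = a + m + n by ring, show m + (a + n) = a + m + n by ring]
  have e1 : m + n = -a ↔ a + m + n = 0 := by constructor <;> intro h <;> linarith
  have e2 : D.B u' ⁅u, w⁆ = -D.B u ⁅u', w⁆ := by
    rw [← D.B_inv, ← lie_skew, map_neg, LinearMap.neg_apply, D.B_inv]
  simp only [e1, e2]
  split_ifs <;> module

/-- The brackets of the modes. -/
theorem T_T (m n : ℤ) (u w : 𝔤) : ⁅P.T m u, P.T n w⁆ =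
    P.T (m + n) ⁅u, w⁆ + (if m + n = 0 then m * D.B u w else 0) • P.K := by
  have h1 (n : ℤ) (u w : 𝔤) := hP.t1_T n u w
  have h2 (n : ℤ) (u w : 𝔤) := hP.tm1_T n u w
  simp only [← T_one, ← T_neg_one] at h1 h2
  induction m using Int.induction_on generalizing n u w with
  | zero => simpa [T_zero] using hP.t0_T n u w
  | succ m ih =>
    rcases Nat.eq_zero_or_pos m with rfl | hm
    · have e : 1 + n = 0 ↔ n = -1 := by omega
      simpa [e] using h1 n u w
    have := hP.T_lie_right 1 1 (m := m) (by simpa using h1) (fun u w => by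
      rw [h1, if_neg (by omega), zero_smul, add_zero]) ih n u w
    rw [add_comm (m : ℤ) 1, this]; push_cast; rfl
  | pred m ih =>
    rcases Nat.eq_zero_or_pos m with rfl | hm
    · have e : -1 + n = 0 ↔ n = 1 := by omega
      simpa [e] using h2 n u w
    have := hP.T_lie_right (-1) (-1) (m := -m) (by simpa using h2) (fun u w => by
      rw [h2, if_neg (by omega), zero_smul, add_zero]) ih n u w
    rw [show -(m : ℤ) - 1 = -1 + -m by ring, this]; push_cast; rfl

theorem Lo_T (m : ℤ) (u : 𝔤) : ⁅P.Lo, P.T m u⁆ = -(m : ℂ) • P.T (m + 1) u := by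
  rcases m with n | n
  · exact (hP.upInv n).Lo u
  · have h := (hP.downInv n).Lo u
    cases n with
    | zero => refine h.trans ?_; simp; rfl
    | succ n =>
      have e : Int.negSucc (n + 1) + 1 = Int.negSucc n := by omega
      rw [e]
      refine h.trans ?_
      rw [Int.cast_negSucc]; push_cast
      change _ = -(-(n + 1 + 1 : ℂ)) • modes D P.t0 P.tm1 (n + 1) u
      module

theorem eps_T_neg (n : ℕ) (u : 𝔤) : ⁅P.eps, P.T (-n) u⁆ = 0 := by
  cases n with
  | zero => exact P.eps_t0 u
  | succ n => exact (hP.downInv n).eps u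

end LocalData.IsTransitive

end

section

/-! ### The part of level one and the Sugawara operator -/

open LieSuper

section Casimir

variable {𝔤 : Type*} [LieRing 𝔤] [LieAlgebra ℂ 𝔤] {κ : Type*} [Fintype κ] [DecidableEq κ]
  {B : 𝔤 →ₗ[ℂ] 𝔤 →ₗ[ℂ] ℂ} {u : Module.Basis κ ℂ 𝔤} {u' : κ → 𝔤}
  (hB : ∀ i j, B (u i) (u' j) = if i = j then 1 else 0)

include hB

theorem dual_repr (w : 𝔤) (j : κ) : u.repr w j = B w (u' j) := by
  conv_rhs => rw [← u.sum_repr w]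
  simp [hB, -Module.Basis.sum_repr]

theorem sum_dual_left (w : 𝔤) : ∑ j, B w (u' j) • u j = w := by
  simpa only [dual_repr hB] using u.sum_repr w

variable (hs : ∀ u w, B u w = B w u) (hn : ∀ u, (∀ w, B u w = 0) → u = 0)

include hs hn

theorem sum_dual_right (w : 𝔤) : ∑ j, B w (u j) • u' j = w := by
  rw [← sub_eq_zero]
  refine hn _ fun z => ?_
  conv_lhs => rw [← sum_dual_left hB z]
  simp [hs (u' _) (u _), hB, hs z]

variable {M : Type*} [AddCommGroup M] [Module ℂ M] (β : 𝔤 →ₗ[ℂ] 𝔤 →ₗ[ℂ] M)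

theorem sum_dual_symm : ∑ j, β (u j) (u' j) = ∑ j, β (u' j) (u j) := by
  have h1 (j) : β (u j) (u' j) = ∑ k, B (u j) (u k) • β (u' k) (u' j) := by
    conv_lhs => rw [← sum_dual_right hB hs hn (u j)]
    simp
  have h2 (j) : β (u' j) (u j) = ∑ k, B (u j) (u k) • β (u' j) (u' k) := by
    conv_lhs => rw [← sum_dual_right hB hs hn (u j)]
    simp
  simp_rw [h1, h2]
  rw [Finset.sum_comm]
  simp_rw [hs (u _) (u _)]

theorem sum_dual_lie (hi : ∀ u w z, B ⁅u, w⁆ z = B u ⁅w, z⁆) (x : 𝔤) :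
    ∑ j, β ⁅u j, x⁆ (u' j) = -∑ j, β (u j) ⁅u' j, x⁆ := by
  have h1 (j) : β ⁅u j, x⁆ (u' j) = ∑ k, B ⁅u j, x⁆ (u' k) • β (u k) (u' j) := by
    conv_lhs => rw [← sum_dual_left hB ⁅u j, x⁆]
    simp
  have h2 (j) : β (u j) ⁅u' j, x⁆ = ∑ k, B ⁅u' j, x⁆ (u k) • β (u j) (u' k) := by
    conv_lhs => rw [← sum_dual_right hB hs hn ⁅u' j, x⁆]
    simp
  simp_rw [h1, h2]
  rw [Finset.sum_comm, ← Finset.sum_neg_distrib]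
  refine Finset.sum_congr rfl fun k _ => ?_
  rw [← Finset.sum_neg_distrib]
  refine Finset.sum_congr rfl fun j _ => ?_
  rw [hi, hs ⁅u' k, x⁆, ← lie_skew, map_neg, neg_smul]

theorem casimir (hi : ∀ u w z, B ⁅u, w⁆ z = B u ⁅w, z⁆) {g : ℂ}
    (hg : ∀ x y, killingForm ℂ 𝔤 x y = 2 * g * B x y) (x : 𝔤) :
    ∑ j, ⁅u j, ⁅u' j, x⁆⁆ = (2 * g) • x := by
  rw [← sub_eq_zero]
  refine hn _ fun y => ?_
  rw [map_sub, map_smul, LinearMap.sub_apply, LinearMap.smul_apply, smul_eq_mul, ← hg, sub_eq_zero,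
    killingForm_apply_apply, LinearMap.trace_eq_matrix_trace ℂ u, Matrix.trace, map_sum, LinearMap.sum_apply]
  refine Finset.sum_congr rfl fun j _ => ?_
  rw [Matrix.diag_apply, LinearMap.toMatrix_apply, dual_repr hB]
  simp only [LinearMap.comp_apply, LieAlgebra.ad_apply]
  rw [hs ⁅x, _⁆, ← hi, ← hi, hi, hs]

end Casimir

namespace LocalData

variable {ι 𝔤 : Type*} [Fintype ι] [LieRing 𝔤] [LieAlgebra ℂ 𝔤]
  {L : Type*} [AddCommGroup L] [Module ℂ L] [Bracket L L] [LieSuper L] {D : SimpleData ι 𝔤}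
  (P : LocalData D.B L)

/-- The span of the elements obtained from `eps` by applying `n` elements `t1 u`. -/
def V : ℕ → Submodule ℂ L
  | 0 => ℂ ∙ P.eps
  | n + 1 => ⨆ u, (V n).map (ad (P.t1 u))

variable {P}

theorem t1_mem_V {n : ℕ} (u : 𝔤) {w : L} (hw : w ∈ P.V n) : ⁅P.t1 u, w⁆ ∈ P.V (n + 1) :=
  Submodule.mem_iSup_of_mem u ⟨w, hw, rfl⟩

theorem V_succ_le {n : ℕ} {N : Submodule ℂ L} (h : ∀ u, ∀ w ∈ P.V n, ⁅P.t1 u, w⁆ ∈ N) :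
    P.V (n + 1) ≤ N :=
  iSup_le fun u => by rintro _ ⟨w, hw, rfl⟩; exact h u w hw

theorem eps_mem_V : P.eps ∈ P.V 0 := Submodule.mem_span_singleton_self _

theorem iSup_V_le {N : Submodule ℂ L} (h0 : P.eps ∈ N) (h : ∀ u, ∀ w ∈ N, ⁅P.t1 u, w⁆ ∈ N) :
    ⨆ n, P.V n ≤ N := by
  refine iSup_le fun n => ?_
  induction n with
  | zero => exact (Submodule.span_singleton_le_iff_mem _ _).2 h0
  | succ n ih => exact V_succ_le fun u w hw => h u w (ih hw)

theorem mem_iSup_V {n : ℕ} {w : L} (hw : w ∈ P.V n) : w ∈ ⨆ n, P.V n := Submodule.mem_iSup_of_mem n hw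

theorem iSup_V_stab {x : L} (h : ∀ n, ∀ w ∈ P.V n, ⁅x, w⁆ ∈ ⨆ n, P.V n) : x ∈ stab (⨆ n, P.V n) := by
  intro w hw
  have : ⨆ n, P.V n ≤ (⨆ n, P.V n).comap (ad x) := iSup_le fun n w hw => h n w hw
  exact this hw

theorem K_V (w : L) (hw : w ∈ ⨆ n, P.V n) : ⁅P.K, w⁆ = -w := by
  have : ⨆ n, P.V n ≤ LinearMap.ker (ad P.K + LinearMap.id) := by
    refine iSup_V_le ?_ fun u w hw => ?_
    · rw [LinearMap.mem_ker, LinearMap.add_apply, ad_apply, P.K_eps, LinearMap.id_apply, neg_add_cancel]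
    · simp only [LinearMap.mem_ker, LinearMap.add_apply, ad_apply, LinearMap.id_apply] at hw ⊢
      rw [P.K_lie, P.K_t1, zero_br, zero_add, ← br_add, hw, br_zero]
  exact eq_neg_of_add_eq_zero_left (this hw)

theorem t0_V {n : ℕ} (u : 𝔤) {w : L} (hw : w ∈ P.V n) : ⁅P.t0 u, w⁆ ∈ P.V n := by
  suffices h : P.V n ≤ (P.V n).comap (ad (P.t0 u)) from h hw
  induction n generalizing w with
  | zero => exact (Submodule.span_singleton_le_iff_mem _ _).2 (by
    rw [Submodule.mem_comap, ad_apply, P.t0_eps]; exact zero_mem _)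
  | succ n ih =>
    refine V_succ_le fun z w hw => ?_
    rw [Submodule.mem_comap, ad_apply, P.t0_lie, P.t0_t1]
    exact add_mem (t1_mem_V _ hw) (t1_mem_V _ (ih hw hw))

theorem tm1_eps_mem (u : 𝔤) {w : L} (hw : w ∈ P.V 0) : ⁅P.tm1 u, w⁆ = 0 := by
  obtain ⟨c, rfl⟩ := Submodule.mem_span_singleton.1 hw
  rw [br_smul, P.tm1_eps, smul_zero]

theorem tm1_V {n : ℕ} (u : 𝔤) {w : L} (hw : w ∈ P.V (n + 1)) : ⁅P.tm1 u, w⁆ ∈ P.V n := by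
  suffices h : P.V (n + 1) ≤ (P.V n).comap (ad (P.tm1 u)) from h hw
  clear hw
  induction n with
  | zero =>
    refine V_succ_le fun z w hw => ?_
    rw [Submodule.mem_comap, ad_apply, P.tm1_lie, P.tm1_t1, tm1_eps_mem u hw, sub_br, neg_br, smul_br,
      K_V w (mem_iSup_V hw), br_zero, add_zero]
    exact sub_mem (neg_mem (t0_V _ hw)) (Submodule.smul_mem _ _ (neg_mem hw))
  | succ n ih =>
    refine V_succ_le fun z w hw => ?_
    rw [Submodule.mem_comap, ad_apply, P.tm1_lie, P.tm1_t1, sub_br, neg_br, smul_br, K_V w (mem_iSup_V hw)]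
    exact add_mem (sub_mem (neg_mem (t0_V _ hw)) (Submodule.smul_mem _ _ (neg_mem hw))) (t1_mem_V z (ih hw))

theorem t0_stab (u : 𝔤) : P.t0 u ∈ stab (⨆ n, P.V n) := iSup_V_stab fun _ _ hw => mem_iSup_V (t0_V u hw)

theorem t1_stab (u : 𝔤) : P.t1 u ∈ stab (⨆ n, P.V n) := iSup_V_stab fun _ _ hw => mem_iSup_V (t1_mem_V u hw)

theorem tm1_stab (u : 𝔤) : P.tm1 u ∈ stab (⨆ n, P.V n) := iSup_V_stab fun n w hw => by
  cases n with
  | zero => rw [tm1_eps_mem u hw]; exact zero_mem _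
  | succ n => exact mem_iSup_V (tm1_V u hw)

namespace IsTransitive

variable {Neg Pos : Submodule ℂ L} (hP : P.IsTransitive Neg Pos)

include hP

theorem T_mem_of {N : Submodule ℂ L} (h0 : ∀ u, P.t0 u ∈ N) (h1 : ∀ u, P.t1 u ∈ N) (h2 : ∀ u, P.tm1 u ∈ N)
    (h : ∀ x ∈ LieSuper.even (L := L), ∀ y, x ∈ N → y ∈ N → ⁅x, y⁆ ∈ N) (m : ℤ) (u : 𝔤) : P.T m u ∈ N := by
  have key (a m : ℤ) (ha : ∀ u, P.T a u ∈ N) (hm : ∀ u, P.T m u ∈ N) (h0 : a + m ≠ 0) (u : 𝔤) :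
      P.T (a + m) u ∈ N := by
    have : (⊤ : Submodule ℂ 𝔤) ≤ N.comap (P.T (a + m)) := by
      rw [← D.span_lie_eq_top]
      refine Submodule.span_le.2 ?_
      rintro _ ⟨u, w, rfl⟩
      have := h _ (hP.T_even a u) _ (ha u) (hm w)
      rwa [hP.T_T, if_neg h0, zero_smul, add_zero] at this
    exact this (Submodule.mem_top (x := u))
  induction m using Int.induction_on generalizing u with
  | zero => exact h0 u
  | succ m ih => rw [add_comm]; exact key 1 m h1 ih (by omega) u
  | pred m ih => rw [sub_eq_add_neg, add_comm]; exact key (-1) (-m) h2 ih (by omega) u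

theorem T_stab (m : ℤ) (u : 𝔤) : P.T m u ∈ stab (⨆ n, P.V n) :=
  hP.T_mem_of t0_stab t1_stab tm1_stab (fun _ hx _ => lie_mem_stab hx) m u

theorem Lo_stab : P.Lo ∈ stab (⨆ n, P.V n) := by
  have : ⨆ n, P.V n ≤ (⨆ n, P.V n) ⊓ (⨆ n, P.V n).comap (ad P.Lo) := by
    refine iSup_V_le ⟨mem_iSup_V eps_mem_V, ?_⟩ fun u w hw => ⟨t1_stab u w hw.1, ?_⟩
    · rw [SetLike.mem_coe, Submodule.mem_comap, ad_apply, hP.Lo_eps_eq_zero]; exact zero_mem _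
    · have h := hP.Lo_T 1 u
      rw [T_one] at h
      rw [SetLike.mem_coe, Submodule.mem_comap, ad_apply, P.Lo_lie, h, smul_br]
      exact add_mem (Submodule.smul_mem _ _ (hP.T_stab _ u w hw.1)) (t1_stab u _ hw.2)
  exact fun w hw => (this hw).2

theorem T_neg_eps (n : ℕ) (u : 𝔤) : ⁅P.T (-n) u, P.eps⁆ = 0 := by
  rw [lie_eq_neg_of_even (hP.T_even _ u), hP.eps_T_neg, neg_zero]

/-- The action of `v` and of the lowering modes on elements of degree `n + 1`. -/
theorem exists_v_eq {n : ℕ} {w : L} (hw : w ∈ P.V (n + 1)) : ∃ z : 𝔤, ⁅P.v, w⁆ = P.T (n + 2) z ∧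
    (∀ u, ⁅P.T (-(n + 1 : ℕ)) u, w⁆ = -D.B u z • P.eps) ∧ ∀ k : ℕ, n + 1 < k → ∀ u, ⁅P.T (-k) u, w⁆ = 0 := by
  let N : ℕ → Submodule ℂ L := fun n =>
    { carrier := {w | ∃ z : 𝔤, ⁅P.v, w⁆ = P.T (n + 2) z ∧
        (∀ u, ⁅P.T (-(n + 1 : ℕ)) u, w⁆ = -D.B u z • P.eps) ∧ ∀ k : ℕ, n + 1 < k → ∀ u, ⁅P.T (-k) u, w⁆ = 0}
      add_mem' := by
        rintro a b ⟨z, h1, h2, h3⟩ ⟨z', h1', h2', h3'⟩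
        refine ⟨z + z', by rw [br_add, h1, h1', map_add], fun u => ?_, fun k hk u => ?_⟩
        · rw [br_add, h2, h2', map_add]; module
        · rw [br_add, h3 k hk, h3' k hk, add_zero]
      zero_mem' := ⟨0, by simp⟩
      smul_mem' := by
        rintro c a ⟨z, h1, h2, h3⟩
        refine ⟨c • z, by rw [br_smul, h1, map_smul], fun u => ?_, fun k hk u => ?_⟩
        · rw [br_smul, h2, map_smul, smul_eq_mul]; module
        · rw [br_smul, h3 k hk, smul_zero] }
  have comm (k : ℕ) (u x : 𝔤) (w : L) (hk : 2 ≤ k) :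
      ⁅P.T (-k) u, ⁅P.t1 x, w⁆⁆ = ⁅P.T (-(k - 1 : ℕ)) ⁅u, x⁆, w⁆ + ⁅P.t1 x, ⁅P.T (-k) u, w⁆⁆ := by
    have h := hP.T_T (-k) 1 u x
    rw [if_neg (by omega), zero_smul, add_zero, T_one] at h
    rw [jacobi_even _ (hP.T_even _ u), h, show -(k : ℤ) + 1 = -(k - 1 : ℕ) by omega]
  suffices h : P.V (n + 1) ≤ N n from h hw
  clear hw
  induction n with
  | zero =>
    refine V_succ_le fun x w hw => ?_
    obtain ⟨c, rfl⟩ := Submodule.mem_span_singleton.1 hw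
    rw [br_smul]
    refine Submodule.smul_mem _ _ ⟨-x, ?_, fun u => ?_, fun k hk u => ?_⟩
    · have h := hP.Lo_T 1 x
      rw [T_one] at h
      rw [P.v_t1_lie, P.v_eps, br_neg, P.lie_Lo, neg_neg, h, map_neg]
      simp
    · rw [zero_add, Nat.cast_one, T_neg_one, P.tm1_lie, P.tm1_t1, P.tm1_eps, sub_br, neg_br, smul_br, P.K_eps, P.t0_eps,
        map_neg, D.B_symm]
      simp
    · rw [comm k u x _ (by omega), hP.T_neg_eps, hP.T_neg_eps]; simp
  | succ n ih =>
    refine V_succ_le fun x w hw => ?_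
    obtain ⟨z, h1, h2, h3⟩ := ih hw
    refine ⟨⁅x, z⁆, ?_, fun u => ?_, fun k hk u => ?_⟩
    · have h := hP.T_T 1 (n + 2) x z
      rw [if_neg (by omega), zero_smul, add_zero, T_one] at h
      rw [P.v_t1_lie, h1, h]; congr 2; push_cast; ring
    · rw [comm _ u x _ (by omega), Nat.add_sub_cancel, h3 (n + 1 + 1) (by omega), h2, D.B_inv]; simp
    · rw [comm k u x _ (by omega), h3 _ (by omega), h3 _ (by omega)]; simp

theorem T_neg_of_tm1 {w : L} (h : ∀ u, ⁅P.tm1 u, w⁆ = 0) (n : ℕ) (u : 𝔤) : ⁅P.T (-(n + 1 : ℕ)) u, w⁆ = 0 := by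
  induction n generalizing u with
  | zero => exact h u
  | succ n ih =>
    have : ad.flip w ∘ₗ P.T (-(n + 1 + 1 : ℕ)) = 0 := by
      refine D.ext_of_lie fun u u' => ?_
      have h' := hP.T_T (-1) (-(n + 1 : ℕ)) u u'
      rw [if_neg (by omega), zero_smul, add_zero, T_neg_one, show (-1 : ℤ) + -(n + 1 : ℕ) = -(n + 1 + 1 : ℕ) by omega] at h'
      change ⁅P.T (-(n + 1 + 1 : ℕ)) ⁅u, u'⁆, w⁆ = 0
      have hJ := P.tm1_lie u (P.T (-(n + 1 : ℕ)) u') w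
      rw [h', h, br_zero, ih, br_zero, add_zero] at hJ
      exact hJ.symm
    exact LinearMap.congr_fun this u

theorem V_le_pos (n : ℕ) : P.V (n + 1) ≤ Pos := by
  induction n with
  | zero =>
    refine V_succ_le fun u w hw => ?_
    obtain ⟨c, rfl⟩ := Submodule.mem_span_singleton.1 hw
    rw [br_smul]; exact Submodule.smul_mem _ _ (hP.t1_eps u)
  | succ n ih => exact V_succ_le fun u w hw => hP.t1_mem u w (ih hw)

/-- Level one contains no singular vectors of degree `n + 1`. -/
theorem eq_zero_of_singular (h0 : P.eps ≠ 0) {n : ℕ} {w : L} (hw : w ∈ P.V (n + 1)) (h : ∀ u, ⁅P.tm1 u, w⁆ = 0) :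
    w = 0 := by
  obtain ⟨z, h1, h2, -⟩ := hP.exists_v_eq hw
  have hz : z = 0 := D.B_nondeg _ fun u => by
    have h3 := h2 u
    rw [hP.T_neg_of_tm1 h, eq_comm, smul_eq_zero] at h3
    rw [D.B_symm]
    exact neg_eq_zero.1 (h3.resolve_right h0)
  refine hP.pos w (hP.V_le_pos n hw) h fun u => ?_
  have h3 := P.v_tm1_lie u w
  rw [h, h1, hz, map_zero, br_zero, br_zero, add_zero, zero_eq_neg] at h3
  exact h3

/-- Level one is irreducible, if its parts of different degrees are independent. -/
theorem eps_mem_of_stable (h0 : P.eps ≠ 0) (hV : ∀ (N : ℕ) (a : ℕ → L), (∀ n, a n ∈ P.V n) →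
      ∑ n ∈ Finset.range N, a n = 0 → ∀ n < N, a n = 0) {W : Submodule ℂ L} (hW : ∀ u, P.tm1 u ∈ stab W)
    (N : ℕ) {a : ℕ → L} (ha : ∀ n, a n ∈ P.V n) (hw : ∑ n ∈ Finset.range N, a n ∈ W)
    (hw0 : ∑ n ∈ Finset.range N, a n ≠ 0) : P.eps ∈ W := by
  induction N generalizing a with
  | zero => simp at hw0
  | succ N ih =>
    have hs (u : 𝔤) : ⁅P.tm1 u, ∑ n ∈ Finset.range (N + 1), a n⁆ = ∑ n ∈ Finset.range N, ⁅P.tm1 u, a (n + 1)⁆ := by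
      rw [Finset.sum_range_succ', br_add, tm1_eps_mem u (ha 0), add_zero, br_sum]
    by_cases h : ∀ u, ⁅P.tm1 u, ∑ n ∈ Finset.range (N + 1), a n⁆ = 0
    · have h1 (n) (hn : n < N) : a (n + 1) = 0 := hP.eq_zero_of_singular h0 (ha _) fun u =>
        hV N (fun n => ⁅P.tm1 u, a (n + 1)⁆) (fun n => tm1_V u (ha _)) (by rw [← hs, h]) n hn
      rw [Finset.sum_range_succ', Finset.sum_eq_zero fun n hn => h1 n (Finset.mem_range.1 hn), zero_add] at hw hw0
      obtain ⟨c, hc⟩ := Submodule.mem_span_singleton.1 (ha 0)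
      rw [← hc] at hw hw0
      exact (Submodule.smul_mem_iff _ fun hc0 => hw0 (by rw [hc0, zero_smul])).1 hw
    · push Not at h
      obtain ⟨u, hu⟩ := h
      have := hW u _ hw
      rw [hs] at this hu
      exact ih (fun n => tm1_V u (ha _)) this hu

/-- Elements of level one are annihilated by almost all lowering modes. -/
theorem exists_T_neg_eq_zero {w : L} (hw : w ∈ ⨆ n, P.V n) : ∃ k₀ : ℕ, ∀ k : ℕ, k₀ ≤ k → ∀ u, ⁅P.T (-k) u, w⁆ = 0 := by
  let N : Submodule ℂ L :=
    { carrier := {w | ∃ k₀ : ℕ, ∀ k : ℕ, k₀ ≤ k → ∀ u, ⁅P.T (-k) u, w⁆ = 0}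
      add_mem' := by
        rintro a b ⟨k, h⟩ ⟨k', h'⟩
        exact ⟨max k k', fun l hl u => by
          rw [br_add, h l ((le_max_left _ _).trans hl), h' l ((le_max_right _ _).trans hl), add_zero]⟩
      zero_mem' := ⟨0, by simp⟩
      smul_mem' := by
        rintro c a ⟨k, h⟩
        exact ⟨k, fun l hl u => by rw [br_smul, h l hl, smul_zero]⟩ }
  suffices h : ⨆ n, P.V n ≤ N from h hw
  refine iSup_V_le ⟨0, fun k _ u => hP.T_neg_eps k u⟩ ?_
  rintro x w ⟨k₀, h⟩
  refine ⟨k₀ + 2, fun k hk u => ?_⟩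
  have h' := hP.T_T (-k) 1 u x
  rw [if_neg (by omega), zero_smul, add_zero, T_one] at h'
  rw [jacobi_even _ (hP.T_even _ u), h', h k (by omega), show -(k : ℤ) + 1 = -(k - 1 : ℕ) by omega, h _ (by omega)]
  simp

section Sugawara

variable {κ : Type*} [Fintype κ] [DecidableEq κ] {u : Module.Basis κ ℂ 𝔤} {u' : κ → 𝔤}
  (hB : ∀ i j, D.B (u i) (u' j) = if i = j then 1 else 0) {g : ℂ} (hg : ∀ x y, killingForm ℂ 𝔤 x y = 2 * g * D.B x y)

include hB

omit hP in
variable (P u u') in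
/-- The sum over dual bases of two modes. -/
def _root_.TensorHierarchy.LocalData.TT (m n : ℤ) : L →ₗ[ℂ] L := ∑ j, ad (P.T m (u j)) ∘ₗ ad (P.T n (u' j))

omit hP hB in
theorem TT_apply (m n : ℤ) (w : L) : P.TT u u' m n w = ∑ j, ⁅P.T m (u j), ⁅P.T n (u' j), w⁆⁆ := by
  simp [TT]; rfl

include hg in
theorem sum_T_one_T_one (x : 𝔤) (w : L) :
    ∑ j, ⁅P.T 1 (u j), ⁅P.T 1 ⁅u' j, x⁆, w⁆⁆ = g • ⁅P.T 2 x, w⁆ := by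
  let β : 𝔤 →ₗ[ℂ] 𝔤 →ₗ[ℂ] L := LinearMap.mk₂ ℂ (fun a b => ⁅P.T 1 a, ⁅P.T 1 b, w⁆⁆) (by simp) (by simp) (by simp) (by simp)
  let γ : 𝔤 →ₗ[ℂ] 𝔤 →ₗ[ℂ] L := LinearMap.mk₂ ℂ (fun a b => ⁅P.T 1 ⁅a, x⁆, ⁅P.T 1 b, w⁆⁆) (by simp) (by simp) (by simp) (by simp)
  have h1 := sum_dual_lie hB D.B_symm D.B_nondeg β D.B_inv x
  have h2 := sum_dual_symm hB D.B_symm D.B_nondeg γ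
  simp only [β, γ, LinearMap.mk₂_apply] at h1 h2
  have h3 (j) : ⁅P.T 1 (u j), ⁅P.T 1 ⁅u' j, x⁆, w⁆⁆ = ⁅P.T 2 ⁅u j, ⁅u' j, x⁆⁆, w⁆ + ⁅P.T 1 ⁅u' j, x⁆, ⁅P.T 1 (u j), w⁆⁆ := by
    have h := hP.T_T 1 1 (u j) ⁅u' j, x⁆
    rw [if_neg (by omega), zero_smul, add_zero] at h
    rw [jacobi_even _ (hP.T_even _ _), h]; rfl
  have h4 := Finset.sum_congr rfl fun j (_ : j ∈ Finset.univ) => h3 j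
  rw [Finset.sum_add_distrib, ← h2, h1, ← sum_br, ← map_sum, casimir hB D.B_symm D.B_nondeg D.B_inv hg, map_smul, smul_br] at h4
  refine smul_right_injective L (two_ne_zero (α := ℂ)) ?_
  change (2 : ℂ) • _ = (2 : ℂ) • _
  linear_combination (norm := module) h4

omit hP hB in
theorem sum_Icc_one {M : Type*} [AddCommMonoid M] (a : ℤ → M) (N : ℕ) :
    ∑ n ∈ Finset.Icc (1 : ℤ) N, a n = ∑ k ∈ Finset.range N, a (k + 1) :=
  Finset.sum_nbij' (fun n => (n - 1).toNat) (fun k => (k : ℤ) + 1) (fun n hn => by simp at hn ⊢; omega)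
    (fun k hk => by simp at hk ⊢; omega) (fun n hn => by simp at hn ⊢; omega) (fun k hk => by simp)
    fun n hn => by simp at hn ⊢; congr; omega

theorem TT_t1 {w : L} (hw : ⁅P.K, w⁆ = -w) (x : 𝔤) (n : ℕ) : P.TT u u' (n + 1) (-n) ⁅P.t1 x, w⁆ =
    ⁅P.t1 x, P.TT u u' (n + 1) (-n) w⁆ + ∑ j, ⁅P.T (n + 1) (u j), ⁅P.T (1 - n) ⁅u' j, x⁆, w⁆⁆ -
      ∑ j, ⁅P.T (n + 2) (u j), ⁅P.T (-n) ⁅u' j, x⁆, w⁆⁆ + if n = 1 then ⁅P.T 2 x, w⁆ else 0 := by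
  let β : 𝔤 →ₗ[ℂ] 𝔤 →ₗ[ℂ] L := LinearMap.mk₂ ℂ (fun a b => ⁅P.T (n + 2) a, ⁅P.T (-n) b, w⁆⁆) (by simp) (by simp)
    (by simp) (by simp)
  have h1 := sum_dual_lie hB D.B_symm D.B_nondeg β D.B_inv x
  simp only [β, LinearMap.mk₂_apply] at h1
  have h2 (j) : ⁅P.T (n + 1) (u j), ⁅P.T (-n) (u' j), ⁅P.t1 x, w⁆⁆⁆ =
      ⁅P.T (n + 1) (u j), ⁅P.T (1 - n) ⁅u' j, x⁆, w⁆⁆ + (if n = 1 then ⁅P.T 2 (D.B x (u' j) • u j), w⁆ else 0) +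
        (⁅P.T (n + 2) ⁅u j, x⁆, ⁅P.T (-n) (u' j), w⁆⁆ + ⁅P.t1 x, ⁅P.T (n + 1) (u j), ⁅P.T (-n) (u' j), w⁆⁆⁆) := by
    have h := hP.T_T (-n) 1 (u' j) x
    have h' := hP.T_T (n + 1) 1 (u j) x
    rw [if_neg (by omega), zero_smul, add_zero, T_one, add_assoc, one_add_one_eq_two] at h'
    rw [T_one, show -(n : ℤ) + 1 = 1 - n by ring] at h
    rw [jacobi_even _ (hP.T_even (-n) _), h, add_br, smul_br, hw, br_add, br_add, br_smul, br_neg,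
      jacobi_even _ (hP.T_even (n + 1) _) (P.t1 x), h', D.B_symm]
    by_cases hn : n = 1
    · subst hn
      simp
    · rw [if_neg (by omega), if_neg hn, zero_smul]
  rw [TT_apply, TT_apply, br_sum, Finset.sum_congr rfl fun j _ => h2 j]
  simp only [Finset.sum_add_distrib]
  rw [h1]
  have h3 : ∑ j, (if n = 1 then ⁅P.T 2 (D.B x (u' j) • u j), w⁆ else 0) = if n = 1 then ⁅P.T 2 x, w⁆ else 0 := by
    split_ifs
    · rw [← sum_br, ← map_sum, sum_dual_left hB]
    · simp
  rw [h3]; abel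

include hg in
/-- Up to normalization, `Lo` acts on level one as the Sugawara operator. -/
theorem sugawara {w : L} (hw : w ∈ ⨆ n, P.V n) :
    ∀ᶠ N : ℕ in Filter.atTop, ∑ n ∈ Finset.range N, P.TT u u' (n + 1) (-n) w = -(1 + g) • ⁅P.Lo, w⁆ := by
  let N : Submodule ℂ L :=
    { carrier := {w | ∀ᶠ N : ℕ in Filter.atTop, ∑ n ∈ Finset.range N, P.TT u u' (n + 1) (-n) w = -(1 + g) • ⁅P.Lo, w⁆}
      add_mem' := fun {a b} ha hb => by
        filter_upwards [ha, hb] with N ha hb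
        simp only [map_add, Finset.sum_add_distrib, ha, hb, br_add, smul_add]
      zero_mem' := by simp
      smul_mem' := fun c a ha => by
        filter_upwards [ha] with N ha
        simp only [map_smul, ← Finset.smul_sum, ha, br_smul, smul_comm c] }
  suffices h : ⨆ n, P.V n ≤ (⨆ n, P.V n) ⊓ N from (h hw).2
  refine iSup_V_le ⟨mem_iSup_V eps_mem_V, .of_forall fun N => ?_⟩ fun x w hw => ⟨t1_stab x w hw.1, ?_⟩
  · rw [hP.Lo_eps_eq_zero, smul_zero]
    refine Finset.sum_eq_zero fun n _ => ?_
    simp [TT_apply, hP.T_neg_eps]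
  · obtain ⟨k₀, hk⟩ := hP.exists_T_neg_eq_zero hw.1
    have h2 : ∀ᶠ N : ℕ in Filter.atTop, _ := hw.2
    change ∀ᶠ N : ℕ in Filter.atTop, _
    filter_upwards [h2, Filter.eventually_ge_atTop (k₀ + 2)] with N hN hN2
    have h3 := Finset.sum_range_sub' (fun n : ℕ => ∑ j, ⁅P.T (n + 1) (u j), ⁅P.T (1 - n) ⁅u' j, x⁆, w⁆⁆) N
    have h4 (n : ℕ) (z) : P.T (1 - (n + 1 : ℕ)) z = P.T (-n) z := by congr 2; push_cast; ring
    have h5 (n : ℕ) (z) : P.T ((n + 1 : ℕ) + 1) z = P.T (n + 2) z := by congr 2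
    obtain ⟨M, rfl⟩ : ∃ M, N = M + 1 := ⟨N - 1, by omega⟩
    have h6 : ∑ j, ⁅P.T ((M + 1 : ℕ) + 1) (u j), ⁅P.T (1 - (M + 1 : ℕ)) ⁅u' j, x⁆, w⁆⁆ = 0 :=
      Finset.sum_eq_zero fun j _ => by rw [h4, hk M (by omega), br_zero]
    have h7 := hP.sum_T_one_T_one hB hg x w
    have h8 := hP.Lo_T 1 x
    rw [T_one] at h8
    rw [h6, sub_zero] at h3
    simp only [h4, h5, Nat.cast_zero, zero_add, sub_zero, h7] at h3
    simp only [hP.TT_t1 hB (K_V w hw.1) x, Finset.sum_add_distrib, add_sub_assoc, ← br_sum, hN, h3]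
    rw [Finset.sum_ite_eq' _ 1, if_pos (by simp; omega), P.Lo_lie, h8, br_smul]
    simp
    module

end Sugawara

end IsTransitive

end LocalData

end

section

/-! ### The affine algebra and level one in `S` -/

open LieSuper MonSuper LocalData LocalData.IsTransitive

variable {ι 𝔤 : Type*} [Fintype ι] [LieRing 𝔤] [LieAlgebra ℂ 𝔤]

namespace LocalData.IsTransitive

variable {L : Type*} [AddCommGroup L] [Module ℂ L] [Bracket L L] [LieSuper L] {D : SimpleData ι 𝔤}
  {P : LocalData D.B L} {Neg Pos : Submodule ℂ L} (hP : P.IsTransitive Neg Pos)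

include hP

/-- The modes are determined by their brackets and their values on the generators. -/
theorem T_unique {T : ℤ → 𝔤 →ₗ[ℂ] L} {K : L} (hx : ∀ i, T 0 (D.x i) = P.t0 (D.x i))
    (hy : ∀ i, T 0 (D.y i) = P.t0 (D.y i)) (hY : T 1 D.Y = P.t1 D.Y) (hX : T (-1) D.X = P.tm1 D.X)
    (hT : ∀ m n u w, ⁅T m u, T n w⁆ = T (m + n) ⁅u, w⁆ + (if m + n = 0 then m * D.B u w else 0) • K) :
    T = P.T ∧ K = P.K := by
  have T0_T (n : ℤ) (u w) : ⁅T 0 u, T n w⁆ = T n ⁅u, w⁆ := by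
    have := hT 0 n u w
    rw [zero_add] at this
    rw [this]; simp
  have h0 : T 0 = P.t0 := by
    have := D.gen (LinearMap.eqLocus (T 0) P.t0) hx hy
      (fun i z hz => by
        rw [LinearMap.mem_eqLocus] at hz ⊢
        rw [← T0_T, hx, hz, P.t0_t0])
      (fun i z hz => by
        rw [LinearMap.mem_eqLocus] at hz ⊢
        rw [← T0_T, hy, hz, P.t0_t0])
    exact LinearMap.eqLocus_eq_top.1 this
  have key (n : ℤ) (z : 𝔤) (hz0 : z ≠ 0) (hz : T n z = P.T n z) : T n = P.T n := by
    refine LinearMap.eqLocus_eq_top.1 ((D.simple (LinearMap.eqLocus (T n) (P.T n)) fun u w hw => ?_).resolve_left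
      fun h => hz0 ((Submodule.mem_bot ℂ).1 (h ▸ hz)))
    rw [LinearMap.mem_eqLocus] at hw ⊢
    rw [← T0_T, h0, hw, hP.t0_T]
  have h1 : T 1 = P.T 1 := key 1 D.Y D.Y_ne_zero hY
  have h2 : T (-1) = P.T (-1) := key (-1) D.X D.X_ne_zero hX
  refine ⟨funext fun m => ?_, ?_⟩
  · have step (a m : ℤ) (ha : T a = P.T a) (hm : T m = P.T m) (h : a + m ≠ 0) : T (a + m) = P.T (a + m) := by
      refine D.ext_of_lie fun u w => ?_
      have h3 := hT a m u w
      have h4 := hP.T_T a m u w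
      rw [if_neg h, zero_smul, add_zero] at h3 h4
      rw [← h3, ← h4, ha, hm]
    induction m using Int.induction_on with
    | zero => exact h0
    | succ m ih => rw [add_comm]; exact step 1 m h1 ih (by omega)
    | pred m ih => rw [sub_eq_add_neg, add_comm]; exact step (-1) (-m) h2 ih (by omega)
  · have h3 := hT 1 (-1) D.Y D.X
    have h4 := hP.T_T 1 (-1) D.Y D.X
    rw [h1, h2, h4] at h3
    simpa [h0, T_zero, D.B_symm D.Y, D.B_X_Y] using h3.symm

end LocalData.IsTransitive

namespace SimpleData

variable (D : SimpleData ι 𝔤)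

theorem loc_h_ne_zero (i : ι) : D.loc.t0 (D.h i) ≠ 0 := by
  intro h
  have h1 : toS D.A (D.th (some i)) = 0 := (D.ofGen_eq (.h (some i))).trans h
  have h2 : D.th (some i) ∈ comp (L := STilde D.A) {0} := mon_mem_comp (x := .of (.h (some i))) rfl
  have h3 := proj_zero_maximalIdeal D.A ((toS_eq_zero D.A).1 h1)
  rw [proj_eq_self subset_rfl h2] at h3
  have h4 := D.π_th_some i
  rw [h3, map_zero] at h4
  have h5 := fun w => (Model.t0_add_K D.B_inv' (u := D.h i) (c := 0) ((add_eq_left.2 (zero_smul ℂ _)).trans h4.symm) w).1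
  exact D.h_indep.ne_zero i (D.eq_zero_of_central h5)

theorem loc_eps_ne_zero : D.loc.eps ≠ 0 := by
  obtain ⟨i, -⟩ := D.exists_adjacent
  intro h
  have := D.loc.eps_ph (D.h i)
  rw [h, zero_br] at this
  exact D.loc_h_ne_zero i this.symm

theorem loc_T_mem (m : ℤ) (u : 𝔤) : D.loc.T m u ∈ comp (bi 0 m) := by
  have key (a m : ℤ) (ha : ∀ u, D.loc.T a u ∈ comp (bi 0 a)) (hm : ∀ u, D.loc.T m u ∈ comp (bi 0 m)) (h0 : a + m ≠ 0)
      (u : 𝔤) : D.loc.T (a + m) u ∈ comp (bi 0 (a + m)) := by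
    have : (⊤ : Submodule ℂ 𝔤) ≤ (comp (bi 0 (a + m))).comap (D.loc.T (a + m)) := by
      rw [← D.span_lie_eq_top]
      refine Submodule.span_le.2 ?_
      rintro _ ⟨u, w, rfl⟩
      have h1 := D.loc_isTransitive.T_T a m u w
      rw [if_neg h0, zero_smul, add_zero] at h1
      have h2 := lie_mem_bi (ha u) (hm w)
      rwa [zero_add, h1] at h2
    exact this (Submodule.mem_top (x := u))
  induction m using Int.induction_on generalizing u with
  | zero => exact D.loc_t0_mem u
  | succ m ih => rw [add_comm]; exact key 1 m D.loc_t1_mem ih (by omega) u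
  | pred m ih => rw [sub_eq_add_neg, add_comm]; exact key (-1) (-m) D.loc_tm1_mem ih (by omega) u

theorem proj_bi {l p q : ℤ} {x : S D.A} (hx : x ∈ comp (bi l p)) : proj (bi l q) x = if p = q then x else 0 := by
  split_ifs with h
  · rw [h] at hx; exact proj_eq_self subset_rfl hx
  · exact proj_eq_zero (fun d hd hd' => h (hd.2.symm.trans hd'.2)) hx

theorem loc_T_eq_zero {m : ℤ} {u : 𝔤} (h : D.loc.T m u = 0) : u = 0 := by
  refine ((D.simple (LinearMap.ker (D.loc.T m)) fun w z hz => ?_).resolve_right fun h => ?_).le h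
  · rw [LinearMap.mem_ker] at hz ⊢
    rw [← D.loc_isTransitive.t0_T, hz, br_zero]
  · have h1 := D.loc_isTransitive.T_T m (-m) D.Y D.X
    rw [LinearMap.ker_eq_top.1 h, LinearMap.zero_apply, zero_br, add_neg_cancel, if_pos rfl, D.B_symm, D.B_X_Y, mul_one,
      T_zero] at h1
    have h2 := congr_arg (⁅·, D.loc.eps⁆) h1
    simp only [zero_br, add_br, smul_br, D.loc.t0_eps, D.loc.K_eps, zero_add, smul_neg, zero_eq_neg, smul_eq_zero,
      D.loc_eps_ne_zero, or_false, Int.cast_eq_zero] at h2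
    obtain ⟨i, -⟩ := D.exists_adjacent
    have h3 := LinearMap.congr_fun (LinearMap.ker_eq_top.1 h) (D.h i)
    rw [h2] at h3
    exact D.loc_h_ne_zero i h3

theorem loc_injective : Function.Injective (fun p : (ℤ →₀ 𝔤) × ℂ => (p.1.sum fun m u => D.loc.T m u) + p.2 • D.loc.K) := by
  let F : ((ℤ →₀ 𝔤) × ℂ) →ₗ[ℂ] S D.A :=
    (Finsupp.lsum ℂ D.loc.T).coprod (LinearMap.toSpanSingleton ℂ _ D.loc.K)
  change Function.Injective F
  rw [injective_iff_map_eq_zero]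
  rintro ⟨a, c⟩ h
  have h0 : (a.sum fun m u => D.loc.T m u) + c • D.loc.K = 0 := h
  have h1 (m : ℤ) : D.loc.T m (a m) + (if 0 = m then c • D.loc.K else 0) = 0 := by
    have h2 := congr_arg (proj (bi 0 m)) h0
    rw [map_zero, map_add, map_smul, proj_bi D D.loc_K_mem, Finsupp.sum, map_sum,
      Finset.sum_congr rfl fun n _ => proj_bi D (D.loc_T_mem n (a n)), Finset.sum_ite_eq'] at h2
    refine Eq.trans ?_ h2
    congr 1
    · split_ifs with h
      · rfl
      rw [Finsupp.notMem_support_iff.1 h, map_zero]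
    · split_ifs <;> simp
  have hc : c = 0 := by
    have h2 := congr_arg (⁅·, D.loc.eps⁆) (h1 0)
    simpa [T_zero, D.loc.t0_eps, D.loc.K_eps, D.loc_eps_ne_zero] using h2
  refine Prod.ext (Finsupp.ext fun m => D.loc_T_eq_zero (m := m) ?_) hc
  simpa [hc] using h1 m

theorem phi_eq (i : ι) : phi D.A i = D.loc.ph (D.h i) := D.ofGen_eq _
theorem eps_eq : eps D.A = D.loc.eps := D.ofGen_eq _
theorem e_none_eq : e D.A none = D.loc.t1 D.Y := D.ofGen_eq _
theorem e_some_eq (i : ι) : e D.A (some i) = D.loc.t0 (D.x i) := D.ofGen_eq _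
theorem f_none_eq : f D.A none = D.loc.tm1 D.X := D.ofGen_eq _
theorem f_some_eq (i : ι) : f D.A (some i) = D.loc.t0 (D.y i) := D.ofGen_eq _
theorem h_none_eq : TensorHierarchy.h D.A none = D.loc.K - D.loc.t0 D.Θ := D.ofGen_eq _
theorem h_some_eq (i : ι) : TensorHierarchy.h D.A (some i) = D.loc.t0 (D.h i) := D.ofGen_eq _

theorem extraGenerator_eq (i : ι) : extraGenerator D.A i (D.loc.t0 D.X) = -(D.A (some i) none : ℂ) • D.loc.Lo := by
  rw [extraGenerator, phi_eq, eps_eq, e_none_eq, D.loc.t0_ph, ← lie_skew, D.h_X, ← neg_smul, neg_neg, map_smul, br_smul,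
    D.loc.t1_ph, D.B_symm, D.B_X_Y, one_smul, br_smul, D.loc.eps_v, smul_neg, neg_smul]

theorem extraGenerator_eq' (i : ι) : ⁅phi D.A i, ⁅D.loc.t0 D.X, ⁅e D.A none, eps D.A⁆⁆⁆ =
    -(D.A (some i) none : ℂ) • D.loc.Lo := by
  rw [phi_eq, eps_eq, e_none_eq, D.loc.t0_lie, D.loc.t0_eps, br_zero, add_zero, D.loc.t0_t1, D.X_Y, D.loc.ph_t1_lie,
    D.loc.ph_eps, D.loc.t1_t0, D.Θ_h, map_zero, add_zero, D.loc.v_eps, D.B_Θ_h]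
  simp

theorem mem_bosonic (m : ℤ) (u : 𝔤) : D.loc.T m u ∈ bosonicSubalgebra D.A := by
  have hb : (∀ a, e D.A a ∈ bosonicSubalgebra D.A ∧ f D.A a ∈ bosonicSubalgebra D.A ∧
        TensorHierarchy.h D.A a ∈ bosonicSubalgebra D.A) ∧
      ∀ x ∈ bosonicSubalgebra D.A, ∀ y ∈ bosonicSubalgebra D.A, ⁅x, y⁆ ∈ bosonicSubalgebra D.A := by
    simp only [bosonicSubalgebra, Submodule.mem_sInf]
    exact ⟨fun a => ⟨fun W hW => (hW.1 a).1, fun W hW => (hW.1 a).2.1, fun W hW => (hW.1 a).2.2⟩,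
      fun x hx y hy W hW => hW.2 x (hx W hW) y (hy W hW)⟩
  have h0 (u : 𝔤) : D.loc.t0 u ∈ bosonicSubalgebra D.A := by
    have := D.gen ((bosonicSubalgebra D.A).comap D.loc.t0) (fun i => by rw [Submodule.mem_comap, ← e_some_eq]; exact (hb.1 _).1)
      (fun i => by rw [Submodule.mem_comap, ← f_some_eq]; exact (hb.1 _).2.1)
      (fun i z hz => by
        rw [Submodule.mem_comap, ← D.loc.t0_t0, ← e_some_eq]; exact hb.2 _ (hb.1 _).1 _ hz)
      (fun i z hz => by
        rw [Submodule.mem_comap, ← D.loc.t0_t0, ← f_some_eq]; exact hb.2 _ (hb.1 _).2.1 _ hz)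
    exact this.ge (Submodule.mem_top (x := u))
  have key (f : 𝔤 →ₗ[ℂ] S D.A) (hf : ∀ u w, ⁅D.loc.t0 u, f w⁆ = f ⁅u, w⁆) (z : 𝔤) (hz : z ≠ 0)
      (hz' : f z ∈ bosonicSubalgebra D.A) (u : 𝔤) : f u ∈ bosonicSubalgebra D.A := by
    refine ((D.simple ((bosonicSubalgebra D.A).comap f) fun w z hz => ?_).resolve_left
      fun h => hz ((Submodule.mem_bot ℂ).1 (h ▸ hz'))).ge (Submodule.mem_top (x := u))
    rw [Submodule.mem_comap, ← hf]; exact hb.2 _ (h0 w) _ hz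
  refine D.loc_isTransitive.T_mem_of h0 (key _ D.loc.t0_t1 _ D.Y_ne_zero ?_) (key _ D.loc.t0_tm1 _ D.X_ne_zero ?_)
    (fun _ _ _ hx hy => hb.2 _ hx _ hy) m u
  · rw [← e_none_eq]; exact (hb.1 _).1
  · rw [← f_none_eq]; exact (hb.1 _).2.1

theorem bosonicSubalgebra_le : bosonicSubalgebra D.A ≤
    Submodule.span ℂ ((⋃ m, Set.range (D.loc.T m)) ∪ {D.loc.K}) := by
  have hT (m u) : D.loc.T m u ∈ Submodule.span ℂ ((⋃ m, Set.range (D.loc.T m)) ∪ {D.loc.K}) :=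
    Submodule.subset_span (.inl (Set.mem_iUnion.2 ⟨m, u, rfl⟩))
  have hK : D.loc.K ∈ Submodule.span ℂ ((⋃ m, Set.range (D.loc.T m)) ∪ {D.loc.K}) := Submodule.subset_span (.inr rfl)
  have hP := D.loc_isTransitive
  refine sInf_le ⟨?_, fun x hx y hy => ?_⟩
  · rintro (_ | i)
    · rw [e_none_eq, f_none_eq, h_none_eq]
      exact ⟨hT 1 _, hT (-1) _, sub_mem hK (hT 0 _)⟩
    · rw [e_some_eq, f_some_eq, h_some_eq]
      exact ⟨hT 0 _, hT 0 _, hT 0 _⟩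
  · refine LieSuper.span_lie_mem (fun a ha x hx => ?_) hx hy
    suffices h : _ ≤ (Submodule.span ℂ ((⋃ m, Set.range (D.loc.T m)) ∪ {D.loc.K})).comap (ad a) from h hx
    refine Submodule.span_le.2 ?_
    rintro b hb
    rw [SetLike.mem_coe, Submodule.mem_comap, ad_apply]
    rcases ha with ha | rfl
    · obtain ⟨m, u, rfl⟩ := Set.mem_iUnion.1 ha
      rcases hb with hb | rfl
      · obtain ⟨n, w, rfl⟩ := Set.mem_iUnion.1 hb
        rw [hP.T_T]
        exact add_mem (hT _ _) (Submodule.smul_mem _ _ hK)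
      · rw [D.loc.lie_K, hP.K_T, neg_zero]; exact zero_mem _
    · rcases hb with hb | rfl
      · obtain ⟨n, w, rfl⟩ := Set.mem_iUnion.1 hb
        rw [hP.K_T]; exact zero_mem _
      · rw [lie_self_even D.loc.K_even]; exact zero_mem _

theorem Lo_notMem_bosonic : D.loc.Lo ∉ bosonicSubalgebra D.A := by
  intro h
  have h1 : bosonicSubalgebra D.A ≤ (LinearMap.range (D.loc.T 1)).comap (proj (bi 0 1)) := by
    refine D.bosonicSubalgebra_le.trans (Submodule.span_le.2 ?_)
    rintro b (hb | rfl)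
    · obtain ⟨n, w, rfl⟩ := Set.mem_iUnion.1 hb
      rw [SetLike.mem_coe, Submodule.mem_comap, proj_bi D (D.loc_T_mem n w)]
      split_ifs with hn
      · exact ⟨w, by rw [hn]⟩
      · exact zero_mem _
    · rw [SetLike.mem_coe, Submodule.mem_comap, proj_bi D D.loc_K_mem, if_neg zero_ne_one]; exact zero_mem _
  obtain ⟨a, ha⟩ := h1 h
  rw [proj_bi D D.loc_Lo_mem, if_pos rfl] at ha
  have h2 : a = 0 := D.eq_zero_of_central fun u => D.loc_T_eq_zero (m := 1) (by
    rw [T_one, ← D.loc.t1_t0, ← T_one, ha, D.loc.Lo_t0])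
  obtain ⟨i, -⟩ := D.exists_adjacent
  have h3 := D.loc.Lo_tm1 (D.h i)
  rw [← ha, h2, map_zero, zero_br] at h3
  exact D.loc_h_ne_zero i h3.symm

theorem loc_V_mem (n : ℕ) : D.loc.V n ≤ comp (bi 1 (n + 1)) := by
  induction n with
  | zero => exact (Submodule.span_singleton_le_iff_mem _ _).2 (by simpa using D.loc_eps_mem)
  | succ n ih =>
    refine V_succ_le fun u w hw => ?_
    have h := lie_mem_bi (D.loc_t1_mem u) (ih hw)
    rwa [zero_add, add_comm (1 : ℤ)] at h

theorem levelComponent_one : levelComponent D.A 1 = ⨆ n, D.loc.V n := by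
  refine le_antisymm (D.levelComponent_one_le (mem_iSup_V eps_mem_V) t0_stab (t1_stab _) (tm1_stab _)
    D.loc_isTransitive.Lo_stab) (iSup_le fun n => (D.loc_V_mem n).trans ?_)
  rw [levelComponent_eq]
  exact comp_mono fun d hd => hd.1

theorem bosonicStable_levelComponent (l : ℤ) : IsBosonicStable D.A (levelComponent D.A l) := by
  intro x hx w hw
  have hx' : x ∈ comp {d | d none = 0} := by
    refine (D.bosonicSubalgebra_le.trans (Submodule.span_le.2 ?_)) hx
    rintro b (hb | rfl)
    · obtain ⟨n, w, rfl⟩ := Set.mem_iUnion.1 hb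
      exact comp_mono (fun d hd => hd.1) (D.loc_T_mem n w)
    · exact comp_mono (fun d hd => hd.1) D.loc_K_mem
  rw [levelComponent_eq] at hw ⊢
  refine lie_mem_comp (fun p hp q hq => ?_) hx' hw
  simp only [Set.mem_ofPred_eq, Finsupp.add_apply] at hp hq ⊢
  omega

theorem levelComponent_one_irreducible {W : Submodule ℂ (S D.A)} (hW : W ≤ levelComponent D.A 1)
    (hs : IsBosonicStable D.A W) : W = ⊥ ∨ W = levelComponent D.A 1 := by
  rw [levelComponent_one] at hW ⊢
  rw [or_iff_not_imp_left]
  intro h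
  obtain ⟨w, hw, hw0⟩ := W.ne_bot_iff.1 h
  have ht (m : ℤ) (u : 𝔤) : D.loc.T m u ∈ stab W := fun w hw => hs _ (D.mem_bosonic m u) w hw
  refine le_antisymm hW (iSup_V_le ?_ (ht 1))
  obtain ⟨a, ha, rfl⟩ := (Submodule.mem_iSup_iff_exists_finsupp _ _).1 (hW hw)
  obtain ⟨N, hN⟩ : ∃ N, a.support ⊆ Finset.range N := ⟨_, Finset.subset_range_sup_succ _⟩
  rw [Finsupp.sum_of_support_subset a hN _ (fun _ _ => rfl)] at hw hw0
  refine D.loc_isTransitive.eps_mem_of_stable D.loc_eps_ne_zero (fun N b hb h n hn => ?_) (fun u => by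
    rw [← T_neg_one]; exact ht (-1) u) N ha hw hw0
  have h1 := congr_arg (proj (bi 1 (n + 1))) h
  rw [map_zero, map_sum, Finset.sum_congr rfl fun k _ => proj_bi D (D.loc_V_mem k (hb k)), Finset.sum_congr rfl
    (g := fun k => if k = n then b k else 0) fun k _ => by congr 1; simp, Finset.sum_ite_eq',
    if_pos (Finset.mem_range.2 hn)] at h1
  exact h1

end SimpleData

end

section

/-! ### Root systems with a highest root -/

namespace RootSystem

open RootPairing Module

variable {ι M N : Type*} [Fintype ι] [AddCommGroup M] [Module ℂ M] [AddCommGroup N] [Module ℂ N]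
  {P : RootPairing ι ℂ M N} {b : P.Base}

theorem exists_nat_sum {a : M} (ha : a ∈ AddSubmonoid.closure (P.root '' b.support)) :
    ∃ n : b.support → ℕ, a = ∑ j, (n j : ℂ) • P.root j := by
  classical
  induction ha using AddSubmonoid.closure_induction with
  | mem x hx =>
    obtain ⟨j, hj, rfl⟩ := hx
    refine ⟨Pi.single ⟨j, hj⟩ 1, ?_⟩
    rw [Finset.sum_eq_single ⟨j, hj⟩ (fun i _ hi => by simp [hi]) (by simp)]
    simp
  | zero => exact ⟨0, by simp⟩
  | add x y _ _ hx hy =>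
    obtain ⟨n, rfl⟩ := hx
    obtain ⟨m, rfl⟩ := hy
    exact ⟨n + m, by simp [add_smul, Finset.sum_add_distrib]⟩

theorem linearIndependent_root : LinearIndependent ℂ fun j : b.support => P.root j := b.linearIndepOn_root

theorem eq_zero_of_neg_mem {a : M} (ha : a ∈ AddSubmonoid.closure (P.root '' b.support))
    (ha' : -a ∈ AddSubmonoid.closure (P.root '' b.support)) : a = 0 := by
  obtain ⟨n, rfl⟩ := exists_nat_sum ha
  obtain ⟨m, hm⟩ := exists_nat_sum ha'
  have h : ∑ j, ((n j + m j : ℕ) : ℂ) • P.root j = 0 := by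
    simp only [Nat.cast_add, add_smul, Finset.sum_add_distrib, ← hm, add_neg_cancel]
  have h2 := Fintype.linearIndependent_iff.1 (linearIndependent_root (b := b)) _ h
  refine Finset.sum_eq_zero fun j _ => ?_
  have h3 : n j + m j = 0 := by exact_mod_cast h2 j
  rw [show n j = 0 by omega]; simp

theorem two_mul_rootForm (x : M) (j : ι) :
    2 * P.RootForm x (P.root j) = P.coroot' j x * P.RootForm (P.root j) (P.root j) := by
  have h := congr_arg (P.toLinearMap x) (P.rootForm_self_smul_coroot j)
  have hs : P.RootForm (P.root j) x = P.RootForm x (P.root j) := P.rootForm_symmetric.eq _ _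
  rw [map_smul, map_nsmul, P.toLinearMap_apply_apply_Polarization, hs] at h
  rw [mul_comm (P.coroot' j x)]
  simpa using h.symm

section

variable [P.IsCrystallographic]

theorem coroot'_root (i j : ι) : P.coroot' j (P.root i) = (P.pairingIn ℤ i j : ℂ) := by
  rw [P.root_coroot'_eq_pairing, ← P.algebraMap_pairingIn ℤ]; rfl

theorem exists_rootForm_self {x : M} (hx : ∀ j, ∃ m : ℤ, P.coroot' j x = m) :
    ∃ k : ℕ, P.RootForm x x = k ∧ (k = 0 → ∀ j, P.coroot' j x = 0) := by
  choose m hm using hx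
  have h0 : 0 ≤ ∑ j, m j * m j := Finset.sum_nonneg fun j _ => mul_self_nonneg _
  obtain ⟨k, hk⟩ := Int.eq_ofNat_of_zero_le h0
  refine ⟨k, ?_, fun h j => ?_⟩
  · rw [P.rootForm_apply_apply]
    simp only [hm]
    exact_mod_cast hk
  · rw [h, Nat.cast_zero, Finset.sum_eq_zero_iff_of_nonneg fun j _ => mul_self_nonneg _] at hk
    rw [hm, mul_self_eq_zero.1 (hk j (Finset.mem_univ j)), Int.cast_zero]

theorem exists_rootForm_sum {x : M} (n : b.support → ℕ) (hx : ∀ j : b.support, ∃ m : ℕ, P.coroot' j x = m) :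
    ∃ k : ℕ, 2 * P.RootForm x (∑ j, (n j : ℂ) • P.root j) = k := by
  choose m hm using hx
  choose k hk using fun j : b.support => exists_rootForm_self (P := P) (x := P.root j) fun i => ⟨_, coroot'_root (P := P) j i⟩
  refine ⟨∑ j, n j * (m j * k j), ?_⟩
  simp only [map_sum, map_smul, Finset.mul_sum, smul_eq_mul]
  push_cast
  refine Finset.sum_congr rfl fun j _ => ?_
  rw [mul_left_comm, two_mul_rootForm, hm, (hk j).1]

theorem coroot'_sum (n : b.support → ℤ) (i : ι) :
    P.coroot' i (∑ j, (n j : ℂ) • P.root j) = (∑ j : b.support, P.pairingIn ℤ j i * n j : ℤ) := by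
  rw [map_sum]; push_cast
  refine Finset.sum_congr rfl fun j _ => ?_
  rw [map_smul, coroot'_root, smul_eq_mul, mul_comm]

variable [P.IsRootSystem]

theorem eq_zero_of_coroot' {x : M} (hx : ∀ j : b.support, P.coroot' j x = 0) : x = 0 := by
  have h : P.toLinearMap x = 0 := b.toCoweightBasis.ext fun j => by simpa using hx j
  exact P.toPerfPair.injective (by simpa using h)

theorem eq_zero_of_sum (n : b.support → ℤ) (h : ∀ i : b.support, ∑ j : b.support, P.pairingIn ℤ j i * n j = 0) : n = 0 := by
  have h1 := eq_zero_of_coroot' (b := b) (x := ∑ j, (n j : ℂ) • P.root j) fun i => by rw [coroot'_sum, h, Int.cast_zero]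
  funext j
  exact_mod_cast Fintype.linearIndependent_iff.1 (linearIndependent_root (b := b)) _ h1 j

theorem exists_pos (n : b.support → ℕ) (hn : n ≠ 0) : ∃ i : b.support, 0 < ∑ j : b.support, P.pairingIn ℤ j i * n j := by
  by_contra! h
  have hc := coroot'_sum (P := P) (b := b) (fun j => n j)
  simp only [Int.cast_natCast] at hc
  obtain ⟨k, hk⟩ := exists_rootForm_sum (b := b) (x := -∑ j, (n j : ℂ) • P.root j) n fun i =>
    ⟨(-∑ j : b.support, P.pairingIn ℤ j i * n j).toNat, by
      rw [map_neg, hc, ← Int.cast_neg, ← Int.cast_natCast, Int.toNat_of_nonneg (by have := h i; omega)]⟩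
  obtain ⟨l, hl, hl0⟩ := exists_rootForm_self (P := P) (x := ∑ j, (n j : ℂ) • P.root j) fun i => ⟨_, hc i⟩
  rw [map_neg, LinearMap.neg_apply, hl] at hk
  have h1 : (-(2 * l : ℤ)) = k := by
    have : ((-(2 * l : ℤ) : ℤ) : ℂ) = ((k : ℤ) : ℂ) := by push_cast; rw [← hk]; ring
    exact_mod_cast this
  refine hn (funext fun j => ?_)
  have h2 := eq_zero_of_sum (b := b) (fun j => (n j : ℤ)) fun i => by
    have h3 := hl0 (by omega) i
    rw [hc] at h3
    exact_mod_cast h3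
  exact Int.natCast_eq_zero.1 (congr_fun h2 j)

variable {θ : ι} (hθ : ∀ γ, P.root θ - P.root γ ∈ AddSubmonoid.closure (P.root '' b.support))

include hθ

omit [P.IsCrystallographic] [P.IsRootSystem] in
theorem highest_sub_neg (γ : ι) : P.root θ + P.root γ ∈ AddSubmonoid.closure (P.root '' b.support) := by
  have h := hθ (P.reflectionPerm γ γ)
  rwa [P.root_reflectionPerm, P.reflection_apply_self, sub_neg_eq_add] at h

omit [P.IsCrystallographic] [P.IsRootSystem] in
theorem highest_mem : P.root θ ∈ AddSubmonoid.closure (P.root '' b.support) := by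
  rcases b.root_mem_or_neg_mem θ with h | h
  · exact h
  · simpa using add_mem (highest_sub_neg hθ θ) h

omit [P.IsCrystallographic] [P.IsRootSystem] in
theorem highest_add_ne (j : b.support) (γ : ι) : P.root γ ≠ P.root θ + P.root j := by
  intro h
  have h1 := hθ γ
  rw [h, sub_add_cancel_left] at h1
  exact P.ne_zero j (eq_zero_of_neg_mem (AddSubmonoid.subset_closure (Set.mem_image_of_mem _ j.2)) h1)

omit [P.IsCrystallographic] [P.IsRootSystem] in
theorem highest_ne_neg (j : b.support) : P.root θ ≠ -P.root j := by
  intro h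
  have h1 := highest_mem hθ
  rw [h] at h1
  exact P.ne_zero j (eq_zero_of_neg_mem (AddSubmonoid.subset_closure (Set.mem_image_of_mem _ j.2)) h1)

omit [P.IsRootSystem] in
theorem highest_nonneg (j : b.support) : 0 ≤ P.pairingIn ℤ θ j := by
  by_contra! h
  obtain ⟨γ, hγ⟩ := P.root_add_root_mem_of_pairingIn_neg h (highest_ne_neg hθ j)
  exact highest_add_ne hθ j γ hγ

omit [P.IsRootSystem] in
theorem highest_nonneg' (j : b.support) : 0 ≤ P.pairingIn ℤ j θ := by
  by_contra! h
  obtain ⟨γ, hγ⟩ := P.root_add_root_mem_of_pairingIn_neg h fun h => highest_ne_neg hθ j (by rw [h, neg_neg])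
  exact highest_add_ne hθ j γ (by rw [hγ, add_comm])

omit [P.IsCrystallographic] [P.IsRootSystem] in
theorem highest_two_add {γ δ : ι} (h : P.root δ = P.root θ + P.root θ + P.root γ) : P.root γ = -P.root θ := by
  have h1 := hθ δ
  rw [h] at h1
  have h2 := eq_zero_of_neg_mem (highest_sub_neg hθ γ) (by convert h1 using 1; abel)
  exact eq_neg_of_add_eq_zero_right h2

/-- A positive root `β ≠ θ` either has `β(θ^∨) = 1`, or `β - θ` is not antidominant. -/
theorem exists_pos_of_ne {β : ι} (hβ : P.root β ∈ AddSubmonoid.closure (P.root '' b.support)) (hne : β ≠ θ) :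
    (∃ k : b.support, 0 < P.pairingIn ℤ β k - P.pairingIn ℤ θ k) ∨ P.pairingIn ℤ β θ = 1 := by
  obtain ⟨n, hn⟩ := exists_nat_sum hβ
  have h0 : 0 ≤ P.pairingIn ℤ β θ := by
    have h1 := coroot'_sum (P := P) (b := b) (fun j => n j) θ
    simp only [Int.cast_natCast, ← hn, coroot'_root] at h1
    rw [Int.cast_injective h1]
    exact Finset.sum_nonneg fun j _ => mul_nonneg (highest_nonneg' hθ j) (Int.natCast_nonneg _)
  rw [or_iff_not_imp_right]
  intro h1
  by_contra! h2
  obtain ⟨p, hp⟩ := Int.eq_ofNat_of_zero_le h0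
  rcases p with _ | _ | p
  · obtain ⟨k, hk⟩ := exists_rootForm_sum (b := b) (x := P.root θ - P.root β) n fun i =>
      ⟨(P.pairingIn ℤ θ i - P.pairingIn ℤ β i).toNat, by
        rw [map_sub, coroot'_root, coroot'_root, ← Int.cast_sub, ← Int.cast_natCast, Int.toNat_of_nonneg (by have := h2 i; omega)]⟩
    obtain ⟨l, hl, hl0⟩ := exists_rootForm_self (P := P) (x := P.root β) fun i => ⟨_, coroot'_root β i⟩
    have h3 := two_mul_rootForm (P := P) (P.root β) θ
    rw [coroot'_root, hp] at h3
    rw [← hn, map_sub, LinearMap.sub_apply, hl, mul_sub, ← P.rootForm_symmetric.eq, RingHom.id_apply, h3] at hk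
    have h4 : (-(2 * l : ℤ)) = k := by
      have : ((-(2 * l : ℤ) : ℤ) : ℂ) = ((k : ℤ) : ℂ) := by push_cast; rw [← hk]; simp
      exact_mod_cast this
    exact P.ne_zero β (eq_zero_of_coroot' (b := b) fun j => hl0 (by omega) j)
  · exact h1 hp
  · have h3 := highest_sub_neg hθ (P.reflectionPerm θ β)
    rw [P.root_reflectionPerm, P.reflection_apply, coroot'_root, hp] at h3
    have h4 := eq_zero_of_neg_mem h3 (by
      have h5 := add_mem (hθ β) (nsmul_mem (highest_mem hθ) p)
      convert h5 using 1
      rw [← Nat.cast_smul_eq_nsmul ℂ]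
      push_cast; module)
    have h5 : P.root β = (p + 1 : ℂ) • P.root θ := by
      rw [← sub_eq_zero, ← h4]; push_cast; module
    have h6 := congr_arg (P.coroot' θ) h5
    rw [map_smul, coroot'_root, coroot'_root, hp, P.pairingIn_same ℤ] at h6
    have h7 : p = 0 := by
      have : ((p + 1 + 1 : ℕ) : ℂ) = (((p + 1) * 2 : ℕ) : ℂ) := by push_cast at h6 ⊢; exact h6
      have := Nat.cast_injective this
      omega
    rw [h7] at h5
    exact hne (P.root.injective (by simpa using h5))

end

end RootSystem

end

section

open LieAlgebra LieAlgebra.IsKilling LieModule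

/-! ### Root spaces of a simple Lie algebra -/

variable {𝔤 : Type*} [LieRing 𝔤] [LieAlgebra ℂ 𝔤] [FiniteDimensional ℂ 𝔤]
  [LieAlgebra.IsSimple ℂ 𝔤] {H : LieSubalgebra ℂ 𝔤} [H.IsCartanSubalgebra]

theorem lie_mem_rootSpace {χ ψ ω : H → ℂ} {u w : 𝔤} (hu : u ∈ rootSpace H χ)
    (hw : w ∈ rootSpace H ψ) (h : χ + ψ = ω) : ⁅u, w⁆ ∈ rootSpace H ω :=
  h ▸ lie_mem_genWeightSpace_of_mem_genWeightSpace hu hw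

theorem coe_lie_of_mem_rootSpace {χ : H → ℂ} {u : 𝔤} (hu : u ∈ rootSpace H χ) (t : H) :
    ⁅(t : 𝔤), u⁆ = χ t • u :=
  lie_eq_smul_of_mem_rootSpace hu t

theorem exists_eq_smul {α : Weight ℂ H 𝔤} (hα : α.IsNonZero) {u w : 𝔤} (hu : u ∈ rootSpace H α)
    (hu0 : u ≠ 0) (hw : w ∈ rootSpace H α) : ∃ c : ℂ, w = c • u := by
  obtain ⟨c, hc⟩ := (finrank_eq_one_iff_of_nonzero' (⟨u, hu⟩ : rootSpace H α)
    (by simpa [Subtype.ext_iff] using hu0)).1 (finrank_rootSpace_eq_one α hα) ⟨w, hw⟩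
  exact ⟨c, (congr_arg Subtype.val hc).symm⟩

theorem isSl2Triple {α : Weight ℂ H 𝔤} (hα : α.IsNonZero) {x y : 𝔤} (hx : x ∈ rootSpace H α)
    (hy : y ∈ rootSpace H (-α)) (hxy : ⁅x, y⁆ = (coroot α : 𝔤)) :
    IsSl2Triple (coroot α : 𝔤) x y where
  h_ne_zero := by simpa using hα
  lie_e_f := hxy
  lie_h_e_nsmul := by
    rw [coe_lie_of_mem_rootSpace hx, root_apply_coroot hα, two_smul, two_nsmul]
  lie_h_f_nsmul := by
    rw [coe_lie_of_mem_rootSpace hy, Pi.neg_apply, root_apply_coroot hα, neg_smul, two_smul,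
      two_nsmul]

theorem lie_ne_zero {α β : Weight ℂ H 𝔤} (hα : α.IsNonZero) (hβ : β.IsNonZero) {x y u : 𝔤}
    (hx : x ∈ rootSpace H α) (hy : y ∈ rootSpace H (-α)) (hxy : ⁅x, y⁆ = (coroot α : 𝔤))
    (hu : u ∈ rootSpace H β) (hu0 : u ≠ 0) (hne : rootSpace H (α + β : H → ℂ) ≠ ⊥) :
    ⁅x, u⁆ ≠ 0 := by
  classical
  intro h0
  have t := isSl2Triple hα hx hy hxy
  have p : t.HasPrimitiveVectorWith u (β (coroot α)) :=
    ⟨hu0, coe_lie_of_mem_rootSpace hu _, h0⟩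
  obtain ⟨n, hn⟩ := p.exists_nat
  obtain ⟨w, hw, hw0⟩ : ∃ w ∈ rootSpace H (α + β : H → ℂ), w ≠ 0 := by
    by_contra! h
    exact hne ((LieSubmodule.eq_bot_iff _).2 h)
  have hex : ∃ m, (toEnd ℂ 𝔤 𝔤 x ^ m) w = 0 := by
    obtain ⟨m, hm⟩ := isNilpotent_ad_of_mem_rootSpace H (χ := α) (by simpa using hα) hx
    exact ⟨m, by rw [show toEnd ℂ 𝔤 𝔤 x ^ m = 0 from hm, LinearMap.zero_apply]⟩
  obtain ⟨m, hm⟩ : ∃ m, Nat.find hex = m + 1 :=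
    Nat.exists_eq_succ_of_ne_zero fun h => hw0 (by simpa [h] using Nat.find_spec hex)
  have hz0 : (toEnd ℂ 𝔤 𝔤 x ^ m) w ≠ 0 := Nat.find_min hex (by omega)
  have hz : (toEnd ℂ 𝔤 𝔤 x ^ m) w ∈ rootSpace H (m • (α : H → ℂ) + (α + β)) :=
    toEnd_pow_apply_mem hx hw m
  have hz1 : ⁅x, (toEnd ℂ 𝔤 𝔤 x ^ m) w⁆ = 0 := by
    have h := Nat.find_spec hex
    rwa [hm, pow_succ', Module.End.mul_apply, toEnd_apply_apply] at h
  have q : t.HasPrimitiveVectorWith ((toEnd ℂ 𝔤 𝔤 x ^ m) w) ((2 * m + 2 + n : ℕ) : ℂ) := by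
    refine ⟨hz0, ?_, hz1⟩
    rw [coe_lie_of_mem_rootSpace hz]
    congr 1
    simp only [Pi.add_apply, Pi.smul_apply, root_apply_coroot hα, hn]
    push_cast
    simp
    ring
  obtain ⟨c, hc⟩ := exists_eq_smul hβ hu hu0
    (w := (toEnd ℂ 𝔤 𝔤 y ^ (m + 1)) ((toEnd ℂ 𝔤 𝔤 x ^ m) w)) (by
      have h := toEnd_pow_apply_mem hy hz (m + 1)
      convert h using 2
      ext t
      simp
      ring)
  have h1 := q.lie_e_pow_succ_toEnd_f m
  rw [hc, lie_smul, h0, smul_zero] at h1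
  refine (smul_ne_zero (mul_ne_zero ?_ ?_) (q.pow_toEnd_f_ne_zero_of_eq_nat rfl ?_)) h1.symm
  · exact_mod_cast m.succ_ne_zero
  · rw [← Nat.cast_sub (by omega)]
    exact_mod_cast (by omega)
  · omega

theorem eq_top_of_rootSpace_le {N : Submodule ℂ 𝔤}
    (hN : ∀ α : Weight ℂ H 𝔤, (rootSpace H α).toSubmodule ≤ N) : N = ⊤ := by
  have h := congr_arg LieSubmodule.toSubmodule (iSup_genWeightSpace_eq_top' ℂ H 𝔤)
  rw [LieSubmodule.iSup_toSubmodule, LieSubmodule.top_toSubmodule] at h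
  exact top_le_iff.1 (h ▸ iSup_le hN)

theorem lie_lie_of_rootSpace_eq_bot {α : Weight ℂ H 𝔤} (hα : α.IsNonZero) {X Y : 𝔤}
    (hX : X ∈ rootSpace H α) (hY : Y ∈ rootSpace H (-α)) (hXY : ⁅X, Y⁆ = (coroot α : 𝔤))
    (hκ : killingForm ℂ 𝔤 X Y ≠ 0)
    (h : ∀ γ : Weight ℂ H 𝔤, (γ : H → ℂ) ≠ -α → rootSpace H (α + (α + γ) : H → ℂ) = ⊥) (w : 𝔤) :
    ⁅X, ⁅X, w⁆⁆ = (-2 * ((killingForm ℂ 𝔤 X Y)⁻¹ * killingForm ℂ 𝔤 X w)) • X := by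
  set κ := killingForm ℂ 𝔤 X Y
  let F : 𝔤 →ₗ[ℂ] 𝔤 := ad ℂ 𝔤 X ∘ₗ ad ℂ 𝔤 X
  let G : 𝔤 →ₗ[ℂ] 𝔤 := ((-2 * κ⁻¹) • killingForm ℂ 𝔤 X).smulRight X
  suffices hFG : LinearMap.eqLocus F G = ⊤ by
    have hw : w ∈ LinearMap.eqLocus F G := hFG ▸ Submodule.mem_top
    simpa [F, G, mul_assoc] using hw
  refine eq_top_of_rootSpace_le (H := H) fun γ u hu => ?_
  replace hu : u ∈ rootSpace H γ := hu
  by_cases hγ : (γ : H → ℂ) = -α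
  · rw [hγ] at hu
    have hY0 : Y ≠ 0 := fun h => hκ (by simp [κ, h])
    obtain ⟨c, rfl⟩ := exists_eq_smul (α := -α) (by simpa using hα)
      (by simpa using hY) hY0 (by simpa using hu)
    change ⁅X, ⁅X, c • Y⁆⁆ = (-2 * κ⁻¹ * killingForm ℂ 𝔤 X (c • Y)) • X
    rw [map_smul, _root_.lie_smul, _root_.lie_smul, hXY, ← lie_skew, coe_lie_of_mem_rootSpace hX,
      root_apply_coroot hα, ← neg_smul, smul_smul]
    congr 1
    change c * -2 = (-2 * κ⁻¹) * (c * κ)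
    field_simp
  · have h1 : ⁅X, ⁅X, u⁆⁆ = 0 := by
      have := lie_mem_rootSpace hX (lie_mem_rootSpace hX hu rfl) rfl
      rwa [h γ hγ, LieSubmodule.mem_bot] at this
    have h2 : killingForm ℂ 𝔤 X u = 0 :=
      killingForm_apply_eq_zero_of_mem_rootSpace_of_add_ne_zero ℂ 𝔤 H hX hu fun h =>
        hγ (eq_neg_of_add_eq_zero_right h)
    simp [F, G, h1, h2]

end

section

open LieAlgebra LieAlgebra.IsKilling LieModule

variable {𝔤 : Type*} [LieRing 𝔤] [LieAlgebra ℂ 𝔤] [FiniteDimensional ℂ 𝔤]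
  [LieAlgebra.IsSimple ℂ 𝔤] {H : LieSubalgebra ℂ 𝔤} [H.IsCartanSubalgebra]
  {b : (rootSystem H).Base} {θ : H.root} {x y : b.support → 𝔤}

theorem rootSpace_le_of_isPos {f : Weight ℂ H 𝔤 → Weight ℂ H 𝔤}
    (hf0 : ∀ α, α.IsNonZero → (f α).IsNonZero)
    (hf : ∀ α β γ : Weight ℂ H 𝔤, (γ : H → ℂ) = α + β → (f γ : H → ℂ) = f α + f β)
    (hx : ∀ i : b.support, x i ∈ rootSpace H (f i.1.1))
    (hy : ∀ i : b.support, y i ∈ rootSpace H (-(f i.1.1 : H → ℂ)))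
    (hxy : ∀ i : b.support, ⁅x i, y i⁆ = (coroot (f i.1.1) : 𝔤))
    (N : Submodule ℂ 𝔤) (hN : ∀ i, x i ∈ N) (hN' : ∀ i, ∀ z ∈ N, ⁅x i, z⁆ ∈ N)
    {β : H.root} (hβ : b.IsPos β) : (rootSpace H (f β.1)).toSubmodule ≤ N := by
  have hnz : ∀ β : H.root, (f β.1).IsNonZero := fun β => hf0 _ (H.isNonZero_coe_root β)
  refine hβ.induction_on_add (p := fun β => (rootSpace H (f β.1)).toSubmodule ≤ N) ?_ ?_
  · intro i hi w hw
    have h0 : x ⟨i, hi⟩ ≠ 0 := fun h => by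
      have h1 := hxy ⟨i, hi⟩
      rw [h, zero_lie] at h1
      exact (by simpa using hnz i : (coroot (f i.1) : 𝔤) ≠ 0) h1.symm
    obtain ⟨c, rfl⟩ := exists_eq_smul (hnz i) (hx ⟨i, hi⟩) h0 hw
    exact N.smul_mem _ (hN _)
  · intro i j k hk hi hj w hw
    obtain ⟨u, hu, hu0⟩ := (f i.1).exists_ne_zero
    have hk' : (f k.1 : H → ℂ) = f j.1 + f i.1 := by
      refine hf _ _ _ ?_
      rw [add_comm]
      exact congr_arg (fun l : Module.Dual ℂ H => (l : H → ℂ)) hk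
    have h1 : ⁅x ⟨j, hj⟩, u⁆ ≠ 0 := lie_ne_zero (hnz j) (hnz i) (hx ⟨j, hj⟩) (hy ⟨j, hj⟩)
      (hxy ⟨j, hj⟩) hu hu0 (hk' ▸ (f k.1).genWeightSpace_ne_bot)
    obtain ⟨c, rfl⟩ := exists_eq_smul (hnz k) (lie_mem_rootSpace (hx ⟨j, hj⟩) hu hk'.symm) h1 hw
    exact N.smul_mem _ (hN' _ _ (hi hu))

variable (hxy : ∀ i : b.support, IsRootPair i.1 (x i) (y i))

include hxy

theorem rootSpace_le (N : Submodule ℂ 𝔤) (hN : ∀ i, x i ∈ N) (hN' : ∀ i, ∀ z ∈ N, ⁅x i, z⁆ ∈ N)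
    {β : H.root} (hβ : b.IsPos β) : (rootSpace H β.1).toSubmodule ≤ N :=
  rootSpace_le_of_isPos (f := id) (fun _ => id) (fun _ _ _ => id) (fun i => (hxy i).1)
    (fun i => (hxy i).2.1) (fun i => (hxy i).2.2) N hN hN' hβ

theorem rootSpace_neg_le (N : Submodule ℂ 𝔤) (hN : ∀ i, y i ∈ N)
    (hN' : ∀ i, ∀ z ∈ N, ⁅y i, z⁆ ∈ N) {β : H.root} (hβ : b.IsPos β) :
    (rootSpace H (-(β.1 : H → ℂ))).toSubmodule ≤ N := by
  have h := rootSpace_le_of_isPos (b := b) (f := Neg.neg) (x := y) (y := x)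
    (fun _ h => by simpa using h)
    (fun α β γ h => by simp only [Weight.coe_neg, h, neg_add]) (fun i => by simpa using (hxy i).2.1)
    (fun i => by simpa using (hxy i).1)
    (fun i => by rw [coroot_neg, ← lie_skew, (hxy i).2.2]; simp) N hN hN' hβ
  simpa using h

theorem eq_top_of_mem (N : Submodule ℂ 𝔤) (hx : ∀ i, x i ∈ N) (hy : ∀ i, y i ∈ N)
    (hx' : ∀ i, ∀ z ∈ N, ⁅x i, z⁆ ∈ N) (hy' : ∀ i, ∀ z ∈ N, ⁅y i, z⁆ ∈ N) : N = ⊤ := by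
  refine eq_top_of_rootSpace_le (H := H) fun α => ?_
  by_cases hα : α.IsZero
  · rw [show (α : H → ℂ) = 0 from hα, rootSpace_zero_eq]
    intro t ht
    have h1 : (⊤ : Submodule ℂ H) ≤ N.comap H.toSubmodule.subtype := by
      rw [← b.toCoweightBasis.span_eq, Submodule.span_le]
      rintro _ ⟨i, rfl⟩
      have h2 : ⁅x i, y i⁆ ∈ N := hx' i _ (hy i)
      rw [(hxy i).2.2] at h2
      change ((b.toCoweightBasis i : H) : 𝔤) ∈ N
      rwa [b.toCoweightBasis_apply]
    exact h1 (Submodule.mem_top (x := ⟨t, ht⟩))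
  · let β : H.root := ⟨α, by simpa using hα⟩
    rcases b.height_ne_zero β |>.lt_or_gt with h | h
    · let _ := (rootSystem H).indexNeg
      have h2 : b.IsPos (-β) := (RootPairing.Base.IsPos.or_neg b β).resolve_left (by
        rw [RootPairing.Base.isPos_iff]; omega)
      have h3 := rootSpace_neg_le hxy N hy hy' h2
      have h4 : (rootSystem H).root (-β) = -(rootSystem H).root β :=
        ((rootSystem H).root_reflectionPerm β β).trans ((rootSystem H).reflection_apply_self β)
      have h5 : (((-β : H.root).1 : Weight ℂ H 𝔤) : H → ℂ) = -(α : H → ℂ) :=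
        congr_arg (fun l : Module.Dual ℂ H => (l : H → ℂ)) h4
      rwa [h5, neg_neg] at h3
    · exact rootSpace_le hxy N hx hx' (β := β) h

end

section

open LieAlgebra LieAlgebra.IsKilling LieModule

variable {𝔤 : Type*} [LieRing 𝔤] [LieAlgebra ℂ 𝔤] [FiniteDimensional ℂ 𝔤]
  [LieAlgebra.IsSimple ℂ 𝔤] {H : LieSubalgebra ℂ 𝔤} [H.IsCartanSubalgebra]
  {b : (rootSystem H).Base} {θ : H.root} {x y : b.support → 𝔤}

theorem root_apply_coroot' (α β : H.root) :
    (β.1 : H → ℂ) (coroot α.1) = ((rootSystem H).pairingIn ℤ β α : ℂ) := by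
  rw [← rootSystem_pairing_apply, ← (rootSystem H).algebraMap_pairingIn ℤ]; rfl

theorem coroot_lie {α β : H.root} {u : 𝔤} (hu : u ∈ rootSpace H (β.1 : H → ℂ)) :
    ⁅(coroot α.1 : 𝔤), u⁆ = ((rootSystem H).pairingIn ℤ β α : ℂ) • u := by
  rw [coe_lie_of_mem_rootSpace hu, root_apply_coroot']

theorem coroot_lie_neg {α β : H.root} {u : 𝔤} (hu : u ∈ rootSpace H (-(β.1 : H → ℂ))) :
    ⁅(coroot α.1 : 𝔤), u⁆ = -((rootSystem H).pairingIn ℤ β α : ℂ) • u := by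
  rw [coe_lie_of_mem_rootSpace hu, Pi.neg_apply, root_apply_coroot']

theorem coroot_lie_coroot (α β : H.root) : ⁅(coroot α.1 : 𝔤), (coroot β.1 : 𝔤)⁆ = 0 := by
  rw [← LieSubalgebra.coe_bracket, trivial_lie_zero, ZeroMemClass.coe_zero]

theorem rootSpace_neg_ne_bot {a : H → ℂ} (h : rootSpace H a ≠ ⊥) : rootSpace H (-a) ≠ ⊥ := by
  let α : Weight ℂ H 𝔤 := ⟨a, h⟩
  have h1 := (-α).genWeightSpace_ne_bot'
  exact h1

/-- A nonzero weight, as a root. -/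
def rootOfWeight {α : Weight ℂ H 𝔤} (hα : (α : H → ℂ) ≠ 0) : H.root :=
  ⟨α, by simpa using (hα : α.IsNonZero)⟩

theorem rootSpace_eq_bot {a : H → ℂ} (h0 : a ≠ 0)
    (h : ∀ γ : H.root, (γ.1 : H → ℂ) ≠ a) : rootSpace H a = ⊥ := by
  by_contra hne
  exact h (rootOfWeight (α := ⟨a, hne⟩) h0) rfl

theorem root_ext {α : H.root} {l : Module.Dual ℂ H} (h : (α.1 : H → ℂ) = l) :
    (rootSystem H).root α = l := LinearMap.ext fun t => congr_fun h t

theorem exists_killingForm_coroot (θ : H.root) : ∃ k : ℕ,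
    killingForm ℂ 𝔤 (coroot θ.1 : 𝔤) (coroot θ.1 : 𝔤) = k ∧ k ≠ 0 := by
  have h := congr_arg (fun B => B (coroot θ.1) (coroot θ.1)) (corootForm_rootSystem_eq_killing H)
  obtain ⟨k, hk, hk'⟩ := RootSystem.exists_rootForm_self (P := (rootSystem H).flip)
    (x := coroot θ.1) fun j => ⟨_, root_apply_coroot' θ j⟩
  refine ⟨k, h.symm.trans hk, fun h0 => ?_⟩
  have h1 : (θ.1 : H → ℂ) (coroot θ.1) = 0 := hk' h0 θ
  rw [root_apply_coroot (H.isNonZero_coe_root θ)] at h1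
  exact two_ne_zero h1

theorem dualCoxeter_ne_zero (θ : H.root) : dualCoxeter θ ≠ 0 := by
  obtain ⟨k, hk, hk'⟩ := exists_killingForm_coroot θ
  rw [dualCoxeter, hk]
  exact div_ne_zero (Nat.cast_ne_zero.2 hk') (by norm_num)

theorem one_add_dualCoxeter_ne_zero (θ : H.root) : 1 + dualCoxeter θ ≠ 0 := by
  obtain ⟨k, hk, hk'⟩ := exists_killingForm_coroot θ
  rw [dualCoxeter, hk]
  intro h
  have h1 : ((4 + k : ℕ) : ℂ) = 0 := by push_cast; linear_combination 4 * h
  exact absurd (Nat.cast_eq_zero.1 h1) (by omega)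

theorem killingForm_rootPair {α : H.root} {X Y : 𝔤} (h : IsRootPair α X Y) :
    killingForm ℂ 𝔤 X Y = 2 * dualCoxeter α := by
  have h1 := traceForm_apply_lie_apply ℂ 𝔤 𝔤 X Y (coroot α.1 : 𝔤)
  rw [h.2.2, ← lie_skew, coroot_lie_neg h.2.1, RootPairing.pairingIn_same, ← neg_smul, map_smul,
    smul_eq_mul] at h1
  rw [dualCoxeter, h1]
  change _ = 2 * ((- -((2 : ℤ) : ℂ)) * killingForm ℂ 𝔤 X Y / 4)
  push_cast
  ring

/-- The form `normalizedForm`, as a bilinear map. -/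
def normalizedBilin (θ : H.root) : 𝔤 →ₗ[ℂ] 𝔤 →ₗ[ℂ] ℂ :=
  (2 * dualCoxeter θ)⁻¹ • killingForm ℂ 𝔤

theorem normalizedBilin_apply (u w : 𝔤) : normalizedBilin θ u w = normalizedForm θ u w := by
  rw [normalizedForm, div_eq_inv_mul]; rfl

theorem rootSpace_add_add_eq_bot (hθ : IsHighestRoot b θ) (γ : Weight ℂ H 𝔤)
    (hγ : (γ : H → ℂ) ≠ -θ.1) : rootSpace H (θ.1 + (θ.1 + γ) : H → ℂ) = ⊥ := by
  have hnz := H.isNonZero_coe_root θ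
  by_contra hne
  by_cases h0 : γ.IsZero
  · rw [show (γ : H → ℂ) = 0 from h0, add_zero, ← two_smul ℕ] at hne
    exact hne (rootSpace_two_smul θ.1 hnz)
  · by_cases h1 : (θ.1 + (θ.1 + γ) : H → ℂ) = 0
    · have h2 := rootSpace_two_smul (-θ.1) (by simpa using hnz)
      rw [show 2 • ((-θ.1 : Weight ℂ H 𝔤) : H → ℂ) = γ by
        rw [Weight.coe_neg]; linear_combination (norm := module) -h1] at h2
      exact γ.genWeightSpace_ne_bot' h2
    · have h2 := RootSystem.highest_two_add hθ (γ := rootOfWeight (α := γ) h0)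
        (δ := rootOfWeight (α := ⟨_, hne⟩) h1) (root_ext (by rw [add_assoc]; rfl))
      exact hγ (congr_arg (fun l : Module.Dual ℂ H => (l : H → ℂ)) h2)

theorem rootSpace_neg_add_add_eq_bot (hθ : IsHighestRoot b θ) (γ : Weight ℂ H 𝔤)
    (hγ : (γ : H → ℂ) ≠ -(-θ.1 : Weight ℂ H 𝔤)) :
    rootSpace H ((-θ.1 : Weight ℂ H 𝔤) + ((-θ.1 : Weight ℂ H 𝔤) + γ) : H → ℂ) = ⊥ := by
  by_contra hne
  refine rootSpace_neg_ne_bot hne ?_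
  have h := rootSpace_add_add_eq_bot hθ (-γ) fun h => hγ (by
    rw [Weight.coe_neg, neg_inj] at h; rw [h, Weight.coe_neg, neg_neg])
  rw [Weight.coe_neg] at h
  convert h using 2
  rw [Weight.coe_neg]
  module

theorem lie_lie_rootPair (hθ : IsHighestRoot b θ) {X Y : 𝔤} (h : IsRootPair θ X Y) (w : 𝔤) :
    ⁅X, ⁅X, w⁆⁆ = (-2 * normalizedBilin θ X w) • X := by
  have h1 := killingForm_rootPair h
  rw [lie_lie_of_rootSpace_eq_bot (H.isNonZero_coe_root θ) h.1 h.2.1 h.2.2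
    (by simpa [h1] using dualCoxeter_ne_zero θ) (rootSpace_add_add_eq_bot hθ), h1]
  rfl

theorem lie_lie_rootPair' (hθ : IsHighestRoot b θ) {X Y : 𝔤} (h : IsRootPair θ X Y) (w : 𝔤) :
    ⁅Y, ⁅Y, w⁆⁆ = (-2 * normalizedBilin θ Y w) • Y := by
  have h1 := killingForm_rootPair h
  have h1' : killingForm ℂ 𝔤 Y X = 2 * dualCoxeter θ := (traceForm_comm ℂ 𝔤 𝔤 Y X).trans h1
  rw [lie_lie_of_rootSpace_eq_bot (α := -θ.1) (by simpa using H.isNonZero_coe_root θ)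
    (by simpa using h.2.1) (by simpa using h.1) (by rw [← lie_skew, h.2.2, coroot_neg]; simp)
    (by simpa [h1'] using dualCoxeter_ne_zero θ) (rootSpace_neg_add_add_eq_bot hθ), h1']
  rfl

theorem mem_closure_of_isPos (β : H.root) (hβ : b.IsPos β) :
    (rootSystem H).root β ∈ AddSubmonoid.closure ((rootSystem H).root '' b.support) :=
  hβ.induction_on_add (fun _ hi => AddSubmonoid.subset_closure (Set.mem_image_of_mem _ hi))
    fun _ _ _ hk hi hj =>
      hk ▸ add_mem hi (AddSubmonoid.subset_closure (Set.mem_image_of_mem _ hj))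

theorem isPos_of_mem (β : H.root)
    (hβ : (rootSystem H).root β ∈ AddSubmonoid.closure ((rootSystem H).root '' b.support)) :
    b.IsPos β := by
  refine (RootPairing.Base.IsPos.or_neg b β).resolve_right fun h => ?_
  have h1 := mem_closure_of_isPos _ h
  have h2 : (rootSystem H).root ((rootSystem H).reflectionPerm β β) = -(rootSystem H).root β :=
    ((rootSystem H).root_reflectionPerm β β).trans ((rootSystem H).reflection_apply_self β)
  exact (rootSystem H).ne_zero β (RootSystem.eq_zero_of_neg_mem hβ (h2 ▸ h1))

variable (hxy : ∀ i : b.support, IsRootPair i.1 (x i) (y i))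

include hxy

theorem lie_eq_zero_of_ne {i j : b.support} (hij : i ≠ j) : ⁅x i, y j⁆ = 0 := by
  have h := lie_mem_rootSpace (hxy i).1 (hxy j).2.1 rfl
  rwa [rootSpace_eq_bot, LieSubmodule.mem_bot] at h
  · intro h0
    refine hij (Subtype.ext ((rootSystem H).root.injective (root_ext ?_)))
    rw [← sub_eq_add_neg, sub_eq_zero] at h0
    exact h0
  · intro γ hγ
    refine b.sub_notMem_range_root i.2 j.2 ⟨γ, root_ext ?_⟩
    rw [hγ, sub_eq_add_neg]
    rfl

theorem lie_highest_eq_zero (hθ : IsHighestRoot b θ) {X Y : 𝔤} (h : IsRootPair θ X Y)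
    (i : b.support) : ⁅x i, X⁆ = 0 := by
  have h1 := lie_mem_rootSpace (hxy i).1 h.1 rfl
  rwa [rootSpace_eq_bot, LieSubmodule.mem_bot] at h1
  · intro h0
    exact RootSystem.highest_ne_neg hθ i (root_ext (eq_neg_of_add_eq_zero_right h0))
  · intro γ hγ
    exact RootSystem.highest_add_ne hθ i γ (root_ext (hγ.trans (add_comm _ _)))

theorem lie_lowest_eq_zero (hθ : IsHighestRoot b θ) {X Y : 𝔤} (h : IsRootPair θ X Y)
    (i : b.support) : ⁅y i, Y⁆ = 0 := by
  have h1 := lie_mem_rootSpace (hxy i).2.1 h.2.1 rfl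
  rw [← LieSubmodule.mem_bot (R := ℂ) (L := H)]
  by_contra hne
  have h2 : rootSpace H (-(i.1.1 : H → ℂ) + -θ.1) ≠ ⊥ := fun h => hne (h ▸ h1)
  refine rootSpace_neg_ne_bot h2 (rootSpace_eq_bot ?_ ?_)
  · intro h0
    refine RootSystem.highest_ne_neg hθ i (root_ext ?_)
    change (θ.1 : H → ℂ) = -(i.1.1 : H → ℂ)
    linear_combination (norm := module) h0
  · intro γ hγ
    refine RootSystem.highest_add_ne hθ i γ (root_ext ?_)
    change (γ.1 : H → ℂ) = θ.1 + i.1.1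
    linear_combination (norm := module) hγ

end

section

open LieAlgebra LieAlgebra.IsKilling LieModule

variable {𝔤 : Type*} [LieRing 𝔤] [LieAlgebra ℂ 𝔤] [FiniteDimensional ℂ 𝔤]
  [LieAlgebra.IsSimple ℂ 𝔤] {H : LieSubalgebra ℂ 𝔤} [H.IsCartanSubalgebra]
  {b : (rootSystem H).Base} {θ : H.root} {x y : b.support → 𝔤}

theorem iterate_lie_eq_zero {α : H → ℂ} (hα : α ≠ 0) {z : 𝔤} (hz : z ∈ rootSpace H α) (w : 𝔤) :
    ∃ n : ℕ, (fun u => ⁅z, u⁆)^[n] w = 0 := by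
  obtain ⟨n, hn⟩ := isNilpotent_ad_of_mem_rootSpace H hα hz
  exact ⟨n, by rw [SimpleData.iterate_eq, hn, LinearMap.zero_apply]⟩

theorem coroot'_closure {n : b.support → ℕ} {β : H.root}
    (h : (rootSystem H).root β = ∑ j, (n j : ℂ) • (rootSystem H).root j) (i : H.root) :
    ∑ j : b.support, (rootSystem H).pairingIn ℤ j i * n j = (rootSystem H).pairingIn ℤ β i := by
  have h1 := RootSystem.coroot'_sum (P := rootSystem H) (b := b) (fun j => n j) i
  simp only [Int.cast_natCast] at h1
  rw [← h, RootSystem.coroot'_root] at h1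
  exact_mod_cast h1.symm

theorem pairingIn_list_sum {l : List b.support} {β : H.root}
    (h : (rootSystem H).root β = (l.map fun j : b.support => (rootSystem H).root j).sum) (i : H.root) :
    (l.map fun j : b.support => (rootSystem H).pairingIn ℤ j i).sum = (rootSystem H).pairingIn ℤ β i := by
  have h1 := congr_arg ((rootSystem H).coroot' i) h
  rw [RootSystem.coroot'_root, map_list_sum, List.map_map] at h1
  simp only [Function.comp_def, RootSystem.coroot'_root] at h1
  have h2 : ((l.map fun j : b.support => (rootSystem H).pairingIn ℤ j i).sum : ℂ) =
    (l.map fun j : b.support => ((rootSystem H).pairingIn ℤ j i : ℂ)).sum := by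
    rw [Int.cast_list_sum, List.map_map]; rfl
  exact_mod_cast h2.trans h1.symm

variable (hxy : ∀ i : b.support, IsRootPair i.1 (x i) (y i))

include hxy

theorem foldr_mem_rootSpace (l : List b.support) (i : b.support) :
    l.foldr (fun j z => ⁅x j, z⁆) (x i) ∈
      rootSpace H (((i :: l).map fun j : b.support => (rootSystem H).root j).sum : Module.Dual ℂ H) := by
  induction l with
  | nil => simpa using (hxy i).1
  | cons j l ih =>
    refine lie_mem_rootSpace (hxy j).1 ih ?_
    simp only [List.map_cons, List.sum_cons, LinearMap.add_apply]
    ext t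
    simp
    ring

theorem foldr_highest (hθ : IsHighestRoot b θ) {X Y : 𝔤} (h : IsRootPair θ X Y)
    (l : List b.support) (i : b.support) (hl : l.foldr (fun j z => ⁅x j, z⁆) (x i) ≠ 0) :
    (∃ k : b.support, 0 < ((i :: l).map fun j : b.support => (rootSystem H).pairingIn ℤ j k).sum +
      -(rootSystem H).pairingIn ℤ θ k) ∨
      ((i :: l).map fun j : b.support => -(rootSystem H).pairingIn ℤ j θ).sum = -1 ∨
      ∃ c : ℂ, l.foldr (fun j z => ⁅x j, z⁆) (x i) = c • X := by
  have hm := foldr_mem_rootSpace hxy l i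
  set a := ((i :: l).map fun j : b.support => (rootSystem H).root j).sum with ha
  have hcl : ∀ l : List b.support, (l.map fun j : b.support => (rootSystem H).root j).sum ∈
      AddSubmonoid.closure ((rootSystem H).root '' b.support) := fun l =>
    AddSubmonoid.list_sum_mem _ fun z hz => by
      obtain ⟨j, -, rfl⟩ := List.mem_map.1 hz
      exact AddSubmonoid.subset_closure (Set.mem_image_of_mem _ j.2)
  have ha0 : a ≠ 0 := fun h0 => by
    refine (rootSystem H).ne_zero i (RootSystem.eq_zero_of_neg_mem (b := b)
      (AddSubmonoid.subset_closure (Set.mem_image_of_mem _ i.2)) ?_)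
    rw [ha, List.map_cons, List.sum_cons] at h0
    rw [neg_eq_of_add_eq_zero_right h0]
    exact hcl l
  have hne : rootSpace H (a : H → ℂ) ≠ ⊥ := fun h => hl (by rwa [h, LieSubmodule.mem_bot] at hm)
  let β : H.root := rootOfWeight (α := ⟨a, hne⟩) fun h0 => ha0 (LinearMap.ext (congr_fun h0))
  have hβ : (rootSystem H).root β = a := root_ext rfl
  by_cases hβθ : β = θ
  · refine .inr (.inr (exists_eq_smul (H.isNonZero_coe_root θ) h.1 (fun h0 => ?_) ?_))
    · have h1 := h.2.2
      rw [h0, zero_lie] at h1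
      exact (by simp : (coroot θ.1 : 𝔤) ≠ 0) h1.symm
    · rw [← hβθ]; exact hm
  · rcases RootSystem.exists_pos_of_ne hθ (β := β) (by rw [hβ]; exact hcl _) hβθ with ⟨k, hk⟩ | h1
    · exact .inl ⟨k, by rw [pairingIn_list_sum (hβ.trans ha)]; omega⟩
    · refine .inr (.inl ?_)
      rw [← h1, ← pairingIn_list_sum (hβ.trans ha), List.sum_neg, List.map_map]
      rfl

/-- The data of a simple Lie algebra with Chevalley generators and highest root vectors. -/
def simpleData (hθ : IsHighestRoot b θ) {X Y : 𝔤} (hXY : IsRootPair θ X Y) :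
    SimpleData b.support 𝔤 where
  A := affineCartan b θ
  x := x
  y := y
  h i := (coroot i.1.1 : 𝔤)
  X := X
  Y := Y
  Θ := (coroot θ.1 : 𝔤)
  B := normalizedBilin θ
  A_diag a := by cases a <;> simp [affineCartan]
  A_off a a' haa := by
    match a, a' with
    | none, none => exact absurd rfl haa
    | none, some j => exact neg_nonpos.2 (RootSystem.highest_nonneg' hθ j)
    | some i, none => exact neg_nonpos.2 (RootSystem.highest_nonneg hθ i)
    | some i, some j =>
      exact b.pairingIn_le_zero_of_ne (fun h => haa (by rw [Subtype.ext h])) j.2 i.2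
  A_zero i := by
    change -_ = _ ↔ -_ = _
    rw [neg_eq_zero, neg_eq_zero, RootPairing.pairingIn_eq_zero_iff]
  A_inj n hn := RootSystem.eq_zero_of_sum n hn
  marks := by
    obtain ⟨n, hn⟩ := RootSystem.exists_nat_sum (RootSystem.highest_mem hθ)
    refine ⟨fun j => n j, fun i => ?_, ?_⟩
    · exact (coroot'_closure hn _).trans (neg_neg _).symm
    · have h := coroot'_closure hn θ
      rw [RootPairing.pairingIn_same] at h
      change ∑ j : b.support, -(rootSystem H).pairingIn ℤ j θ * n j = -2
      rw [← h, ← Finset.sum_neg_distrib]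
      exact Finset.sum_congr rfl fun j _ => neg_mul _ _
  h_indep := by
    have h := b.linearIndepOn_coroot
    exact LinearIndependent.map' h H.toSubmodule.subtype (Submodule.ker_subtype _)
  h_h i j := coroot_lie_coroot _ _
  h_x i j := coroot_lie (hxy j).1
  h_y i j := coroot_lie_neg (hxy j).2.1
  x_y_same i := (hxy i).2.2
  x_y_ne i j hij := lie_eq_zero_of_ne hxy hij
  h_X i := by
    rw [coroot_lie hXY.1]; simp [affineCartan]
  h_Y i := by
    rw [coroot_lie_neg hXY.2.1]; simp [affineCartan]
  Θ_x j := by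
    rw [coroot_lie (hxy j).1]; simp [affineCartan]
  Θ_y j := by
    rw [coroot_lie_neg (hxy j).2.1]; simp [affineCartan]
  Θ_h i := coroot_lie_coroot _ _
  X_Y := hXY.2.2
  Θ_X := by rw [coroot_lie hXY.1]; simp
  Θ_Y := by rw [coroot_lie_neg hXY.2.1]; simp
  x_X := lie_highest_eq_zero hxy hθ hXY
  y_Y := lie_lowest_eq_zero hxy hθ hXY
  B_symm u w := congr_arg ((2 * dualCoxeter θ)⁻¹ * ·) (traceForm_comm ℂ 𝔤 𝔤 u w)
  B_inv u w z := congr_arg ((2 * dualCoxeter θ)⁻¹ * ·) (traceForm_apply_lie_apply ℂ 𝔤 𝔤 u w z)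
  B_nondeg u hu := by
    refine (killingForm_nondegenerate ℂ 𝔤).1 u fun w => ?_
    have h : (2 * dualCoxeter θ)⁻¹ * killingForm ℂ 𝔤 u w = 0 := hu w
    exact (mul_eq_zero.1 h).resolve_left
      (inv_ne_zero (mul_ne_zero two_ne_zero (dualCoxeter_ne_zero θ)))
  B_X_Y := by
    change (2 * dualCoxeter θ)⁻¹ * killingForm ℂ 𝔤 X Y = 1
    rw [killingForm_rootPair hXY]
    exact inv_mul_cancel₀ (mul_ne_zero two_ne_zero (dualCoxeter_ne_zero θ))
  X_X := lie_lie_rootPair hθ hXY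
  Y_Y := lie_lie_rootPair' hθ hXY
  nil_x i := iterate_lie_eq_zero (H.isNonZero_coe_root i.1) (hxy i).1
  nil_y i := iterate_lie_eq_zero (neg_ne_zero.2 (H.isNonZero_coe_root i.1)) (hxy i).2.1
  exists_adjacent := by
    obtain ⟨j, hj, h⟩ := RootPairing.Base.exists_mem_support_pos_pairingIn_ne_zero (b := b) θ
    exact ⟨⟨j, hj⟩, neg_ne_zero.2 fun h0 => h (((rootSystem H).pairingIn_eq_zero_iff).1 h0)⟩
  pos n hn := RootSystem.exists_pos n hn
  root l i hl := foldr_highest hxy hθ hXY l i hl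
  gen := eq_top_of_mem hxy
  X_mem N hN hN' := rootSpace_le hxy N hN hN'
    (isPos_of_mem θ (RootSystem.highest_mem hθ)) hXY.1
  simple N hN := by
    let I : LieIdeal ℂ 𝔤 := { N with lie_mem := fun {u z} hz => hN u z hz }
    rcases LieAlgebra.IsSimple.eq_bot_or_eq_top I with h | h
    · exact .inl (congr_arg LieSubmodule.toSubmodule h)
    · exact .inr (congr_arg LieSubmodule.toSubmodule h)

theorem exists_simpleData (hθ : IsHighestRoot b θ) {X Y : 𝔤} (hXY : IsRootPair θ X Y) :
    ∃ D : SimpleData b.support 𝔤, D.A = affineCartan b θ ∧ D.x = x ∧ D.y = y ∧ D.X = X ∧ D.Y = Y ∧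
      ∀ u w, D.B u w = normalizedForm θ u w :=
  ⟨simpleData hxy hθ hXY, rfl, rfl, rfl, rfl, rfl, normalizedBilin_apply⟩

end

end TensorHierarchy

end

set_option maxHeartbeats 1000000 in
theorem mainTheorem1 {𝔤 : Type*} [LieRing 𝔤] [LieAlgebra ℂ 𝔤] [FiniteDimensional ℂ 𝔤]
    [LieAlgebra.IsSimple ℂ 𝔤] (H : LieSubalgebra ℂ 𝔤) [H.IsCartanSubalgebra]
    (b : (rootSystem H).Base) (θ : H.root) (hθ : IsHighestRoot b θ)
    (x y : b.support → 𝔤) (hxy : ∀ i : b.support, IsRootPair i.1 (x i) (y i))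
    (xθ yθ : 𝔤) (hxyθ : IsRootPair θ xθ yθ)
    (i₁ : b.support) (c : ℤ) (hc : c = (rootSystem H).pairingIn ℤ θ i₁) (hc0 : c ≠ 0)
    (A : Matrix (Option b.support) (Option b.support) ℤ) (hA : A = affineCartan b θ) :
    (∃! TK : (ℤ → 𝔤 →ₗ[ℂ] S A) × S A, IsLoopRealization θ x y xθ yθ TK.1 TK.2) ∧
    ∀ (T : ℤ → 𝔤 →ₗ[ℂ] S A) (K J : S A),
      IsLoopRealization θ x y xθ yθ T K →
      J = extraGenerator A i₁ (T 0 xθ) →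
      -- the loop generators and the central element are linearly independent in `S`
      Function.Injective (fun p : (ℤ →₀ 𝔤) × ℂ => (p.1.sum fun m u => T m u) + p.2 • K) ∧
      -- the second expression for `J`
      J = ⁅phi A i₁, ⁅T 0 xθ, ⁅e A none, eps A⁆⁆⁆ ∧
      -- `J` has level `0` and no expression without `ε` and `φ`
      J ∈ levelComponent A 0 ∧
      J ∉ bosonicSubalgebra A ∧
      -- brackets with the Chevalley generators
      (∀ i : b.support, ⁅e A (some i), J⁆ = 0 ∧ ⁅f A (some i), J⁆ = 0) ∧
      ⁅f A none, J⁆ = (-(c : ℂ)) • T 0 xθ ∧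
      ⁅e A none, J⁆ = (-(c : ℂ) / 2) • ⁅e A none, ⁅e A none, T 0 xθ⁆⁆ ∧
      -- `J` acts as `c L₁` on the affine algebra
      (∀ (m : ℤ) (u : 𝔤), ⁅J, T m u⁆ = (-(c : ℂ) * m) • T (m + 1) u) ∧
      ⁅J, K⁆ = 0 ∧
      -- `J` annihilates `ε`
      ⁅eps A, J⁆ = 0 ∧ ⁅J, eps A⁆ = 0 ∧
      -- level `1` is the fundamental: irreducible, with lowest weight vector `ε`, where `k = -1`
      (eps A ∈ levelComponent A 1 ∧ eps A ≠ 0 ∧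
        (∀ a, ⁅f A a, eps A⁆ = 0) ∧
        (∀ a, ⁅h A a, eps A⁆ = (if a = none then (-1 : ℂ) else 0) • eps A) ∧
        IsBosonicStable A (levelComponent A 1) ∧
        (∀ W ≤ levelComponent A 1, IsBosonicStable A W → W = ⊥ ∨ W = levelComponent A 1) ∧
        ∀ v ∈ levelComponent A 1, ⁅K, v⁆ = -v) ∧
      -- on level `1`, `J` is `c` times the Sugawara operator `L₁` at `k = -1`
      ∀ (u : Module.Basis (Fin (Module.finrank ℂ 𝔤)) ℂ 𝔤) (u' : Fin (Module.finrank ℂ 𝔤) → 𝔤),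
        (∀ i j, normalizedForm θ (u i) (u' j) = if i = j then 1 else 0) →
        ∀ v ∈ levelComponent A 1, ∀ᶠ N : ℕ in Filter.atTop,
          ⁅J, v⁆ = (c : ℂ) • sugawaraL1 θ (-1) u u' T N v := by
  obtain ⟨D, hDA, rfl, rfl, rfl, rfl, hB⟩ := exists_simpleData hxy hθ hxyθ
  rw [← hDA] at hA
  subst hA
  have hcA : (c : ℂ) = -(D.A (some i₁) none : ℂ) := by
    rw [hc, hDA]; simp [affineCartan]
  have hP := D.loc_isTransitive
  have hT : IsLoopRealization θ D.x D.y D.X D.Y D.loc.T D.loc.K :=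
    { e_simple := fun i => (D.e_some_eq i).symm
      f_simple := fun i => (D.f_some_eq i).symm
      e_zero := D.e_none_eq.symm
      f_zero := D.f_none_eq.symm
      bracket := fun m n u v => by rw [← hB]; exact hP.T_T m n u v
      central := hP.K_T }
  have huniq : ∀ (T : ℤ → 𝔤 →ₗ[ℂ] S D.A) (K : S D.A),
      IsLoopRealization θ D.x D.y D.X D.Y T K → T = D.loc.T ∧ K = D.loc.K := fun T K h =>
    hP.T_unique (fun i => (h.e_simple i).trans (D.e_some_eq i))
      (fun i => (h.f_simple i).trans (D.f_some_eq i)) (h.e_zero.trans D.e_none_eq)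
      (h.f_zero.trans D.f_none_eq) fun m n u w => by rw [hB]; exact h.bracket m n u w
  refine ⟨⟨(D.loc.T, D.loc.K), hT, fun TK h => Prod.ext (huniq _ _ h).1 (huniq _ _ h).2⟩, ?_⟩
  intro T K J hTK hJ
  obtain ⟨rfl, rfl⟩ := huniq T K hTK
  replace hJ : J = (c : ℂ) • D.loc.Lo := by rw [hJ, hcA]; exact D.extraGenerator_eq i₁
  subst hJ
  have hc0' : (c : ℂ) ≠ 0 := Int.cast_ne_zero.2 hc0
  refine ⟨D.loc_injective, by rw [hcA]; exact (D.extraGenerator_eq' i₁).symm, ?_, fun h => ?_,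
    fun i => ⟨?_, ?_⟩, ?_, ?_, fun m u => ?_, ?_, ?_, ?_, ⟨?_, ?_, fun a => ?_, fun a => ?_,
      D.bosonicStable_levelComponent 1, fun W => D.levelComponent_one_irreducible,
      fun v hv => ?_⟩, ?_⟩
  · rw [levelComponent_eq]
    exact Submodule.smul_mem _ _ (MonSuper.comp_mono (fun d hd => hd.1) D.loc_Lo_mem)
  · exact D.Lo_notMem_bosonic ((Submodule.smul_mem_iff _ hc0').1 h)
  · rw [D.e_some_eq, LieSuper.br_smul, D.loc.t0_Lo, smul_zero]
  · rw [D.f_some_eq, LieSuper.br_smul, D.loc.t0_Lo, smul_zero]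
  · rw [D.f_none_eq, LieSuper.br_smul, D.loc.lie_Lo, D.loc.Lo_tm1, smul_neg, neg_smul,
      LocalData.IsTransitive.T_zero]
  · have h1 := hP.Lo_T 1 D.Y
    have h2 := hP.T_T 1 0 D.Y D.X
    have h3 := hP.T_T 1 1 D.Y D.Θ
    rw [D.Y_X] at h2
    rw [← lie_skew, D.Θ_Y] at h3
    rw [LocalData.IsTransitive.T_one] at h1 h2 h3
    norm_num at h1 h2 h3
    rw [D.e_none_eq, LieSuper.br_smul, D.loc.lie_Lo, h1, h2, LieSuper.br_neg, LocalData.IsTransitive.T_one, h3]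
    module
  · rw [LieSuper.smul_br, hP.Lo_T, smul_smul]; congr 1; ring
  · rw [LieSuper.smul_br, D.loc.lie_K, D.loc.K_Lo, neg_zero, smul_zero]
  · rw [D.eps_eq, LieSuper.br_smul, D.loc.lie_Lo, hP.Lo_eps_eq_zero, neg_zero, smul_zero]
  · rw [D.eps_eq, LieSuper.smul_br, hP.Lo_eps_eq_zero, smul_zero]
  · rw [D.levelComponent_one, D.eps_eq]
    exact LocalData.mem_iSup_V LocalData.eps_mem_V
  · rw [D.eps_eq]; exact D.loc_eps_ne_zero
  · rcases a with _ | i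
    · rw [D.f_none_eq, D.eps_eq, D.loc.tm1_eps]
    · rw [D.f_some_eq, D.eps_eq, D.loc.t0_eps]
  · rcases a with _ | i
    · rw [D.h_none_eq, D.eps_eq, LieSuper.sub_br, D.loc.K_eps, D.loc.t0_eps]; simp
    · rw [D.h_some_eq, D.eps_eq, D.loc.t0_eps]; simp
  · rw [D.levelComponent_one] at hv
    exact LocalData.K_V v hv
  · intro u u' huu v hv
    rw [D.levelComponent_one] at hv
    have hg := dualCoxeter_ne_zero θ
    have hg' := one_add_dualCoxeter_ne_zero θ
    filter_upwards [hP.sugawara (u := u) (u' := u') (g := dualCoxeter θ)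
      (fun i j => (hB _ _).trans (huu i j))
      (fun x y => by rw [hB, normalizedForm]; field_simp) hv] with N hN
    rw [sugawaraL1, LocalData.IsTransitive.sum_Icc_one, LieSuper.smul_br]
    have h1 : ∑ n ∈ Finset.range N, D.loc.TT u u' (n + 1) (-n) v =
        ∑ n ∈ Finset.range N, ∑ j, ⁅D.loc.T (n + 1) (u j), ⁅D.loc.T (1 - (n + 1)) (u' j), v⁆⁆ :=
      Finset.sum_congr rfl fun n _ => by
        rw [LocalData.IsTransitive.TT_apply, show 1 - ((n : ℤ) + 1) = -n by ring]
    have h2 : 1 / (-1 - dualCoxeter θ) * -(1 + dualCoxeter θ) = 1 := by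
      rw [show -1 - dualCoxeter θ = -(1 + dualCoxeter θ) by ring, one_div,
        inv_mul_cancel₀ (neg_ne_zero.2 hg')]
    rw [← h1, hN, smul_smul (1 / _), h2, one_smul]
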